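/- Let $n\ge 1$, $\operatorname{Im}\tau>0$, and let $\mathcal A$ be a finite set of affine-linear functions $\alpha(x)=a_0+a_1x_1+\dots+a_nx_n$ on $\mathbb C^n$, with gradients $\alpha_0=(a_1,\dots,a_n)$ such that $(\alpha_0,\alpha_0)=\sum_j a_j^2\neq 0$. Assume that the subgroup $\mathcal M$ of the dual space generated by the $\alpha_0$ has rank $n$ over $\mathbb Z$ and spans the dual space over $\mathbb C$; put $\mathcal L=\{l\in\mathbb C^n:\ \alpha_0(l)\in\mathbb Z\ \text{for all}\ \alpha\in\mathcal A\}=\mathrm{Hom}(\mathcal M,\mathbb Z)$ and $T=\mathbb C^n/(\mathcal L+\tau\mathcal L)$. Let $m_\alpha\in\mathbb Z_{>0}$ and $$L=-\Delta+u,\qquad u(x)=\sum_{\alpha\in\mathcal A}m_\alpha(m_\alpha+1)(\alpha_0,\alpha_0)\,\wp(\alpha(x)|\tau),$$ where $\wp(z|\tau)$ is the Weierstrass function with periods $1,\tau$. Assume that the hyperplanes $\pi_\alpha^{p,q}=\{\alpha(x)=p+q\tau\}$ ($\alpha\in\mathcal A$, $p,q\in\mathbb Z$) are pairwise different, let $Sing$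 be their union (and also its image in $T$), and assume that $L$ is a generalized Lamé operator: for each $\pi=\pi_\alpha^{p,q}$ the function $u(x)-u(s_\pi x)$, where $s_\pi$ is the orthogonal reflection in $\pi$, is divisible by $(\alpha(x)-p-q\tau)^{2m_\alpha+1}$ (at the points of $\pi$ that lie on no other hyperplane of $Sing$). Let $L$ be strongly integrable: $L_1=L,L_2,\dots,L_n$ are pairwise commuting differential operators with meromorphic, $(\mathcal L+\tau\mathcal L)$-periodic coefficients and with constant homogeneous highest symbols $s_1,\dots,s_n$ which are algebraically independent and such that $\mathbb C[\xi_1,\dots,\xi_n]$ is a finitely generated module over $\mathbb C[s_1,\dots,s_n]$. Then $\mathbb C[\xi_1,\dots,\xi_n]$ is a free $\mathbb C[s_1,\dots,s_n]$-module, of a rank denoted by $N$; the coefficients of all $L_i$ are holomorphic outside $Sing$; and for every $\lambda=(\lambda_1,\dots,\lambda_n)\in\mathbb C^n$ the system $$L_i\psi=\lambda_i\psi,\qquad i=1,\dots,n,$$ is a holonomic system of rank $N$ on $T$ with singularities along $Sing$, in the sense that the space of its holomorphic solutions in any simply connected domain of $T\setminus Sing$ has dimension $N$; and this system has regular singularities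 along $Sing$: for every holomorphic map $\varphi$ from a disc $|z|<\varepsilon$ to $\mathbb C^n$ with $\varphi(z)\in Sing$ exactly for $z=0$, every branch over a sector $0<|z|<\varepsilon$, $a<\arg z<b$, $a<b\le a+2\pi$, of a (multivalued) solution $\psi$ along $\varphi$ and every multi-index $k$, there are $C,K,r>0$ such that $|(\partial^k\psi)(\varphi(z))|\le C|z|^{-K}$ for all $z$ of the sector with $|z|<r$. -/

import Mathlib

open scoped Topology

noncomputable section

namespace LameOperators

/-! ### Meromorphic functions and differential operators on `ℂⁿ` -/

/-- A function on `ℂⁿ` is meromorphic if near every point it is a quotient of two holomorphic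
functions, the denominator not vanishing identically. Values on the zero set of the denominator
are irrelevant. -/
def IsMeromorphic {n : ℕ} (f : (Fin n → ℂ) → ℂ) : Prop :=
  ∀ x : Fin n → ℂ, ∃ g h : (Fin n → ℂ) → ℂ, AnalyticAt ℂ g x ∧ AnalyticAt ℂ h x ∧
    (∃ᶠ y in 𝓝 x, h y ≠ 0) ∧ ∀ᶠ y in 𝓝 x, h y ≠ 0 → f y = g y / h y

/-- The partial derivative `∂ᵢ f`. -/
def pderivFun {n : ℕ} (i : Fin n) (f : (Fin n → ℂ) → ℂ) : (Fin n → ℂ) → ℂ :=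
  fun x => fderiv ℂ f x (Pi.single i 1)

/-- The iterated partial derivative `∂^k f = ∂₁^{k₁} ⋯ ∂ₙ^{kₙ} f`. -/
def partialDeriv {n : ℕ} (k : Fin n →₀ ℕ) (f : (Fin n → ℂ) → ℂ) : (Fin n → ℂ) → ℂ :=
  (List.finRange n).foldr (fun i g => (pderivFun i)^[k i] g) f

/-- A linear differential operator `∑ₖ aₖ(x) ∂^k`, recorded by its full symbol `∑ₖ aₖ(x) ξ^k`
(coefficients on the left). The product of polynomials is not the composition of operators. -/
abbrev DiffOp (n : ℕ) : Type := MvPolynomial (Fin n) ((Fin n → ℂ) → ℂ)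

/-- The action of a differential operator on functions. -/
def DiffOp.apply {n : ℕ} (D : DiffOp n) (f : (Fin n → ℂ) → ℂ) : (Fin n → ℂ) → ℂ :=
  fun x => ∑ k ∈ D.support, D.coeff k x * partialDeriv k f x

/-- All coefficients of the operator are holomorphic near `x`. -/
def DiffOp.RegularAt {n : ℕ} (D : DiffOp n) (x : Fin n → ℂ) : Prop :=
  ∀ k : Fin n →₀ ℕ, AnalyticAt ℂ (D.coeff k) x

/-- `[P, Q] = 0`, tested on holomorphic germs at the points where both operators are regular. -/
def DiffOp.Commutes {n : ℕ} (P Q : DiffOp n) : Prop :=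
  ∀ x : Fin n → ℂ, P.RegularAt x → Q.RegularAt x →
    ∀ f : (Fin n → ℂ) → ℂ, AnalyticAt ℂ f x →
      P.apply (Q.apply f) x = Q.apply (P.apply f) x

/-! ### Generalized Lamé operators -/

/-- The affine-linear function `x ↦ const + ∑ⱼ gradⱼ xⱼ` on `ℂⁿ`. -/
structure AffineForm (n : ℕ) where
  grad : Fin n → ℂ
  const : ℂ

/-- Evaluation of an affine-linear function. -/
def AffineForm.eval {n : ℕ} (α : AffineForm n) (x : Fin n → ℂ) : ℂ :=
  α.const + ∑ j, α.grad j * x j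

/-- The complex bilinear square `(α₀, α₀)` of the gradient. -/
def AffineForm.sq {n : ℕ} (α : AffineForm n) : ℂ := ∑ j, α.grad j ^ 2

/-- The pair of periods `1, τ`. -/
def periodPair (τ : UpperHalfPlane) : PeriodPair where
  ω₁ := 1
  ω₂ := τ
  indep := by
    rw [LinearIndependent.pair_iff]
    intro a b h
    have him := congrArg Complex.im h
    have hre := congrArg Complex.re h
    have hb : b = 0 := by
      have : b * (τ : ℂ).im = 0 := by simpa using him
      rcases mul_eq_zero.mp this with h0 | h0
      · exact h0
      · exact absurd h0 τ.im_pos.ne'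
    subst hb
    exact ⟨by simpa using hre, rfl⟩

/-- The hyperplane `α(x) = p + q τ`. -/
def hyperplane {n : ℕ} (τ : UpperHalfPlane) (α : AffineForm n) (p q : ℤ) : Set (Fin n → ℂ) :=
  {x | α.eval x = (p : ℂ) + (q : ℂ) * (τ : ℂ)}

/-- The union of all the hyperplanes `α(x) = p + q τ`, `α ∈ A`, `p, q ∈ ℤ`. -/
def singularLocus {n : ℕ} (τ : UpperHalfPlane) (A : Finset (AffineForm n)) :
    Set (Fin n → ℂ) :=
  ⋃ α ∈ A, ⋃ p : ℤ, ⋃ q : ℤ, hyperplane τ α p q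

/-- The orthogonal reflection in the hyperplane `α(x) = p + q τ`, with respect to the complex
bilinear scalar product. -/
def reflection {n : ℕ} (τ : UpperHalfPlane) (α : AffineForm n) (p q : ℤ) (x : Fin n → ℂ) :
    Fin n → ℂ :=
  x - (2 * (α.eval x - ((p : ℂ) + (q : ℂ) * (τ : ℂ))) / α.sq) • α.grad

/-- The potential `u(x) = ∑_α m_α (m_α + 1) (α₀, α₀) ℘(α(x) | τ)`. -/
def potential {n : ℕ} (τ : UpperHalfPlane) (A : Finset (AffineForm n)) (m : AffineForm n → ℕ) :
    (Fin n → ℂ) → ℂ :=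
  fun x => ∑ α ∈ A, (m α : ℂ) * ((m α : ℂ) + 1) * α.sq *
    (periodPair τ).weierstrassP (α.eval x)

/-- The Schrödinger operator `-Δ + u`. -/
def schrodinger {n : ℕ} (u : (Fin n → ℂ) → ℂ) : DiffOp n :=
  -(∑ j : Fin n, MvPolynomial.X j ^ 2) + MvPolynomial.C u

/-- The data `(τ, A, m)` define a generalized Lamé operator. -/
structure IsGeneralizedLame {n : ℕ} (τ : UpperHalfPlane) (A : Finset (AffineForm n))
    (m : AffineForm n → ℕ) : Prop where
  nonisotropic : ∀ α ∈ A, α.sq ≠ 0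
  /-- The `ℤ`-span of the gradients is a lattice of rank `n` which spans the dual space. -/
  rank_eq : Module.finrank ℤ (Submodule.span ℤ (AffineForm.grad '' (A : Set (AffineForm n)))) = n
  span_eq : Submodule.span ℂ (AffineForm.grad '' (A : Set (AffineForm n))) = ⊤
  m_pos : ∀ α ∈ A, 0 < m α
  /-- The hyperplanes are pairwise different. -/
  hyperplane_inj : ∀ α ∈ A, ∀ β ∈ A, ∀ p q p' q' : ℤ,
    hyperplane τ α p q = hyperplane τ β p' q' → α = β ∧ p = p' ∧ q = q'
  /-- `u - u ∘ s_π` is divisible by `(α - p - qτ)^{2 m_α + 1}` at the generic points of each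
  hyperplane `π`, that is, at those which lie on no other polar hyperplane. -/
  quasi_invariant : ∀ α ∈ A, ∀ p q : ℤ, ∀ x ∈ hyperplane τ α p q,
    (∀ β ∈ A, ∀ p' q' : ℤ, x ∈ hyperplane τ β p' q' →
      hyperplane τ β p' q' = hyperplane τ α p q) →
    ∃ g : (Fin n → ℂ) → ℂ, AnalyticAt ℂ g x ∧ ∀ᶠ y in 𝓝 x,
      potential τ A m y - potential τ A m (reflection τ α p q y) =
        (α.eval y - ((p : ℂ) + (q : ℂ) * (τ : ℂ))) ^ (2 * m α + 1) * g y

/-! ### The torus -/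

/-- The lattice `𝓛 = Hom(M, ℤ) ⊂ ℂⁿ`, where `M` is the `ℤ`-span of the gradients. -/
def dualLattice {n : ℕ} (A : Finset (AffineForm n)) : AddSubgroup (Fin n → ℂ) where
  carrier := {l | ∀ α ∈ A, ∃ p : ℤ, ∑ j, α.grad j * l j = (p : ℂ)}
  zero_mem' := fun α _ => ⟨0, by simp⟩
  add_mem' := by
    intro a b ha hb α hα
    obtain ⟨p, hp⟩ := ha α hα
    obtain ⟨q, hq⟩ := hb α hα
    exact ⟨p + q, by simp [mul_add, Finset.sum_add_distrib, hp, hq]⟩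
  neg_mem' := by
    intro a ha α hα
    obtain ⟨p, hp⟩ := ha α hα
    exact ⟨-p, by simp [hp]⟩

/-- The period lattice `𝓛 + τ 𝓛`. -/
def periodLattice {n : ℕ} (τ : UpperHalfPlane) (A : Finset (AffineForm n)) :
    AddSubgroup (Fin n → ℂ) :=
  dualLattice A ⊔
    (dualLattice A).map (DistribSMul.toAddMonoidHom (Fin n → ℂ) (τ : ℂ))

/-- The torus `T = ℂⁿ / (𝓛 + τ 𝓛)`. -/
abbrev Torus {n : ℕ} (τ : UpperHalfPlane) (A : Finset (AffineForm n)) : Type :=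
  (Fin n → ℂ) ⧸ periodLattice τ A

/-- The projection of `ℂⁿ` onto the torus. -/
def toTorus {n : ℕ} (τ : UpperHalfPlane) (A : Finset (AffineForm n)) :
    (Fin n → ℂ) → Torus τ A :=
  fun x => (QuotientAddGroup.mk x : (Fin n → ℂ) ⧸ periodLattice τ A)

/-! ### Strong integrability -/

/-- The operators `L₁ = L₀, L₂, …, Lₙ`, with meromorphic coefficients that are periodic with
respect to `Λ`, commute, and have algebraically independent homogeneous constant highest symbols
`s₁, …, sₙ` over which the polynomial ring is a finite module. -/
structure IsStronglyIntegrable {n : ℕ} [NeZero n] (Λ : AddSubgroup (Fin n → ℂ)) (L₀ : DiffOp n)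
    (L : Fin n → DiffOp n) (s : Fin n → MvPolynomial (Fin n) ℂ) : Prop where
  first_eq : L 0 = L₀
  meromorphic : ∀ i k, IsMeromorphic ((L i).coeff k)
  periodic : ∀ i k, ∀ l ∈ Λ, ∀ x, (L i).coeff k (x + l) = (L i).coeff k x
  commutes : ∀ i j, (L i).Commutes (L j)
  homogeneous : ∀ i, (s i).IsHomogeneous (s i).totalDegree
  symbol_eq : ∀ i (k : Fin n →₀ ℕ), (s i).totalDegree ≤ k.degree →
    (L i).coeff k = fun _ => (s i).coeff k
  algebraicIndependent : AlgebraicIndependent ℂ s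
  finite : Module.Finite (Algebra.adjoin ℂ (Set.range s)) (MvPolynomial (Fin n) ℂ)

/-! ### Solutions of the joint eigenvalue problem -/

/-- `ψ` is holomorphic at `x` and `Lᵢ ψ = λᵢ ψ` at `x` for all those `i` for which `Lᵢ` is
regular at `x`. On an open set this is the identity `Lᵢ ψ = λᵢ ψ` of meromorphic functions. -/
def IsSolutionAt {n : ℕ} (L : Fin n → DiffOp n) (lam : Fin n → ℂ) (ψ : (Fin n → ℂ) → ℂ)
    (x : Fin n → ℂ) : Prop :=
  AnalyticAt ℂ ψ x ∧ ∀ i, (L i).RegularAt x → (L i).apply ψ x = lam i * ψ x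

theorem analyticAt_pderivFun {n : ℕ} (i : Fin n) {f : (Fin n → ℂ) → ℂ} {x : Fin n → ℂ}
    (hf : AnalyticAt ℂ f x) : AnalyticAt ℂ (pderivFun i f) x :=
  ((ContinuousLinearMap.apply ℂ ℂ (Pi.single i 1 : Fin n → ℂ)).analyticAt _).comp hf.fderiv

theorem analyticAt_iterate {n : ℕ} (i : Fin n) (r : ℕ) {f : (Fin n → ℂ) → ℂ} {x : Fin n → ℂ}
    (hf : AnalyticAt ℂ f x) : AnalyticAt ℂ ((pderivFun i)^[r] f) x := by
  induction r with
  | zero => exact hf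
  | succ r ih => rw [Function.iterate_succ_apply']; exact analyticAt_pderivFun i ih

theorem pderivFun_congr {n : ℕ} (i : Fin n) {f g : (Fin n → ℂ) → ℂ} {x : Fin n → ℂ}
    (h : f =ᶠ[𝓝 x] g) : pderivFun i f =ᶠ[𝓝 x] pderivFun i g :=
  (h.fderiv (𝕜 := ℂ)).mono fun y hy => by simp only [pderivFun, hy]

theorem pderivFun_lin {n : ℕ} (i : Fin n) (c : ℂ) {f g : (Fin n → ℂ) → ℂ} {x : Fin n → ℂ}
    (hf : AnalyticAt ℂ f x) (hg : AnalyticAt ℂ g x) :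
    pderivFun i (c • f + g) =ᶠ[𝓝 x] c • pderivFun i f + pderivFun i g := by
  filter_upwards [hf.eventually_analyticAt, hg.eventually_analyticAt] with y hy hy'
  simp only [pderivFun, Pi.add_apply, Pi.smul_apply]
  rw [fderiv_add (hy.differentiableAt.const_smul c) hy'.differentiableAt,
    fderiv_const_smul hy.differentiableAt]
  simp

theorem iterate_lin {n : ℕ} (i : Fin n) (r : ℕ) (c : ℂ) {f g h : (Fin n → ℂ) → ℂ}
    {x : Fin n → ℂ} (hf : AnalyticAt ℂ f x) (hg : AnalyticAt ℂ g x)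
    (hh : h =ᶠ[𝓝 x] c • f + g) :
    (pderivFun i)^[r] h =ᶠ[𝓝 x] c • (pderivFun i)^[r] f + (pderivFun i)^[r] g := by
  induction r with
  | zero => exact hh
  | succ r ih =>
    simp only [Function.iterate_succ_apply']
    exact (pderivFun_congr i ih).trans
      (pderivFun_lin i c (analyticAt_iterate i r hf) (analyticAt_iterate i r hg))

theorem foldr_lin {n : ℕ} (k : Fin n →₀ ℕ) (c : ℂ) {f g : (Fin n → ℂ) → ℂ} {x : Fin n → ℂ}
    (hf : AnalyticAt ℂ f x) (hg : AnalyticAt ℂ g x) (l : List (Fin n)) :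
    AnalyticAt ℂ (l.foldr (fun i g => (pderivFun i)^[k i] g) f) x ∧
    AnalyticAt ℂ (l.foldr (fun i g => (pderivFun i)^[k i] g) g) x ∧
    l.foldr (fun i g => (pderivFun i)^[k i] g) (c • f + g) =ᶠ[𝓝 x]
      c • l.foldr (fun i g => (pderivFun i)^[k i] g) f +
        l.foldr (fun i g => (pderivFun i)^[k i] g) g := by
  induction l with
  | nil => exact ⟨hf, hg, Filter.EventuallyEq.rfl⟩
  | cons a l ih =>
    simp only [List.foldr_cons]
    exact ⟨analyticAt_iterate a _ ih.1, analyticAt_iterate a _ ih.2.1,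
      iterate_lin a _ c ih.1 ih.2.1 ih.2.2⟩

theorem isSolutionAt_lin {n : ℕ} (L : Fin n → DiffOp n) (lam : Fin n → ℂ) (c : ℂ)
    {f g : (Fin n → ℂ) → ℂ} {x : Fin n → ℂ} (hf : IsSolutionAt L lam f x)
    (hg : IsSolutionAt L lam g x) : IsSolutionAt L lam (c • f + g) x := by
  refine ⟨(hf.1.const_smul).add hg.1, fun i hi => ?_⟩
  have h : (L i).apply (c • f + g) x = c * (L i).apply f x + (L i).apply g x := by
    simp only [DiffOp.apply, Finset.mul_sum, ← Finset.sum_add_distrib]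
    refine Finset.sum_congr rfl fun k _ => ?_
    have := (foldr_lin k c hf.1 hg.1 (List.finRange n)).2.2.eq_of_nhds
    simp only [partialDeriv, this, Pi.add_apply, Pi.smul_apply, smul_eq_mul]
    ring
  rw [h, hf.2 i hi, hg.2 i hi]
  simp only [Pi.add_apply, Pi.smul_apply, smul_eq_mul]
  ring

theorem isSolutionAt_zero {n : ℕ} (L : Fin n → DiffOp n) (lam : Fin n → ℂ) (x : Fin n → ℂ) :
    IsSolutionAt L lam 0 x := by
  have h1 : ∀ (i : Fin n) (r : ℕ), (pderivFun i)^[r] (0 : (Fin n → ℂ) → ℂ) = 0 := by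
    intro i r
    induction r with
    | zero => rfl
    | succ r ih =>
      rw [Function.iterate_succ_apply', ih]
      funext y
      simp [pderivFun]
  have h2 : ∀ (k : Fin n →₀ ℕ) (l : List (Fin n)),
      l.foldr (fun i g => (pderivFun i)^[k i] g) (0 : (Fin n → ℂ) → ℂ) = 0 := by
    intro k l
    induction l with
    | nil => rfl
    | cons a l ih => rw [List.foldr_cons, ih, h1]
  exact ⟨analyticAt_const, fun i _ => by simp [DiffOp.apply, partialDeriv, h2]⟩

/-- The space of solutions of `Lᵢ ψ = λᵢ ψ` in a subset `U` of `ℂⁿ` (meant to be open); a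
function on `U` is represented by its extension by zero. -/
def solutionSpace {n : ℕ} (L : Fin n → DiffOp n) (lam : Fin n → ℂ) (U : Set (Fin n → ℂ)) :
    Submodule ℂ ((Fin n → ℂ) → ℂ) where
  carrier := {ψ | (∀ x ∉ U, ψ x = 0) ∧ ∀ x ∈ U, IsSolutionAt L lam ψ x}
  zero_mem' := ⟨fun _ _ => rfl, fun x _ => isSolutionAt_zero L lam x⟩
  add_mem' := by
    intro f g hf hg
    refine ⟨fun x hx => by simp [hf.1 x hx, hg.1 x hx], fun x hx => ?_⟩
    simpa using isSolutionAt_lin L lam 1 (hf.2 x hx) (hg.2 x hx)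
  smul_mem' := by
    intro c f hf
    refine ⟨fun x hx => by simp [hf.1 x hx], fun x hx => ?_⟩
    simpa using isSolutionAt_lin L lam c (hf.2 x hx) (isSolutionAt_zero L lam x)

/-- The space of solutions in a subset `W` of the torus: the functions on `W` (extended by zero)
whose pull-back to `ℂⁿ` is a solution in the preimage of `W`. -/
def torusSolutionSpace {n : ℕ} (τ : UpperHalfPlane) (A : Finset (AffineForm n))
    (L : Fin n → DiffOp n) (lam : Fin n → ℂ) (W : Set (Torus τ A)) :
    Submodule ℂ (Torus τ A → ℂ) :=
  (solutionSpace L lam (toTorus τ A ⁻¹' W)).comap (LinearMap.funLeft ℂ ℂ (toTorus τ A))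

/-! ### Regular singularities -/

/-- The open sector `{ρ e^{iθ} : 0 < ρ < ε, a < θ < b}`. -/
def sector (ε a b : ℝ) : Set ℂ :=
  {z | ∃ ρ θ : ℝ, 0 < ρ ∧ ρ < ε ∧ a < θ ∧ θ < b ∧ z = ρ * Complex.exp (θ * Complex.I)}

/-- A branch over `S ⊆ ℂ` of a multivalued solution along the arc `φ`: for each `z ∈ S` the germ
at `φ z` of a solution `Ψ z`, these germs being analytic continuations of each other along `φ`. -/
def IsBranchAlong {n : ℕ} (L : Fin n → DiffOp n) (lam : Fin n → ℂ) (φ : ℂ → (Fin n → ℂ))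
    (S : Set ℂ) (Ψ : ℂ → (Fin n → ℂ) → ℂ) : Prop :=
  ∀ z ∈ S, (∀ᶠ x in 𝓝 (φ z), IsSolutionAt L lam (Ψ z) x) ∧
    ∀ᶠ w in 𝓝 z, Ψ w =ᶠ[𝓝 (φ w)] Ψ z

/-- The system `Lᵢ ψ = λᵢ ψ` has regular singularities along `Sing`: its restriction to every
holomorphic disc which meets `Sing` only in its centre has a regular singularity there. That is,
every branch over a sector of a solution, together with all its partial derivatives (they are the
components of the horizontal sections of the associated flat connection), has at most power growth
at the centre. -/
def HasRegularSingularities {n : ℕ} (L : Fin n → DiffOp n) (lam : Fin n → ℂ)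
    (Sing : Set (Fin n → ℂ)) : Prop :=
  ∀ (ε : ℝ) (φ : ℂ → (Fin n → ℂ)), 0 < ε → AnalyticOnNhd ℂ φ (Metric.ball 0 ε) →
    φ 0 ∈ Sing → (∀ z ∈ Metric.ball (0 : ℂ) ε, z ≠ 0 → φ z ∉ Sing) →
    ∀ a b : ℝ, a < b → b ≤ a + 2 * Real.pi →
    ∀ Ψ : ℂ → (Fin n → ℂ) → ℂ, IsBranchAlong L lam φ (sector ε a b) Ψ →
    ∀ k : Fin n →₀ ℕ, ∃ (C r : ℝ) (K : ℕ), 0 < r ∧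
      ∀ z ∈ sector ε a b, ‖z‖ < r → ‖partialDeriv k (Ψ z) (φ z)‖ ≤ C / ‖z‖ ^ K

/-- The rank `N` of the polynomial ring `ℂ[ξ₁, …, ξₙ]` over `ℂ[s₁, …, sₙ]`. -/
def symbolRank {n : ℕ} (s : Fin n → MvPolynomial (Fin n) ℂ) : ℕ :=
  Module.finrank (Algebra.adjoin ℂ (Set.range s)) (MvPolynomial (Fin n) ℂ)

end LameOperators

end

/-! Algebra. The highest symbols `s` are homogeneous and ℂ[ξ] is finite over ℂ[s], so a power of
each variable lies in the ideal (s). Powers of the variables form a regular sequence, which makes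
the Koszul complex of `s` exact in degree one. Consequently monomials ξ^{e_j} that form a basis of
ℂ[ξ]/(s) form a basis of ℂ[ξ] over ℂ[s] (`IsQuotBasis.exists_basis`,
`IsQuotBasis.exists_adjoin_basis`).

Holonomicity. The operator ∂^{e_j} L^β has leading symbol ξ^{e_j} s^β. Filtering by order, these
operators form a basis of all differential operators over the functions, so modulo the left ideal
generated by the L_i - λ_i the ∂^{e_j} form a basis (`exists_reduction`). A solution is thus
determined by the numbers ∂^{e_j}ψ(p). Conversely the reduction prescribes the whole Taylor series
from these numbers; it converges by Cauchy estimates and solves the system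
(`IsHolonomic.exists_solution`). The monodromy theorem (`exists_continuation`) extends local
solutions over simply connected domains, and such a domain of the torus lifts to ℂⁿ because ℂⁿ → T
is a covering.

Coefficients. If P commutes with -Δ + u and P_r(x, ξ) is the part of degree r of its symbol, then 2
(ξ·∂_x) P_r(x, ξ) is expressed by u and the parts of degree greater than r (`two_mul_sum_D_evalAt`,
`commDefect_mem_degLT`). Downward induction on r together with integration in the direction ξ, for ξ
in an open set, is used twice. Off Sing it shows that the coefficients are holomorphic
(`exists_map_res_eq`). In a convex cone with vertex on Sing, where u has at most a double pole along
the boundary, it shows that the coefficient of ∂^k in L_i has a pole of order at most deg s_i - |k|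
(`IsCorner.mem_symbolSpace`).

Regular singularities. With these pole orders the derivatives of a solution, weighted by powers of
the distance to the boundary of the cone, satisfy a system with a simple pole along lines in the
cone, and Gronwall's inequality yields polynomial growth (`IsHolonomic.exists_growth`). Along a disc
φ each α(φ(z)) - α(φ(0)) is z^p times a nonvanishing function, so near every ray the disc lies in
such a cone, at a distance at least c|z|^p from its boundary. Compactness of the interval of
arguments makes the bound uniform in the sector. -/

/-! ### Koszul relations -/

namespace Koszul

variable {R : Type*} [CommRing R] {n : ℕ}

/-- The linear form `v ↦ ∑ sᵢ vᵢ`. -/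
def form (s : Fin n → R) : Module.Dual R (Fin n → R) := ∑ i, s i • LinearMap.proj i

theorem form_apply (s v : Fin n → R) : form s v = ∑ i, s i * v i := by
  simp [form]

/-- The Koszul differential on the exterior algebra. -/
def diff (s : Fin n → R) :
    ExteriorAlgebra R (Fin n → R) →ₗ[R] ExteriorAlgebra R (Fin n → R) :=
  CliffordAlgebra.contractLeft (form s)

theorem diff_ι_mul (s v : Fin n → R) (x : ExteriorAlgebra R (Fin n → R)) :
    diff s (ExteriorAlgebra.ι R v * x) = form s v • x - ExteriorAlgebra.ι R v * diff s x :=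
  CliffordAlgebra.contractLeft_ι_mul (Q := (0 : QuadraticForm R (Fin n → R))) (form s) v x

theorem diff_diff (s : Fin n → R) (x : ExteriorAlgebra R (Fin n → R)) :
    diff s (diff s x) = 0 :=
  CliffordAlgebra.contractLeft_contractLeft _ _

theorem map_mem_smul_top {M N : Type*} [AddCommGroup M] [Module R M] [AddCommGroup N] [Module R N]
    (J : Ideal R) (f : M →ₗ[R] N) {x : M} (hx : x ∈ J • (⊤ : Submodule R M)) :
    f x ∈ J • (⊤ : Submodule R N) := by
  have h : f x ∈ (J • (⊤ : Submodule R M)).map f := Submodule.mem_map_of_mem hx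
  rw [Submodule.map_smul''] at h
  exact Submodule.smul_mono le_rfl le_top h

/-- An element that can be cancelled modulo J can be cancelled coordinate by coordinate in a free
module; it will be applied to the exterior algebra. -/
theorem mem_smul_top_of_smul_mem {M ι : Type*} [AddCommGroup M] [Module R M] [Finite ι]
    (b : Module.Basis ι R M)
    (J : Ideal R) (g : R) (hg : ∀ r, g * r ∈ J → r ∈ J) {x : M}
    (hx : g • x ∈ J • (⊤ : Submodule R M)) : x ∈ J • (⊤ : Submodule R M) := by
  have := Fintype.ofFinite ι
  have h : ∀ i, b.repr x i ∈ J := fun i => by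
    have h1 := map_mem_smul_top J (b.coord i) hx
    apply hg
    simpa using h1
  rw [← b.sum_repr x]
  exact Submodule.sum_mem _ fun i _ => Submodule.smul_mem_smul (h i) trivial

/-- Exactness of the Koszul complex modulo `J` in degree `i`. -/
def Exact (s : Fin n → R) (J : Ideal R) (i : ℕ) : Prop :=
  ∀ z ∈ ⋀[R]^i (Fin n → R), diff s z ∈ J • (⊤ : Submodule R (ExteriorAlgebra R (Fin n → R))) →
    ∃ w, z - diff s w ∈ J • (⊤ : Submodule R (ExteriorAlgebra R (Fin n → R)))

/-- Writing g = form(c), multiplication by c is a homotopy: d(c∧z) = g z - c∧dz. So a cycle z modulo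
J gives a cycle c∧z modulo J + (g), and a primitive of the latter produces one of z after division
by g. One generator of J is traded for one degree. -/
theorem Exact.descend {s : Fin n → R} {J : Ideal R} {i : ℕ} {g : R}
    (hgs : g ∈ Ideal.span (Set.range s)) (hg : ∀ r, g * r ∈ J → r ∈ J)
    (h : Exact s (J ⊔ Ideal.span {g}) (i + 1)) : Exact s J i := by
  intro z hz hdz
  obtain ⟨c, hc⟩ := (Ideal.mem_span_range_iff_exists_fun).1 hgs
  have hgc : form s c = g := by rw [form_apply, ← hc]; exact Finset.sum_congr rfl fun _ _ => mul_comm _ _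
  have h1 : ExteriorAlgebra.ι R c * diff s z ∈ J • (⊤ : Submodule R (ExteriorAlgebra R (Fin n → R))) :=
    map_mem_smul_top J (LinearMap.mulLeft R (ExteriorAlgebra.ι R c)) hdz
  have hdw : diff s (ExteriorAlgebra.ι R c * z) = g • z - ExteriorAlgebra.ι R c * diff s z := by
    rw [diff_ι_mul, hgc]
  obtain ⟨u, hu⟩ := h (ExteriorAlgebra.ι R c * z) (by
      have hc1 : ExteriorAlgebra.ι R c ∈ ⋀[R]^1 (Fin n → R) := by simp
      have := SetLike.mul_mem_graded (A := fun i : ℕ => ⋀[R]^i (Fin n → R)) hc1 hz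
      rwa [add_comm] at this) (by
      rw [hdw]
      refine Submodule.sub_mem _ (Submodule.smul_mem_smul ?_ trivial)
        (Submodule.smul_mono_left le_sup_left h1)
      exact Ideal.mem_sup_right (Ideal.mem_span_singleton_self g))
  rw [Submodule.sup_smul] at hu
  obtain ⟨r1, hr1, r2', hr2, hr⟩ := Submodule.mem_sup.1 hu
  rw [Submodule.ideal_span_singleton_smul] at hr2
  obtain ⟨r2, -, rfl⟩ := hr2
  -- The primitive of `z` is the coefficient `r2` of g in the error c∧z - du; the element `u` itself
  -- drops out on applying d, since d² = 0.
  refine ⟨r2, mem_smul_top_of_smul_mem (Module.Basis.ExteriorAlgebra (Pi.basisFun R (Fin n))) J g hg ?_⟩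
  have e1 : diff s (ExteriorAlgebra.ι R c * z) = diff s r1 + g • diff s r2 := by
    have := congrArg (diff s) hr
    rw [map_sub, diff_diff, sub_zero, map_add] at this
    rw [← this]
    exact congrArg _ (map_smul (diff s) g r2)
  have : g • (z - diff s r2) = diff s r1 + ExteriorAlgebra.ι R c * diff s z := by
    have := hdw.symm.trans e1
    rw [smul_sub, sub_eq_iff_eq_add.1 this]
    abel
  rw [this]
  exact Submodule.add_mem _ (map_mem_smul_top J _ hr1) h1

/-- There are no subsets of `Fin n` with more than n elements, so the exterior power is zero. This
starts the descent. -/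
theorem Exact.of_lt {s : Fin n → R} {J : Ideal R} {i : ℕ} (hi : n < i) : Exact s J i := by
  intro z hz _
  have : z = 0 := by
    rcases subsingleton_or_nontrivial R with hR | hR
    · have := Module.subsingleton R (ExteriorAlgebra R (Fin n → R))
      exact Subsingleton.elim _ _
    have hb : IsEmpty (Set.powersetCard (Fin n) i) := by
      refine ⟨fun t => ?_⟩
      have h1 := t.2
      rw [Set.powersetCard.mem_iff] at h1
      have h2 := Finset.card_le_univ t.1
      simp at h2
      omega
    have b := (Pi.basisFun R (Fin n)).exteriorPower i
    have hs : Subsingleton (⋀[R]^i (Fin n → R)) := b.repr.toEquiv.subsingleton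
    exact congrArg Subtype.val (hs.elim (⟨z, hz⟩ : ⋀[R]^i (Fin n → R)) 0)
  exact ⟨0, by simp [this]⟩

/-- Descent from degree n + 1 modulo all the g's to degree 1 modulo 0; each step removes the last
remaining element of the regular sequence. -/
theorem Exact.one_of_regular {s g : Fin n → R} (hgs : ∀ i, g i ∈ Ideal.span (Set.range s))
    (hreg : ∀ (i : Fin n) (r : R), g i * r ∈ Ideal.span (g '' {j | j < i}) →
      r ∈ Ideal.span (g '' {j | j < i})) : Exact s ⊥ 1 := by
  have key : ∀ k : ℕ, k ≤ n →
      Exact s (Ideal.span (g '' {j | (j : ℕ) < n - k})) (n - k + 1) := by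
    intro k
    induction k with
    | zero => exact fun _ => Exact.of_lt (by omega)
    | succ k ih =>
      intro hk
      have hlt : n - (k + 1) < n := by omega
      have h := ih (by omega)
      refine Exact.descend (hgs ⟨n - (k + 1), hlt⟩) (hreg ⟨n - (k + 1), hlt⟩) ?_
      rw [← Ideal.span_union]
      convert h using 2
      · ext x
        simp only [Set.mem_union, Set.mem_image, Set.mem_ofPred_eq, Set.mem_singleton_iff]
        constructor
        · rintro (⟨j, hj, rfl⟩ | rfl)
          · exact ⟨j, by omega, rfl⟩
          · exact ⟨_, by simp; omega, rfl⟩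
        · rintro ⟨j, hj, rfl⟩
          by_cases hj' : (j : ℕ) < n - (k + 1)
          · exact Or.inl ⟨j, hj', rfl⟩
          · exact Or.inr (congrArg g (Fin.ext (by simp; omega)))
      · omega
  have := key n le_rfl
  simpa using this

/-- The Koszul relations. -/
def relations (s : Fin n → R) : Submodule R (Fin n → R) where
  carrier := {u | ∃ w : Fin n → Fin n → R, (∀ i, w i i = 0) ∧ (∀ i j, w i j = -w j i) ∧
    ∀ i, u i = ∑ l, s l * w i l}
  zero_mem' := ⟨0, by simp, by simp, by simp⟩
  add_mem' := by
    rintro a b ⟨w, h1, h2, h3⟩ ⟨w', h1', h2', h3'⟩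
    refine ⟨w + w', by simp [h1, h1'], fun i j => ?_, by simp [h3, h3', mul_add, Finset.sum_add_distrib]⟩
    simp only [Pi.add_apply]
    rw [h2, h2']
    ring
  smul_mem' := by
    rintro c a ⟨w, h1, h2, h3⟩
    refine ⟨c • w, by simp [h1], fun i j => ?_, fun i => ?_⟩
    · simp only [Pi.smul_apply]
      rw [h2, smul_neg]
    · simp only [Pi.smul_apply, smul_eq_mul, h3, Finset.mul_sum]
      exact Finset.sum_congr rfl fun _ _ => by ring

theorem fst_diff (s : Fin n → R) (x : ExteriorAlgebra R (Fin n → R)) :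
    (ExteriorAlgebra.toTrivSqZeroExt (diff s x)).fst =
      form s (ExteriorAlgebra.toTrivSqZeroExt x).snd := by
  induction x using CliffordAlgebra.left_induction with
  | algebraMap r =>
    rw [diff, CliffordAlgebra.contractLeft_algebraMap, AlgHom.commutes]
    simp [TrivSqZeroExt.algebraMap_eq_inl]
  | add x y hx hy => simp only [map_add, TrivSqZeroExt.fst_add, TrivSqZeroExt.snd_add, hx, hy]
  | ι_mul x m _ =>
    have h := diff_ι_mul s m x
    rw [ExteriorAlgebra.ι] at h
    have h0 := ExteriorAlgebra.toTrivSqZeroExt_ι (R := R) m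
    rw [ExteriorAlgebra.ι] at h0
    rw [h]
    simp [h0, mul_comm]

/-- A primitive in `Exact` need not be homogeneous, so the degree-one part of `diff s x` is computed
for every x. If x = m∧y and b is the linear part of y, it equals s(m) b - s(b) m, the Koszul
relation attached to m∧b. -/
theorem snd_diff_mem (s : Fin n → R) (x : ExteriorAlgebra R (Fin n → R)) :
    (ExteriorAlgebra.toTrivSqZeroExt (diff s x)).snd ∈ relations s := by
  induction x using CliffordAlgebra.left_induction with
  | algebraMap r =>
    rw [diff, CliffordAlgebra.contractLeft_algebraMap, map_zero]
    exact Submodule.zero_mem _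
  | add x y hx hy =>
    simp only [map_add, TrivSqZeroExt.snd_add]
    exact Submodule.add_mem _ hx hy
  | ι_mul x m _ =>
    have h := diff_ι_mul s m x
    have h1 := fst_diff s x
    rw [ExteriorAlgebra.ι] at h
    have h0 := ExteriorAlgebra.toTrivSqZeroExt_ι (R := R) m
    rw [ExteriorAlgebra.ι] at h0
    rw [h]
    set b := (ExteriorAlgebra.toTrivSqZeroExt x).snd with hb
    have : (ExteriorAlgebra.toTrivSqZeroExt (form s m • x -
        (CliffordAlgebra.ι (0 : QuadraticForm R (Fin n → R))) m * diff s x)).snd =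
        form s m • b - form s b • m := by
      simp [h0, h1, hb]
    rw [this]
    refine ⟨fun i l => m l * b i - b l * m i, fun i => by ring, fun i j => by ring, fun i => ?_⟩
    simp only [Pi.sub_apply, Pi.smul_apply, smul_eq_mul, form_apply, Finset.sum_mul,
      ← Finset.sum_sub_distrib]
    exact Finset.sum_congr rfl fun _ _ => by ring

theorem Exact.exists_relations {s : Fin n → R} (h : Exact s ⊥ 1) {u : Fin n → R}
    (hu : ∑ i, s i * u i = 0) :
    ∃ w : Fin n → Fin n → R, (∀ i, w i i = 0) ∧ (∀ i j, w i j = -w j i) ∧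
      ∀ i, u i = ∑ l, s l * w i l := by
  obtain ⟨w, hw⟩ := h (ExteriorAlgebra.ι R u) (by simp) (by
    have := CliffordAlgebra.contractLeft_ι (Q := (0 : QuadraticForm R (Fin n → R))) (form s) u
    rw [diff, ExteriorAlgebra.ι, this, form_apply, hu, map_zero]
    exact Submodule.zero_mem _)
  rw [Submodule.bot_smul, Submodule.mem_bot, sub_eq_zero] at hw
  have := snd_diff_mem s w
  rw [← hw, ExteriorAlgebra.toTrivSqZeroExt_ι, TrivSqZeroExt.snd_inr] at this
  exact this

/-- The powers of the variables form a regular sequence. -/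
theorem mem_of_X_pow_mul_mem {k : Type*} [CommRing k] (M : ℕ) (i : Fin n)
    (r : MvPolynomial (Fin n) k)
    (h : MvPolynomial.X i ^ M * r ∈ Ideal.span ((fun j : Fin n =>
      (MvPolynomial.X j ^ M : MvPolynomial (Fin n) k)) '' {j | j < i})) :
    r ∈ Ideal.span ((fun j : Fin n =>
      (MvPolynomial.X j ^ M : MvPolynomial (Fin n) k)) '' {j | j < i}) := by
  have e : ((fun j : Fin n => (MvPolynomial.X j ^ M : MvPolynomial (Fin n) k)) '' {j | j < i}) =
      (fun a => MvPolynomial.monomial a 1) '' ((fun j => Finsupp.single j M) '' {j | j < i}) := by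
    rw [Set.image_image]
    exact Set.image_congr fun j _ => by rw [MvPolynomial.X_pow_eq_monomial]
  rw [e, MvPolynomial.mem_ideal_span_monomial_image] at h ⊢
  intro a ha
  -- The ideal is monomial: some X_j^M with j < i divides X_i^M X^a, and since j ≠ i it already
  -- divides X^a.
  have := h (Finsupp.single i M + a) (by
    rw [MvPolynomial.mem_support_iff, MvPolynomial.X_pow_eq_monomial,
      MvPolynomial.coeff_monomial_mul, one_mul]
    exact MvPolynomial.mem_support_iff.1 ha)
  obtain ⟨_, ⟨j, hj, rfl⟩, hle⟩ := this
  refine ⟨_, ⟨j, hj, rfl⟩, ?_⟩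
  rw [Finsupp.single_le_iff] at hle ⊢
  have hji : i ≠ j := (ne_of_lt hj).symm
  simpa [Finsupp.single_eq_of_ne' hji, Finsupp.single_eq_of_ne hji.symm] using hle

/-- Only a regular sequence inside the ideal (s) is required; regularity of `s` itself never has to
be established. -/
theorem exists_relations_of_X_pow_mem {k : Type*} [CommRing k]
    {s u : Fin n → MvPolynomial (Fin n) k} (M : ℕ)
    (hM : ∀ i, MvPolynomial.X i ^ M ∈ Ideal.span (Set.range s)) (hu : ∑ i, s i * u i = 0) :
    ∃ w : Fin n → Fin n → MvPolynomial (Fin n) k, (∀ i, w i i = 0) ∧ (∀ i j, w i j = -w j i) ∧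
      ∀ i, u i = ∑ l, s l * w i l :=
  (Exact.one_of_regular (g := fun j => MvPolynomial.X j ^ M) hM
    fun i r => mem_of_X_pow_mul_mem M i r).exists_relations hu

end Koszul

noncomputable section

/-! ### Freeness over a subalgebra generated by homogeneous parameters -/

namespace HomogeneousParameters

open MvPolynomial

variable {n : ℕ}

theorem homogeneousComponent_mul {d e : ℕ} {p q : MvPolynomial (Fin n) ℂ} (hp : p.IsHomogeneous e) :
    homogeneousComponent d (p * q) =
      if e ≤ d then p * homogeneousComponent (d - e) q else 0 := by
  let : GradedAlgebra (homogeneousSubmodule (Fin n) ℂ) := gradedAlgebra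
  have := DirectSum.coe_decompose_mul_of_left_mem (homogeneousSubmodule (Fin n) ℂ) (a := p) (b := q)
    (i := e) d hp
  have h : ∀ (r : MvPolynomial (Fin n) ℂ) (j : ℕ),
      (DirectSum.decompose (homogeneousSubmodule (Fin n) ℂ) r j : MvPolynomial (Fin n) ℂ) =
        homogeneousComponent j r := fun r j => decomposition.decompose'_apply r j
  rwa [h, h] at this

variable {s : Fin n → MvPolynomial (Fin n) ℂ}

/-- The ideal generated by the parameters. -/
abbrev paramIdeal (s : Fin n → MvPolynomial (Fin n) ℂ) : Ideal (MvPolynomial (Fin n) ℂ) :=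
  Ideal.span (Set.range s)

/-- The ideal is homogeneous because its generators are: taking the component of degree d of a
representation leaves homogeneous cofactors, and those whose degree would be negative vanish. -/
theorem exists_homogeneousComponent_of_mem (hs : ∀ i, (s i).IsHomogeneous (s i).totalDegree)
    {x : MvPolynomial (Fin n) ℂ} (hx : x ∈ paramIdeal s) (d : ℕ) :
    ∃ y : Fin n → MvPolynomial (Fin n) ℂ, homogeneousComponent d x = ∑ i, s i * y i ∧
      ∀ i, ((s i).totalDegree ≤ d → (y i).IsHomogeneous (d - (s i).totalDegree)) ∧
        (¬ (s i).totalDegree ≤ d → y i = 0) := by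
  obtain ⟨c, rfl⟩ := Ideal.mem_span_range_iff_exists_fun.1 hx
  refine ⟨fun i => if (s i).totalDegree ≤ d then
    homogeneousComponent (d - (s i).totalDegree) (c i) else 0, ?_, fun i => ⟨fun h => ?_, fun h => ?_⟩⟩
  · rw [map_sum]
    refine Finset.sum_congr rfl fun i _ => ?_
    rw [mul_comm, homogeneousComponent_mul (hs i)]
    split_ifs with h
    · simp [h]
    · simp [h]
  · simp only [h, if_true]
    exact homogeneousComponent_isHomogeneous _ _
  · simp [h]

theorem totalDegree_pos (ha : AlgebraicIndependent ℂ s) (i : Fin n) : 0 < (s i).totalDegree := by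
  rw [Nat.pos_iff_ne_zero]
  intro h
  rw [totalDegree_eq_zero_iff_eq_C] at h
  have h1 : aeval s (X i - C (coeff 0 (s i)) : MvPolynomial (Fin n) ℂ) = 0 := by
    rw [map_sub, aeval_X, aeval_C]
    exact sub_eq_zero.2 h
  have h2 := (map_eq_zero_iff (aeval s) ha).1 h1
  have h3 := congrArg (coeff (Finsupp.single i 1)) h2
  simp [coeff_C] at h3
  have h4 : (0 : Fin n →₀ ℕ) ≠ Finsupp.single i 1 := by
    intro h; have := DFunLike.congr_fun h i; simp at this
  simp [h4] at h3

theorem exists_C_sub_mem {b : MvPolynomial (Fin n) ℂ} (hb : b ∈ Algebra.adjoin ℂ (Set.range s)) :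
    ∃ c : ℂ, b - C c ∈ paramIdeal s := by
  induction hb using Algebra.adjoin_induction with
  | mem x hx => exact ⟨0, by simpa using Ideal.subset_span hx⟩
  | algebraMap r => exact ⟨r, by simp [algebraMap_eq]⟩
  | add x y _ _ hx hy =>
    obtain ⟨c, hc⟩ := hx
    obtain ⟨d, hd⟩ := hy
    exact ⟨c + d, by simpa [add_sub_add_comm] using Ideal.add_mem _ hc hd⟩
  | mul x y _ _ hx hy =>
    obtain ⟨c, hc⟩ := hx
    obtain ⟨d, hd⟩ := hy
    refine ⟨c * d, ?_⟩
    have : x * y - C (c * d) = y * (x - C c) + C c * (y - C d) := by rw [C_mul]; ring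
    rw [this]
    exact Ideal.add_mem _ (Ideal.mul_mem_left _ _ hc) (Ideal.mul_mem_left _ _ hd)

/-- An integral equation of X_i over ℂ[s] becomes, modulo (s), monic with constant coefficients. The
ideal is homogeneous, and the top component of that polynomial is the pure power of X_i. -/
theorem exists_X_pow_mem (hs : ∀ i, (s i).IsHomogeneous (s i).totalDegree)
    (hf : Module.Finite (Algebra.adjoin ℂ (Set.range s)) (MvPolynomial (Fin n) ℂ)) :
    ∃ M, ∀ i, (X i : MvPolynomial (Fin n) ℂ) ^ M ∈ paramIdeal s := by
  have key : ∀ i, ∃ M, (X i : MvPolynomial (Fin n) ℂ) ^ M ∈ paramIdeal s := by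
    intro i
    obtain ⟨p, hp, h0⟩ := IsIntegral.of_finite (Algebra.adjoin ℂ (Set.range s))
      (X i : MvPolynomial (Fin n) ℂ)
    refine ⟨p.natDegree, ?_⟩
    choose c hc using fun k => exists_C_sub_mem (p.coeff k).2
    have h1 : (X i : MvPolynomial (Fin n) ℂ) ^ p.natDegree +
        ∑ k ∈ Finset.range p.natDegree, C (c k) * X i ^ k ∈ paramIdeal s := by
      rw [Polynomial.eval₂_eq_sum_range, Finset.sum_range_succ, hp.coeff_natDegree, map_one,
        one_mul] at h0
      have h2 : (X i : MvPolynomial (Fin n) ℂ) ^ p.natDegree +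
          ∑ k ∈ Finset.range p.natDegree, C (c k) * X i ^ k =
          -∑ k ∈ Finset.range p.natDegree, ((p.coeff k : MvPolynomial (Fin n) ℂ) - C (c k)) * X i ^ k := by
        rw [eq_neg_iff_add_eq_zero, add_assoc, ← Finset.sum_add_distrib, ← h0, add_comm]
        congr 1
        exact Finset.sum_congr rfl fun k _ => by
          change _ = (p.coeff k : MvPolynomial (Fin n) ℂ) * _
          ring
      rw [h2]
      exact Ideal.neg_mem_iff _ |>.2 (Ideal.sum_mem _ fun k _ => Ideal.mul_mem_right _ _ (hc k))
    obtain ⟨y, hy, -⟩ := exists_homogeneousComponent_of_mem hs h1 p.natDegree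
    have h3 : homogeneousComponent p.natDegree ((X i : MvPolynomial (Fin n) ℂ) ^ p.natDegree +
        ∑ k ∈ Finset.range p.natDegree, C (c k) * X i ^ k) = X i ^ p.natDegree := by
      rw [map_add, map_sum, homogeneousComponent_of_mem (isHomogeneous_X_pow i _),
        if_pos rfl, Finset.sum_eq_zero, add_zero]
      intro k hk
      rw [homogeneousComponent_C_mul, homogeneousComponent_of_mem (isHomogeneous_X_pow i _),
        if_neg (Finset.mem_range.1 hk).ne', mul_zero]
    rw [← h3, hy]
    exact Ideal.sum_mem _ fun k _ => Ideal.mul_mem_right _ _ (Ideal.subset_span ⟨k, rfl⟩)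
  choose M hM using key
  refine ⟨∑ i, M i, fun i => ?_⟩
  exact Ideal.pow_mem_of_pow_mem _ (hM i) (Finset.single_le_sum (f := M) (fun _ _ => Nat.zero_le _) (Finset.mem_univ i))

theorem monomial_mem {M : ℕ} (hM : ∀ i, (X i : MvPolynomial (Fin n) ℂ) ^ M ∈ paramIdeal s)
    {k : Fin n →₀ ℕ} {i : Fin n} (hk : M ≤ k i) : monomial k (1 : ℂ) ∈ paramIdeal s := by
  have : monomial k (1 : ℂ) = X i ^ M * monomial (k - Finsupp.single i M) 1 := by
    rw [X_pow_eq_monomial, monomial_mul, one_mul, add_tsub_cancel_of_le]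
    rwa [Finsupp.single_le_iff]
  rw [this]
  exact Ideal.mul_mem_right _ _ (hM i)

/-- Pigeonhole on the exponents. This is what later closes the system formed by all derivatives
below one fixed order. -/
theorem monomial_mem_of_degree {M : ℕ} (hM : ∀ i, (X i : MvPolynomial (Fin n) ℂ) ^ M ∈ paramIdeal s)
    {k : Fin n →₀ ℕ} (hk : n * M < k.degree) : monomial k (1 : ℂ) ∈ paramIdeal s := by
  by_contra h
  have : ∀ i, k i ≤ M := fun i => by
    by_contra h'
    exact h (monomial_mem hM (i := i) (by omega))
  have h2 : k.degree ≤ ∑ _i : Fin n, M := by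
    rw [Finsupp.degree_eq_sum]
    exact Finset.sum_le_sum fun i _ => this i
  simp at h2
  omega

/-- The products `s^β ξ^{e j}`. -/
def prodFamily (s : Fin n → MvPolynomial (Fin n) ℂ) {κ : Type*} (e : κ → Fin n →₀ ℕ)
    (p : κ × (Fin n →₀ ℕ)) : MvPolynomial (Fin n) ℂ :=
  monomial (e p.1) 1 * ∏ i, s i ^ p.2 i

/-- The degree of `s^β ξ^{e j}`. -/
def prodDegree (s : Fin n → MvPolynomial (Fin n) ℂ) {κ : Type*} (e : κ → Fin n →₀ ℕ)
    (p : κ × (Fin n →₀ ℕ)) : ℕ :=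
  (e p.1).degree + ∑ i, p.2 i * (s i).totalDegree

/-- The monomials `ξ^{e j}` form a basis of the quotient by the parameters. -/
structure IsQuotBasis (s : Fin n → MvPolynomial (Fin n) ℂ) {κ : Type*} (e : κ → Fin n →₀ ℕ) : Prop where
  indep : LinearIndependent ℂ fun j => Ideal.Quotient.mk (paramIdeal s) (monomial (e j) (1 : ℂ))
  span : Submodule.span ℂ (Set.range fun j => Ideal.Quotient.mk (paramIdeal s) (monomial (e j) (1 : ℂ)))
    = ⊤

/-- Monomials span the quotient, so a basis can be extracted from them; monomials with nonzero class
have bounded exponents, hence the basis is finite. -/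
theorem exists_isQuotBasis (hs : ∀ i, (s i).IsHomogeneous (s i).totalDegree)
    (hf : Module.Finite (Algebra.adjoin ℂ (Set.range s)) (MvPolynomial (Fin n) ℂ)) :
    ∃ (κ : Type) (_ : Fintype κ) (e : κ → Fin n →₀ ℕ), IsQuotBasis s e := by
  obtain ⟨κ, a, ha, hsp, hli⟩ := exists_linearIndependent' ℂ
    (fun k : Fin n →₀ ℕ => Ideal.Quotient.mk (paramIdeal s) (monomial k (1 : ℂ)))
  obtain ⟨M, hM⟩ := exists_X_pow_mem hs hf
  have hfin : Finite κ := by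
    have : ∀ j i, a j i ≤ M := by
      intro j i
      by_contra h
      exact hli.ne_zero j (Ideal.Quotient.eq_zero_iff_mem.2 (monomial_mem hM (i := i) (by omega)))
    have h2 : Set.Finite (Set.range a) := by
      refine (Set.finite_Iic (Finsupp.equivFunOnFinite.symm fun _ : Fin n => M)).subset ?_
      rintro _ ⟨j, rfl⟩
      exact fun i => this j i
    exact Set.finite_range_iff ha |>.1 h2
  refine ⟨κ, Fintype.ofFinite κ, a, hli, ?_⟩
  rw [eq_top_iff]
  rintro x -
  obtain ⟨p, rfl⟩ := Ideal.Quotient.mk_surjective x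
  change _ ∈ Submodule.span ℂ (Set.range ((fun k : Fin n →₀ ℕ =>
    Ideal.Quotient.mk (paramIdeal s) (monomial k (1 : ℂ))) ∘ a))
  rw [hsp]
  rw [p.as_sum, map_sum]
  refine Submodule.sum_mem _ fun k _ => ?_
  have : monomial k (coeff k p) = coeff k p • monomial k (1 : ℂ) := by
    rw [smul_monomial, smul_eq_mul, mul_one]
  rw [this]
  exact Submodule.smul_mem _ (coeff k p) (Submodule.subset_span (Set.mem_range_self k))

section

variable {κ : Type} [Fintype κ] {e : κ → Fin n →₀ ℕ}

theorem IsQuotBasis.exists_sub_mem (he : IsQuotBasis s e) (r : MvPolynomial (Fin n) ℂ) :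
    ∃ c : κ → ℂ, r - ∑ j, c j • monomial (e j) (1 : ℂ) ∈ paramIdeal s := by
  have h : Ideal.Quotient.mk (paramIdeal s) r ∈ Submodule.span ℂ (Set.range fun j =>
      Ideal.Quotient.mk (paramIdeal s) (monomial (e j) (1 : ℂ))) := by
    rw [he.span]; trivial
  obtain ⟨c, hc⟩ := (Submodule.mem_span_range_iff_exists_fun ℂ).1 h
  refine ⟨c, Ideal.Quotient.eq.1 ?_⟩
  rw [← hc, map_sum]
  rfl

/-- Graded Nakayama: modulo (s) a form is a combination of the ξ^{e_j}, and the cofactors of the s_i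
have smaller degree because deg s_i > 0. Keeping products of the exact degree d is what later makes
the comparison with operators triangular for the order filtration. -/
theorem IsQuotBasis.mem_span (he : IsQuotBasis s e) (hs : ∀ i, (s i).IsHomogeneous (s i).totalDegree)
    (hpos : ∀ i, 0 < (s i).totalDegree) (d : ℕ) (r : MvPolynomial (Fin n) ℂ) (hr : r.IsHomogeneous d) :
    r ∈ Submodule.span ℂ (prodFamily s e '' {p | prodDegree s e p = d}) := by
  induction d using Nat.strong_induction_on generalizing r with
  | _ d ih =>
    obtain ⟨c, hc⟩ := he.exists_sub_mem r
    obtain ⟨y, hy, hy'⟩ := exists_homogeneousComponent_of_mem hs hc d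
    have h1 : r = ∑ j, (if (e j).degree = d then c j • monomial (e j) (1 : ℂ) else 0) +
        ∑ i, s i * y i := by
      rw [← hy, map_sub, map_sum, homogeneousComponent_of_mem hr, if_pos rfl,
        ← add_sub_assoc, add_comm, eq_comm, sub_eq_iff_eq_add]
      congr 1
      refine Finset.sum_congr rfl fun j _ => ?_
      rw [map_smul, homogeneousComponent_of_mem (isHomogeneous_monomial (1 : ℂ) rfl)]
      split_ifs with h1 h2 h2
      · rfl
      · exact absurd h1.symm h2
      · exact absurd h2.symm h1
      · simp
    rw [h1]
    refine Submodule.add_mem _ (Submodule.sum_mem _ fun j _ => ?_) (Submodule.sum_mem _ fun i _ => ?_)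
    · split_ifs with hj
      · refine Submodule.smul_mem _ _ (Submodule.subset_span ⟨(j, 0), ?_, ?_⟩)
        · simp [prodDegree, hj]
        · simp [prodFamily]
      · exact Submodule.zero_mem _
    · by_cases hi : (s i).totalDegree ≤ d
      · have := ih (d - (s i).totalDegree) (by have := hpos i; omega) (y i) ((hy' i).1 hi)
        have h2 := Submodule.mem_map_of_mem (f := LinearMap.mulLeft ℂ (s i)) this
        rw [Submodule.map_span] at h2
        refine Submodule.span_mono ?_ h2
        rintro _ ⟨_, ⟨⟨j, β⟩, hp, rfl⟩, rfl⟩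
        refine ⟨(j, β + Finsupp.single i 1), ?_, ?_⟩
        · simp only [prodDegree, Set.mem_ofPred_eq, Finsupp.add_apply, add_mul, Finset.sum_add_distrib] at hp ⊢
          rw [Finset.sum_eq_single (f := fun x => (Finsupp.single i 1 : Fin n →₀ ℕ) x * _) i
            (fun b _ hb => by simp [Finsupp.single_eq_of_ne hb]) (by simp)]
          simp
          omega
        · simp only [prodFamily, Finsupp.add_apply, pow_add, Finset.prod_mul_distrib,
            LinearMap.mulLeft_apply]
          rw [Finset.prod_eq_single (f := fun x => s x ^ (Finsupp.single i 1 : Fin n →₀ ℕ) x) i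
            (fun b _ hb => by simp [Finsupp.single_eq_of_ne hb]) (by simp)]
          simp
          ring
      · rw [(hy' i).2 hi, mul_zero]
        exact Submodule.zero_mem _

/-- The map `(Pⱼ) ↦ ∑ Pⱼ(s) ξ^{e j}`. -/
def combine (s : Fin n → MvPolynomial (Fin n) ℂ) (e : κ → Fin n →₀ ℕ) :
    (κ → MvPolynomial (Fin n) ℂ) →ₗ[ℂ] MvPolynomial (Fin n) ℂ where
  toFun P := ∑ j, aeval s (P j) * monomial (e j) 1
  map_add' P Q := by simp [add_mul, Finset.sum_add_distrib]
  map_smul' c P := by simp [Finset.smul_sum]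

theorem combine_apply (P : κ → MvPolynomial (Fin n) ℂ) :
    combine s e P = ∑ j, aeval s (P j) * monomial (e j) 1 := rfl

theorem IsQuotBasis.combine_surjective (he : IsQuotBasis s e)
    (hs : ∀ i, (s i).IsHomogeneous (s i).totalDegree)
    (hpos : ∀ i, 0 < (s i).totalDegree) : Function.Surjective (combine s e) := by
  classical
  rw [← LinearMap.range_eq_top, eq_top_iff]
  rintro r -
  rw [← sum_homogeneousComponent r]
  refine Submodule.sum_mem _ fun d _ => ?_
  refine (Submodule.span_le.2 ?_) (he.mem_span hs hpos d _ (homogeneousComponent_isHomogeneous d r))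
  rintro _ ⟨⟨j, β⟩, -, rfl⟩
  refine ⟨Pi.single j (monomial β 1), ?_⟩
  rw [combine_apply, Finset.sum_eq_single j (fun i _ hi => by simp [hi]) (by simp)]
  rw [Pi.single_eq_same, aeval_monomial, map_one, one_mul, Finsupp.prod_fintype _ _ (by simp), prodFamily,
      mul_comm]

theorem combine_X_mul (i : Fin n) (P : κ → MvPolynomial (Fin n) ℂ) :
    combine s e (fun j => X i * P j) = s i * combine s e P := by
  simp only [combine_apply, map_mul, aeval_X, Finset.mul_sum]
  exact Finset.sum_congr rfl fun _ _ => by ring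

/-- All monomials of `P` have degree at least `k`. -/
def lowDegree (k : ℕ) : Submodule ℂ (MvPolynomial (Fin n) ℂ) where
  carrier := {P | ∀ β, β.degree < k → coeff β P = 0}
  zero_mem' := by simp
  add_mem' := by
    intro P Q hP hQ β hβ
    rw [coeff_add, hP β hβ, hQ β hβ, add_zero]
  smul_mem' := by
    intro c P hP β hβ
    rw [coeff_smul, hP β hβ, smul_zero]

theorem X_mul_mem_lowDegree {k : ℕ} {P : MvPolynomial (Fin n) ℂ} (hP : P ∈ lowDegree k) (i : Fin n) :
    X i * P ∈ lowDegree (k + 1) := by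
  intro β hβ
  rw [coeff_X_mul']
  split_ifs with h
  · apply hP
    have h1 : β - Finsupp.single i 1 + Finsupp.single i 1 = β :=
      tsub_add_cancel_of_le (by
        rw [Finsupp.single_le_iff]
        exact Nat.one_le_iff_ne_zero.2 (Finsupp.mem_support_iff.1 h))
    have h2 := congrArg Finsupp.degree h1
    rw [map_add, Finsupp.degree_single] at h2
    omega
  · rfl

theorem exists_sum_X_mul (P : MvPolynomial (Fin n) ℂ) (h : coeff 0 P = 0) :
    ∃ Q : Fin n → MvPolynomial (Fin n) ℂ, P = ∑ i, X i * Q i := by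
  have : P ∈ Ideal.span (X '' (Set.univ : Set (Fin n))) := by
    rw [mem_ideal_span_X_image]
    intro m hm
    by_contra h'
    push Not at h'
    have : m = 0 := Finsupp.ext fun i => h' i trivial
    exact mem_support_iff.1 hm (this ▸ h)
  rw [Set.image_univ] at this
  obtain ⟨c, hc⟩ := Ideal.mem_span_range_iff_exists_fun.1 this
  exact ⟨c, by rw [← hc]; exact Finset.sum_congr rfl fun _ _ => mul_comm _ _⟩

/-- Let Σ P_j(s) ξ^{e_j} = 0. Independence modulo (s) kills the constant terms, so P = Σ X_i Q_i and
Σ s_i combine(Q_i) = 0. By the Koszul relations combine(Q_i) = Σ s_l w_il with w antisymmetric.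
Lifting w to an antisymmetric ω, the elements Q_i - Σ X_l ω_il are again in the kernel, while
replacing Q_i by them does not change P. Hence every gain in the order of vanishing of kernel
elements at 0 implies a further one, and the kernel is zero. -/
theorem IsQuotBasis.combine_injective (he : IsQuotBasis s e)
    (hs : ∀ i, (s i).IsHomogeneous (s i).totalDegree)
    (hpos : ∀ i, 0 < (s i).totalDegree)
    (hf : Module.Finite (Algebra.adjoin ℂ (Set.range s)) (MvPolynomial (Fin n) ℂ)) :
    Function.Injective (combine s e) := by
  obtain ⟨M, hM⟩ := exists_X_pow_mem hs hf
  have key : ∀ k, ∀ P, combine s e P = 0 → ∀ j, P j ∈ lowDegree k := by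
    intro k
    induction k with
    | zero => exact fun P _ j β hβ => absurd hβ (by omega)
    | succ k ih =>
      intro P hP
      have hsmem : ∀ i, s i ∈ paramIdeal s := fun i => Ideal.subset_span ⟨i, rfl⟩
      have h0 : ∀ j, coeff 0 (P j) = 0 := by
        have hcong : ∀ Q : MvPolynomial (Fin n) ℂ, Ideal.Quotient.mk (paramIdeal s) (aeval s Q) =
            Ideal.Quotient.mk (paramIdeal s) (C (coeff 0 Q)) := by
          intro Q
          obtain ⟨q, hq⟩ := exists_sum_X_mul (Q - C (coeff 0 Q)) (by simp)
          rw [Ideal.Quotient.eq]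
          have : aeval s Q - C (coeff 0 Q) = ∑ i, s i * aeval s (q i) := by
            have := congrArg (aeval s) hq
            simp only [map_sub, aeval_C, map_sum, map_mul, aeval_X] at this
            exact this
          rw [this]
          exact Ideal.sum_mem _ fun i _ => Ideal.mul_mem_right _ _ (hsmem i)
        have h1 := congrArg (Ideal.Quotient.mk (paramIdeal s)) hP
        rw [combine_apply, map_sum, map_zero] at h1
        have h2 := (Fintype.linearIndependent_iff.1 he.indep) (fun j => coeff 0 (P j)) (by
          rw [← h1]
          refine Finset.sum_congr rfl fun j _ => ?_
          rw [map_mul, hcong, ← map_mul, C_mul', ← Ideal.Quotient.mkₐ_eq_mk ℂ, map_smul])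
        exact h2
      choose Q hQ using fun j => exists_sum_X_mul (P j) (h0 j)
      have hu : ∑ i, s i * combine s e (fun j => Q j i) = 0 := by
        rw [← hP]
        simp only [← combine_X_mul]
        rw [← map_sum]
        congr 1
        ext1 j
        rw [hQ j, Finset.sum_apply]
      obtain ⟨w, hw0, hw1, hw2⟩ := Koszul.exists_relations_of_X_pow_mem M hM hu
      choose ω0 hω0 using fun i l => he.combine_surjective hs hpos (w i l)
      -- Antisymmetrizing an arbitrary lift of w does not change its image, because w is already
      -- antisymmetric.
      set ω : Fin n → Fin n → κ → MvPolynomial (Fin n) ℂ :=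
        fun i l => (1 / 2 : ℂ) • (ω0 i l - ω0 l i) with hω
      have hω1 : ∀ i l, combine s e (ω i l) = w i l := by
        intro i l
        rw [hω]
        simp only [map_smul, map_sub, hω0]
        rw [hw1 l i, sub_neg_eq_add, ← two_smul ℂ, smul_smul]
        norm_num
      have hrel : ∀ i j, Q j i - ∑ l, X l * ω i l j ∈ lowDegree k := by
        intro i
        refine ih (fun j => Q j i - ∑ l, X l * ω i l j) ?_
        have : (fun j => Q j i - ∑ l, X l * ω i l j) =
            (fun j => Q j i) - ∑ l, fun j => X l * ω i l j := by
          ext1 j; simp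
        rw [this, map_sub, map_sum, hw2 i, sub_eq_zero]
        exact Finset.sum_congr rfl fun l _ => by rw [combine_X_mul, hω1]
      intro j
      have hanti : ∑ i, X i * ∑ l, X l * ω i l j = 0 := by
        have h1 : ∑ i, X i * ∑ l, X l * ω i l j = -∑ i, X i * ∑ l, X l * ω i l j := by
          conv_lhs => simp only [Finset.mul_sum]
          rw [Finset.sum_comm]
          simp only [Finset.mul_sum, ← Finset.sum_neg_distrib]
          refine Finset.sum_congr rfl fun i _ => Finset.sum_congr rfl fun l _ => ?_
          have : ω l i j = -ω i l j := by
            simp only [hω, Pi.smul_apply, Pi.sub_apply, ← smul_neg, neg_sub]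
          rw [this]
          ring
        exact self_eq_neg.1 h1
      have : P j = ∑ i, X i * (Q j i - ∑ l, X l * ω i l j) := by
        simp only [mul_sub, Finset.sum_sub_distrib]
        rw [hanti, sub_zero, hQ j]
      rw [this]
      exact Submodule.sum_mem _ fun i _ => X_mul_mem_lowDegree (hrel i j) i
  rw [← LinearMap.ker_eq_bot, LinearMap.ker_eq_bot']
  intro P hP
  ext j β
  exact key (β.degree + 1) P hP j β (Nat.lt_succ_self _)

/-- The products `s^β ξ^{e j}` form a basis. -/
theorem IsQuotBasis.exists_basis (he : IsQuotBasis s e)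
    (hs : ∀ i, (s i).IsHomogeneous (s i).totalDegree)
    (hpos : ∀ i, 0 < (s i).totalDegree)
    (hf : Module.Finite (Algebra.adjoin ℂ (Set.range s)) (MvPolynomial (Fin n) ℂ)) :
    ∃ b : Module.Basis (κ × (Fin n →₀ ℕ)) ℂ (MvPolynomial (Fin n) ℂ), ⇑b = prodFamily s e := by
  classical
  let E : (κ → MvPolynomial (Fin n) ℂ) ≃ₗ[ℂ] MvPolynomial (Fin n) ℂ :=
    LinearEquiv.ofBijective (combine s e)
      ⟨he.combine_injective hs hpos hf, he.combine_surjective hs hpos⟩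
  refine ⟨((Pi.basis fun _ : κ => basisMonomials (Fin n) ℂ).map E).reindex
    (Equiv.sigmaEquivProd κ (Fin n →₀ ℕ)), ?_⟩
  ext1 ⟨j, β⟩
  have : E (Pi.single j (monomial β 1)) = prodFamily s e (j, β) := by
    change combine s e _ = _
    rw [combine_apply, Finset.sum_eq_single j (fun i _ hi => by simp [hi]) (by simp)]
    rw [Pi.single_eq_same, aeval_monomial, map_one, one_mul, Finsupp.prod_fintype _ _ (by simp), prodFamily,
      mul_comm]
  rw [← this]
  simp

theorem IsQuotBasis.exists_adjoin_basis (he : IsQuotBasis s e)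
    (hs : ∀ i, (s i).IsHomogeneous (s i).totalDegree)
    (hpos : ∀ i, 0 < (s i).totalDegree)
    (hf : Module.Finite (Algebra.adjoin ℂ (Set.range s)) (MvPolynomial (Fin n) ℂ)) :
    Nonempty (Module.Basis κ (Algebra.adjoin ℂ (Set.range s)) (MvPolynomial (Fin n) ℂ)) := by
  have hmem : ∀ b : Algebra.adjoin ℂ (Set.range s), ∃ p : MvPolynomial (Fin n) ℂ, aeval s p = (b : MvPolynomial (Fin n) ℂ) := by
    intro b
    have : (b : MvPolynomial (Fin n) ℂ) ∈ (aeval (R := ℂ) s).range := by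
      rw [← Algebra.adjoin_range_eq_range_aeval]
      exact b.2
    exact this
  refine ⟨Module.Basis.mk (v := fun j => monomial (e j) (1 : ℂ)) ?_ ?_⟩
  · rw [Fintype.linearIndependent_iff]
    intro g hg
    choose P hP using hmem
    have h0 : combine s e (fun j => P (g j)) = 0 := by
      rw [combine_apply, ← hg]
      exact Finset.sum_congr rfl fun j _ => by rw [hP]; rfl
    have h1 := (map_eq_zero_iff _ (he.combine_injective hs hpos hf)).1 h0
    intro j
    have h2 := congrFun h1 j
    apply Subtype.ext
    rw [← hP (g j), h2]
    simp
  · rintro r -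
    obtain ⟨P, rfl⟩ := he.combine_surjective hs hpos r
    rw [combine_apply]
    refine Submodule.sum_mem _ fun j _ => ?_
    have hP : aeval s (P j) ∈ Algebra.adjoin ℂ (Set.range s) := by
      rw [Algebra.adjoin_range_eq_range_aeval]
      exact ⟨P j, rfl⟩
    exact Submodule.smul_mem _ (⟨_, hP⟩ : Algebra.adjoin ℂ (Set.range s)) (Submodule.subset_span ⟨j, rfl⟩)

end

end HomogeneousParameters

end

noncomputable section

/-! ### Holomorphic functions of several complex variables -/

namespace SeveralComplex

open Set Metric Filter MeasureTheory
open scoped Real NNReal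

universe u

variable {F : Type u} [NormedAddCommGroup F] [NormedSpace ℂ F]

/-- Integration of a product of two continuous functions over an interval. -/
def integralBilin {a b : ℝ} (hab : a ≤ b) :
    C(Icc a b, ℂ) →L[ℂ] C(Icc a b, F) →L[ℂ] F :=
  LinearMap.mkContinuous₂
    (LinearMap.mk₂ ℂ (fun k h => ∫ t in a..b, k (projIcc a b hab t) • h (projIcc a b hab t))
      (fun k k' h => by
        simp only [ContinuousMap.add_apply, add_smul]
        refine intervalIntegral.integral_add ?_ ?_ <;>
        exact Continuous.intervalIntegrable (by fun_prop) _ _)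
      (fun c k h => by
        simp only [ContinuousMap.smul_apply, smul_assoc, intervalIntegral.integral_smul])
      (fun k h h' => by
        simp only [ContinuousMap.add_apply, smul_add]
        refine intervalIntegral.integral_add ?_ ?_ <;>
        exact Continuous.intervalIntegrable (by fun_prop) _ _)
      (fun c k h => by
        simp only [ContinuousMap.smul_apply, smul_comm _ c, intervalIntegral.integral_smul]))
    |b - a|
    (fun k h => by
      simp only [LinearMap.mk₂_apply]
      refine (intervalIntegral.norm_integral_le_of_norm_le_const (C := ‖k‖ * ‖h‖)
        fun t _ => ?_).trans (le_of_eq (by ring))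
      rw [norm_smul]
      exact mul_le_mul (k.norm_coe_le_norm _) (h.norm_coe_le_norm _) (norm_nonneg _)
        (norm_nonneg _))

theorem integralBilin_apply {a b : ℝ} (hab : a ≤ b) (k : C(Icc a b, ℂ)) (h : C(Icc a b, F)) :
    integralBilin hab k h = ∫ t in a..b, k (projIcc a b hab t) • h (projIcc a b hab t) := rfl

/-- Cauchy's formula holds at each t, hence for `g` as a function with values in C(T, F), and the
Cauchy integral of a continuous function is analytic. -/
theorem differentiableOn_of_eval {T : Type*} [TopologicalSpace T] [CompactSpace T]
    [CompleteSpace F] {U : Set ℂ} (hU : IsOpen U) {g : ℂ → C(T, F)} (hg : ContinuousOn g U)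
    (h : ∀ t, DifferentiableOn ℂ (fun w => g w t) U) : DifferentiableOn ℂ g U := by
  intro c hc
  obtain ⟨R, hR, hRU⟩ := Metric.nhds_basis_closedBall.mem_iff.mp (hU.mem_nhds hc)
  lift R to ℝ≥0 using hR.le
  have hci : CircleIntegrable g c R :=
    (hg.mono (sphere_subset_closedBall.trans hRU)).circleIntegrable R.2
  have hp := hasFPowerSeriesOn_cauchy_integral hci (by exact_mod_cast hR)
  have hd : DifferentiableAt ℂ
      (fun w => (2 * π * Complex.I : ℂ)⁻¹ • ∮ z in C(c, R), (z - w)⁻¹ • g z) c :=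
    hp.analyticAt.differentiableAt
  refine (hd.congr_of_eventuallyEq ?_).differentiableWithinAt
  filter_upwards [ball_mem_nhds c hR] with w hw
  ext t
  have hcl : DiffContOnCl ℂ (fun w => g w t) (ball c R) :=
    DifferentiableOn.diffContOnCl ((h t).mono (closure_ball_subset_closedBall.trans hRU))
  have h1 := hcl.two_pi_i_inv_smul_circleIntegral_sub_inv_smul hw
  rw [← h1]
  have h2 : CircleIntegrable (fun z => (z - w)⁻¹ • g z) c R := by
    refine ContinuousOn.circleIntegrable R.2 (ContinuousOn.smul (ContinuousOn.inv₀
      (f := fun z : ℂ => z - w) (by fun_prop) fun z hz => ?_) (hg.mono (sphere_subset_closedBall.trans hRU)))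
    rw [sub_ne_zero]
    rintro rfl
    exact (mem_ball.mp hw).ne (mem_sphere.mp hz)
  have h3 := (ContinuousMap.evalCLM ℂ t).intervalIntegral_comp_comm h2.out
  simp only [circleIntegral, ContinuousMap.smul_apply]
  simpa [ContinuousMap.evalCLM] using h3

/-- Inversion is analytic on the units of the Banach algebra C(T, ℂ). With T the parameter interval
of a circle this is the Cauchy kernel as an analytic function of its pole. -/
theorem exists_analyticAt_inv_sub {T : Type*} [TopologicalSpace T] [CompactSpace T] (k : C(T, ℂ))
    {c : ℂ} (hc : ∀ t, k t ≠ c) :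
    ∃ K : ℂ → C(T, ℂ), AnalyticAt ℂ K c ∧ ∀ᶠ z in 𝓝 c, ∀ t, K z t = (k t - z)⁻¹ := by
  let l : ℂ → C(T, ℂ) := fun z => k - algebraMap ℂ C(T, ℂ) z
  have hl : AnalyticAt ℂ l c := by
    refine analyticAt_const.sub ?_
    exact (Algebra.linearMap ℂ C(T, ℂ)).toContinuousLinearMap.analyticAt c
  have hu : IsUnit (l c) := by
    rw [ContinuousMap.isUnit_iff_forall_ne_zero]
    intro t
    simpa [l, sub_eq_zero] using hc t
  refine ⟨fun z => Ring.inverse (l z), ?_, ?_⟩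
  · refine AnalyticAt.comp (g := Ring.inverse) ?_ hl
    exact analyticAt_inverse hu.unit
  · have : ∀ᶠ z in 𝓝 c, IsUnit (l z) := hl.continuousAt.eventually
      (Units.isOpen.mem_nhds hu)
    filter_upwards [this] with z hz t
    have h1 : l z * Ring.inverse (l z) = 1 := Ring.mul_inverse_cancel _ hz
    have h2 := congrArg (fun f : C(T, ℂ) => f t) h1
    simp only [ContinuousMap.mul_apply, ContinuousMap.one_apply] at h2
    have h3 : l z t = k t - z := by simp [l]
    rw [h3] at h2
    exact eq_inv_of_mul_eq_one_right h2

/-- Osgood's lemma: a continuous separately holomorphic function is analytic. -/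
theorem analyticOnNhd_of_separately : ∀ (n : ℕ) {F : Type u} [NormedAddCommGroup F]
    [NormedSpace ℂ F] [CompleteSpace F] {U : Set (Fin n → ℂ)} (_ : IsOpen U)
    {f : (Fin n → ℂ) → F} (_ : ContinuousOn f U)
    (_ : ∀ x ∈ U, ∀ i, DifferentiableAt ℂ (fun z => f (Function.update x i z)) (x i)),
    AnalyticOnNhd ℂ f U
  | 0, F, _, _, _, U, hU, f, hf, hs => by
    intro x hx
    have : f = fun _ => f x := by ext y; rw [Subsingleton.elim y x]
    rw [this]; exact analyticAt_const
  | n + 1, F, _, _, _, U, hU, f, hf, hs => by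
    intro x hx
    obtain ⟨r, hr, hrU⟩ := Metric.nhds_basis_closedBall.mem_iff.mp (hU.mem_nhds hx)
    have hcons : ∀ z ∈ closedBall (x 0) r, ∀ y ∈ closedBall (fun i => x (Fin.succ i)) r,
        (Fin.cons z y : Fin (n + 1) → ℂ) ∈ closedBall x r := by
      intro z hz y hy
      rw [mem_closedBall, dist_pi_le_iff hr.le] at hy ⊢
      intro i
      refine Fin.cases ?_ (fun i => ?_) i
      · simpa using hz
      · simpa using hy i
    have h2π : (0 : ℝ) ≤ 2 * π := by positivity
    have hcm : ∀ θ : ℝ, circleMap (x 0) r θ ∈ closedBall (x 0) r := fun θ =>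
      sphere_subset_closedBall (circleMap_mem_sphere _ hr.le θ)
    -- the family of functions on the circle
    let G : (Fin n → ℂ) → Icc (0 : ℝ) (2 * π) → F := fun y t => f (Fin.cons (circleMap (x 0) r t) y)
    let g : (Fin n → ℂ) → C(Icc (0 : ℝ) (2 * π), F) := fun y => ContinuousMap.mkD (G y) 0
    have hGc : ContinuousOn (Function.uncurry G)
        ((ball (fun i => x (Fin.succ i)) r) ×ˢ univ) := by
      refine hf.comp (f := fun p : (Fin n → ℂ) × Icc (0 : ℝ) (2 * π) =>
        (Fin.cons (circleMap (x 0) r p.2) p.1 : Fin (n + 1) → ℂ)) ?_ ?_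
      · refine Continuous.continuousOn ?_
        refine continuous_pi fun i => ?_
        refine Fin.cases ?_ (fun i => ?_) i
        · simp only [Fin.cons_zero]; fun_prop
        · simp only [Fin.cons_succ]; fun_prop
      · rintro ⟨y, t⟩ ⟨hy, -⟩
        exact hrU (hcons _ (hcm _) _ (ball_subset_closedBall hy))
    have hgc : ContinuousOn g (ball (fun i => x (Fin.succ i)) r) :=
      ContinuousMap.continuousOn_mkD_of_uncurry (X := Icc (0 : ℝ) (2 * π)) G 0 hGc
    have hga : ∀ y ∈ ball (fun i => x (Fin.succ i)) r, ∀ t, g y t = G y t := by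
      intro y hy t
      have hc : Continuous (G y) := hGc.comp_continuous (Continuous.prodMk_right y)
        fun t => ⟨hy, trivial⟩
      rw [show g y = ⟨G y, hc⟩ from ContinuousMap.mkD_of_continuous hc]
      rfl
    -- The induction is over all complete target spaces, so it applies in n variables to `g`, whose
    -- values are functions on the circle.
    have hgan : AnalyticOnNhd ℂ g (ball (fun i => x (Fin.succ i)) r) := by
      refine analyticOnNhd_of_separately n isOpen_ball hgc fun y hy i => ?_
      have hupd : Continuous fun z : ℂ => Function.update y i z := continuous_const.update i continuous_id
      have hV : IsOpen ((fun z : ℂ => Function.update y i z) ⁻¹' ball (fun i => x (Fin.succ i)) r) :=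
        isOpen_ball.preimage hupd
      have hyV : y i ∈ (fun z : ℂ => Function.update y i z) ⁻¹' ball (fun i => x (Fin.succ i)) r := by
        simpa using hy
      refine (differentiableOn_of_eval hV (hgc.comp hupd.continuousOn fun z hz => hz)
        fun t z hz => ?_).differentiableAt (hV.mem_nhds hyV)
      have h1 := hs _ (hrU (hcons _ (hcm t) _ (ball_subset_closedBall hz))) i.succ
      simp only [Fin.cons_succ, Function.update_self, ← Fin.cons_update,
        Function.update_idem] at h1
      refine (h1.congr_of_eventuallyEq ?_).differentiableWithinAt
      filter_upwards [hV.mem_nhds hz] with w hw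
      exact hga _ hw t
    let cm : C(Icc (0 : ℝ) (2 * π), ℂ) := ⟨fun t => circleMap (x 0) r t, by fun_prop⟩
    let cd : C(Icc (0 : ℝ) (2 * π), ℂ) := ⟨fun t => deriv (circleMap (x 0) r) t, by
      simp only [deriv_circleMap]; fun_prop⟩
    obtain ⟨K, hK, hKe⟩ := exists_analyticAt_inv_sub cm (c := x 0) fun t =>
      circleMap_ne_center hr.ne'
    have hK' : AnalyticAt ℂ (fun z => cd * K z) (x 0) := analyticAt_const.mul hK
    let p0 : (Fin (n + 1) → ℂ) →L[ℂ] ℂ := ContinuousLinearMap.proj 0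
    let pt : (Fin (n + 1) → ℂ) →L[ℂ] (Fin n → ℂ) :=
      ContinuousLinearMap.pi fun i => ContinuousLinearMap.proj (Fin.succ i)
    -- Cauchy's formula in the first variable exhibits f as a bounded bilinear pairing of the
    -- analytic kernel with the analytic map `g`.
    have hmain : AnalyticAt ℂ (fun y : Fin (n + 1) → ℂ => (2 * π * Complex.I : ℂ)⁻¹ •
        integralBilin (F := F) h2π (cd * K (p0 y)) (g (pt y))) x := by
      refine AnalyticAt.const_smul ?_
      have h1 : AnalyticAt ℂ (fun y => (cd * K (p0 y), g (pt y))) x :=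
        (AnalyticAt.comp (g := fun z => cd * K z) (f := p0) hK' (p0.analyticAt x)).prod
          (AnalyticAt.comp (g := g) (f := pt) (hgan _ (mem_ball_self hr)) (pt.analyticAt x))
      exact AnalyticAt.comp (g := fun q : C(Icc (0 : ℝ) (2 * π), ℂ) × C(Icc (0 : ℝ) (2 * π), F) =>
        integralBilin (F := F) h2π q.1 q.2) (f := fun y => (cd * K (p0 y), g (pt y)))
        ((integralBilin (F := F) h2π).analyticAt_bilinear (cd * K (p0 x), g (pt x))) h1
    refine hmain.congr ?_
    have e1 : ∀ᶠ y in 𝓝 x, ∀ t, K (p0 y) t = (cm t - p0 y)⁻¹ :=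
      p0.continuous.continuousAt.eventually hKe
    filter_upwards [e1, ball_mem_nhds x hr] with y hy hyb
    have hyt : pt y ∈ ball (fun i => x (Fin.succ i)) r := by
      rw [mem_ball, dist_pi_lt_iff hr] at hyb ⊢
      exact fun i => hyb i.succ
    have hy0 : y 0 ∈ ball (x 0) r := by
      rw [mem_ball, dist_pi_lt_iff hr] at hyb
      exact hyb 0
    have hfd : DiffContOnCl ℂ (fun z => f (Fin.cons z (pt y))) (ball (x 0) r) := by
      refine DifferentiableOn.diffContOnCl fun z hz => ?_
      have := hs _ (hrU (hcons z (closure_ball_subset_closedBall hz) (pt y)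
        (ball_subset_closedBall hyt))) 0
      simp only [Fin.cons_zero, Fin.update_cons_zero] at this
      exact this.differentiableWithinAt
    have h1 := hfd.two_pi_i_inv_smul_circleIntegral_sub_inv_smul hy0
    have hyc : (Fin.cons (y 0) (pt y) : Fin (n + 1) → ℂ) = y := Fin.cons_self_tail y
    rw [hyc] at h1
    rw [← h1, integralBilin_apply, circleIntegral]
    congr 1
    refine intervalIntegral.integral_congr fun θ hθ => ?_
    rw [uIcc_of_le h2π] at hθ
    simp only [projIcc_of_mem h2π hθ, ContinuousMap.mul_apply, hga _ hyt, hy, mul_smul]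
    rfl

end SeveralComplex
end

/-! ### Holomorphic dependence of integrals on parameters -/

noncomputable section

namespace SeveralComplex

open Set Metric Filter MeasureTheory
open scoped Real NNReal

variable {n : ℕ}

/-- By Osgood's lemma x ↦ H(x, ·) is analytic with values in C([a,b], ℂ), and integration is a
continuous linear functional there. -/
theorem analyticOnNhd_intervalIntegral {a b : ℝ} (hab : a ≤ b) {U : Set (Fin n → ℂ)}
    (hU : IsOpen U) {H : (Fin n → ℂ) → ℝ → ℂ}
    (hc : ContinuousOn (Function.uncurry H) (U ×ˢ Icc a b))
    (hH : ∀ t ∈ Icc a b, AnalyticOnNhd ℂ (fun x => H x t) U) :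
    AnalyticOnNhd ℂ (fun x => ∫ t in a..b, H x t) U := by
  let G : (Fin n → ℂ) → Icc a b → ℂ := fun y t => H y t
  have hG : ContinuousOn (Function.uncurry G) (U ×ˢ univ) :=
    hc.comp (f := fun p : (Fin n → ℂ) × Icc a b => (p.1, (p.2 : ℝ))) (by fun_prop)
      fun p hp => ⟨hp.1, p.2.2⟩
  let g : (Fin n → ℂ) → C(Icc a b, ℂ) := fun y => ContinuousMap.mkD (G y) 0
  have hg : ContinuousOn g U := ContinuousMap.continuousOn_mkD_of_uncurry (X := Icc a b) G 0 hG
  have hga : ∀ y ∈ U, ∀ t, g y t = G y t := by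
    intro y hy t
    have hc : Continuous (G y) := hG.comp_continuous (Continuous.prodMk_right y)
      fun t => ⟨hy, trivial⟩
    rw [show g y = ⟨G y, hc⟩ from ContinuousMap.mkD_of_continuous hc]
    rfl
  have hgan : AnalyticOnNhd ℂ g U := by
    refine analyticOnNhd_of_separately n hU hg fun y hy i => ?_
    have hupd : Continuous fun z : ℂ => Function.update y i z :=
      continuous_const.update i continuous_id
    have hV : IsOpen ((fun z : ℂ => Function.update y i z) ⁻¹' U) := hU.preimage hupd
    have hyV : y i ∈ (fun z : ℂ => Function.update y i z) ⁻¹' U := by simpa using hy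
    refine (differentiableOn_of_eval hV (hg.comp hupd.continuousOn fun z hz => hz)
      fun t z hz => ?_).differentiableAt (hV.mem_nhds hyV)
    have h1 : DifferentiableAt ℂ (fun z => H (Function.update y i z) t) z :=
      DifferentiableAt.comp (g := fun x => H x t) z
        (hH t t.2 (Function.update y i z) hz).differentiableAt
        (hasDerivAt_update y i z).differentiableAt
    refine (h1.congr_of_eventuallyEq ?_).differentiableWithinAt
    filter_upwards [hV.mem_nhds hz] with w hw
    exact hga _ hw t
  have h1 : AnalyticOnNhd ℂ (fun x => integralBilin (F := ℂ) hab 1 (g x)) U := fun x hx =>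
    ((integralBilin (F := ℂ) hab 1).analyticAt _).comp (hgan x hx)
  refine h1.congr hU fun x hx => ?_
  simp only [integralBilin_apply]
  refine intervalIntegral.integral_congr fun t ht => ?_
  rw [uIcc_of_le hab] at ht
  simp [projIcc_of_mem hab ht, hga x hx, G]

end SeveralComplex
end

noncomputable section

/-! ### Differential operators as symbols over a differential ring -/

namespace SymbolCalculus

set_option linter.unusedSectionVars false
set_option linter.style.haveILetI false

open MvPolynomial

variable {n : ℕ}

/-- Evaluation of polynomials at a commuting family of elements of an algebra. -/
def commAeval {R A ι : Type*} [CommRing R] [Ring A] [Algebra R A] (f : ι → A)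
    (h : ∀ i j, f i * f j = f j * f i) : MvPolynomial ι R →ₐ[R] A :=
  letI : CommRing (Algebra.adjoin R (Set.range f)) :=
    Algebra.adjoinCommRingOfComm R (by rintro _ ⟨i, rfl⟩ _ ⟨j, rfl⟩; exact h i j)
  (Algebra.adjoin R (Set.range f)).val.comp
    (aeval (R := R) (S₁ := Algebra.adjoin R (Set.range f))
      fun i => ⟨f i, Algebra.subset_adjoin ⟨i, rfl⟩⟩)

@[simp] theorem commAeval_X {R A ι : Type*} [CommRing R] [Ring A] [Algebra R A] (f : ι → A)
    (h : ∀ i j, f i * f j = f j * f i) (i : ι) : commAeval (R := R) f h (X i) = f i := by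
  letI : CommRing (Algebra.adjoin R (Set.range f)) :=
    Algebra.adjoinCommRingOfComm R (by rintro _ ⟨i, rfl⟩ _ ⟨j, rfl⟩; exact h i j)
  have := aeval_X (R := R) (S₁ := Algebra.adjoin R (Set.range f))
    (fun i => ⟨f i, Algebra.subset_adjoin ⟨i, rfl⟩⟩) i
  exact congrArg Subtype.val this

theorem commAeval_monomial_add_single {R A ι : Type*} [CommRing R] [Ring A] [Algebra R A]
    (f : ι → A) (h : ∀ i j, f i * f j = f j * f i) (k : ι →₀ ℕ) (i : ι) :
    commAeval (R := R) f h (monomial (k + Finsupp.single i 1) 1) =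
      f i * commAeval (R := R) f h (monomial k 1) := by
  rw [← commAeval_X (R := R) f h i, ← map_mul]
  congr 1
  rw [X, monomial_mul, one_mul, add_comm]

/-- Induction on exponents by adding unit vectors. -/
theorem exponent_induction {ι : Type*} {P : (ι →₀ ℕ) → Prop} (zero : P 0)
    (step : ∀ k i, P k → P (k + Finsupp.single i 1)) (k : ι →₀ ℕ) : P k := by
  classical
  induction k using Finsupp.induction with
  | zero => exact zero
  | single_add i b f _ _ hf =>
    clear * - hf step
    induction b with
    | zero => simpa using hf
    | succ b ih =>
      have := step _ i ih
      rwa [add_right_comm, ← Finsupp.single_add] at this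

variable {K : Type*} [CommRing K] [Algebra ℂ K]

/-- A flat connection on a module over a ring with derivations. -/
structure Connection (D : Fin n → Derivation ℂ K K) (P : Type*) [AddCommGroup P] [Module ℂ P]
    [Module K P] where
  nabla : Fin n → P →ₗ[ℂ] P
  comm : ∀ i j x, nabla i (nabla j x) = nabla j (nabla i x)
  leibniz : ∀ i (a : K) x, nabla i (a • x) = D i a • x + a • nabla i x

namespace Connection

variable {D : Fin n → Derivation ℂ K K} {P : Type*} [AddCommGroup P] [Module ℂ P] [Module K P]

/-- The action of constant coefficient operators. -/
def poly (c : Connection D P) : MvPolynomial (Fin n) ℂ →ₐ[ℂ] Module.End ℂ P :=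
  commAeval c.nabla fun i j => LinearMap.ext fun x => c.comm i j x

@[simp] theorem poly_X (c : Connection D P) (i : Fin n) : c.poly (X i) = c.nabla i :=
  commAeval_X _ _ _

/-- The derivative `∇^k x`. -/
def deriv (c : Connection D P) (k : Fin n →₀ ℕ) (x : P) : P := c.poly (monomial k 1) x

@[simp] theorem deriv_zero (c : Connection D P) (x : P) : c.deriv 0 x = x := by
  simp [deriv, ← C_apply]

theorem deriv_add_single (c : Connection D P) (k : Fin n →₀ ℕ) (i : Fin n) (x : P) :
    c.deriv (k + Finsupp.single i 1) x = c.nabla i (c.deriv k x) := by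
  simp only [deriv, poly, commAeval_monomial_add_single]; rfl

theorem deriv_add (c : Connection D P) (k : Fin n →₀ ℕ) (x y : P) :
    c.deriv k (x + y) = c.deriv k x + c.deriv k y := map_add _ _ _

theorem deriv_smul (c : Connection D P) (k : Fin n →₀ ℕ) (a : ℂ) (x : P) :
    c.deriv k (a • x) = a • c.deriv k x := map_smul _ _ _

/-- The action on `x` of the operator with a given full symbol. -/
def act (c : Connection D P) (x : P) : MvPolynomial (Fin n) K →ₗ[K] P :=
  (basisMonomials (Fin n) K).constr K fun k => c.deriv k x

theorem act_monomial (c : Connection D P) (x : P) (k : Fin n →₀ ℕ) (a : K) :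
    c.act x (monomial k a) = a • c.deriv k x := by
  have : monomial k a = a • basisMonomials (Fin n) K k := by simp [smul_monomial]
  rw [this, map_smul, act, Module.Basis.constr_basis]

@[simp] theorem act_one (c : Connection D P) (x : P) : c.act x 1 = x := by
  rw [← C_1, C_apply, act_monomial]; simp

theorem act_eq_sum (c : Connection D P) (x : P) (l : MvPolynomial (Fin n) K) :
    c.act x l = ∑ k ∈ l.support, l.coeff k • c.deriv k x := by
  conv_lhs => rw [l.as_sum, map_sum]
  exact Finset.sum_congr rfl fun k _ => c.act_monomial x k _

theorem act_add_left (c : Connection D P) (x y : P) (l : MvPolynomial (Fin n) K) :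
    c.act (x + y) l = c.act x l + c.act y l := by
  simp [act_eq_sum, deriv_add, Finset.sum_add_distrib]

theorem act_smul_left [IsScalarTower ℂ K P] [SMulCommClass ℂ K P] (c : Connection D P) (a : ℂ)
    (x : P) (l : MvPolynomial (Fin n) K) : c.act (a • x) l = a • c.act x l := by
  simp [act_eq_sum, deriv_smul, Finset.smul_sum, smul_comm a]

end Connection

/-- A linear map applied to all coefficients. -/
def coeffMap (d : K →ₗ[ℂ] K) : MvPolynomial (Fin n) K →ₗ[ℂ] MvPolynomial (Fin n) K where
  toFun f := AddMonoidAlgebra.ofCoeff ((AddMonoidAlgebra.coeff f).mapRange d (map_zero d))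
  map_add' f g := by
    refine MvPolynomial.ext _ _ fun k => ?_
    exact map_add d (coeff k f) (coeff k g)
  map_smul' a f := by
    refine MvPolynomial.ext _ _ fun k => ?_
    exact map_smul d a (coeff k f)

@[simp] theorem coeff_coeffMap (d : K →ₗ[ℂ] K) (f : MvPolynomial (Fin n) K) (k : Fin n →₀ ℕ) :
    coeff k (coeffMap d f) = d (coeff k f) := rfl

theorem coeffMap_X_mul (d : K →ₗ[ℂ] K) (i : Fin n) (f : MvPolynomial (Fin n) K) :
    coeffMap d (X i * f) = X i * coeffMap d f := by
  ext k
  simp only [coeff_coeffMap, coeff_X_mul']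
  split_ifs <;> simp

/-- The ring of symbols, with left multiplication by the `∂ᵢ`. -/
def symbolConnection (D : Fin n → Derivation ℂ K K) (hD : ∀ i j a, D i (D j a) = D j (D i a)) :
    Connection D (MvPolynomial (Fin n) K) where
  nabla i := coeffMap (D i).toLinearMap + LinearMap.mulLeft ℂ (X i)
  comm i j x := by
    simp only [LinearMap.add_apply, LinearMap.mulLeft_apply, map_add, coeffMap_X_mul]
    have : coeffMap (D i).toLinearMap (coeffMap (D j).toLinearMap x) =
        coeffMap (D j).toLinearMap (coeffMap (D i).toLinearMap x) := by
      ext k; simpa using hD i j _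
    rw [this]; ring
  leibniz i a x := by
    have : coeffMap (D i).toLinearMap (a • x) = D i a • x + a • coeffMap (D i).toLinearMap x := by
      ext k; simp; ring
    simp only [LinearMap.add_apply, LinearMap.mulLeft_apply, this, smul_add, mul_smul_comm]
    abel

section Symbol

variable {D : Fin n → Derivation ℂ K K} (hD : ∀ i j a, D i (D j a) = D j (D i a))

theorem symbol_nabla (i : Fin n) (f : MvPolynomial (Fin n) K) :
    (symbolConnection D hD).nabla i f = coeffMap (D i).toLinearMap f + X i * f := rfl

theorem symbol_nabla_monomial (i : Fin n) (k : Fin n →₀ ℕ) (a : K) :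
    (symbolConnection D hD).nabla i (monomial k a) =
      monomial k (D i a) + monomial (k + Finsupp.single i 1) a := by
  classical
  rw [symbol_nabla]
  congr 1
  · ext l; simp only [coeff_coeffMap, coeff_monomial]; split_ifs <;> simp
  · rw [X, monomial_mul, one_mul, add_comm]

variable {P : Type*} [AddCommGroup P] [Module ℂ P] [Module K P]

theorem act_nabla (c : Connection D P) (x : P) (i : Fin n) (f : MvPolynomial (Fin n) K) :
    c.act x ((symbolConnection D hD).nabla i f) = c.nabla i (c.act x f) := by
  induction f using MvPolynomial.induction_on' with
  | monomial k a =>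
    rw [symbol_nabla_monomial, map_add, c.act_monomial, c.act_monomial, c.act_monomial,
      c.leibniz, c.deriv_add_single]
  | add p q hp hq => simp only [map_add, hp, hq]

/-- Under left multiplication by K and the ∂_i, the operators are generated by 1. Associativity and
commutation of operators are deduced below by comparing values at 1 only. -/
theorem linearMap_ext_of_nabla {S S' : MvPolynomial (Fin n) K →ₗ[K] P} (c : Connection D P)
    (h : ∀ i f, S ((symbolConnection D hD).nabla i f) = c.nabla i (S f))
    (h' : ∀ i f, S' ((symbolConnection D hD).nabla i f) = c.nabla i (S' f)) (h1 : S 1 = S' 1) :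
    S = S' := by
  refine (basisMonomials (Fin n) K).ext fun k => ?_
  simp only [coe_basisMonomials]
  induction k using exponent_induction with
  | zero => simpa [← C_apply] using h1
  | step k i ih =>
    have : monomial (k + Finsupp.single i 1) (1 : K) =
        (symbolConnection D hD).nabla i (monomial k 1) := by rw [symbol_nabla_monomial]; simp
    rw [this, h, h', ih]

/-- This is associativity f(l x) = (f l) x. For symbols, `act l f` is the composition of f after l,
so `act l` is right multiplication by l, a K-linear map because coefficients stand on the left. -/
theorem act_act (c : Connection D P) (x : P) (l f : MvPolynomial (Fin n) K) :
    c.act (c.act x l) f = c.act x ((symbolConnection D hD).act l f) := by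
  have : c.act (c.act x l) = (c.act x).comp ((symbolConnection D hD).act l) := by
    refine linearMap_ext_of_nabla hD c (fun i f => act_nabla hD c _ i f) (fun i f => ?_) ?_
    · simp only [LinearMap.comp_apply, act_nabla]
    · simp
  rw [this]; rfl

theorem act_deriv (c : Connection D P) (x : P) (k : Fin n →₀ ℕ) (f : MvPolynomial (Fin n) K) :
    c.act x ((symbolConnection D hD).deriv k f) = c.deriv k (c.act x f) := by
  induction k using exponent_induction with
  | zero => simp
  | step k i ih => rw [Connection.deriv_add_single, Connection.deriv_add_single, act_nabla, ih]

/-- Commuting operators give commuting right multiplications. -/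
theorem act_comm {l l' : MvPolynomial (Fin n) K}
    (h : (symbolConnection D hD).act l l' = (symbolConnection D hD).act l' l) :
    (symbolConnection D hD).act l * (symbolConnection D hD).act l' =
      (symbolConnection D hD).act l' * (symbolConnection D hD).act l := by
  refine linearMap_ext_of_nabla hD (symbolConnection D hD) (fun i f => ?_) (fun i f => ?_) ?_
  · simp only [Module.End.mul_apply, act_nabla]
  · simp only [Module.End.mul_apply, act_nabla]
  · simpa using h

end Symbol

/-- Symbols of degree less than `d`. -/
def degLT (K : Type*) [CommRing K] (n d : ℕ) : Submodule K (MvPolynomial (Fin n) K) where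
  carrier := {f | ∀ k, d ≤ k.degree → coeff k f = 0}
  zero_mem' := fun _ _ => by simp
  add_mem' := fun ha hb k hk => by simp [ha k hk, hb k hk]
  smul_mem' := fun a f hf k hk => by simp [hf k hk]

theorem degLT_mono {d d' : ℕ} (h : d ≤ d') : degLT K n d ≤ degLT K n d' :=
  fun _ hf k hk => hf k (h.trans hk)

theorem exists_mem_degLT (f : MvPolynomial (Fin n) K) : ∃ d, f ∈ degLT K n d := by
  refine ⟨f.totalDegree + 1, fun k hk => coeff_eq_zero_of_totalDegree_lt ?_⟩
  rw [Finsupp.degree_apply] at hk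
  exact hk

theorem degLT_zero {f : MvPolynomial (Fin n) K} (hf : f ∈ degLT K n 0) : f = 0 := by
  ext k; simpa using hf k (Nat.zero_le _)

theorem monomial_mem_degLT {d : ℕ} {k : Fin n →₀ ℕ} (h : k.degree < d) (a : K) :
    monomial k a ∈ degLT K n d := by
  classical
  intro l hl
  rw [coeff_monomial, if_neg]
  rintro rfl; omega

theorem mul_mem_degLT {a b : ℕ} {f g : MvPolynomial (Fin n) K} (hf : f ∈ degLT K n (a + 1))
    (hg : g ∈ degLT K n b) : f * g ∈ degLT K n (a + b) := by
  classical
  intro k hk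
  rw [coeff_mul]
  refine Finset.sum_eq_zero fun p hp => ?_
  rw [Finset.HasAntidiagonal.mem_antidiagonal] at hp
  have : p.1.degree + p.2.degree = k.degree := by rw [← map_add, hp]
  rcases Nat.lt_or_ge p.1.degree (a + 1) with h | h
  · rw [hg p.2 (by omega), mul_zero]
  · rw [hf p.1 h, zero_mul]

theorem map_mem_degLT {d : ℕ} {f : MvPolynomial (Fin n) ℂ} (hf : f.IsHomogeneous d) :
    map (algebraMap ℂ K) f ∈ degLT K n (d + 1) := by
  intro k hk
  rw [coeff_map, hf.coeff_eq_zero, map_zero]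
  omega

theorem mem_degLT_induction {d : ℕ} {p : MvPolynomial (Fin n) K → Prop}
    (hz : p 0) (hadd : ∀ f g, p f → p g → p (f + g))
    (hm : ∀ k (a : K), k.degree < d → p (monomial k a)) {f : MvPolynomial (Fin n) K}
    (hf : f ∈ degLT K n d) : p f := by
  rw [f.as_sum]
  refine Finset.sum_induction _ p hadd hz fun k hk => ?_
  refine hm k _ ?_
  by_contra! h
  exact (mem_support_iff.mp hk) (hf k h)

section Degree

variable {D : Fin n → Derivation ℂ K K} (hD : ∀ i j a, D i (D j a) = D j (D i a))

theorem symbol_nabla_sub_mem {d : ℕ} {f : MvPolynomial (Fin n) K} (hf : f ∈ degLT K n d)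
    (i : Fin n) : (symbolConnection D hD).nabla i f - X i * f ∈ degLT K n d := by
  intro k hk
  simp [symbol_nabla, hf k hk]

theorem symbol_deriv_sub_mem {d : ℕ} {f : MvPolynomial (Fin n) K} (hf : f ∈ degLT K n (d + 1))
    (k : Fin n →₀ ℕ) :
    (symbolConnection D hD).deriv k f - monomial k 1 * f ∈ degLT K n (d + k.degree) := by
  induction k using exponent_induction with
  | zero => simp [← C_apply]
  | step k i ih =>
    rw [Connection.deriv_add_single]
    set g := (symbolConnection D hD).deriv k f
    have hX : (X i : MvPolynomial (Fin n) K) ∈ degLT K n (1 + 1) := monomial_mem_degLT (by simp) 1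
    have hg : g ∈ degLT K n (d + (k + Finsupp.single i 1).degree) := by
      have h1 : monomial k 1 * f ∈ degLT K n (k.degree + (d + 1)) :=
        mul_mem_degLT (monomial_mem_degLT (by omega) 1) hf
      have : g = (g - monomial k 1 * f) + monomial k 1 * f := by abel
      rw [this]
      refine add_mem (degLT_mono ?_ ih) (degLT_mono ?_ h1) <;> simp <;> omega
    have e : (symbolConnection D hD).nabla i g - monomial (k + Finsupp.single i 1) 1 * f =
        ((symbolConnection D hD).nabla i g - X i * g) + X i * (g - monomial k 1 * f) := by
      have : monomial (k + Finsupp.single i 1) (1 : K) = X i * monomial k 1 := by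
        rw [X, monomial_mul, one_mul, add_comm]
      rw [this]; ring
    rw [e]
    refine add_mem (symbol_nabla_sub_mem hD hg i) (degLT_mono ?_ (mul_mem_degLT hX ih))
    simp; omega

/-- Leading symbols multiply under composition, since moving a derivative past a coefficient lowers
the order. -/
theorem symbol_act_sub_mem {c d : ℕ} {l σ : MvPolynomial (Fin n) K} (hσ : σ ∈ degLT K n (c + 1))
    (hl : l - σ ∈ degLT K n c) {f : MvPolynomial (Fin n) K} (hf : f ∈ degLT K n (d + 1)) :
    (symbolConnection D hD).act l f - σ * f ∈ degLT K n (c + d) := by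
  refine mem_degLT_induction (p := fun f =>
    (symbolConnection D hD).act l f - σ * f ∈ degLT K n (c + d)) ?_ ?_ ?_ hf
  · simp
  · intro f g hf hg
    have : (symbolConnection D hD).act l (f + g) - σ * (f + g) =
      ((symbolConnection D hD).act l f - σ * f) + ((symbolConnection D hD).act l g - σ * g) := by
      rw [map_add]; ring
    rw [this]; exact add_mem hf hg
  · intro k a hk
    have hl' : l ∈ degLT K n (c + 1) := by
      have : l = (l - σ) + σ := by abel
      rw [this]; exact add_mem (degLT_mono (by omega) hl) hσ
    have e : (symbolConnection D hD).act l (monomial k a) - σ * monomial k a =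
        a • (((symbolConnection D hD).deriv k l - monomial k 1 * l) +
          monomial k 1 * (l - σ)) := by
      rw [Connection.act_monomial]
      have : monomial k a = a • monomial k (1 : K) := by simp [smul_monomial]
      rw [this, mul_smul_comm, ← smul_sub]; congr 1; ring
    rw [e]
    refine Submodule.smul_mem _ _ (add_mem (degLT_mono ?_ (symbol_deriv_sub_mem hD hl' k))
      (degLT_mono ?_ (mul_mem_degLT (monomial_mem_degLT (Nat.lt_succ_self _) 1) hl))) <;> omega

end Degree

end SymbolCalculus
end

/-! ### Operators modulo the left ideal of the system -/

noncomputable section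

namespace SymbolCalculus

open MvPolynomial HomogeneousParameters

set_option linter.unusedSectionVars false

variable {n : ℕ} {K : Type*} [CommRing K] [Algebra ℂ K]
variable {D : Fin n → Derivation ℂ K K} (hD : ∀ i j a, D i (D j a) = D j (D i a))
variable {s : Fin n → MvPolynomial (Fin n) ℂ} {l : Fin n → MvPolynomial (Fin n) K}

theorem prod_pow_add_single {R : Type*} [CommRing R] (f : Fin n → R) (β : Fin n →₀ ℕ) (i : Fin n) :
    ∏ j, f j ^ (β + Finsupp.single i 1 : Fin n →₀ ℕ) j = f i * ∏ j, f j ^ β j := by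
  have : ∏ j, f j ^ (Finsupp.single i 1 : Fin n →₀ ℕ) j = f i := by
    rw [Finset.prod_eq_single i] <;> simp +contextual [Finsupp.single_apply, eq_comm]
  simp only [Finsupp.add_apply, pow_add, Finset.prod_mul_distrib, this, mul_comm]

/-- Products of the right multiplications by the operators `lᵢ`. -/
def rightMul (hc : ∀ i j, (symbolConnection D hD).act (l i) * (symbolConnection D hD).act (l j) =
    (symbolConnection D hD).act (l j) * (symbolConnection D hD).act (l i)) (β : Fin n →₀ ℕ) :
    Module.End K (MvPolynomial (Fin n) K) :=
  commAeval (R := K) (fun i => (symbolConnection D hD).act (l i)) hc (monomial β 1)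

section

variable (hc : ∀ i j, (symbolConnection D hD).act (l i) * (symbolConnection D hD).act (l j) =
    (symbolConnection D hD).act (l j) * (symbolConnection D hD).act (l i))

theorem rightMul_zero (f : MvPolynomial (Fin n) K) : rightMul hD hc 0 f = f := by
  rw [rightMul, ← C_apply, C_1, map_one, Module.End.one_apply]

theorem rightMul_add_single (β : Fin n →₀ ℕ) (i : Fin n) (f : MvPolynomial (Fin n) K) :
    rightMul hD hc (β + Finsupp.single i 1) f =
      (symbolConnection D hD).act (l i) (rightMul hD hc β f) := by
  rw [rightMul, commAeval_monomial_add_single]; rfl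

theorem rightMul_nabla (β : Fin n →₀ ℕ) (i : Fin n) (f : MvPolynomial (Fin n) K) :
    rightMul hD hc β ((symbolConnection D hD).nabla i f) =
      (symbolConnection D hD).nabla i (rightMul hD hc β f) := by
  induction β using exponent_induction with
  | zero => simp only [rightMul_zero]
  | step β j ih => simp only [rightMul_add_single, ih, act_nabla]

theorem rightMul_sub_mem (hs : ∀ i, (s i).IsHomogeneous (s i).totalDegree)
    (hl : ∀ i, l i - map (algebraMap ℂ K) (s i) ∈ degLT K n (s i).totalDegree)
    (β : Fin n →₀ ℕ) {d : ℕ} {f : MvPolynomial (Fin n) K} (hf : f ∈ degLT K n (d + 1)) :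
    rightMul hD hc β f - map (algebraMap ℂ K) (∏ i, s i ^ β i) * f ∈
      degLT K n (d + ∑ i, β i * (s i).totalDegree) := by
  induction β using exponent_induction with
  | zero => simp [rightMul_zero]
  | step β i ih =>
    rw [rightMul_add_single]
    set g := rightMul hD hc β f
    have hdeg : ∑ j, (β + Finsupp.single i 1 : Fin n →₀ ℕ) j * (s j).totalDegree =
        ∑ j, β j * (s j).totalDegree + (s i).totalDegree := by
      simp [add_mul, Finset.sum_add_distrib, Finsupp.single_apply]
    have hprod : ∏ j, s j ^ (β + Finsupp.single i 1 : Fin n →₀ ℕ) j =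
        s i * ∏ j, s j ^ β j := prod_pow_add_single s β i
    have hσ : (∏ j, s j ^ β j).IsHomogeneous (∑ j, β j * (s j).totalDegree) := by
      refine IsHomogeneous.prod _ _ _ fun j _ => ?_
      have := (hs j).pow (β j)
      rwa [mul_comm] at this
    have hg : g ∈ degLT K n (d + ∑ j, β j * (s j).totalDegree + 1) := by
      have h1 := mul_mem_degLT (map_mem_degLT (K := K) hσ) hf
      have : g = (g - map (algebraMap ℂ K) (∏ i, s i ^ β i) * f) +
        map (algebraMap ℂ K) (∏ i, s i ^ β i) * f := by abel
      rw [this]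
      exact add_mem (degLT_mono (by omega) ih) (degLT_mono (by omega) h1)
    have h2 := symbol_act_sub_mem hD (map_mem_degLT (K := K) (hs i)) (hl i) hg
    have h3 := mul_mem_degLT (map_mem_degLT (K := K) (hs i)) ih
    rw [hdeg, hprod, map_mul]
    have e : (symbolConnection D hD).act (l i) g -
        map (algebraMap ℂ K) (s i) * map (algebraMap ℂ K) (∏ j, s j ^ β j) * f =
        ((symbolConnection D hD).act (l i) g - map (algebraMap ℂ K) (s i) * g) +
        map (algebraMap ℂ K) (s i) * (g - map (algebraMap ℂ K) (∏ i, s i ^ β i) * f) := by ring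
    rw [e]
    exact add_mem (degLT_mono (by omega) h2) (degLT_mono (by omega) h3)

end

/-- Base change of a symbol with constant coefficients, as a linear map. -/
def mapLinear (K : Type*) [CommRing K] [Algebra ℂ K] :
    MvPolynomial (Fin n) ℂ →ₗ[ℂ] MvPolynomial (Fin n) K :=
  (mapAlgHom (Algebra.ofId ℂ K)).toLinearMap

theorem mapLinear_apply (f : MvPolynomial (Fin n) ℂ) :
    mapLinear K f = map (algebraMap ℂ K) f := rfl

theorem exists_linear_extension {V : Type*} [AddCommGroup V] [Module K V] [Module ℂ V]
    [IsScalarTower ℂ K V] (g : MvPolynomial (Fin n) ℂ →ₗ[ℂ] V) :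
    ∃ G : MvPolynomial (Fin n) K →ₗ[K] V, ∀ f, G (map (algebraMap ℂ K) f) = g f := by
  refine ⟨(basisMonomials (Fin n) K).constr K fun k => g (monomial k 1), fun f => ?_⟩
  induction f using MvPolynomial.induction_on' with
  | monomial k a =>
    have h1 : map (algebraMap ℂ K) (monomial k a) = algebraMap ℂ K a • basisMonomials (Fin n) K k := by
      rw [coe_basisMonomials, map_monomial, smul_monomial, smul_eq_mul, mul_one]
    have h2 : monomial k a = a • monomial k (1 : ℂ) := by rw [smul_monomial, smul_eq_mul, mul_one]
    rw [h1, map_smul, Module.Basis.constr_basis, h2, map_smul, algebraMap_smul]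
  | add p q hp hq => simp only [map_add, hp, hq]

/-- Reduction of the ring of symbols modulo the system `lᵢ = λᵢ`. -/
theorem exists_reduction {κ : Type} [Fintype κ] [DecidableEq κ] {e : κ → Fin n →₀ ℕ}
    (he : IsQuotBasis s e)
    (hs : ∀ i, (s i).IsHomogeneous (s i).totalDegree) (hpos : ∀ i, 0 < (s i).totalDegree)
    (hf : Module.Finite (Algebra.adjoin ℂ (Set.range s)) (MvPolynomial (Fin n) ℂ))
    (hl : ∀ i, l i - map (algebraMap ℂ K) (s i) ∈ degLT K n (s i).totalDegree)
    (hcomm : ∀ i j, (symbolConnection D hD).act (l i) (l j) =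
      (symbolConnection D hD).act (l j) (l i)) (lam : Fin n → ℂ) :
    ∃ π : MvPolynomial (Fin n) K →ₗ[K] (κ → K),
      (∀ j, π (monomial (e j) 1) = Pi.single j 1) ∧
      (∀ i f, π ((symbolConnection D hD).act (l i) f) = lam i • π f) ∧
      (∀ i f j, π ((symbolConnection D hD).nabla i f) j = D i (π f j) +
        ∑ k, π f k * π ((symbolConnection D hD).nabla i (monomial (e k) 1)) j) ∧
      ∀ f, f - ∑ j, π f j • monomial (e j) (1 : K) ∈ Submodule.span K
        {g | ∃ i h, g = (symbolConnection D hD).act (l i) h - lam i • h} := by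
  obtain ⟨b, hb⟩ := he.exists_basis hs hpos hf
  have hc : ∀ i j, (symbolConnection D hD).act (l i) * (symbolConnection D hD).act (l j) =
    (symbolConnection D hD).act (l j) * (symbolConnection D hD).act (l i) :=
    fun i j => act_comm hD (hcomm i j)
  -- `T` replaces the commutative product s^β ξ^{e_j} by the operator ∂^{e_j} l^β, the l's being
  -- multiplied on the right so that `T` is K-linear.
  obtain ⟨T, hT⟩ := exists_linear_extension (K := K)
    (b.constr ℂ fun p => rightMul hD hc p.2 (monomial (e p.1) (1 : K)))
  -- `π₀` substitutes λ for s. Composed with the inverse of `T` it will replace every l_i on the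
  -- right by the number λ_i.
  obtain ⟨π₀, hπ₀⟩ := exists_linear_extension (K := K)
    (b.constr ℂ fun p => (∏ i, lam i ^ p.2 i) • (Pi.single p.1 1 : κ → K))
  have hTb : ∀ p, T (map (algebraMap ℂ K) (prodFamily s e p)) =
      rightMul hD hc p.2 (monomial (e p.1) (1 : K)) := fun p => by
    rw [hT, ← hb, Module.Basis.constr_basis]
  have hπb : ∀ p, π₀ (map (algebraMap ℂ K) (prodFamily s e p)) =
      (∏ i, lam i ^ p.2 i) • (Pi.single p.1 1 : κ → K) := fun p => by
    rw [hπ₀, ← hb, Module.Basis.constr_basis]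
  -- `T` is the identity up to terms of lower degree
  have hTb' : ∀ p, T (map (algebraMap ℂ K) (prodFamily s e p)) -
      map (algebraMap ℂ K) (prodFamily s e p) ∈ degLT K n (prodDegree s e p) := by
    intro p
    rw [hTb, prodFamily, map_mul, map_monomial, (algebraMap ℂ K).map_one, mul_comm (monomial (e p.1) (1 : K))]
    exact rightMul_sub_mem hD hc hs hl p.2 (monomial_mem_degLT (Nat.lt_succ_self _) 1)
  have hTlow : ∀ d, ∀ f ∈ degLT K n (d + 1), T f - f ∈ degLT K n d := by
    intro d f hf
    refine mem_degLT_induction (p := fun f => T f - f ∈ degLT K n d) (by simp) ?_ ?_ hf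
    · intro f g hf hg
      have : T (f + g) - (f + g) = (T f - f) + (T g - g) := by rw [map_add]; abel
      rw [this]; exact add_mem hf hg
    · intro k a hk
      have h1 := he.mem_span hs hpos k.degree (monomial k 1) (isHomogeneous_monomial 1 rfl)
      have h2 : ∀ f ∈ Submodule.span ℂ (prodFamily s e '' {p | prodDegree s e p = k.degree}),
          T (map (algebraMap ℂ K) f) - map (algebraMap ℂ K) f ∈ degLT K n d := by
        intro f hf
        induction hf using Submodule.span_induction with
        | mem x hx =>
          obtain ⟨p, hp, rfl⟩ := hx
          have hp' : prodDegree s e p = k.degree := hp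
          exact degLT_mono (by omega) (hTb' p)
        | zero => simp
        | add x y _ _ hx hy =>
          have : T (map (algebraMap ℂ K) (x + y)) - map (algebraMap ℂ K) (x + y) =
            (T (map (algebraMap ℂ K) x) - map (algebraMap ℂ K) x) +
            (T (map (algebraMap ℂ K) y) - map (algebraMap ℂ K) y) := by
            rw [map_add, map_add]; abel
          rw [this]; exact add_mem hx hy
        | smul c x _ hx =>
          have : map (algebraMap ℂ K) (c • x) = algebraMap ℂ K c • map (algebraMap ℂ K) x := by
            rw [smul_eq_C_mul, map_mul, map_C, smul_eq_C_mul]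
          rw [this, map_smul, ← smul_sub]
          exact Submodule.smul_mem _ _ hx
      have h3 := h2 _ h1
      have e1 : monomial k a = a • map (algebraMap ℂ K) (monomial k 1) := by
        simp [smul_monomial]
      rw [e1, map_smul, ← smul_sub]
      exact Submodule.smul_mem _ _ h3
  have hinj : ∀ d, ∀ f ∈ degLT K n d, T f = 0 → f = 0 := by
    intro d
    induction d with
    | zero => exact fun f hf _ => degLT_zero hf
    | succ d ih =>
      intro f hf h0
      refine ih f ?_ h0
      have := hTlow d f hf
      rw [h0, zero_sub] at this
      simpa using neg_mem this
  have hsurj : ∀ d, ∀ f ∈ degLT K n d, ∃ g, T g = f := by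
    intro d
    induction d with
    | zero => exact fun f hf => ⟨0, by rw [degLT_zero hf, map_zero]⟩
    | succ d ih =>
      intro f hf
      obtain ⟨g, hg⟩ := ih _ (hTlow d f hf)
      exact ⟨f - g, by rw [map_sub, hg]; abel⟩
  -- Being unipotent for the filtration by order, `T` is bijective: the operators ∂^{e_j} l^β form a
  -- K-basis of all operators.
  let E : MvPolynomial (Fin n) K ≃ₗ[K] MvPolynomial (Fin n) K := LinearEquiv.ofBijective T
    ⟨by
      rw [← LinearMap.ker_eq_bot, LinearMap.ker_eq_bot']
      intro f hf
      obtain ⟨d, hd⟩ := exists_mem_degLT f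
      exact hinj d f hd hf, fun f => by
      obtain ⟨d, hd⟩ := exists_mem_degLT f
      exact hsurj d f hd⟩
  have hEsymm : ∀ f, E.symm (T f) = f := fun f => E.symm_apply_apply f
  let π : MvPolynomial (Fin n) K →ₗ[K] (κ → K) := π₀.comp E.symm.toLinearMap
  have hπ : ∀ j β, π (rightMul hD hc β (monomial (e j) 1)) =
      (∏ i, lam i ^ β i) • (Pi.single j 1 : κ → K) := by
    intro j β
    have := hTb (j, β)
    simp only at this
    rw [← this]
    change π₀ (E.symm _) = _
    rw [hEsymm, hπb]
  have hind : ∀ {p : MvPolynomial (Fin n) K → Prop} (_ : p 0)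
      (_ : ∀ f g, p f → p g → p (f + g))
      (_ : ∀ (a : K) j β, p (a • rightMul hD hc β (monomial (e j) 1))) (f), p f := by
    intro p h0 hadd hm f
    have hspan : Submodule.span K (Set.range fun q => map (algebraMap ℂ K) (prodFamily s e q)) = ⊤ := by
      rw [eq_top_iff, ← (basisMonomials (Fin n) K).span_eq, Submodule.span_le]
      rintro _ ⟨k, rfl⟩
      have h1 : monomial k (1 : ℂ) ∈ Submodule.span ℂ (Set.range b) := by rw [b.span_eq]; trivial
      rw [hb] at h1
      have h2 := Submodule.mem_map_of_mem (f := mapLinear K) h1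
      rw [Submodule.map_span, ← Set.range_comp, mapLinear_apply, map_monomial, map_one] at h2
      rw [coe_basisMonomials]
      exact Submodule.span_le_restrictScalars ℂ K _ h2
    obtain ⟨g, rfl⟩ := E.surjective f
    have hg : g ∈ Submodule.span K (Set.range fun q => map (algebraMap ℂ K) (prodFamily s e q)) := by
      rw [hspan]; trivial
    rw [Finsupp.mem_span_range_iff_exists_finsupp] at hg
    obtain ⟨c, rfl⟩ := hg
    change p (T _)
    rw [Finsupp.sum, map_sum]
    refine Finset.sum_induction _ p hadd h0 fun q _ => ?_
    rw [map_smul, hTb]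
    exact hm _ _ _
  have hprod : ∀ (β : Fin n →₀ ℕ) i, ∏ j, lam j ^ (β + Finsupp.single i 1 : Fin n →₀ ℕ) j =
      lam i * ∏ j, lam j ^ β j := prod_pow_add_single lam
  have hπ0 : ∀ j, π (monomial (e j) 1) = Pi.single j 1 := by
    intro j
    have := hπ j 0
    simpa [rightMul_zero] using this
  have hπR : ∀ i f, π ((symbolConnection D hD).act (l i) f) = lam i • π f := by
    intro i f
    refine hind (p := fun f => π ((symbolConnection D hD).act (l i) f) = lam i • π f) ?_ ?_ ?_ f
    · simp
    · intro f g hf hg; simp only [map_add, hf, hg, smul_add]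
    · intro a j β
      rw [map_smul, map_smul, map_smul, ← rightMul_add_single, hπ, hπ, hprod, mul_smul,
        smul_comm a]
  have hπR' : ∀ β f, π (rightMul hD hc β f) = (∏ i, lam i ^ β i) • π f := by
    intro β f
    induction β using exponent_induction with
    | zero => simp [rightMul_zero]
    | step β i ih => rw [rightMul_add_single, hπR, ih, hprod, mul_smul]
  refine ⟨π, hπ0, hπR, ?_, ?_⟩
  · intro i f
    refine hind (p := fun f => ∀ j, π ((symbolConnection D hD).nabla i f) j = D i (π f j) +
        ∑ k, π f k * π ((symbolConnection D hD).nabla i (monomial (e k) 1)) j) ?_ ?_ ?_ f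
    · simp
    · intro f g hf hg j
      simp only [map_add, Pi.add_apply, hf, hg, add_mul, Finset.sum_add_distrib]
      abel
    -- The Leibniz rule treats the coefficient a. Left multiplication by ∂_i commutes with right
    -- multiplication by l^β, so the factor λ^β comes out and only the case β = 0 contributes matrix
    -- entries.
    · intro a j β k
      rw [(symbolConnection D hD).leibniz, map_add, map_smul, map_smul, ← rightMul_nabla, hπR', hπR',
        hπ0, map_smul, hπ]
      set c := ∏ i, lam i ^ β i
      have h1 : ∀ x : κ, (a • c • (Pi.single j 1 : κ → K)) x = if x = j then c • a else 0 := by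
        intro x
        simp only [Pi.smul_apply, Pi.single_apply]
        split_ifs <;> simp [Algebra.smul_def, mul_comm]
      simp only [h1, ite_mul, zero_mul, Finset.sum_ite_eq', Finset.mem_univ, if_true]
      simp only [Pi.add_apply, Pi.smul_apply, Pi.single_apply]
      congr 1
      · split_ifs <;> simp [Algebra.smul_def, mul_comm]
      · simp [Algebra.smul_def]; ring
  · intro f
    set N := Submodule.span K {g | ∃ i h, g = (symbolConnection D hD).act (l i) h - lam i • h}
    have hN : ∀ j β, rightMul hD hc β (monomial (e j) 1) -
        (∏ i, lam i ^ β i) • monomial (e j) (1 : K) ∈ N := by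
      intro j β
      induction β using exponent_induction with
      | zero => simp [rightMul_zero]
      | step β i ih =>
        rw [rightMul_add_single, hprod]
        set g := rightMul hD hc β (monomial (e j) 1)
        have e1 : (symbolConnection D hD).act (l i) g -
            (lam i * ∏ i, lam i ^ β i) • monomial (e j) (1 : K) =
            ((symbolConnection D hD).act (l i) g - lam i • g) +
            lam i • (g - (∏ i, lam i ^ β i) • monomial (e j) (1 : K)) := by
          rw [smul_sub, mul_smul]; abel
        rw [e1]
        refine add_mem (Submodule.subset_span ⟨i, g, rfl⟩) ?_
        rw [← algebraMap_smul K (lam i)]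
        exact Submodule.smul_mem _ _ ih
    refine hind (p := fun f => f - ∑ j, π f j • monomial (e j) (1 : K) ∈ N) ?_ ?_ ?_ f
    · simp
    · intro f g hf hg
      have : f + g - ∑ j, π (f + g) j • monomial (e j) (1 : K) =
          (f - ∑ j, π f j • monomial (e j) (1 : K)) +
          (g - ∑ j, π g j • monomial (e j) (1 : K)) := by
        simp only [map_add, Pi.add_apply, add_smul, Finset.sum_add_distrib]; abel
      rw [this]; exact add_mem hf hg
    · intro a j β
      have : ∑ k, π (a • rightMul hD hc β (monomial (e j) 1)) k • monomial (e k) (1 : K) =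
          a • (∏ i, lam i ^ β i) • monomial (e j) (1 : K) := by
        rw [map_smul, hπ, Finset.sum_eq_single j]
        · simp [smul_comm a]
        · intro k _ hk; simp [hk]
        · simp
      rw [this, ← smul_sub]
      exact Submodule.smul_mem _ _ (hN j β)

end SymbolCalculus
end

noncomputable section

/-! ### The differential ring of holomorphic functions -/

namespace SeveralComplex

open Set Metric Filter TopologicalSpace LameOperators SymbolCalculus
open scoped ContDiff

variable {n : ℕ}

/-- Extension by zero of a function on `U`. -/
def extendZero {U : Opens (Fin n → ℂ)} (f : U → ℂ) : (Fin n → ℂ) → ℂ :=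
  Function.extend Subtype.val f 0

@[simp] theorem extendZero_coe {U : Opens (Fin n → ℂ)} (f : U → ℂ) (x : U) :
    extendZero f x = f x := Subtype.val_injective.extend_apply _ _ _

theorem extendZero_mem {U : Opens (Fin n → ℂ)} (f : U → ℂ) {x : Fin n → ℂ} (hx : x ∈ U) :
    extendZero f x = f ⟨x, hx⟩ := extendZero_coe f ⟨x, hx⟩

theorem analyticOnNhd_extendZero_iff {U : Opens (Fin n → ℂ)} {f : U → ℂ} :
    AnalyticOnNhd ℂ (extendZero f) U ↔
      ∃ F : (Fin n → ℂ) → ℂ, AnalyticOnNhd ℂ F U ∧ ∀ x : U, f x = F x := by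
  refine ⟨fun h => ⟨_, h, fun x => by simp⟩, fun ⟨F, hF, h⟩ => hF.congr U.isOpen fun x hx => ?_⟩
  rw [extendZero_mem f hx, h]

/-- The holomorphic functions on `U`, as a subalgebra of all functions. -/
def holSubalgebra (U : Opens (Fin n → ℂ)) : Subalgebra ℂ (U → ℂ) where
  carrier := {f | AnalyticOnNhd ℂ (extendZero f) U}
  mul_mem' {f g} hf hg := analyticOnNhd_extendZero_iff.mpr
    ⟨_, AnalyticOnNhd.mul hf hg, fun x => by simp⟩
  add_mem' {f g} hf hg := analyticOnNhd_extendZero_iff.mpr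
    ⟨_, AnalyticOnNhd.add hf hg, fun x => by simp⟩
  algebraMap_mem' c := analyticOnNhd_extendZero_iff.mpr
    ⟨_, analyticOnNhd_const (v := c), fun x => by simp⟩

/-- The ring of holomorphic functions on `U`. -/
def Hol (U : Opens (Fin n → ℂ)) : Type := holSubalgebra U

instance (U : Opens (Fin n → ℂ)) : CommRing (Hol U) := inferInstanceAs (CommRing (holSubalgebra U))
instance (U : Opens (Fin n → ℂ)) : Algebra ℂ (Hol U) :=
  inferInstanceAs (Algebra ℂ (holSubalgebra U))

namespace Hol

variable {U : Opens (Fin n → ℂ)}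

/-- The extension by zero of a holomorphic function on `U`. -/
def toFun (f : Hol U) : (Fin n → ℂ) → ℂ := extendZero f.1

/-- The restriction to `U` of a function that is holomorphic there. -/
def mk (F : (Fin n → ℂ) → ℂ) (hF : AnalyticOnNhd ℂ F U) : Hol U :=
  ⟨fun x => F x, analyticOnNhd_extendZero_iff.mpr ⟨F, hF, fun _ => rfl⟩⟩

theorem analyticOnNhd (f : Hol U) : AnalyticOnNhd ℂ f.toFun U := f.2

theorem toFun_mk {F : (Fin n → ℂ) → ℂ} (hF : AnalyticOnNhd ℂ F U) {x : Fin n → ℂ} (hx : x ∈ U) :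
    (mk F hF).toFun x = F x := extendZero_mem _ hx

theorem ext_toFun {f g : Hol U} (h : ∀ x ∈ U, f.toFun x = g.toFun x) : f = g := by
  refine Subtype.ext (funext fun x => ?_)
  have := h x x.2
  simpa [toFun] using this

theorem toFun_add (f g : Hol U) {x : Fin n → ℂ} (hx : x ∈ U) :
    (f + g).toFun x = f.toFun x + g.toFun x := by
  simp only [toFun, extendZero_mem _ hx]; rfl

theorem toFun_mul (f g : Hol U) {x : Fin n → ℂ} (hx : x ∈ U) :
    (f * g).toFun x = f.toFun x * g.toFun x := by
  simp only [toFun, extendZero_mem _ hx]; rfl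

theorem toFun_smul (c : ℂ) (f : Hol U) {x : Fin n → ℂ} (hx : x ∈ U) :
    (c • f).toFun x = c * f.toFun x := by
  simp only [toFun, extendZero_mem _ hx]; rfl

theorem toFun_zero {x : Fin n → ℂ} : (0 : Hol U).toFun x = 0 := by
  by_cases hx : x ∈ U
  · simp only [toFun, extendZero_mem _ hx]; rfl
  · simp only [toFun, extendZero]
    rw [Function.extend_apply' _ _ _ (by rintro ⟨y, rfl⟩; exact hx y.2)]; rfl

theorem toFun_algebraMap (c : ℂ) {x : Fin n → ℂ} (hx : x ∈ U) :
    (algebraMap ℂ (Hol U) c).toFun x = c := by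
  simp only [toFun, extendZero_mem _ hx]; rfl

theorem toFun_one {x : Fin n → ℂ} (hx : x ∈ U) : (1 : Hol U).toFun x = 1 := by
  simp only [toFun, extendZero_mem _ hx]; rfl

theorem toFun_sum {ι : Type*} (s : Finset ι) (f : ι → Hol U) {x : Fin n → ℂ} (hx : x ∈ U) :
    (∑ i ∈ s, f i).toFun x = ∑ i ∈ s, (f i).toFun x := by
  classical
  induction s using Finset.induction_on with
  | empty => simp [toFun_zero]
  | insert a s ha ih => rw [Finset.sum_insert ha, Finset.sum_insert ha, toFun_add _ _ hx, ih]

theorem eventuallyEq_of_eqOn {f g : (Fin n → ℂ) → ℂ} (h : ∀ x ∈ U, f x = g x) {x : Fin n → ℂ}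
    (hx : x ∈ U) : f =ᶠ[𝓝 x] g :=
  Filter.mem_of_superset (U.isOpen.mem_nhds hx) h

theorem pderivFun_eqOn (i : Fin n) {f g : (Fin n → ℂ) → ℂ} (h : ∀ x ∈ U, f x = g x) :
    ∀ x ∈ U, pderivFun i f x = pderivFun i g x := fun _ hx =>
  (pderivFun_congr i (eventuallyEq_of_eqOn h hx)).eq_of_nhds

theorem _root_.AnalyticOnNhd.pderivFun {f : (Fin n → ℂ) → ℂ} {S : Set (Fin n → ℂ)}
    (hf : AnalyticOnNhd ℂ f S) (i : Fin n) : AnalyticOnNhd ℂ (LameOperators.pderivFun i f) S :=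
  fun x hx => analyticAt_pderivFun i (hf x hx)

/-- The partial derivative of a holomorphic function. -/
def pd (i : Fin n) (f : Hol U) : Hol U := mk (pderivFun i f.toFun) (f.analyticOnNhd.pderivFun i)

theorem toFun_pd (i : Fin n) (f : Hol U) {x : Fin n → ℂ} (hx : x ∈ U) :
    (pd i f).toFun x = pderivFun i f.toFun x := toFun_mk (f.analyticOnNhd.pderivFun i) hx

/-- The partial derivatives, as derivations. -/
def D (i : Fin n) : Derivation ℂ (Hol U) (Hol U) where
  toFun f := pd i f
  map_add' f g := by
    refine ext_toFun fun x hx => ?_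
    rw [toFun_pd _ _ hx, toFun_add _ _ hx, toFun_pd _ _ hx, toFun_pd _ _ hx,
      pderivFun_eqOn i (g := f.toFun + g.toFun) (fun y hy => toFun_add f g hy) x hx]
    simp only [pderivFun]
    rw [fderiv_add (f.analyticOnNhd x hx).differentiableAt (g.analyticOnNhd x hx).differentiableAt]
    rfl
  map_smul' c f := by
    refine ext_toFun fun x hx => ?_
    rw [toFun_pd _ _ hx, RingHom.id_apply, toFun_smul _ _ hx, toFun_pd _ _ hx,
      pderivFun_eqOn i (g := c • f.toFun) (fun y hy => toFun_smul c f hy) x hx]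
    simp only [pderivFun]
    rw [fderiv_const_smul (f.analyticOnNhd x hx).differentiableAt]
    rfl
  map_one_eq_zero' := by
    refine ext_toFun fun x hx => ?_
    change (pd i 1).toFun x = _
    rw [toFun_pd _ _ hx, toFun_zero, pderivFun_eqOn i (g := fun _ => 1) (fun y hy => toFun_one hy) x hx]
    simp [pderivFun]
  leibniz' f g := by
    refine ext_toFun fun x hx => ?_
    change (pd i (f * g)).toFun x = (f * pd i g + g * pd i f).toFun x
    rw [toFun_pd _ _ hx, toFun_add _ _ hx, toFun_mul _ _ hx, toFun_mul _ _ hx, toFun_pd _ _ hx,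
      toFun_pd _ _ hx, pderivFun_eqOn i (g := f.toFun * g.toFun) (fun y hy => toFun_mul f g hy) x hx]
    simp only [pderivFun]
    rw [fderiv_mul (f.analyticOnNhd x hx).differentiableAt (g.analyticOnNhd x hx).differentiableAt]
    simp

theorem toFun_D (i : Fin n) (f : Hol U) {x : Fin n → ℂ} (hx : x ∈ U) :
    (D i f).toFun x = pderivFun i f.toFun x := toFun_pd i f hx

theorem _root_.SeveralComplex.pderivFun_comm (i j : Fin n) {f : (Fin n → ℂ) → ℂ} {x : Fin n → ℂ}
    (hf : AnalyticAt ℂ f x) :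
    pderivFun i (pderivFun j f) x = pderivFun j (pderivFun i f) x := by
  have hs : IsSymmSndFDerivAt ℂ f x := (hf.contDiffAt (n := ω)).isSymmSndFDerivAt (by simp)
  have h : ∀ i j : Fin n, pderivFun i (pderivFun j f) x =
      fderiv ℂ (fderiv ℂ f) x (Pi.single i 1) (Pi.single j 1) := by
    intro i j
    have hd := hf.fderiv.differentiableAt
    change fderiv ℂ (fun y => fderiv ℂ f y (Pi.single j 1)) x (Pi.single i 1) = _
    rw [fderiv_clm_apply hd (differentiableAt_const _)]
    simp
  rw [h, h, hs]

theorem D_comm (i j : Fin n) (f : Hol U) : D i (D j f) = D j (D i f) := by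
  refine ext_toFun fun x hx => ?_
  rw [toFun_D _ _ hx, toFun_D _ _ hx, pderivFun_eqOn i (fun y hy => toFun_D j f hy) x hx,
    pderivFun_eqOn j (fun y hy => toFun_D i f hy) x hx, pderivFun_comm i j (f.analyticOnNhd x hx)]

/-- Restriction to a smaller open set. -/
def res {O : Opens (Fin n → ℂ)} (h : U ≤ O) : Hol O →ₐ[ℂ] Hol U where
  toFun f := mk f.toFun (f.analyticOnNhd.mono h)
  map_one' := ext_toFun fun x hx => by rw [toFun_mk _ hx, toFun_one hx, toFun_one (h hx)]
  map_zero' := ext_toFun fun x hx => by rw [toFun_mk _ hx, toFun_zero, toFun_zero]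
  map_mul' f g := ext_toFun fun x hx => by
    rw [toFun_mul _ _ hx, toFun_mk _ hx, toFun_mk _ hx, toFun_mk _ hx, toFun_mul _ _ (h hx)]
  map_add' f g := ext_toFun fun x hx => by
    rw [toFun_add _ _ hx, toFun_mk _ hx, toFun_mk _ hx, toFun_mk _ hx, toFun_add _ _ (h hx)]
  commutes' c := ext_toFun fun x hx => by
    rw [toFun_mk _ hx, toFun_algebraMap _ hx, toFun_algebraMap _ (h hx)]

theorem toFun_res {O : Opens (Fin n → ℂ)} (h : U ≤ O) (f : Hol O) {x : Fin n → ℂ} (hx : x ∈ U) :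
    (res h f).toFun x = f.toFun x := toFun_mk (f.analyticOnNhd.mono h) hx

end Hol

/-- The holomorphic functions on `U ⊆ O`, as a module over those on `O`. -/
def Sec {O U : Opens (Fin n → ℂ)} (_ : U ≤ O) : Type := Hol U

variable {O U : Opens (Fin n → ℂ)} {h : U ≤ O}

instance : AddCommGroup (Sec h) := inferInstanceAs (AddCommGroup (Hol U))
instance : Module ℂ (Sec h) := inferInstanceAs (Module ℂ (Hol U))
instance : Module (Hol O) (Sec h) := Module.compHom (Hol U) (Hol.res h).toRingHom
instance : IsScalarTower ℂ (Hol O) (Sec h) where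
  smul_assoc c a (f : Hol U) := by
    change (Hol.res h (c • a)) * f = c • (Hol.res h a * f)
    rw [map_smul, smul_mul_assoc]
instance : SMulCommClass ℂ (Hol O) (Sec h) where
  smul_comm c a (f : Hol U) := by
    change c • (Hol.res h a * f) = Hol.res h a * (c • f)
    rw [mul_smul_comm]

namespace Sec

/-- The function extended by zero. -/
def toFun (f : Sec h) : (Fin n → ℂ) → ℂ := Hol.toFun (U := U) f

/-- The restriction to `U` of a function that is holomorphic there. -/
def mk (h : U ≤ O) (F : (Fin n → ℂ) → ℂ) (hF : AnalyticOnNhd ℂ F U) : Sec h := Hol.mk F hF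

theorem analyticOnNhd (f : Sec h) : AnalyticOnNhd ℂ f.toFun U := f.2

theorem toFun_mk {F : (Fin n → ℂ) → ℂ} (hF : AnalyticOnNhd ℂ F U) {x : Fin n → ℂ} (hx : x ∈ U) :
    (mk h F hF).toFun x = F x := Hol.toFun_mk hF hx

theorem ext_toFun {f g : Sec h} (h : ∀ x ∈ U, f.toFun x = g.toFun x) : f = g := Hol.ext_toFun h

theorem toFun_smul (c : ℂ) (f : Sec h) {x : Fin n → ℂ} (hx : x ∈ U) :
    (c • f).toFun x = c * f.toFun x := Hol.toFun_smul c f hx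

theorem toFun_add (f g : Sec h) {x : Fin n → ℂ} (hx : x ∈ U) :
    (f + g).toFun x = f.toFun x + g.toFun x := Hol.toFun_add (U := U) f g hx

theorem toFun_zero {x : Fin n → ℂ} : (0 : Sec h).toFun x = 0 := Hol.toFun_zero (U := U)

theorem toFun_hol_smul (a : Hol O) (f : Sec h) {x : Fin n → ℂ} (hx : x ∈ U) :
    (a • f).toFun x = a.toFun x * f.toFun x := by
  have : (a • f).toFun x = (Hol.res h a).toFun x * f.toFun x :=
    Hol.toFun_mul (U := U) (Hol.res h a) f hx
  rw [this, Hol.toFun_res h a hx]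

theorem toFun_sum {ι : Type*} (s : Finset ι) (f : ι → Sec h) {x : Fin n → ℂ} (hx : x ∈ U) :
    (∑ i ∈ s, f i).toFun x = ∑ i ∈ s, (f i).toFun x := Hol.toFun_sum (U := U) s f hx

/-- The partial derivatives as a connection. -/
def conn (h : U ≤ O) : Connection (Hol.D (U := O)) (Sec h) where
  nabla i := (Hol.D (U := U) i).toLinearMap
  comm i j x := Hol.D_comm (U := U) i j x
  leibniz i a (f : Hol U) := by
    change Hol.D (U := U) i (Hol.res h a * f) = Hol.res h (Hol.D i a) * f + Hol.res h a * Hol.D i f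
    rw [Derivation.leibniz, smul_eq_mul, smul_eq_mul, add_comm, mul_comm f]
    congr 2
    refine Hol.ext_toFun fun x hx => ?_
    rw [Hol.toFun_D _ _ hx, Hol.toFun_res h _ hx, Hol.toFun_D _ _ (h hx)]
    exact Hol.pderivFun_eqOn i (fun y hy => Hol.toFun_res h a hy) x hx

theorem toFun_nabla (i : Fin n) (f : Sec h) {x : Fin n → ℂ} (hx : x ∈ U) :
    ((conn h).nabla i f).toFun x = pderivFun i f.toFun x := Hol.toFun_D (U := U) i f hx

/-- The monomial is factored as a list product in the order used by `partialDeriv`, so that both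
sides are built up one variable at a time. -/
theorem toFun_deriv_of_eqOn (k : Fin n →₀ ℕ) {f : Sec h} {F : (Fin n → ℂ) → ℂ}
    (hF : ∀ x ∈ U, f.toFun x = F x) :
    ∀ x ∈ U, ((conn h).deriv k f).toFun x = partialDeriv k F x := by
  have hk : (MvPolynomial.monomial k (1 : ℂ)) =
      ((List.finRange n).map fun i => (MvPolynomial.X i : MvPolynomial (Fin n) ℂ) ^ k i).prod := by
    rw [MvPolynomial.monomial_eq, MvPolynomial.C_1, one_mul, Finsupp.prod_fintype _ _ (by simp),
      ← List.ofFn_eq_map, List.prod_ofFn]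
  have hl : ∀ l : List (Fin n), ∀ x ∈ U,
      ((conn h).poly (l.map fun i => (MvPolynomial.X i : MvPolynomial (Fin n) ℂ) ^ k i).prod
        f).toFun x = l.foldr (fun i g => (pderivFun i)^[k i] g) F x := by
    intro l
    induction l with
    | nil => simpa using hF
    | cons a l ih =>
      simp only [List.map_cons, List.prod_cons, map_mul, map_pow, Connection.poly_X,
        Module.End.mul_apply, List.foldr_cons]
      generalize k a = r
      induction r with
      | zero => simpa using ih
      | succ r ihr =>
        intro x hx
        rw [pow_succ', Module.End.mul_apply, toFun_nabla a _ hx, Function.iterate_succ_apply']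
        exact Hol.pderivFun_eqOn a ihr x hx
  intro x hx
  rw [Connection.deriv, hk]
  exact hl _ x hx

theorem toFun_deriv (k : Fin n →₀ ℕ) (f : Sec h) {x : Fin n → ℂ} (hx : x ∈ U) :
    ((conn h).deriv k f).toFun x = partialDeriv k f.toFun x :=
  toFun_deriv_of_eqOn k (fun _ _ => rfl) x hx

theorem toFun_act (f : Sec h) (l : MvPolynomial (Fin n) (Hol O)) {x : Fin n → ℂ} (hx : x ∈ U) :
    ((conn h).act f l).toFun x =
      ∑ k ∈ l.support, (l.coeff k).toFun x * partialDeriv k f.toFun x := by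
  rw [Connection.act_eq_sum, toFun_sum _ _ hx]
  exact Finset.sum_congr rfl fun k _ => by rw [toFun_hol_smul _ _ hx, toFun_deriv k f hx]

/-- Passage between multi-indices and Fréchet derivatives: it brings the Taylor expansion to bear on
statements about coordinate derivatives. -/
theorem iteratedFDeriv_eq (f : Sec h) (d : ℕ) (v : Fin d → Fin n) :
    ∀ x ∈ U, iteratedFDeriv ℂ d f.toFun x (fun j => Pi.single (v j) 1) =
      ((conn h).deriv (∑ j, Finsupp.single (v j) 1) f).toFun x := by
  induction d with
  | zero => intro x hx; simp
  | succ d ih =>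
    intro x hx
    have hsum : ∑ j, Finsupp.single (v j) 1 =
        ∑ j : Fin d, Finsupp.single (v j.succ) 1 + Finsupp.single (v 0) 1 := by
      rw [Fin.sum_univ_succ, add_comm]
    rw [iteratedFDeriv_succ_apply_left, hsum, Connection.deriv_add_single,
      toFun_nabla _ _ hx, ← Hol.pderivFun_eqOn (v 0) (ih fun j => v j.succ) x hx]
    have hd : DifferentiableAt ℂ (iteratedFDeriv ℂ d f.toFun) x :=
      (f.analyticOnNhd.iteratedFDeriv d x hx).differentiableAt
    simp only [pderivFun]
    rw [fderiv_continuousMultilinear_apply_const hd]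
    rfl

/-- A holomorphic function all of whose derivatives vanish at a point is zero. -/
theorem eq_zero_of_deriv_eq_zero (hU : IsPreconnected (U : Set (Fin n → ℂ))) {f : Sec h}
    {p : Fin n → ℂ} (hp : p ∈ U) (h0 : ∀ k, ((conn h).deriv k f).toFun p = 0) : f = 0 := by
  have hz : ∀ d, iteratedFDeriv ℂ d f.toFun p = 0 := by
    intro d
    refine ContinuousMultilinearMap.toMultilinearMap_injective ?_
    refine Module.Basis.ext_multilinear (fun _ => Pi.basisFun ℂ (Fin n)) fun v => ?_
    simp only [Pi.basisFun_apply]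
    change iteratedFDeriv ℂ d f.toFun p _ = 0
    rw [iteratedFDeriv_eq f d v p hp, h0]
  obtain ⟨q, r, hq⟩ := f.analyticOnNhd p hp
  have hev : f.toFun =ᶠ[𝓝 p] 0 := by
    have hq0 := hq.eventually_hasSum_sub
    filter_upwards [hq0] with y hy
    have : ∀ d, q d (fun _ => y - p) = 0 := by
      intro d
      have h1 := hq.factorial_smul (y - p) d
      rw [hz d] at h1
      simpa [Nat.factorial_ne_zero] using h1
    simp only [this] at hy
    exact hy.unique hasSum_zero
  have := f.analyticOnNhd.eqOn_zero_of_preconnected_of_eventuallyEq_zero hU hp hev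
  exact ext_toFun fun x hx => by rw [toFun_zero]; exact this hx

end Sec

end SeveralComplex
end

noncomputable section

/-! ### Local solutions of holonomic systems -/

namespace SeveralComplex

open Set Metric Filter TopologicalSpace LameOperators SymbolCalculus MvPolynomial
open HomogeneousParameters

variable {n : ℕ}

theorem norm_pderivFun_le {F : (Fin n → ℂ) → ℂ} {x : Fin n → ℂ} {ε C : ℝ} (hε : 0 < ε)
    (hF : AnalyticOnNhd ℂ F (closedBall x ε)) (hC : ∀ y ∈ closedBall x ε, ‖F y‖ ≤ C) (i : Fin n) :
    ‖pderivFun i F x‖ ≤ C / ε := by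
  let g : ℂ → (Fin n → ℂ) := fun z => x + z • Pi.single i 1
  have hg : ∀ z ∈ closedBall (0 : ℂ) ε, g z ∈ closedBall x ε := by
    intro z hz
    have h1 : ‖(Pi.single i 1 : Fin n → ℂ)‖ = 1 := by rw [Pi.norm_single, norm_one]
    simpa [g, dist_eq_norm, norm_smul, h1] using hz
  have hgd : ∀ z, HasDerivAt g (Pi.single i 1) z := fun z => by
    have := ((hasDerivAt_id z).smul_const (Pi.single i 1 : Fin n → ℂ)).const_add x
    rwa [one_smul] at this
  have h1 : DiffContOnCl ℂ (F ∘ g) (ball 0 ε) := by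
    refine DifferentiableOn.diffContOnCl fun z hz => ?_
    exact ((hF _ (hg z (closure_ball_subset_closedBall hz))).differentiableAt.comp z
      (hgd z).differentiableAt).differentiableWithinAt
  have h2 := Complex.norm_deriv_le_of_forall_mem_sphere_norm_le hε h1
    fun z hz => hC _ (hg z (sphere_subset_closedBall hz))
  have h3 : HasDerivAt (F ∘ g) (fderiv ℂ F (g 0) (Pi.single i 1)) 0 :=
    (hF _ (hg 0 (by simpa using hε.le))).differentiableAt.hasFDerivAt.comp_hasDerivAt 0 (hgd 0)
  rw [h3.deriv] at h2
  simpa [pderivFun, g] using h2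

/-- Cauchy estimates for the iterated derivatives with respect to a connection. -/
theorem norm_iterate_le {κ : Type*} [Fintype κ] {p : Fin n → ℂ} {R C₀ C₁ : ℝ} (hR : 0 < R)
    (hC₀ : 0 ≤ C₀) (hC₁ : 0 ≤ C₁) {a : (Fin n →₀ ℕ) → κ → (Fin n → ℂ) → ℂ}
    {γ : Fin n → κ → κ → (Fin n → ℂ) → ℂ}
    (ha : ∀ k j, AnalyticOnNhd ℂ (a k j) (ball p R))
    (hrec : ∀ k i j, ∀ x ∈ ball p R, a (k + Finsupp.single i 1) j x =
      pderivFun i (a k j) x + ∑ j', a k j' x * γ i j j' x)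
    (hγ : ∀ i j, ∀ x ∈ ball p R, ∑ j', ‖γ i j j' x‖ ≤ C₁)
    (h0 : ∀ j, ∀ x ∈ ball p R, ‖a 0 j x‖ ≤ C₀) (k : Fin n →₀ ℕ) :
    ∀ j, ∀ x ∈ ball p R, ‖a k j x‖ ≤
      C₀ * ((1 + C₁ * R) * (k.degree + 1) / (R - dist x p)) ^ k.degree := by
  induction k using exponent_induction with
  | zero => simpa using h0
  | step k i ih =>
    intro j x hx
    set d := k.degree with hd
    have hdeg : (k + Finsupp.single i 1).degree = d + 1 := by simp [hd]
    set δ := R - dist x p with hδ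
    have hδ0 : 0 < δ := by rw [hδ, sub_pos]; exact hx
    have hδR : δ ≤ R := by rw [hδ]; linarith [dist_nonneg (x := x) (y := p)]
    set B := 1 + C₁ * R with hB
    have hB1 : 0 < B := by positivity
    have hdd : (0 : ℝ) < (d : ℝ) + 1 := by positivity
    have hdd2 : (0 : ℝ) < (d : ℝ) + 2 := by positivity
    -- On the ball of radius ε the distance to the boundary is still at least δ(d+1)/(d+2), so the
    -- bound for order d deteriorates exactly from (d+1)/δ to (d+2)/δ, and Cauchy's factor 1/ε is
    -- one more such factor.
    set ε := δ / (d + 2) with hε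
    have hε0 : 0 < ε := by positivity
    have hεδ : δ - ε = δ * (d + 1) / (d + 2) := by rw [hε]; field_simp; ring
    have hsub : closedBall x ε ⊆ ball p R := by
      intro y hy
      rw [mem_ball]
      have : ε < δ := by
        have : 0 < δ - ε := by rw [hεδ]; positivity
        linarith
      calc dist y p ≤ dist y x + dist x p := dist_triangle _ _ _
        _ ≤ ε + dist x p := by gcongr; exact hy
        _ < R := by linarith
    have hy : ∀ j, ∀ y ∈ closedBall x ε, ‖a k j y‖ ≤ C₀ * (B * (d + 2) / δ) ^ d := by
      intro j y hy
      refine (ih j y (hsub hy)).trans ?_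
      have h1 : δ * (d + 1) / (d + 2) ≤ R - dist y p := by
        rw [← hεδ]
        have := dist_triangle y x p
        have : dist y x ≤ ε := hy
        linarith
      have h2 : B * (d + 1) / (R - dist y p) ≤ B * (d + 2) / δ := by
        rw [div_le_div_iff₀ (lt_of_lt_of_le (by positivity) h1) hδ0]
        have : δ * (d + 1) ≤ (R - dist y p) * (d + 2) := by
          rwa [div_le_iff₀ hdd2] at h1
        nlinarith
      have h3 : 0 ≤ B * (d + 1) / (R - dist y p) :=
        div_nonneg (by positivity) (le_trans (by positivity) h1)
      gcongr
    have h1 := norm_pderivFun_le hε0 ((ha k j).mono hsub) (hy j) i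
    have hxx : x ∈ closedBall x ε := mem_closedBall_self hε0.le
    have h2 : ‖∑ j', a k j' x * γ i j j' x‖ ≤ C₀ * (B * (d + 2) / δ) ^ d * C₁ := by
      refine (norm_sum_le _ _).trans ?_
      calc ∑ j', ‖a k j' x * γ i j j' x‖ ≤ ∑ j', C₀ * (B * (d + 2) / δ) ^ d * ‖γ i j j' x‖ := by
            refine Finset.sum_le_sum fun j' _ => ?_
            rw [norm_mul]
            exact mul_le_mul_of_nonneg_right (hy j' x hxx) (norm_nonneg _)
        _ ≤ _ := by
            rw [← Finset.mul_sum]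
            exact mul_le_mul_of_nonneg_left (hγ i j x hx) (by positivity)
    rw [hrec k i j x hx, hdeg]
    refine (norm_add_le _ _).trans ((add_le_add h1 h2).trans ?_)
    have e1 : C₀ * (B * (d + 2) / δ) ^ d / ε + C₀ * (B * (d + 2) / δ) ^ d * C₁ =
        C₀ * (B * (d + 2) / δ) ^ d * ((d + 2) / δ + C₁) := by
      rw [hε]; field_simp
    rw [e1, pow_succ, ← mul_assoc]
    push_cast
    rw [show (d : ℝ) + 1 + 1 = d + 2 by ring]
    refine mul_le_mul_of_nonneg_left ?_ (by positivity)
    have h5 : C₁ ≤ C₁ * R * (d + 2) / δ := by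
      rw [le_div_iff₀ hδ0]
      nlinarith [mul_nonneg hC₁ hδ0.le, mul_nonneg hC₁ hR.le,
        mul_nonneg (mul_nonneg hC₁ hR.le) (Nat.cast_nonneg d : (0 : ℝ) ≤ d),
        mul_le_mul_of_nonneg_left hδR hC₁]
    calc (d + 2) / δ + C₁ ≤ (d + 2) / δ + C₁ * R * (d + 2) / δ := by gcongr
      _ = B * (d + 2) / δ := by rw [hB]; ring

theorem exists_sum_single (k : Fin n →₀ ℕ) :
    ∃ (d : ℕ) (v : Fin d → Fin n), k = ∑ j, Finsupp.single (v j) 1 := by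
  induction k using exponent_induction with
  | zero => exact ⟨0, Fin.elim0, by simp⟩
  | step k i ih =>
    obtain ⟨d, v, rfl⟩ := ih
    exact ⟨d + 1, Fin.cons i v, by rw [Fin.sum_univ_succ, add_comm]; simp⟩

/-- Power series with prescribed derivatives. -/
theorem exists_taylor {O : Opens (Fin n → ℂ)} {p : Fin n → ℂ} {ρ C Q : ℝ} (hρ : 0 < ρ)
    (hQ : 0 ≤ Q) (hC : 0 ≤ C) (hQρ : n * Q * ρ ≤ 1) (h : (⟨ball p ρ, isOpen_ball⟩ : Opens _) ≤ O)
    (c : (Fin n →₀ ℕ) → ℂ) (hc : ∀ k, ‖c k‖ ≤ C * Q ^ k.degree * k.degree.factorial) :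
    ∃ ψ : Sec h, ∀ k, ((Sec.conn h).deriv k ψ).toFun p = c k := by
  let lin : (Fin n → ℂ) →ₗ[ℂ] MvPolynomial (Fin n) ℂ :=
    { toFun := fun v => ∑ i, v i • X i
      map_add' := fun v w => by simp [add_smul, Finset.sum_add_distrib]
      map_smul' := fun a v => by simp [mul_smul, Finset.smul_sum] }
  let cl : MvPolynomial (Fin n) ℂ →ₗ[ℂ] ℂ := (basisMonomials (Fin n) ℂ).constr ℂ c
  have hcl : ∀ k, cl (monomial k 1) = c k := fun k => by
    have := (basisMonomials (Fin n) ℂ).constr_basis ℂ c k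
    simpa using this
  -- The term of degree d is obtained by expanding the product of the linear forms Σ v_i X_i into
  -- monomials and replacing X^k by c(k), divided by d!. The expansion has n^d terms, whence the
  -- factor n in the condition on the radius.
  let q : (d : ℕ) → MultilinearMap ℂ (fun _ : Fin d => Fin n → ℂ) ℂ := fun d =>
    ((d.factorial : ℂ)⁻¹) • cl.compMultilinearMap
      ((MultilinearMap.mkPiAlgebra ℂ (Fin d) (MvPolynomial (Fin n) ℂ)).compLinearMap fun _ => lin)
  have hq : ∀ d v, q d v = (d.factorial : ℂ)⁻¹ * cl (∏ j, lin (v j)) := fun d v => rfl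
  have hXprod : ∀ d (f : Fin d → Fin n), ∏ j, (X (f j) : MvPolynomial (Fin n) ℂ) =
      monomial (∑ j, Finsupp.single (f j) 1) 1 := by
    intro d f
    simp only [X, MvPolynomial.monomial_sum_one]
  have hdeg : ∀ d (f : Fin d → Fin n), (∑ j, Finsupp.single (f j) 1).degree = d := by
    intro d f; rw [map_sum]; simp
  have hbound : ∀ d (v : Fin d → (Fin n → ℂ)), ‖q d v‖ ≤ C * (n * Q) ^ d * ∏ j, ‖v j‖ := by
    intro d v
    have hfac : (0 : ℝ) < d.factorial := by exact_mod_cast d.factorial_pos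
    have h1 : ∏ j, lin (v j) = ∑ f : Fin d → Fin n, (∏ j, v j (f j)) •
        monomial (∑ j, Finsupp.single (f j) 1) (1 : ℂ) := by
      simp only [lin, LinearMap.coe_mk, AddHom.coe_mk]
      rw [Finset.prod_univ_sum, Fintype.piFinset_univ]
      refine Finset.sum_congr rfl fun f _ => ?_
      rw [← hXprod, Finset.prod_smul]
    rw [hq, h1, map_sum, norm_mul, norm_inv, Complex.norm_natCast, inv_mul_le_iff₀ hfac]
    refine (norm_sum_le _ _).trans ?_
    calc ∑ f : Fin d → Fin n, ‖cl ((∏ j, v j (f j)) • monomial (∑ j, Finsupp.single (f j) 1) 1)‖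
        ≤ ∑ f : Fin d → Fin n, (∏ j, ‖v j‖) * (C * Q ^ d * d.factorial) := by
          refine Finset.sum_le_sum fun f _ => ?_
          rw [map_smul, hcl, norm_smul, norm_prod]
          refine mul_le_mul (Finset.prod_le_prod (fun _ _ => norm_nonneg _)
            fun j _ => norm_le_pi_norm _ _) ?_ (norm_nonneg _)
            (Finset.prod_nonneg fun _ _ => norm_nonneg _)
          have := hc (∑ j, Finsupp.single (f j) 1)
          rwa [hdeg] at this
      _ = d.factorial * (C * (n * Q) ^ d * ∏ j, ‖v j‖) := by
          rw [Finset.sum_const, Finset.card_univ, Fintype.card_fun, Fintype.card_fin,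
            Fintype.card_fin, nsmul_eq_mul, mul_pow]
          push_cast
          ring
  let P : FormalMultilinearSeries ℂ (Fin n → ℂ) ℂ := fun d =>
    (q d).mkContinuous (C * (n * Q) ^ d) (hbound d)
  have hrad : ENNReal.ofReal ρ ≤ P.radius := by
    refine P.le_radius_of_bound C (r := ρ.toNNReal) fun d => ?_
    rw [Real.coe_toNNReal _ hρ.le]
    have h1 := (q d).mkContinuous_norm_le (C := C * (n * Q) ^ d) (by positivity) (hbound d)
    calc ‖P d‖ * ρ ^ d ≤ C * (n * Q) ^ d * ρ ^ d := by gcongr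
      _ = C * (n * Q * ρ) ^ d := by rw [mul_assoc, ← mul_pow]
      _ ≤ C * 1 := by gcongr; exact pow_le_one₀ (by positivity) hQρ
      _ = C := mul_one C
  have hP := (P.hasFPowerSeriesOnBall (lt_of_lt_of_le (by simpa using hρ) hrad)).comp_sub p
  rw [zero_add] at hP
  have hPa : AnalyticOnNhd ℂ (fun z => P.sum (z - p)) (ball p ρ) := by
    refine hP.analyticOnNhd.mono ?_
    intro x hx
    refine lt_of_lt_of_le ?_ hrad
    rw [edist_dist]
    exact (ENNReal.ofReal_lt_ofReal_iff hρ).mpr hx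
  let ψ : Sec h := Sec.mk h _ hPa
  have hp : p ∈ (⟨ball p ρ, isOpen_ball⟩ : Opens (Fin n → ℂ)) := mem_ball_self hρ
  refine ⟨ψ, fun k => ?_⟩
  have hser : HasFPowerSeriesAt ψ.toFun P p := by
    refine hP.hasFPowerSeriesAt.congr ?_
    exact Hol.eventuallyEq_of_eqOn (fun x hx => (Sec.toFun_mk hPa hx).symm) hp
  obtain ⟨r, hr⟩ := hser
  obtain ⟨d, v, rfl⟩ := exists_sum_single k
  rw [← Sec.iteratedFDeriv_eq ψ d v p hp, hr.iteratedFDeriv_eq_sum_of_completeSpace]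
  -- The derivative is a sum over d! permutations with equal terms, which cancels the factor 1/d!.
  have hPd : ∀ σ : Equiv.Perm (Fin d), P d (fun j => Pi.single (v (σ j)) 1) =
      (d.factorial : ℂ)⁻¹ * c (∑ j, Finsupp.single (v j) 1) := by
    intro σ
    change q d _ = _
    rw [hq]
    have : ∀ i, lin (Pi.single i 1) = X i := by
      intro i
      simp only [lin, LinearMap.coe_mk, AddHom.coe_mk]
      rw [Finset.sum_eq_single i] <;> simp +contextual [Pi.single_apply]
    simp only [this]
    rw [Equiv.prod_comp σ fun j => (X (v j) : MvPolynomial (Fin n) ℂ), hXprod, hcl]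
  simp only [hPd]
  rw [Finset.sum_const, Finset.card_univ, Fintype.card_perm, Fintype.card_fin, nsmul_eq_mul,
    ← mul_assoc, mul_inv_cancel₀ (by exact_mod_cast d.factorial_ne_zero), one_mul]

/-- Commuting operators with holomorphic coefficients on `O` and with principal symbols `sᵢ`. -/
structure IsHolonomic {O : Opens (Fin n → ℂ)} (s : Fin n → MvPolynomial (Fin n) ℂ)
    (l : Fin n → MvPolynomial (Fin n) (Hol O)) : Prop where
  homogeneous : ∀ i, (s i).IsHomogeneous (s i).totalDegree
  pos : ∀ i, 0 < (s i).totalDegree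
  finite : Module.Finite (Algebra.adjoin ℂ (Set.range s)) (MvPolynomial (Fin n) ℂ)
  symbol : ∀ i, l i - map (algebraMap ℂ (Hol O)) (s i) ∈ degLT (Hol O) n (s i).totalDegree
  comm : ∀ i j, (symbolConnection Hol.D Hol.D_comm).act (l i) (l j) =
    (symbolConnection Hol.D Hol.D_comm).act (l j) (l i)

/-- The solutions on `U` of the system `lᵢ ψ = λᵢ ψ`. -/
def Sol {O U : Opens (Fin n → ℂ)} (l : Fin n → MvPolynomial (Fin n) (Hol O)) (lam : Fin n → ℂ)
    (h : U ≤ O) : Submodule ℂ (Sec h) where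
  carrier := {ψ | ∀ i, (Sec.conn h).act ψ (l i) = lam i • ψ}
  zero_mem' i := by
    have := (Sec.conn h).act_smul_left 0 0 (l i)
    simpa using this
  add_mem' hf hg i := by rw [Connection.act_add_left, hf i, hg i, smul_add]
  smul_mem' a f hf i := by rw [Connection.act_smul_left, hf i, smul_comm]

section

variable {O : Opens (Fin n → ℂ)} {s : Fin n → MvPolynomial (Fin n) ℂ}
  {l : Fin n → MvPolynomial (Fin n) (Hol O)} {κ : Type} [Fintype κ] [DecidableEq κ]
  {e : κ → Fin n →₀ ℕ}

/-- All derivatives of solutions are combinations of those of a finite set. -/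
theorem IsHolonomic.exists_act_eq (hS : IsHolonomic s l) (he : IsQuotBasis s e)
    (lam : Fin n → ℂ) (m : MvPolynomial (Fin n) (Hol O)) :
    ∃ c : κ → Hol O, ∀ {U : Opens (Fin n → ℂ)} (h : U ≤ O), ∀ ψ ∈ Sol l lam h,
      (Sec.conn h).act ψ m = ∑ j, c j • (Sec.conn h).deriv (e j) ψ := by
  obtain ⟨π, -, -, -, h4⟩ := exists_reduction Hol.D_comm he hS.homogeneous hS.pos hS.finite
    hS.symbol hS.comm lam
  refine ⟨π m, fun {U} h ψ hψ => ?_⟩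
  -- Operators in the left ideal generated by the l_i - λ_i annihilate every solution.
  have h5 : ∀ g ∈ Submodule.span (Hol O)
      {g | ∃ i h, g = (symbolConnection (Hol.D (U := O)) Hol.D_comm).act (l i) h - lam i • h},
      (Sec.conn h).act ψ g = 0 := by
    intro g hg
    rw [← LinearMap.mem_ker]
    refine Submodule.span_le.mpr ?_ hg
    rintro _ ⟨i, f, rfl⟩
    have h6 : (Sec.conn h).act ψ (lam i • f) = lam i • (Sec.conn h).act ψ f := by
      rw [← algebraMap_smul (Hol O) (lam i) f, map_smul, algebraMap_smul]
    rw [SetLike.mem_coe, LinearMap.mem_ker, map_sub, ← act_act, hψ i, h6,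
      Connection.act_smul_left, sub_self]
  have h7 := h5 _ (h4 m)
  rw [map_sub, sub_eq_zero, map_sum] at h7
  rw [h7]
  refine Finset.sum_congr rfl fun j _ => ?_
  rw [map_smul, Connection.act_monomial, one_smul]

/-- Each derivative at p is a combination of the ∂^{e_j}ψ(p), so the whole Taylor series vanishes.
-/
theorem IsHolonomic.eq_zero_of_deriv (hS : IsHolonomic s l) (he : IsQuotBasis s e)
    {lam : Fin n → ℂ} {U : Opens (Fin n → ℂ)} {h : U ≤ O}
    (hU : IsPreconnected (U : Set (Fin n → ℂ))) {ψ : Sec h} (hψ : ψ ∈ Sol l lam h)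
    {p : Fin n → ℂ} (hp : p ∈ U) (h0 : ∀ j, ((Sec.conn h).deriv (e j) ψ).toFun p = 0) : ψ = 0 := by
  refine Sec.eq_zero_of_deriv_eq_zero hU hp fun k => ?_
  obtain ⟨c, hc⟩ := hS.exists_act_eq he lam (monomial k 1)
  have := hc h ψ hψ
  rw [Connection.act_monomial, one_smul] at this
  rw [this, Sec.toFun_sum _ _ hp]
  exact Finset.sum_eq_zero fun j _ => by rw [Sec.toFun_hol_smul _ _ hp, h0, mul_zero]

theorem exists_bound_closedBall {ι : Type*} [Finite ι] {F : ι → (Fin n → ℂ) → ℂ}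
    {p : Fin n → ℂ} {R : ℝ} (hF : ∀ i, ContinuousOn (F i) (closedBall p R)) :
    ∃ C, 0 ≤ C ∧ ∀ i, ∀ x ∈ closedBall p R, ‖F i x‖ ≤ C := by
  have := Fintype.ofFinite ι
  choose C hC using fun i => (isCompact_closedBall p R).exists_bound_of_continuousOn (hF i)
  refine ⟨∑ i, |C i|, Finset.sum_nonneg fun _ _ => abs_nonneg _, fun i x hx => ?_⟩
  exact (hC i x hx).trans ((le_abs_self _).trans
    (Finset.single_le_sum (f := fun i => |C i|) (fun _ _ => abs_nonneg _) (Finset.mem_univ i)))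

/-- Solutions with prescribed initial values exist in a ball. -/
theorem IsHolonomic.exists_solution (hS : IsHolonomic s l) (he : IsQuotBasis s e)
    (lam : Fin n → ℂ) {p : Fin n → ℂ} (hp : p ∈ O) :
    ∃ ρ₀ > 0, ∀ ρ, 0 < ρ → ρ ≤ ρ₀ → ∃ (h : (⟨ball p ρ, isOpen_ball⟩ : Opens (Fin n → ℂ)) ≤ O),
      ∀ v : κ → ℂ, ∃ ψ ∈ Sol l lam h, ∀ j, ((Sec.conn h).deriv (e j) ψ).toFun p = v j := by
  obtain ⟨π, h1, h2, h3, -⟩ := exists_reduction Hol.D_comm he hS.homogeneous hS.pos hS.finite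
    hS.symbol hS.comm lam
  obtain ⟨R, hR, hRO⟩ := Metric.nhds_basis_closedBall.mem_iff.mp (O.isOpen.mem_nhds hp)
  have hbO : ball p R ⊆ O := ball_subset_closedBall.trans hRO
  let a : (Fin n →₀ ℕ) → κ → (Fin n → ℂ) → ℂ := fun k j => (π (monomial k 1) j).toFun
  let γ : Fin n → κ → κ → (Fin n → ℂ) → ℂ := fun i j k =>
    (π ((symbolConnection Hol.D Hol.D_comm).nabla i (monomial (e k) 1)) j).toFun
  obtain ⟨C₀, hC₀, hb0⟩ := exists_bound_closedBall (F := fun j => a 0 j) (p := p) (R := R)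
    fun j => ((π (monomial 0 1) j).analyticOnNhd.mono hRO).continuousOn
  obtain ⟨C₁, hC₁, hb1⟩ := exists_bound_closedBall (F := fun t : Fin n × κ × κ => γ t.1 t.2.1 t.2.2)
    (p := p) (R := R) fun t => ((π _ _).analyticOnNhd.mono hRO).continuousOn
  have hb := norm_iterate_le (p := p) hR hC₀ (C₁ := Fintype.card κ * C₁) (by positivity) (a := a)
    (γ := γ)
    (fun k j => (π _ j).analyticOnNhd.mono hbO)
    (fun k i j x hx => by
      have hxO := hbO hx
      have e1 : monomial (k + Finsupp.single i 1) (1 : Hol O) =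
        (symbolConnection (Hol.D (U := O)) Hol.D_comm).nabla i (monomial k 1) := by
        rw [symbol_nabla_monomial]; simp
      simp only [a]
      rw [e1, h3, Hol.toFun_add _ _ hxO, Hol.toFun_D _ _ hxO, Hol.toFun_sum _ _ hxO]
      congr 1
      exact Finset.sum_congr rfl fun j' _ => Hol.toFun_mul _ _ hxO)
    (fun i j x hx => by
      refine (Finset.sum_le_card_nsmul _ _ C₁ fun j' _ =>
        hb1 (i, j, j') x (ball_subset_closedBall hx)).trans ?_
      rw [nsmul_eq_mul, Finset.card_univ])
    (fun j x hx => hb0 j x (ball_subset_closedBall hx))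
  set B := 1 + Fintype.card κ * C₁ * R with hB
  have hB0 : 0 < B := by positivity
  set Q : ℝ := B * Real.exp 1 / R with hQ
  have hQ0 : 0 < Q := by positivity
  have hbp : ∀ k j, ‖a k j p‖ ≤ C₀ * Real.exp 1 * Q ^ k.degree * k.degree.factorial := by
    intro k j
    refine (hb k j p (mem_ball_self hR)).trans ?_
    set d := k.degree
    have hfac : (0 : ℝ) < d.factorial := by exact_mod_cast d.factorial_pos
    -- The Cauchy estimates grow like (d+1)^d ≤ e^{d+1} d!, which is a geometric growth of Taylor
    -- coefficients.
    have h5 := Real.pow_div_factorial_le_exp ((d : ℝ) + 1) (by positivity) d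
    rw [div_le_iff₀ hfac] at h5
    rw [dist_self, sub_zero]
    calc C₀ * (B * (d + 1) / R) ^ d = C₀ * (B / R) ^ d * ((d : ℝ) + 1) ^ d := by
          rw [mul_assoc, ← mul_pow]; congr 2; ring
      _ ≤ C₀ * (B / R) ^ d * (Real.exp (d + 1) * d.factorial) := by gcongr
      _ = C₀ * Real.exp 1 * Q ^ d * d.factorial := by
          rw [hQ, Real.exp_add, show (d : ℝ) = d * 1 by ring, Real.exp_nat_mul, mul_div_right_comm,
            mul_pow]
          ring_nf
  refine ⟨min (R / 2) (1 / (n * Q + 1)), by positivity, fun ρ hρ hρ' => ?_⟩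
  have hρR : ρ ≤ R := by linarith [hρ'.trans (min_le_left _ _)]
  have hQρ : n * Q * ρ ≤ 1 := by
    have h6 : ρ ≤ 1 / (n * Q + 1) := hρ'.trans (min_le_right _ _)
    have h7 : 0 < n * Q + 1 := by positivity
    rw [le_div_iff₀ h7] at h6
    linarith
  have h : (⟨ball p ρ, isOpen_ball⟩ : Opens (Fin n → ℂ)) ≤ O :=
    fun x hx => hbO (ball_subset_ball hρR hx)
  refine ⟨h, fun v => ?_⟩
  -- The Taylor coefficients are forced: modulo the system ∂^k equals Σ_j π(∂^k)_j ∂^{e_j}.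
  obtain ⟨ψ, hψ⟩ := exists_taylor hρ hQ0.le (C := C₀ * Real.exp 1 * ∑ j, ‖v j‖) (by positivity)
    hQρ h (fun k => ∑ j, a k j p * v j) fun k => by
      refine (norm_sum_le _ _).trans ?_
      calc ∑ j, ‖a k j p * v j‖ ≤ ∑ j, C₀ * Real.exp 1 * Q ^ k.degree * k.degree.factorial * ‖v j‖ := by
            refine Finset.sum_le_sum fun j _ => ?_
            rw [norm_mul]
            exact mul_le_mul_of_nonneg_right (hbp k j) (norm_nonneg _)
        _ = _ := by rw [← Finset.mul_sum]; ring
  have hpU : p ∈ (⟨ball p ρ, isOpen_ball⟩ : Opens (Fin n → ℂ)) := mem_ball_self hρ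
  have hact : ∀ m, ((Sec.conn h).act ψ m).toFun p = ∑ j, (π m j).toFun p * v j := by
    intro m
    induction m using MvPolynomial.induction_on' with
    | monomial k b =>
      have e1 : monomial k b = b • monomial k (1 : Hol O) := by
        rw [smul_monomial, smul_eq_mul, mul_one]
      rw [Connection.act_monomial, Sec.toFun_hol_smul _ _ hpU, hψ, e1, map_smul, Finset.mul_sum]
      refine Finset.sum_congr rfl fun j _ => ?_
      rw [Pi.smul_apply, smul_eq_mul, Hol.toFun_mul _ _ hp, mul_assoc]
    | add q r hq hr =>
      rw [map_add, Sec.toFun_add _ _ hpU, hq, hr, map_add, ← Finset.sum_add_distrib]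
      refine Finset.sum_congr rfl fun j _ => ?_
      rw [Pi.add_apply, Hol.toFun_add _ _ hp, add_mul]
  refine ⟨ψ, fun i => ?_, fun j => ?_⟩
  -- The derivative ∂^k of (l_i - λ_i)ψ at p is a value of π on ∂^k l_i - λ_i ∂^k, hence zero for
  -- all k, and the identity theorem applies in the ball.
  · rw [← sub_eq_zero]
    refine Sec.eq_zero_of_deriv_eq_zero (convex_ball p ρ).isPreconnected hpU fun k => ?_
    have e1 : (Sec.conn h).deriv k ((Sec.conn h).act ψ (l i) - lam i • ψ) =
        (Sec.conn h).act ψ ((symbolConnection Hol.D Hol.D_comm).act (l i) (monomial k 1)) +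
        (-lam i) • (Sec.conn h).deriv k ψ := by
      rw [Connection.act_monomial, one_smul, act_deriv, sub_eq_add_neg, ← neg_smul,
        Connection.deriv_add, Connection.deriv_smul]
    rw [e1, Sec.toFun_add _ _ hpU, Sec.toFun_smul _ _ hpU, hact, hψ, h2, Finset.mul_sum,
      ← Finset.sum_add_distrib]
    refine Finset.sum_eq_zero fun j _ => ?_
    rw [Pi.smul_apply, Hol.toFun_smul _ _ hp]
    ring
  · rw [hψ, Finset.sum_eq_single j]
    · simp only [a]
      rw [h1, Pi.single_eq_same, Hol.toFun_one hp, one_mul]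
    · intro j' _ hj
      simp only [a]
      rw [h1, Pi.single_eq_of_ne hj, Hol.toFun_zero, zero_mul]
    · simp

end

end SeveralComplex
end

noncomputable section

/-! ### Commutation relations between symbols -/

namespace SymbolCalculus

open MvPolynomial

variable {n : ℕ} {K K' : Type*} [CommRing K] [Algebra ℂ K] [CommRing K'] [Algebra ℂ K']
  {D : Fin n → Derivation ℂ K K} {D' : Fin n → Derivation ℂ K' K'}
  (hD : ∀ i j a, D i (D j a) = D j (D i a)) (hD' : ∀ i j a, D' i (D' j a) = D' j (D' i a))
  (g : K →ₐ[ℂ] K')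

theorem map_coeffMap (hg : ∀ i a, g (D i a) = D' i (g a)) (i : Fin n) (f : MvPolynomial (Fin n) K) :
    map g.toRingHom (coeffMap (D i).toLinearMap f) =
      coeffMap (D' i).toLinearMap (map g.toRingHom f) := by
  ext k; simpa [coeff_map] using hg i _

theorem map_symbol_deriv (hg : ∀ i a, g (D i a) = D' i (g a)) (k : Fin n →₀ ℕ)
    (f : MvPolynomial (Fin n) K) :
    map g.toRingHom ((symbolConnection D hD).deriv k f) =
      (symbolConnection D' hD').deriv k (map g.toRingHom f) := by
  induction k using exponent_induction with
  | zero => simp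
  | step k i ih =>
    rw [Connection.deriv_add_single, Connection.deriv_add_single, ← ih, symbol_nabla, symbol_nabla,
      map_add, map_coeffMap g hg, map_mul, map_X]

theorem map_symbol_act (hg : ∀ i a, g (D i a) = D' i (g a)) (l f : MvPolynomial (Fin n) K) :
    map g.toRingHom ((symbolConnection D hD).act l f) =
      (symbolConnection D' hD').act (map g.toRingHom l) (map g.toRingHom f) := by
  induction f using MvPolynomial.induction_on' with
  | monomial k a =>
    rw [Connection.act_monomial, map_monomial, Connection.act_monomial,
      ← map_symbol_deriv hD hD' g hg, smul_eq_C_mul, map_mul, map_C, smul_eq_C_mul]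
  | add p q hp hq => simp only [map_add, hp, hq]

/-- The symbol of `[f, -Δ + u]` up to the terms containing `∂f`. -/
def commDefect (u : K) (f : MvPolynomial (Fin n) K) : MvPolynomial (Fin n) K :=
  (C u * f - (symbolConnection D hD).act (C u) f) -
    ∑ j, coeffMap (D j).toLinearMap (coeffMap (D j).toLinearMap f)

theorem commDefect_sub (u : K) (f f' : MvPolynomial (Fin n) K) :
    commDefect hD u (f - f') = commDefect hD u f - commDefect hD u f' := by
  simp only [commDefect, map_sub, mul_sub, Finset.sum_sub_distrib]; ring

theorem map_commDefect (hg : ∀ i a, g (D i a) = D' i (g a)) (u : K) (f : MvPolynomial (Fin n) K) :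
    map g.toRingHom (commDefect hD u f) = commDefect hD' (g u) (map g.toRingHom f) := by
  simp only [commDefect, map_sub, map_mul, map_C, map_symbol_act hD hD' g hg, map_sum,
    map_coeffMap g hg]
  rfl

theorem coeffMap_mem_degLT {d : ℕ} {f : MvPolynomial (Fin n) K} (hf : f ∈ degLT K n d)
    (δ : K →ₗ[ℂ] K) : coeffMap δ f ∈ degLT K n d := fun k hk => by simp [hf k hk]

/-- The defect does not raise the order. Its component of degree r + 1 therefore depends only on the
components of f of degree greater than r, which is what permits downward induction on the degree. -/
theorem commDefect_mem_degLT (u : K) {d : ℕ} {f : MvPolynomial (Fin n) K}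
    (hf : f ∈ degLT K n (d + 1)) : commDefect hD u f ∈ degLT K n (d + 1) := by
  refine sub_mem ?_ (sum_mem fun j _ => coeffMap_mem_degLT (coeffMap_mem_degLT hf _) _)
  have h1 : (C u : MvPolynomial (Fin n) K) ∈ degLT K n (0 + 1) := monomial_mem_degLT (by simp) u
  have h2 := symbol_act_sub_mem hD (c := 0) (d := d) (l := C u) h1 (by simp) hf
  rw [← neg_sub]
  exact neg_mem (degLT_mono (by omega) h2)

/-- The commutation relation with `-Δ + u`. -/
theorem two_mul_sum_X_mul_coeffMap (u : K) (f : MvPolynomial (Fin n) K)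
    (h : (symbolConnection D hD).act (-(∑ j, X j ^ 2) + C u) f =
      (symbolConnection D hD).act f (-(∑ j, X j ^ 2) + C u)) :
    2 * ∑ j, X j * coeffMap (D j).toLinearMap f = commDefect hD u f := by
  have hX : ∀ (j : Fin n) (x : MvPolynomial (Fin n) K), (symbolConnection D hD).act x (X j ^ 2) =
      (symbolConnection D hD).nabla j ((symbolConnection D hD).nabla j x) := by
    intro j x
    have e : (X j ^ 2 : MvPolynomial (Fin n) K) =
        monomial (0 + Finsupp.single j 1 + Finsupp.single j 1) 1 := by
      rw [X_pow_eq_monomial]; congr 1; rw [zero_add, ← Finsupp.single_add]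
    rw [e, Connection.act_monomial, one_smul, Connection.deriv_add_single,
      Connection.deriv_add_single, Connection.deriv_zero]
  have hC : ∀ x : MvPolynomial (Fin n) K, (symbolConnection D hD).act x (C u) = C u * x := by
    intro x
    rw [C_apply, Connection.act_monomial, Connection.deriv_zero, smul_eq_C_mul, C_apply]
  have hL : (symbolConnection D hD).act (-(∑ j, X j ^ 2) + C u) f =
      -(∑ j, X j ^ 2) * f + (symbolConnection D hD).act (C u) f := by
    rw [Connection.act_add_left]
    congr 1
    -- constant coefficients act by multiplication
    have : (symbolConnection D hD).act (-(∑ j, X j ^ 2)) =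
        LinearMap.mulLeft K (-(∑ j, X j ^ 2) : MvPolynomial (Fin n) K) := by
      refine linearMap_ext_of_nabla hD (symbolConnection D hD)
        (fun i f => act_nabla hD _ _ i f) (fun i f => ?_) (by simp)
      simp only [LinearMap.mulLeft_apply, symbol_nabla]
      have : ∀ q : MvPolynomial (Fin n) K, coeffMap (D i).toLinearMap (-(∑ j, X j ^ 2) * q) =
          -(∑ j, X j ^ 2) * coeffMap (D i).toLinearMap q := by
        intro q
        simp only [neg_mul, Finset.sum_mul, map_neg, map_sum, pow_two, mul_assoc, coeffMap_X_mul]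
      rw [this]; ring
    rw [this, LinearMap.mulLeft_apply]
  -- Composing f with ∂_j² on the left gives X_j² f plus terms with differentiated coefficients. The
  -- X_j² f cancel in the commutator.
  have hn : ∀ j, (symbolConnection D hD).nabla j ((symbolConnection D hD).nabla j f) =
      coeffMap (D j).toLinearMap (coeffMap (D j).toLinearMap f) +
        2 * (X j * coeffMap (D j).toLinearMap f) + X j ^ 2 * f := by
    intro j
    simp only [symbol_nabla, map_add, coeffMap_X_mul]
    ring
  rw [hL, map_add, map_neg, map_sum, hC] at h
  simp only [hX, hn, Finset.sum_add_distrib, ← Finset.mul_sum, ← Finset.sum_mul] at h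
  rw [commDefect]
  linear_combination h

/-- Evaluation of symbols at a constant covector. -/
def evalAt (ξ : Fin n → ℂ) : MvPolynomial (Fin n) K →ₐ[K] K := aeval fun i => algebraMap ℂ K (ξ i)

theorem evalAt_monomial (ξ : Fin n → ℂ) (k : Fin n →₀ ℕ) (a : K) :
    evalAt ξ (monomial k a) = a * algebraMap ℂ K (∏ i, ξ i ^ k i) := by
  rw [evalAt, aeval_monomial, Finsupp.prod_fintype _ _ (by simp)]
  simp [map_prod]

theorem evalAt_coeffMap (i : Fin n) (ξ : Fin n → ℂ) (f : MvPolynomial (Fin n) K) :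
    evalAt ξ (coeffMap (D i).toLinearMap f) = D i (evalAt ξ f) := by
  induction f using MvPolynomial.induction_on' with
  | monomial k a =>
    classical
    have : coeffMap (D i).toLinearMap (monomial k a) = monomial k (D i a) := by
      ext l; simp only [coeff_coeffMap, coeff_monomial]; split_ifs <;> simp
    rw [this, evalAt_monomial, evalAt_monomial, Derivation.leibniz, Derivation.map_algebraMap,
      smul_zero, zero_add, smul_eq_mul, mul_comm]
  | add p q hp hq => simp only [map_add, hp, hq]

theorem map_evalAt (ξ : Fin n → ℂ) (f : MvPolynomial (Fin n) K) :
    g (evalAt ξ f) = evalAt ξ (map g.toRingHom f) := by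
  induction f using MvPolynomial.induction_on' with
  | monomial k a => rw [map_monomial, evalAt_monomial, evalAt_monomial, map_mul, g.commutes]; rfl
  | add p q hp hq => simp only [map_add, hp, hq]

theorem homogeneousComponent_X_mul (r : ℕ) (j : Fin n) (f : MvPolynomial (Fin n) K) :
    homogeneousComponent (r + 1) (X j * f) = X j * homogeneousComponent r f := by
  ext k
  simp only [coeff_homogeneousComponent, coeff_X_mul']
  by_cases hj : j ∈ k.support
  · have h1 : (k - Finsupp.single j 1).degree + 1 = k.degree := by
      have h2 : k - Finsupp.single j 1 + Finsupp.single j 1 = k :=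
        tsub_add_cancel_of_le (by simpa [Nat.one_le_iff_ne_zero] using hj)
      conv_rhs => rw [← h2]
      simp
    simp only [hj, if_true]
    by_cases h3 : k.degree = r + 1
    · rw [if_pos h3, if_pos (by omega)]
    · rw [if_neg h3, if_neg (by omega)]
  · simp [hj]

theorem homogeneousComponent_coeffMap (r : ℕ) (δ : K →ₗ[ℂ] K) (f : MvPolynomial (Fin n) K) :
    homogeneousComponent r (coeffMap δ f) = coeffMap δ (homogeneousComponent r f) := by
  ext k
  simp only [coeff_homogeneousComponent, coeff_coeffMap]
  split_ifs <;> simp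

theorem homogeneousComponent_eq_zero_of_mem {r : ℕ} {f : MvPolynomial (Fin n) K}
    (hf : f ∈ degLT K n r) : homogeneousComponent r f = 0 := by
  ext k
  rw [coeff_homogeneousComponent]
  split_ifs with h
  · rw [hf k h.ge, coeff_zero]
  · simp

theorem homogeneousComponent_congr {r : ℕ} {f f' : MvPolynomial (Fin n) K}
    (h : f - f' ∈ degLT K n r) : homogeneousComponent r f = homogeneousComponent r f' := by
  rw [← sub_eq_zero, ← map_sub, homogeneousComponent_eq_zero_of_mem h]

/-- The directional derivative of a homogeneous part of the symbol. -/
theorem two_mul_sum_D_evalAt (u : K) (f : MvPolynomial (Fin n) K)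
    (h : (symbolConnection D hD).act (-(∑ j, X j ^ 2) + C u) f =
      (symbolConnection D hD).act f (-(∑ j, X j ^ 2) + C u)) (r : ℕ) (ξ : Fin n → ℂ) :
    2 * ∑ j, algebraMap ℂ K (ξ j) * D j (evalAt ξ (homogeneousComponent r f)) =
      evalAt ξ (homogeneousComponent (r + 1) (commDefect hD u f)) := by
  rw [← two_mul_sum_X_mul_coeffMap hD u f h]
  have e2 : (2 : MvPolynomial (Fin n) K) = C 2 := (map_ofNat C 2).symm
  rw [e2, homogeneousComponent_C_mul, map_sum, map_mul, map_sum]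
  congr 1
  · rw [← algebraMap_eq, AlgHom.commutes]; simp
  refine Finset.sum_congr rfl fun j _ => ?_
  rw [homogeneousComponent_X_mul, homogeneousComponent_coeffMap, map_mul, evalAt_coeffMap]
  simp [evalAt]

end SymbolCalculus

/-! ### Differential operators and their symbols -/

namespace SeveralComplex

open Set Metric Filter TopologicalSpace LameOperators SymbolCalculus MvPolynomial

variable {n : ℕ} {O : Opens (Fin n → ℂ)}

theorem exists_symbol (P : DiffOp n) (hP : ∀ x ∈ O, P.RegularAt x) :
    ∃ l : MvPolynomial (Fin n) (Hol O), ∀ k, ∀ x ∈ O, (l.coeff k).toFun x = P.coeff k x := by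
  classical
  refine ⟨∑ k ∈ P.support, monomial k (Hol.mk (P.coeff k) fun x hx => hP x hx k),
    fun k x hx => ?_⟩
  rw [coeff_sum]
  simp only [coeff_monomial, Finset.sum_ite_eq']
  split_ifs with h
  · exact Hol.toFun_mk _ hx
  · rw [notMem_support_iff.mp h, Hol.toFun_zero, Pi.zero_apply]

/-- A symbol represents a differential operator on `O`. -/
def Represents (l : MvPolynomial (Fin n) (Hol O)) (P : DiffOp n) : Prop :=
  ∀ k, ∀ x ∈ O, (l.coeff k).toFun x = P.coeff k x

theorem Sec.toFun_act_eq_apply {l : MvPolynomial (Fin n) (Hol O)} {P : DiffOp n}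
    {U : Opens (Fin n → ℂ)} {h : U ≤ O} {ψ : Sec h} {F : (Fin n → ℂ) → ℂ}
    (hF : ∀ x ∈ U, ψ.toFun x = F x) {x : Fin n → ℂ} (hx : x ∈ U)
    (hl : ∀ k, (l.coeff k).toFun x = P.coeff k x) :
    ((Sec.conn h).act ψ l).toFun x = P.apply F x := by
  classical
  rw [Sec.toFun_act _ _ hx, DiffOp.apply]
  have h1 : ∀ k, partialDeriv k ψ.toFun x = partialDeriv k F x := fun k => by
    rw [← Sec.toFun_deriv k ψ hx, Sec.toFun_deriv_of_eqOn k hF x hx]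
  have h2 : ∑ k ∈ l.support, (l.coeff k).toFun x * partialDeriv k ψ.toFun x =
      ∑ k ∈ l.support ∪ P.support, P.coeff k x * partialDeriv k F x := by
    refine (Finset.sum_congr rfl fun k _ => ?_).trans
      (Finset.sum_subset Finset.subset_union_left fun k _ hk => ?_)
    · rw [h1, hl k]
    · rw [← hl k, notMem_support_iff.mp hk, Hol.toFun_zero, zero_mul]
  rw [h2]
  refine (Finset.sum_subset Finset.subset_union_right fun k _ hk => ?_).symm
  rw [notMem_support_iff.mp hk, Pi.zero_apply, zero_mul]

theorem Represents.toFun_act {l : MvPolynomial (Fin n) (Hol O)} {P : DiffOp n}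
    (hl : Represents l P) {U : Opens (Fin n → ℂ)} {h : U ≤ O} {ψ : Sec h} {F : (Fin n → ℂ) → ℂ}
    (hF : ∀ x ∈ U, ψ.toFun x = F x) {x : Fin n → ℂ} (hx : x ∈ U) :
    ((Sec.conn h).act ψ l).toFun x = P.apply F x :=
  Sec.toFun_act_eq_apply hF hx fun k => hl k x (h hx)

/-- A symbol that annihilates all holomorphic functions is zero. -/
theorem eq_zero_of_act_eq_zero {m : MvPolynomial (Fin n) (Hol O)}
    (hm : ∀ ψ : Sec (le_refl O), (Sec.conn le_rfl).act ψ m = 0) : m = 0 := by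
  refine MvPolynomial.ext _ _ fun k => Hol.ext_toFun fun x hx => ?_
  rw [coeff_zero, Hol.toFun_zero]
  let q : MvPolynomial (Fin n) ℂ := ∑ k ∈ m.support, monomial k ((m.coeff k).toFun x)
  have hq : q = 0 := by
    refine MvPolynomial.funext fun ξ => ?_
    let ℓ : (Fin n → ℂ) →L[ℂ] ℂ := ∑ i, ξ i • ContinuousLinearMap.proj i
    have hℓ : ∀ i, ℓ (Pi.single i 1) = ξ i := fun i => by
      simp [ℓ, Pi.single_apply]
    -- An operator applied to an exponential e^{ξ·y} multiplies it by its symbol at ξ, so the symbol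
    -- at x vanishes as a polynomial in ξ.
    let F : (Fin n → ℂ) → ℂ := fun y => Complex.exp (ℓ y)
    have hF : AnalyticOnNhd ℂ F O := fun y _ => (ℓ.analyticAt y).cexp
    have hpd : ∀ i y, pderivFun i F y = ξ i * F y := by
      intro i y
      have : HasFDerivAt F (Complex.exp (ℓ y) • ℓ) y := (ℓ.hasFDerivAt).cexp
      simp only [pderivFun, this.fderiv, ContinuousLinearMap.smul_apply, hℓ, F, smul_eq_mul,
        mul_comm]
    have hd : ∀ k : Fin n →₀ ℕ, ∀ y ∈ O, ((Sec.conn le_rfl).deriv k (Sec.mk (le_refl O) F hF)).toFun y =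
        (∏ i, ξ i ^ k i) * F y := by
      intro k
      induction k using exponent_induction with
      | zero => intro y hy; rw [Connection.deriv_zero, Sec.toFun_mk hF hy]; simp
      | step k i ih =>
        intro y hy
        rw [Connection.deriv_add_single, Sec.toFun_nabla _ _ hy,
          Hol.pderivFun_eqOn i (g := (∏ i, ξ i ^ k i) • F) ih y hy, prod_pow_add_single]
        have : pderivFun i ((∏ i, ξ i ^ k i) • F) y = (∏ i, ξ i ^ k i) * pderivFun i F y := by
          simp only [pderivFun]
          rw [fderiv_const_smul (hF y hy).differentiableAt]; rfl
        rw [this, hpd]; ring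
    have h1 := congrArg (fun f : Sec (le_refl O) => f.toFun x) (hm (Sec.mk le_rfl F hF))
    simp only [Connection.act_eq_sum, Sec.toFun_sum _ _ hx, Sec.toFun_hol_smul _ _ hx, hd _ x hx,
      Sec.toFun_zero, ← mul_assoc, ← Finset.sum_mul] at h1
    have h2 := (mul_eq_zero.mp h1).resolve_right (Complex.exp_ne_zero _)
    simp only [q, map_sum, eval_monomial, map_zero]
    rw [← h2]
    refine Finset.sum_congr rfl fun k _ => ?_
    rw [Finsupp.prod_fintype _ _ (by simp)]
  classical
  have h3 := congrArg (coeff k) hq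
  rw [coeff_sum] at h3
  simp only [coeff_monomial, Finset.sum_ite_eq', coeff_zero] at h3
  split_ifs at h3 with h
  · exact h3
  · rw [notMem_support_iff.mp h, Hol.toFun_zero]

theorem Represents.comm {l l' : MvPolynomial (Fin n) (Hol O)} {P P' : DiffOp n}
    (hl : Represents l P) (hl' : Represents l' P') (hP : ∀ x ∈ O, P.RegularAt x)
    (hP' : ∀ x ∈ O, P'.RegularAt x) (hc : P.Commutes P') :
    (symbolConnection Hol.D Hol.D_comm).act l l' =
      (symbolConnection Hol.D Hol.D_comm).act l' l := by
  rw [← sub_eq_zero]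
  refine eq_zero_of_act_eq_zero fun ψ => ?_
  rw [map_sub, ← act_act, ← act_act, sub_eq_zero]
  refine Sec.ext_toFun fun x hx => ?_
  rw [hl'.toFun_act (F := P.apply ψ.toFun) (fun y hy => hl.toFun_act (fun _ _ => rfl) hy) hx,
    hl.toFun_act (F := P'.apply ψ.toFun) (fun y hy => hl'.toFun_act (fun _ _ => rfl) hy) hx]
  exact (hc x (hP x hx) (hP' x hx) ψ.toFun (ψ.analyticOnNhd x hx)).symm

end SeveralComplex
end

noncomputable section

/-! ### Extension of meromorphic functions with holomorphic directional derivatives -/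

namespace SeveralComplex

open Set Metric Filter LameOperators MvPolynomial

variable {n : ℕ}

/-- A linear functional on Q/S turns the hypothesis into a polynomial in ξ that vanishes on an open
set. Information on P_r(·, ξ) for ξ in an open set thus passes to each coefficient; S will consist
of functions that extend holomorphically, or of functions with bounded pole order. -/
theorem mem_of_forall_sum_smul_mem {Q : Type*} [AddCommGroup Q] [Module ℂ Q] (S : Submodule ℂ Q)
    (I : Finset (Fin n →₀ ℕ)) (q : (Fin n →₀ ℕ) → Q) {V : Set (Fin n → ℂ)} (hV : IsOpen V)
    (hne : V.Nonempty) (h : ∀ ξ ∈ V, ∑ k ∈ I, (∏ i, ξ i ^ k i) • q k ∈ S) :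
    ∀ k ∈ I, q k ∈ S := by
  classical
  intro k hk
  rw [← Submodule.Quotient.mk_eq_zero, ← Module.forall_dual_apply_eq_zero_iff ℂ]
  intro φ
  let p : MvPolynomial (Fin n) ℂ := ∑ k ∈ I, monomial k (φ (Submodule.Quotient.mk (q k)))
  obtain ⟨ξ₀, hξ₀⟩ := hne
  obtain ⟨ε, hε, hb⟩ := Metric.isOpen_iff.mp hV ξ₀ hξ₀
  have hp : p = 0 := by
    refine MvPolynomial.funext_set (fun i => ball (ξ₀ i) ε)
      (fun i => infinite_of_mem_nhds _ (ball_mem_nhds _ hε)) fun ξ hξ => ?_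
    rw [← ball_pi _ hε] at hξ
    have h1 := h ξ (hb hξ)
    rw [← Submodule.Quotient.mk_eq_zero] at h1
    have h2 := congrArg φ h1
    rw [map_zero, ← Submodule.mkQ_apply, map_sum, map_sum] at h2
    simp only [map_smul, smul_eq_mul, Submodule.mkQ_apply] at h2
    rw [map_zero, ← h2]
    simp only [p, map_sum, eval_monomial]
    refine Finset.sum_congr rfl fun k _ => ?_
    rw [Finsupp.prod_fintype _ _ (by simp), mul_comm]
  have h3 := congrArg (coeff k) hp
  simp only [p, coeff_sum, coeff_monomial, Finset.sum_ite_eq', hk, if_true, coeff_zero] at h3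
  exact h3

theorem frequently_ne_zero_of_mem_ball {h : (Fin n → ℂ) → ℂ} {x₀ : Fin n → ℂ} {R : ℝ}
    (hR : 0 < R) (hh : AnalyticOnNhd ℂ h (ball x₀ R)) (hne : ∃ᶠ y in 𝓝 x₀, h y ≠ 0)
    {x : Fin n → ℂ} (hx : x ∈ ball x₀ R) : ∃ᶠ y in 𝓝 x, h y ≠ 0 := by
  intro hx0
  refine hne ?_
  have := hh.eqOn_zero_of_preconnected_of_eventuallyEq_zero (convex_ball x₀ R).isPreconnected hx
    (by filter_upwards [hx0] with y hy using not_not.mp hy)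
  filter_upwards [ball_mem_nhds x₀ hR] with y hy
  exact not_not.mpr (this hy)

theorem frequently_mul_ne_zero {f g : (Fin n → ℂ) → ℂ} {x : Fin n → ℂ} (hf : AnalyticAt ℂ f x)
    (hg : AnalyticAt ℂ g x) (hf0 : ∃ᶠ y in 𝓝 x, f y ≠ 0) (hg0 : ∃ᶠ y in 𝓝 x, g y ≠ 0) :
    ∃ᶠ y in 𝓝 x, f y * g y ≠ 0 := by
  obtain ⟨R, hR, hb⟩ := Metric.eventually_nhds_iff_ball.mp
    (hf.eventually_analyticAt.and hg.eventually_analyticAt)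
  rw [Filter.frequently_iff]
  intro U hU
  obtain ⟨V, hVU, hV, hxV⟩ := _root_.mem_nhds_iff.mp hU
  obtain ⟨y, hy, hfy⟩ := Filter.frequently_iff.mp hf0
    (Filter.inter_mem (hV.mem_nhds hxV) (ball_mem_nhds x hR))
  have h1 := frequently_ne_zero_of_mem_ball hR (fun y hy => (hb y hy).2) hg0 hy.2
  obtain ⟨z, hgz, hz⟩ := (h1.and_eventually ((eventually_mem_set.mpr (hV.mem_nhds hy.1)).and
    ((hb y hy.2).1.continuousAt.eventually_ne hfy))).exists
  exact ⟨z, hVU hz.1, mul_ne_zero hz.2 hgz⟩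

theorem exists_common_denominator {ι : Type*} (I : Finset ι) (f : ι → (Fin n → ℂ) → ℂ)
    (hf : ∀ i ∈ I, IsMeromorphic (f i)) (x : Fin n → ℂ) :
    ∃ (h : (Fin n → ℂ) → ℂ) (g : ι → (Fin n → ℂ) → ℂ), AnalyticAt ℂ h x ∧
      (∃ᶠ y in 𝓝 x, h y ≠ 0) ∧ (∀ i ∈ I, AnalyticAt ℂ (g i) x) ∧
      ∀ᶠ y in 𝓝 x, h y ≠ 0 → ∀ i ∈ I, f i y = g i y / h y := by
  classical
  induction I using Finset.induction_on with
  | empty =>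
    exact ⟨1, fun _ => 0, analyticAt_const, Eventually.frequently (by simp), by simp, by simp⟩
  | insert a I ha ih =>
    obtain ⟨h, g, hh, hne, hg, he⟩ := ih fun i hi => hf i (Finset.mem_insert_of_mem hi)
    obtain ⟨g', h', hg', hh', hne', he'⟩ := hf a (Finset.mem_insert_self _ _) x
    refine ⟨fun y => h y * h' y, fun i y => if i = a then g' y * h y else g i y * h' y,
      hh.mul hh', frequently_mul_ne_zero hh hh' hne hne', fun i hi => ?_, ?_⟩
    · by_cases hia : i = a
      · simp only [hia, if_true]; exact hg'.mul hh
      · simp only [hia, if_false]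
        exact (hg i ((Finset.mem_insert.mp hi).resolve_left hia)).mul hh'
    · filter_upwards [he, he'] with y hy hy' h0 i hi
      have h1 := left_ne_zero_of_mul h0
      have h2 := right_ne_zero_of_mul h0
      by_cases hia : i = a
      · simp only [hia, if_true]; rw [hy' h2]; field_simp
      · simp only [hia, if_false]
        rw [hy h1 i ((Finset.mem_insert.mp hi).resolve_left hia)]; field_simp

/-- A meromorphic function with a holomorphic directional derivative is holomorphic, if it is
holomorphic somewhere in this direction. -/
theorem exists_extension_of_fderiv_apply {x₀ ξ : Fin n → ℂ} {R : ℝ} (hR : 0 < R)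
    {h g b : (Fin n → ℂ) → ℂ} (hh : AnalyticOnNhd ℂ h (ball x₀ R))
    (hg : AnalyticOnNhd ℂ g (ball x₀ R)) (hb : AnalyticOnNhd ℂ b (ball x₀ R))
    (hξ : ‖ξ‖ < R / 4) (h1 : h (x₀ + ξ) ≠ 0)
    (hd : ∀ x ∈ ball x₀ R, h x ≠ 0 → fderiv ℂ (fun y => g y / h y) x ξ = b x) :
    ∃ G, AnalyticAt ℂ G x₀ ∧ ∀ᶠ x in 𝓝 x₀, h x ≠ 0 → g x / h x = G x := by
  have hline : ∀ x ∈ ball x₀ (R / 4), ∀ z ∈ ball (0 : ℂ) 2, x + z • ξ ∈ ball x₀ R := by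
    intro x hx z hz
    rw [mem_ball_iff_norm] at hx ⊢
    rw [mem_ball_zero_iff] at hz
    calc ‖x + z • ξ - x₀‖ = ‖(x - x₀) + z • ξ‖ := by congr 1; abel
      _ ≤ ‖x - x₀‖ + ‖z‖ * ‖ξ‖ := by rw [← norm_smul]; exact norm_add_le _ _
      _ < R / 4 + 2 * (R / 4) := by
          have := mul_le_mul hz.le hξ.le (norm_nonneg _) (by norm_num)
          linarith
      _ ≤ R := by linarith
  have hreal : ∀ t ∈ Icc (0 : ℝ) 1, (t : ℂ) ∈ ball (0 : ℂ) 2 := fun t ht => by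
    rw [mem_ball_zero_iff, Complex.norm_real, Real.norm_of_nonneg ht.1]; linarith [ht.2]
  have h1m : (1 : ℂ) ∈ ball (0 : ℂ) 2 := by simp
  have h0m : (0 : ℂ) ∈ ball (0 : ℂ) 2 := by simp
  have hint : AnalyticOnNhd ℂ (fun x => ∫ t in (0 : ℝ)..1, b (x + (t : ℂ) • ξ))
      (ball x₀ (R / 4)) := by
    refine analyticOnNhd_intervalIntegral zero_le_one isOpen_ball
      (H := fun x t => b (x + (t : ℂ) • ξ)) ?_ fun t ht x hx => ?_
    · refine hb.continuousOn.comp (f := fun p : (Fin n → ℂ) × ℝ => p.1 + (p.2 : ℂ) • ξ)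
        (by fun_prop) fun p hp => hline p.1 hp.1 _ (hreal _ hp.2)
    · exact (hb _ (hline x hx _ (hreal t ht))).comp_of_eq
        (f := fun x => x + (t : ℂ) • ξ) (by fun_prop) rfl
  have hx1 : x₀ + ξ ∈ ball x₀ R := by
    have := hline x₀ (mem_ball_self (by positivity)) 1 h1m
    rwa [one_smul] at this
  have hsh : ∀ {F : (Fin n → ℂ) → ℂ}, AnalyticOnNhd ℂ F (ball x₀ R) →
      AnalyticAt ℂ (fun x => F (x + ξ)) x₀ := fun hF =>
    (hF _ hx1).comp_of_eq (f := fun x => x + ξ) (by fun_prop) rfl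
  -- The value at x is recovered from the point x + ξ, where h does not vanish, by integrating the
  -- known derivative back along the segment.
  refine ⟨fun x => g (x + ξ) / h (x + ξ) - ∫ t in (0 : ℝ)..1, b (x + (t : ℂ) • ξ),
    ((hsh hg).div (hsh hh) h1).sub (hint x₀ (mem_ball_self (by positivity))), ?_⟩
  filter_upwards [ball_mem_nhds x₀ (by positivity : 0 < R / 4),
    (hsh hh).continuousAt.eventually_ne h1] with x hx hxξ hx0
  have hcomp : ∀ {F : (Fin n → ℂ) → ℂ}, AnalyticOnNhd ℂ F (ball x₀ R) →
      AnalyticOnNhd ℂ (fun z : ℂ => F (x + z • ξ)) (ball 0 2) := fun hF z hz =>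
    (hF _ (hline x hx z hz)).comp_of_eq (f := fun z : ℂ => x + z • ξ) (by fun_prop) rfl
  -- With β a primitive of b on the complex line, g - hβ is holomorphic on the whole disc and zero
  -- near 1, hence zero at 0. The zeros of h on the segment cause no difficulty.
  obtain ⟨β, hβ1, hβ⟩ := ((hcomp hb).differentiableOn.isExactOn_ball).with_val_at 1
    (g (x + ξ) / h (x + ξ))
  have hβa : AnalyticOnNhd ℂ β (ball 0 2) :=
    DifferentiableOn.analyticOnNhd (fun z hz => (hβ z hz).differentiableAt.differentiableWithinAt)
      isOpen_ball
  have hΦ : AnalyticOnNhd ℂ (fun z => g (x + z • ξ) - h (x + z • ξ) * β z) (ball 0 2) :=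
    (hcomp hg).sub ((hcomp hh).mul hβa)
  have hne1 : ∀ᶠ z in 𝓝 (1 : ℂ), z ∈ ball (0 : ℂ) 2 ∧ h (x + z • ξ) ≠ 0 :=
    (eventually_mem_set.mpr (isOpen_ball.mem_nhds h1m)).and
      ((hcomp hh 1 h1m).continuousAt.eventually_ne (by rwa [one_smul]))
  obtain ⟨r, hr, hball⟩ := Metric.eventually_nhds_iff_ball.mp hne1
  have hder : ∀ z ∈ ball (1 : ℂ) r,
      HasDerivAt (fun z => g (x + z • ξ) / h (x + z • ξ) - β z) 0 z := by
    intro z hz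
    obtain ⟨hz2, hz0⟩ := hball z hz
    have hp := hline x hx z hz2
    have h2 : HasDerivAt (fun z : ℂ => x + z • ξ) ξ z := by
      have := ((hasDerivAt_id z).smul_const ξ).const_add x
      rwa [one_smul] at this
    have h3 := (((hg _ hp).div (hh _ hp) hz0).differentiableAt.hasFDerivAt.comp_hasDerivAt z
      h2).sub (hβ z hz2)
    have h4 : fderiv ℂ (g / h) (x + z • ξ) ξ = b (x + z • ξ) := hd _ hp hz0
    rw [h4, sub_self] at h3
    exact h3
  have hzero : ∀ z ∈ ball (1 : ℂ) r, g (x + z • ξ) - h (x + z • ξ) * β z = 0 := by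
    intro z hz
    have h5 := isOpen_ball.is_const_of_deriv_eq_zero (convex_ball (1 : ℂ) r).isPreconnected
      (fun w hw => (hder w hw).differentiableAt.differentiableWithinAt)
      (fun w hw => (hder w hw).deriv) hz (mem_ball_self hr)
    simp only [one_smul, hβ1, sub_self] at h5
    have hz0 := (hball z hz).2
    rw [sub_eq_zero, div_eq_iff hz0] at h5
    rw [h5]; ring
  have hall := hΦ.eqOn_zero_of_preconnected_of_eventuallyEq_zero
    (convex_ball (0 : ℂ) 2).isPreconnected h1m
    (by filter_upwards [ball_mem_nhds (1 : ℂ) hr] with z hz using hzero z hz) h0m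
  simp only [zero_smul, add_zero, Pi.zero_apply, sub_eq_zero] at hall
  have hftc : ∫ t in (0 : ℝ)..1, b (x + (t : ℂ) • ξ) = β 1 - β 0 := by
    have := intervalIntegral.integral_eq_sub_of_hasDerivAt (a := 0) (b := 1)
      (f := fun t : ℝ => β t) (f' := fun t : ℝ => b (x + (t : ℂ) • ξ))
      (fun t ht => (hβ t (hreal t (by rwa [uIcc_of_le zero_le_one] at ht))).comp_ofReal) ?_
    · simpa using this
    · refine ContinuousOn.intervalIntegrable fun t ht => ?_
      rw [uIcc_of_le zero_le_one] at ht
      exact (((hcomp hb) t (hreal t ht)).continuousAt.comp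
        Complex.continuous_ofReal.continuousAt).continuousWithinAt
  rw [hftc, hβ1, hall]
  field_simp
  ring

/-- Gluing of local analytic extensions. -/
theorem exists_glue {f : (Fin n → ℂ) → ℂ} {O O' : Set (Fin n → ℂ)} (hO : IsOpen O)
    (hO' : IsOpen O') (hd : O ⊆ closure O') (hf : AnalyticOnNhd ℂ f O')
    (hx : ∀ x ∈ O, ∃ G, AnalyticAt ℂ G x ∧
      ∃ h : (Fin n → ℂ) → ℂ, AnalyticAt ℂ h x ∧ (∃ᶠ y in 𝓝 x, h y ≠ 0) ∧
      ∀ᶠ y in 𝓝 x, h y ≠ 0 → f y = G y) :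
    ∃ F, AnalyticOnNhd ℂ F O ∧ ∀ x ∈ O ∩ O', f x = F x := by
  have hx' : ∀ x ∈ O, ∃ G, AnalyticAt ℂ G x ∧ ∀ᶠ y in 𝓝 x, y ∈ O' → f y = G y := by
    intro x hxO
    obtain ⟨G, hG, h, hh, hne, he⟩ := hx x hxO
    refine ⟨G, hG, ?_⟩
    obtain ⟨R, hR, hb⟩ := Metric.eventually_nhds_iff_ball.mp
      (hG.eventually_analyticAt.and (hh.eventually_analyticAt.and he))
    filter_upwards [ball_mem_nhds x hR] with y hy hyO'
    have h1 := frequently_ne_zero_of_mem_ball hR (fun z hz => (hb z hz).2.1) hne hy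
    have h2 : ∃ᶠ z in 𝓝 y, f z - G z = 0 := by
      refine (h1.and_eventually (isOpen_ball.mem_nhds hy)).mono fun z hz => ?_
      rw [(hb z hz.2).2.2 hz.1, sub_self]
    by_contra hne
    exact h2 (((hf y hyO').continuousAt.sub (hb y hy).1.continuousAt).eventually_ne
      (sub_ne_zero.mpr hne))
  choose! G hG he using hx'
  -- Two local extensions agree with f on O', which is dense in O; by continuity they agree where
  -- both are defined.
  have key : ∀ x ∈ O, ∀ᶠ y in 𝓝 x, G y y = G x y := by
    intro x hxO
    filter_upwards [eventually_eventually_nhds.mpr (he x hxO), hO.mem_nhds hxO,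
      (hG x hxO).eventually_analyticAt] with y hy hyO hya
    have h2 : ∃ᶠ z in 𝓝 y, G y z - G x z = 0 := by
      refine ((mem_closure_iff_frequently.mp (hd hyO)).and_eventually (hy.and (he y hyO))).mono
        fun z hz => ?_
      rw [← hz.2.1 hz.1, ← hz.2.2 hz.1, sub_self]
    by_contra hne
    exact h2 (((hG y hyO).continuousAt.sub hya.continuousAt).eventually_ne (sub_ne_zero.mpr hne))
  refine ⟨fun x => G x x, fun x hxO => (hG x hxO).congr ?_, fun x hx => ?_⟩
  · filter_upwards [key x hxO] with y hy using hy.symm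
  · exact (he x hx.1).self_of_nhds hx.2

end SeveralComplex
end

noncomputable section

/-! ### Extension of the coefficients of commuting operators -/

namespace SeveralComplex

open Set Metric Filter TopologicalSpace LameOperators SymbolCalculus MvPolynomial

variable {n : ℕ} {O O' : Opens (Fin n → ℂ)}

theorem Hol.toFun_evalAt_homogeneousComponent (r : ℕ) (ξ : Fin n → ℂ)
    (P : MvPolynomial (Fin n) (Hol O)) {y : Fin n → ℂ} (hy : y ∈ O) :
    (evalAt ξ (homogeneousComponent r P)).toFun y =
      ∑ k ∈ P.support with k.degree = r, (∏ i, ξ i ^ k i) * (P.coeff k).toFun y := by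
  rw [homogeneousComponent_apply, map_sum, Hol.toFun_sum _ _ hy]
  refine Finset.sum_congr rfl fun k _ => ?_
  rw [evalAt_monomial, Hol.toFun_mul _ _ hy, Hol.toFun_algebraMap _ hy, mul_comm]

theorem fderiv_apply_eq_sum (F : (Fin n → ℂ) → ℂ) (y ξ : Fin n → ℂ) :
    fderiv ℂ F y ξ = ∑ j, ξ j * pderivFun j F y := by
  conv_lhs => rw [← Finset.univ_sum_single ξ, map_sum]
  refine Finset.sum_congr rfl fun j _ => ?_
  rw [pderivFun, ← smul_eq_mul, ← map_smul]
  congr 1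
  ext i
  by_cases h : i = j
  · subst h; simp
  · simp [h]

/-- The directional derivative of a homogeneous part of a symbol that commutes with `-Δ + u`. -/
theorem two_mul_fderiv_evalAt {h' : O' ≤ O} {u : Hol O}
    {P : MvPolynomial (Fin n) (Hol O')} {M : MvPolynomial (Fin n) (Hol O)}
    (hc : (symbolConnection Hol.D Hol.D_comm).act (-(∑ j, X j ^ 2) + C (Hol.res h' u)) P =
      (symbolConnection Hol.D Hol.D_comm).act P (-(∑ j, X j ^ 2) + C (Hol.res h' u))) {r : ℕ}
    (hM : P - map (Hol.res h').toRingHom M ∈ degLT (Hol O') n (r + 1)) (ξ : Fin n → ℂ)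
    {y : Fin n → ℂ} (hy : y ∈ O') :
    2 * fderiv ℂ (evalAt ξ (homogeneousComponent r P)).toFun y ξ =
      (evalAt ξ (homogeneousComponent (r + 1) (commDefect Hol.D_comm u M))).toFun y := by
  have h1 := two_mul_sum_D_evalAt Hol.D_comm (Hol.res h' u) P hc r ξ
  have h2 := commDefect_mem_degLT Hol.D_comm (Hol.res h' u) hM
  rw [commDefect_sub] at h2
  have hg : ∀ i a, Hol.res h' (Hol.D i a) = Hol.D i (Hol.res h' a) := fun i a =>
    Hol.ext_toFun fun x hx => by
      rw [Hol.toFun_res h' _ hx, Hol.toFun_D _ _ (h' hx), Hol.toFun_D _ _ hx]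
      exact (Hol.pderivFun_eqOn i (fun y hy => Hol.toFun_res h' a hy) x hx).symm
  rw [homogeneousComponent_congr h2, ← map_commDefect Hol.D_comm Hol.D_comm (Hol.res h') hg] at h1
  have h3 : homogeneousComponent (r + 1) (map (Hol.res h').toRingHom
      (commDefect Hol.D_comm u M)) = map (Hol.res h').toRingHom
        (homogeneousComponent (r + 1) (commDefect Hol.D_comm u M)) := by
    ext k; simp only [coeff_homogeneousComponent, coeff_map]; split_ifs <;> simp
  rw [h3, ← map_evalAt] at h1
  have h4 := congrArg (fun f : Hol O' => f.toFun y) h1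
  simp only [Hol.toFun_res h' _ hy, Hol.toFun_mul _ _ hy, Hol.toFun_sum _ _ hy,
    Hol.toFun_algebraMap _ hy, Hol.toFun_D _ _ hy] at h4
  rw [← h4, fderiv_apply_eq_sum]
  congr 1
  have := Hol.toFun_add (U := O') 1 1 hy
  rw [one_add_one_eq_two, Hol.toFun_one hy, one_add_one_eq_two] at this
  exact this.symm

/-- The coefficients of `P` are meromorphic on `O`, with poles outside `O'`. -/
def HasMeromorphicCoeffs (O : Opens (Fin n → ℂ)) (P : MvPolynomial (Fin n) (Hol O')) : Prop :=
  ∀ x ∈ O, ∃ (h : (Fin n → ℂ) → ℂ) (g : (Fin n →₀ ℕ) → (Fin n → ℂ) → ℂ), AnalyticAt ℂ h x ∧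
    (∃ᶠ y in 𝓝 x, h y ≠ 0) ∧ (∀ k ∈ P.support, AnalyticAt ℂ (g k) x) ∧
    ∀ᶠ y in 𝓝 x, h y ≠ 0 → y ∈ O' ∧ ∀ k ∈ P.support, (P.coeff k).toFun y = g k y / h y

/-- `M` carries the coefficients of degree above r, already extended to O. The derivative of P_r(·,
ξ) along ξ is computed from them, so it is holomorphic on O, and P_r(·, ξ) extends near x₀ whenever
ξ is small and the denominator is nonzero at x₀ + ξ. These ξ fill a nonempty open set, so each
coefficient extends. -/
theorem exists_extension_coeff (h' : O' ≤ O) (hd : (O : Set (Fin n → ℂ)) ⊆ closure O')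
    {u : Hol O} {P : MvPolynomial (Fin n) (Hol O')} (hP : HasMeromorphicCoeffs O P)
    {M : MvPolynomial (Fin n) (Hol O)}
    (hc : (symbolConnection Hol.D Hol.D_comm).act (-(∑ j, X j ^ 2) + C (Hol.res h' u)) P =
      (symbolConnection Hol.D Hol.D_comm).act P (-(∑ j, X j ^ 2) + C (Hol.res h' u))) {r : ℕ}
    (hM : P - map (Hol.res h').toRingHom M ∈ degLT (Hol O') n (r + 1)) {k : Fin n →₀ ℕ}
    (hk : k ∈ P.support) (hkr : k.degree = r) : ∃ a : Hol O, Hol.res h' a = P.coeff k := by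
  classical
  suffices key : ∀ x ∈ O, ∃ G, AnalyticAt ℂ G x ∧ ∃ h : (Fin n → ℂ) → ℂ, AnalyticAt ℂ h x ∧
      (∃ᶠ y in 𝓝 x, h y ≠ 0) ∧ ∀ᶠ y in 𝓝 x, h y ≠ 0 → (P.coeff k).toFun y = G y by
    obtain ⟨F, hF, hFe⟩ := exists_glue O.isOpen O'.isOpen hd (P.coeff k).analyticOnNhd key
    exact ⟨Hol.mk F hF, Hol.ext_toFun fun x hx => by
      rw [Hol.toFun_res h' _ hx, Hol.toFun_mk hF (h' hx), hFe x ⟨h' hx, hx⟩]⟩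
  intro x₀ hx₀
  obtain ⟨h, g, hh, hne, hg, he⟩ := hP x₀ hx₀
  obtain ⟨R, hR, hb⟩ := Metric.eventually_nhds_iff_ball.mp
    (hh.eventually_analyticAt.and ((P.support.eventually_all.mpr
      fun k hk => (hg k hk).eventually_analyticAt).and (he.and (eventually_mem_set.mpr
        (O.isOpen.mem_nhds hx₀)))))
  let S : Submodule ℂ ((Fin n → ℂ) → ℂ) :=
    { carrier := {φ | ∃ G, AnalyticAt ℂ G x₀ ∧ ∀ᶠ x in 𝓝 x₀, h x ≠ 0 → φ x = G x}
      zero_mem' := ⟨0, analyticAt_const, by simp⟩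
      add_mem' := by
        rintro a b ⟨G, hG, hG'⟩ ⟨H, hH, hH'⟩
        refine ⟨G + H, hG.add hH, ?_⟩
        filter_upwards [hG', hH'] with x h1 h2 h0
        simp [h1 h0, h2 h0]
      smul_mem' := by
        rintro c a ⟨G, hG, hG'⟩
        refine ⟨c • G, hG.const_smul, ?_⟩
        filter_upwards [hG'] with x h1 h0
        simp [h1 h0] }
  have hha : AnalyticOnNhd ℂ h (ball x₀ R) := fun x hx => (hb x hx).1
  have hVmap : ∀ ξ ∈ ball (0 : Fin n → ℂ) (R / 4), x₀ + ξ ∈ ball x₀ R := fun ξ hξ => by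
    rw [mem_ball_zero_iff] at hξ
    rw [mem_ball_iff_norm, add_sub_cancel_left]; linarith
  have hV : IsOpen (ball (0 : Fin n → ℂ) (R / 4) ∩ (fun ξ => h (x₀ + ξ)) ⁻¹' {0}ᶜ) :=
    (hha.continuousOn.comp (f := fun ξ => x₀ + ξ) (by fun_prop) hVmap).isOpen_inter_preimage
      isOpen_ball isOpen_compl_singleton
  have hVne : (ball (0 : Fin n → ℂ) (R / 4) ∩ (fun ξ => h (x₀ + ξ)) ⁻¹' {0}ᶜ).Nonempty := by
    obtain ⟨x, hx, hx'⟩ := (hne.and_eventually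
      (ball_mem_nhds x₀ (by positivity : 0 < R / 4))).exists
    refine ⟨x - x₀, by rwa [mem_ball_zero_iff, ← mem_ball_iff_norm], by simpa using hx⟩
  suffices key : ∀ ξ ∈ ball (0 : Fin n → ℂ) (R / 4) ∩ (fun ξ => h (x₀ + ξ)) ⁻¹' {0}ᶜ,
      ∑ k ∈ P.support with k.degree = r, (∏ i, ξ i ^ k i) • (P.coeff k).toFun ∈ S by
    obtain ⟨G, hG, hG'⟩ := mem_of_forall_sum_smul_mem S (P.support.filter fun k => k.degree = r)
      (fun k => (P.coeff k).toFun) hV hVne key k (Finset.mem_filter.mpr ⟨hk, hkr⟩)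
    exact ⟨G, hG, h, hh, hne, hG'⟩
  intro ξ hξ
  obtain ⟨hξ1, hξ2⟩ := hξ
  set b := evalAt ξ (homogeneousComponent (r + 1) (commDefect Hol.D_comm u M)) with hbdef
  have hsum : ∀ x ∈ ball x₀ R, h x ≠ 0 → (evalAt ξ (homogeneousComponent r P)).toFun x =
      (∑ k ∈ P.support with k.degree = r, (∏ i, ξ i ^ k i) * g k x) / h x := by
    intro x hx h0
    obtain ⟨hxO', hxe⟩ := (hb x hx).2.2.1 h0
    rw [Hol.toFun_evalAt_homogeneousComponent r ξ P hxO', Finset.sum_div]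
    refine Finset.sum_congr rfl fun k hk => ?_
    rw [hxe k (Finset.mem_filter.mp hk).1, mul_div_assoc]
  have hfd : ∀ x ∈ ball x₀ R, h x ≠ 0 → fderiv ℂ (fun y =>
      (∑ k ∈ P.support with k.degree = r, (∏ i, ξ i ^ k i) * g k y) / h y) x ξ =
        2⁻¹ * b.toFun x := by
    intro x hx h0
    rw [hbdef, ← two_mul_fderiv_evalAt hc hM ξ ((hb x hx).2.2.1 h0).1,
      inv_mul_cancel_left₀ two_ne_zero]
    congr 1
    refine Filter.EventuallyEq.fderiv_eq ?_
    filter_upwards [isOpen_ball.mem_nhds hx, (hha x hx).continuousAt.eventually_ne h0] with y hy hy0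
    exact (hsum y hy hy0).symm
  obtain ⟨G, hG, hG'⟩ := exists_extension_of_fderiv_apply (ξ := ξ) hR hha
    (g := fun x => ∑ k ∈ P.support with k.degree = r, (∏ i, ξ i ^ k i) * g k x)
    (b := fun x => 2⁻¹ * b.toFun x)
    (fun x hx => Finset.analyticAt_fun_sum _ fun k hk =>
      analyticAt_const.mul ((hb x hx).2.1 k (Finset.mem_filter.mp hk).1))
    (fun x hx => analyticAt_const.mul (b.analyticOnNhd x (hb x hx).2.2.2))
    (by rwa [mem_ball_zero_iff] at hξ1) hξ2 hfd
  refine ⟨G, hG, ?_⟩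
  filter_upwards [hG', ball_mem_nhds x₀ hR] with x h1 hx h0
  rw [← h1 h0, ← hsum x hx h0,
    Hol.toFun_evalAt_homogeneousComponent r ξ P ((hb x hx).2.2.1 h0).1]
  simp

/-- The coefficients of an operator that commutes with `-Δ + u` are holomorphic where `u` is. -/
theorem exists_map_res_eq (h' : O' ≤ O) (hd : (O : Set (Fin n → ℂ)) ⊆ closure O')
    {u : Hol O} {P : MvPolynomial (Fin n) (Hol O')} (hP : HasMeromorphicCoeffs O P)
    (hc : (symbolConnection Hol.D Hol.D_comm).act (-(∑ j, X j ^ 2) + C (Hol.res h' u)) P =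
      (symbolConnection Hol.D Hol.D_comm).act P (-(∑ j, X j ^ 2) + C (Hol.res h' u))) :
    ∀ (r : ℕ) (M : MvPolynomial (Fin n) (Hol O)),
      P - map (Hol.res h').toRingHom M ∈ degLT (Hol O') n r →
      ∃ M' : MvPolynomial (Fin n) (Hol O), map (Hol.res h').toRingHom M' = P
  | 0, M, hM => ⟨M, (sub_eq_zero.mp (degLT_zero hM)).symm⟩
  | r + 1, M, hM => by
    classical
    have h1 : ∀ k, ∃ a : Hol O, k ∈ P.support → k.degree = r → Hol.res h' a = P.coeff k := by
      intro k
      by_cases hk : k ∈ P.support ∧ k.degree = r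
      · obtain ⟨a, ha⟩ := exists_extension_coeff h' hd hP hc hM hk.1 hk.2
        exact ⟨a, fun _ _ => ha⟩
      · exact ⟨0, fun h2 h3 => absurd ⟨h2, h3⟩ hk⟩
    choose a ha using h1
    -- The part of degree r of `M` is exchanged for the extensions just found; the higher parts stay
    -- as they are.
    refine exists_map_res_eq h' hd hP hc r (M - homogeneousComponent r M +
      ∑ k ∈ P.support with k.degree = r, monomial k (a k)) fun k hk => ?_
    simp only [coeff_sub, coeff_map, coeff_add, coeff_homogeneousComponent, coeff_sum,
      coeff_monomial, Finset.sum_ite_eq', Finset.mem_filter]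
    rcases hk.lt_or_eq with hk | hk
    · have := hM k hk
      rw [coeff_sub, coeff_map] at this
      simpa [hk.ne'] using this
    · simp only [← hk, if_true, sub_self, zero_add, and_true]
      split_ifs with h2
      · rw [sub_eq_zero]; exact (ha k h2 hk.symm).symm
      · rw [notMem_support_iff.mp h2]; simp

theorem Hol.eq_of_res_eq {h' : O' ≤ O} (hd : (O : Set (Fin n → ℂ)) ⊆ closure O') {f g : Hol O}
    (h : Hol.res h' f = Hol.res h' g) : f = g := by
  refine Hol.ext_toFun fun x hx => ?_
  by_contra hne
  have h1 := ((f.analyticOnNhd x hx).continuousAt.sub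
    (g.analyticOnNhd x hx).continuousAt).eventually_ne (sub_ne_zero.mpr hne)
  refine (mem_closure_iff_frequently.mp (hd hx)) (h1.mono fun y hy hyO' => hy ?_)
  have := congrArg (fun f : Hol O' => f.toFun y) h
  simp only [Hol.toFun_res h' _ hyO'] at this
  simp [this]

theorem map_res_injective {h' : O' ≤ O} (hd : (O : Set (Fin n → ℂ)) ⊆ closure O') :
    Function.Injective (map (σ := Fin n) (Hol.res h').toRingHom) :=
  map_injective _ fun _ _ => Hol.eq_of_res_eq hd

end SeveralComplex
end

noncomputable section

/-! ### The holonomic system of a strongly integrable generalized Lamé operator -/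

namespace LameOperators

open Set Metric Filter TopologicalSpace SeveralComplex SymbolCalculus MvPolynomial

variable {n : ℕ}

/-- The linear part of an affine form. -/
def AffineForm.lin (α : AffineForm n) : (Fin n → ℂ) →L[ℂ] ℂ :=
  ∑ j, α.grad j • ContinuousLinearMap.proj j

theorem AffineForm.lin_apply (α : AffineForm n) (x : Fin n → ℂ) :
    α.lin x = ∑ j, α.grad j * x j := by
  simp [lin]

theorem AffineForm.eval_eq (α : AffineForm n) (x : Fin n → ℂ) : α.eval x = α.const + α.lin x := by
  rw [lin_apply, eval]

theorem AffineForm.analyticAt_eval (α : AffineForm n) (x : Fin n → ℂ) : AnalyticAt ℂ α.eval x := by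
  rw [show α.eval = fun x => α.const + α.lin x from funext α.eval_eq]
  exact analyticAt_const.add (α.lin.analyticAt x)

theorem AffineForm.continuous_eval (α : AffineForm n) : Continuous α.eval :=
  continuous_iff_continuousAt.mpr fun x => (α.analyticAt_eval x).continuousAt

theorem AffineForm.lin_grad (α : AffineForm n) : α.lin α.grad = α.sq := by
  rw [lin_apply, sq]; exact Finset.sum_congr rfl fun j _ => (pow_two _).symm

theorem AffineForm.lin_ne_zero {α : AffineForm n} (h : α.sq ≠ 0) : α.lin ≠ 0 := by
  intro h0
  rw [← lin_grad, h0] at h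
  simp at h

variable {τ : UpperHalfPlane} {A : Finset (AffineForm n)}

theorem mem_lattice_periodPair {z : ℂ} :
    z ∈ (periodPair τ).lattice ↔ ∃ p q : ℤ, z = p + q * (τ : ℂ) := by
  rw [PeriodPair.mem_lattice]
  simp [periodPair, eq_comm]

theorem mem_singularLocus {x : Fin n → ℂ} :
    x ∈ singularLocus τ A ↔ ∃ α ∈ A, α.eval x ∈ (periodPair τ).lattice := by
  simp only [singularLocus, mem_iUnion, hyperplane, mem_setOf_eq, exists_prop,
    mem_lattice_periodPair]

theorem isClosed_singularLocus : IsClosed (singularLocus τ A) := by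
  have : singularLocus τ A = ⋃ α ∈ A, α.eval ⁻¹' (periodPair τ).lattice := by
    ext x; simp [mem_singularLocus]
  rw [this]
  exact A.finite_toSet.isClosed_biUnion fun α _ =>
    (periodPair τ).isClosed_lattice.preimage α.continuous_eval

/-- The complement of the singular locus. -/
def regularSet (τ : UpperHalfPlane) (A : Finset (AffineForm n)) : Opens (Fin n → ℂ) :=
  ⟨(singularLocus τ A)ᶜ, isClosed_singularLocus.isOpen_compl⟩

theorem mem_regularSet {x : Fin n → ℂ} : x ∈ regularSet τ A ↔ x ∉ singularLocus τ A := Iff.rfl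

/-- Near `x`, only the polar hyperplanes through `x` are met. -/
theorem eventually_eval_mem_lattice (A : Finset (AffineForm n)) (x : Fin n → ℂ) : ∀ᶠ y in 𝓝 x, ∀ α ∈ A,
    α.eval y ∈ (periodPair τ).lattice → α.lin y = α.lin x := by
  rw [Finset.eventually_all]
  intro α _
  filter_upwards [α.continuous_eval.continuousAt
    ((periodPair τ).compl_lattice_sdiff_singleton_mem_nhds (α.eval x))] with y hy hl
  have : α.eval y = α.eval x := by
    by_contra hne
    exact hy ⟨hl, hne⟩
  rw [α.eval_eq, α.eval_eq] at this
  exact add_left_cancel this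

theorem analyticAt_potential (m : AffineForm n → ℕ) {x : Fin n → ℂ} (hx : x ∈ regularSet τ A) :
    AnalyticAt ℂ (potential τ A m) x := by
  refine Finset.analyticAt_fun_sum _ fun α hα => analyticAt_const.mul ?_
  refine ((periodPair τ).analyticOnNhd_weierstrassP (α.eval x) fun h => ?_).comp
    (α.analyticAt_eval x)
  exact hx (mem_singularLocus.mpr ⟨α, hα, h⟩)

/-- The potential as a holomorphic function off the singular locus. -/
def potentialHol (τ : UpperHalfPlane) (A : Finset (AffineForm n)) (m : AffineForm n → ℕ) :
    Hol (regularSet τ A) := Hol.mk (potential τ A m) fun _ hx => analyticAt_potential m hx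

theorem isOpen_setOf_regularAt (L : Fin n → DiffOp n) : IsOpen {x | ∀ i, (L i).RegularAt x} := by
  have : {x | ∀ i, (L i).RegularAt x} =
      ⋂ i, ⋂ k ∈ (L i).support, {x | AnalyticAt ℂ ((L i).coeff k) x} := by
    ext x
    simp only [mem_setOf_eq, mem_iInter, DiffOp.RegularAt]
    refine ⟨fun h i k _ => h i k, fun h i k => ?_⟩
    by_cases hk : k ∈ (L i).support
    · exact h i k hk
    · rw [notMem_support_iff.mp hk]; exact analyticAt_const
  rw [this]
  exact isOpen_iInter_of_finite fun i => isOpen_biInter_finset fun k _ => isOpen_analyticAt ℂ _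

theorem coeff_schrodinger (u : (Fin n → ℂ) → ℂ) (k : Fin n →₀ ℕ) (x : Fin n → ℂ) :
    (schrodinger u).coeff k x =
      (-(∑ j : Fin n, X j ^ 2) : MvPolynomial (Fin n) ℂ).coeff k + if k = 0 then u x else 0 := by
  classical
  rw [schrodinger, coeff_add, coeff_C, Pi.add_apply]
  congr 1
  · have h1 : (-(∑ j : Fin n, X j ^ 2) : DiffOp n) =
        map (algebraMap ℂ ((Fin n → ℂ) → ℂ)) (-(∑ j : Fin n, X j ^ 2)) := by simp
    rw [h1, coeff_map]
    rfl
  · by_cases h : k = 0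
    · simp [h]
    · simp [h, Ne.symm h]

theorem toFun_coeff_schrodinger {O : Opens (Fin n → ℂ)} (u : Hol O) (k : Fin n →₀ ℕ)
    {x : Fin n → ℂ} (hx : x ∈ O) :
    ((-(∑ j : Fin n, X j ^ 2) + C u : MvPolynomial (Fin n) (Hol O)).coeff k).toFun x =
      (schrodinger u.toFun).coeff k x := by
  classical
  rw [coeff_schrodinger, coeff_add, coeff_C, Hol.toFun_add _ _ hx]
  congr 1
  · have h1 : (-(∑ j : Fin n, X j ^ 2) : MvPolynomial (Fin n) (Hol O)) =
        map (algebraMap ℂ (Hol O)) (-(∑ j : Fin n, X j ^ 2)) := by simp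
    rw [h1, coeff_map, Hol.toFun_algebraMap _ hx]
  · by_cases h : k = 0
    · simp [h]
    · simp [h, Ne.symm h, Hol.toFun_zero]

/-- The points off the singular locus where all operators are regular. -/
def regularPoints (τ : UpperHalfPlane) (A : Finset (AffineForm n)) (L : Fin n → DiffOp n) :
    Opens (Fin n → ℂ) :=
  ⟨regularSet τ A ∩ {x | ∀ i, (L i).RegularAt x},
    (regularSet τ A).isOpen.inter (isOpen_setOf_regularAt L)⟩

theorem regularPoints_le {L : Fin n → DiffOp n} : regularPoints τ A L ≤ regularSet τ A := fun _ hx => hx.1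

variable [NeZero n] {m : AffineForm n → ℕ} {L : Fin n → DiffOp n}
  {s : Fin n → MvPolynomial (Fin n) ℂ} {Λ : AddSubgroup (Fin n → ℂ)}

theorem exists_denominator (hL : IsStronglyIntegrable Λ (schrodinger (potential τ A m)) L s)
    (x : Fin n → ℂ) :
    ∃ (h : (Fin n → ℂ) → ℂ) (g : Fin n → (Fin n →₀ ℕ) → (Fin n → ℂ) → ℂ), AnalyticAt ℂ h x ∧
      (∃ᶠ y in 𝓝 x, h y ≠ 0) ∧ (∀ i, ∀ k ∈ (L i).support, AnalyticAt ℂ (g i k) x) ∧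
      ∀ᶠ y in 𝓝 x, h y ≠ 0 → (∀ i, (L i).RegularAt y) ∧
        ∀ i, ∀ k ∈ (L i).support, (L i).coeff k y = g i k y / h y := by
  obtain ⟨h, g, hh, hne, hg, he⟩ := exists_common_denominator
    (Finset.univ.sigma fun i => (L i).support) (fun t : Σ _ : Fin n, Fin n →₀ ℕ => (L t.1).coeff t.2)
    (fun t _ => hL.meromorphic _ _) x
  refine ⟨h, fun i k => g ⟨i, k⟩, hh, hne, fun i k hk => hg ⟨i, k⟩ (by simpa using hk), ?_⟩
  filter_upwards [eventually_eventually_nhds.mpr he, hh.eventually_analyticAt,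
    (Finset.eventually_all _).mpr fun t ht => (hg t ht).eventually_analyticAt] with y hy hhy hgy h0
  refine ⟨fun i k => ?_, fun i k hk => hy.self_of_nhds h0 ⟨i, k⟩ (by simpa using hk)⟩
  by_cases hk : k ∈ (L i).support
  · have hm : (⟨i, k⟩ : Σ _ : Fin n, Fin n →₀ ℕ) ∈ Finset.univ.sigma fun i => (L i).support := by
      simpa using hk
    refine ((hgy _ hm).div hhy h0).congr ?_
    filter_upwards [hy, hhy.continuousAt.eventually_ne h0] with z hz hz0
    exact (hz hz0 _ hm).symm
  · rw [notMem_support_iff.mp hk]; exact analyticAt_const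

/-- Only zeros of a common denominator are lost, and its zero set has empty interior. -/
theorem regularSet_subset_closure
    (hL : IsStronglyIntegrable Λ (schrodinger (potential τ A m)) L s) :
    (regularSet τ A : Set (Fin n → ℂ)) ⊆ closure (regularPoints τ A L) := by
  intro x hx
  obtain ⟨h, g, -, hne, -, he⟩ := exists_denominator hL x
  exact mem_closure_iff_frequently.mpr ((hne.and_eventually
    (he.and ((regularSet τ A).isOpen.mem_nhds hx))).mono fun y hy => ⟨hy.2.2, (hy.2.1 hy.1).1⟩)

/-- The coefficients of the operators extend to the complement of the singular locus. -/
theorem exists_isHolonomic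
    (hL : IsStronglyIntegrable Λ (schrodinger (potential τ A m)) L s) :
    ∃ l : Fin n → MvPolynomial (Fin n) (Hol (regularSet τ A)), IsHolonomic s l ∧
      l 0 = -(∑ j, X j ^ 2) + C (potentialHol τ A m) ∧
      ∀ i k, ∀ x ∈ regularSet τ A, AnalyticAt ℂ ((L i).coeff k) x →
        (L i).coeff k x = ((l i).coeff k).toFun x := by
  classical
  set O := regularSet τ A
  -- The coefficients of the L_i may have arbitrary values on the zeros of their denominators. The
  -- symbols are first formed on the dense open set O', where everything is holomorphic, then
  -- extended to O, and identities are carried over by density.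
  set O' := regularPoints τ A L
  have h' : O' ≤ O := regularPoints_le
  have hd : (O : Set (Fin n → ℂ)) ⊆ closure O' := regularSet_subset_closure hL
  have hreg : ∀ i, ∀ x ∈ O', (L i).RegularAt x := fun i x hx => hx.2 i
  choose P hP using fun i => exists_symbol (L i) (hreg i)
  have hPs : ∀ i, ∀ k ∈ (P i).support, k ∈ (L i).support := by
    intro i k hk
    rw [mem_support_iff] at hk ⊢
    intro h0
    refine hk (Hol.ext_toFun fun x hx => ?_)
    rw [hP i k x hx, h0, Hol.toFun_zero, Pi.zero_apply]
  have hPm : ∀ i, HasMeromorphicCoeffs O (P i) := by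
    intro i x hx
    obtain ⟨h, g, hh, hne, hg, he⟩ := exists_denominator hL x
    refine ⟨h, g i, hh, hne, fun k hk => hg i k (hPs i k hk), ?_⟩
    filter_upwards [he, O.isOpen.mem_nhds hx] with y hy hyO h0
    have hyO' : y ∈ O' := ⟨hyO, (hy h0).1⟩
    exact ⟨hyO', fun k hk => by rw [hP i k y hyO', (hy h0).2 i k (hPs i k hk)]⟩
  set u := potentialHol τ A m
  have hrep0 : Represents (-(∑ j, X j ^ 2) + C (Hol.res h' u)) (L 0) := by
    intro k x hx
    have hu : (Hol.res h' u).toFun x = potential τ A m x := by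
      rw [Hol.toFun_res h' _ hx]
      exact Hol.toFun_mk (fun y hy => analyticAt_potential m hy) (h' hx)
    rw [toFun_coeff_schrodinger _ _ hx, hL.first_eq, coeff_schrodinger, coeff_schrodinger, hu]
  have hc := fun i => Represents.comm hrep0 (hP i) (hreg 0) (hreg i) (hL.commutes 0 i)
  have hsymb : ∀ i, P i - map (Hol.res h').toRingHom (map (algebraMap ℂ (Hol O)) (s i)) ∈
      degLT (Hol O') n (s i).totalDegree := by
    intro i k hk
    rw [coeff_sub, coeff_map, coeff_map, sub_eq_zero]
    refine Hol.ext_toFun fun x hx => ?_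
    rw [hP i k x hx, hL.symbol_eq i k hk]
    have : (Hol.res h').toRingHom ((algebraMap ℂ (Hol O)) ((s i).coeff k)) =
      algebraMap ℂ (Hol O') ((s i).coeff k) := (Hol.res h').commutes _
    rw [this, Hol.toFun_algebraMap _ hx]
  -- The induction starts from the constant symbol s_i, from which L_i differs by terms of order
  -- below deg s_i.
  choose l hl using fun i => exists_map_res_eq h' hd (hPm i) (hc i) _ _ (hsymb i)
  have hinj := map_res_injective (h' := h') hd
  have hDg : ∀ i a, Hol.res h' (Hol.D i a) = Hol.D i (Hol.res h' a) := fun i a =>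
    Hol.ext_toFun fun x hx => by
      rw [Hol.toFun_res h' _ hx, Hol.toFun_D _ _ (h' hx), Hol.toFun_D _ _ hx]
      exact (Hol.pderivFun_eqOn i (fun y hy => Hol.toFun_res h' a hy) x hx).symm
  have hlO' : ∀ i k, ∀ x ∈ O', (L i).coeff k x = ((l i).coeff k).toFun x := by
    intro i k x hx
    rw [← hP i k x hx, ← hl i, coeff_map]
    exact Hol.toFun_res h' _ hx
  refine ⟨l, ⟨hL.homogeneous, HomogeneousParameters.totalDegree_pos hL.algebraicIndependent,
    hL.finite, fun i k hk => ?_, fun i j => ?_⟩, hinj ?_, fun i k x hx ha => ?_⟩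
  · refine Hol.eq_of_res_eq (h' := h') hd ?_
    have := hsymb i k hk
    rw [← hl i, coeff_sub, coeff_map, coeff_map] at this
    rw [coeff_sub, map_sub, map_zero]
    exact this
  · apply hinj
    rw [map_symbol_act Hol.D_comm Hol.D_comm _ hDg, map_symbol_act Hol.D_comm Hol.D_comm _ hDg,
      hl, hl]
    exact Represents.comm (hP i) (hP j) (hreg i) (hreg j) (hL.commutes i j)
  · rw [hl]
    refine MvPolynomial.ext _ _ fun k => Hol.ext_toFun fun x hx => ?_
    rw [hP 0 k x hx, ← hrep0 k x hx]
    simp only [map_add, map_neg, map_sum, map_pow, map_X, map_C]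
    rfl
  · by_contra hne
    have h1 := (ha.continuousAt.sub
      (((l i).coeff k).analyticOnNhd x hx).continuousAt).eventually_ne (sub_ne_zero.mpr hne)
    refine (mem_closure_iff_frequently.mp (hd hx)) (h1.mono fun y hy hyO' => hy ?_)
    rw [Pi.sub_apply, hlO' i k y hyO', sub_self]

/-- Solutions of the original system and of its extension agree. -/
theorem forall_isSolutionAt_iff
    (hL : IsStronglyIntegrable Λ (schrodinger (potential τ A m)) L s)
    {l : Fin n → MvPolynomial (Fin n) (Hol (regularSet τ A))}
    (hl : ∀ i k, ∀ x ∈ regularSet τ A, AnalyticAt ℂ ((L i).coeff k) x →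
        (L i).coeff k x = ((l i).coeff k).toFun x) (lam : Fin n → ℂ)
    {U : Opens (Fin n → ℂ)} (h : U ≤ regularSet τ A) {ψ : (Fin n → ℂ) → ℂ} :
    (∀ x ∈ U, IsSolutionAt L lam ψ x) ↔
      ∃ hψ : AnalyticOnNhd ℂ ψ U, Sec.mk h ψ hψ ∈ Sol l lam h := by
  have key : ∀ (hψ : AnalyticOnNhd ℂ ψ U), ∀ x ∈ U, ∀ i, (L i).RegularAt x →
      ((Sec.conn h).act (Sec.mk h ψ hψ) (l i)).toFun x = (L i).apply ψ x := by
    intro hψ x hx i hr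
    exact Sec.toFun_act_eq_apply (fun y hy => Sec.toFun_mk hψ hy) hx
      fun k => (hl i k x (h hx) (hr k)).symm
  constructor
  · intro hs
    have hψ : AnalyticOnNhd ℂ ψ U := fun x hx => (hs x hx).1
    refine ⟨hψ, fun i => Sec.ext_toFun fun x hx => ?_⟩
    -- The equation is given only where L_i is regular; both sides are continuous on U and such
    -- points are dense.
    by_contra hne
    have h1 := ((((Sec.conn h).act (Sec.mk h ψ hψ) (l i)).analyticOnNhd x hx).continuousAt.sub
      ((lam i • Sec.mk h ψ hψ).analyticOnNhd x hx).continuousAt).eventually_ne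
      (sub_ne_zero.mpr hne)
    refine (mem_closure_iff_frequently.mp (regularSet_subset_closure hL (h hx)))
      ((h1.and (U.isOpen.mem_nhds hx)).mono fun y hy hyO' => hy.1 ?_)
    rw [Pi.sub_apply, key hψ y hy.2 i (hyO'.2 i), Sec.toFun_smul _ _ hy.2, Sec.toFun_mk hψ hy.2,
      (hs y hy.2).2 i (hyO'.2 i), sub_self]
  · rintro ⟨hψ, hs⟩ x hx
    refine ⟨hψ x hx, fun i hr => ?_⟩
    rw [← key hψ x hx i hr, hs i, Sec.toFun_smul _ _ hx, Sec.toFun_mk hψ hx]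

end LameOperators
end

noncomputable section

/-! ### Pole orders along the boundary of a cone -/

namespace SeveralComplex

open Set Metric Filter TopologicalSpace LameOperators SymbolCalculus MvPolynomial

variable {n : ℕ} {O : Opens (Fin n → ℂ)} {δ : (Fin n → ℂ) → ℝ} {x₀ : Fin n → ℂ}

/-- `δ` is a concave gauge of a cone with vertex `x₀` which is contained in `O` near `x₀`. -/
structure IsCorner (δ : (Fin n → ℂ) → ℝ) (x₀ : Fin n → ℂ) (O : Opens (Fin n → ℂ)) : Prop where
  smul : ∀ t : ℝ, 0 ≤ t → ∀ v, δ ((t : ℂ) • v) = t * δ v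
  add_le : ∀ v w, δ v + δ w ≤ δ (v + w)
  abs_le_norm : ∀ v, |δ v| ≤ ‖v‖
  exists_pos : ∃ v, 0 < δ v
  eventually_mem : ∀ᶠ x in 𝓝 x₀, 0 < δ (x - x₀) → x ∈ O

namespace IsCorner

/-- Superadditivity and |δ| ≤ ‖·‖ make δ decrease at most at unit rate, so the open ball of radius
δ(v) about v stays in the cone. -/
theorem sub_norm_le (hc : IsCorner δ x₀ O) (v w : Fin n → ℂ) : δ v - ‖w - v‖ ≤ δ w := by
  have h1 := hc.add_le v (w - v)
  rw [add_sub_cancel] at h1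
  linarith [neg_le_of_abs_le (hc.abs_le_norm (w - v))]

theorem continuous (hc : IsCorner δ x₀ O) : Continuous δ := by
  refine (LipschitzWith.of_dist_le_mul (K := 1) fun v w => ?_).continuous
  rw [NNReal.coe_one, one_mul, Real.dist_eq, dist_eq_norm, abs_le]
  have h1 := hc.sub_norm_le v w
  have h2 := hc.sub_norm_le w v
  rw [norm_sub_rev] at h1
  constructor <;> linarith

/-- Motion in a direction ξ inside the cone increases the distance to the boundary at least
linearly; all integrations run along such lines. -/
theorem le_line (hc : IsCorner δ x₀ O) (v ξ : Fin n → ℂ) {t : ℝ} (ht : 0 ≤ t) :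
    δ v + t * δ ξ ≤ δ (v + (t : ℂ) • ξ) := by
  rw [← hc.smul t ht]; exact hc.add_le _ _

theorem eventually_lt_one (hc : IsCorner δ x₀ O) : ∀ᶠ x in 𝓝 x₀, δ (x - x₀) ≤ 1 := by
  filter_upwards [ball_mem_nhds x₀ one_pos] with x hx
  rw [mem_ball_iff_norm] at hx
  exact ((le_abs_self _).trans (hc.abs_le_norm _)).trans hx.le

/-- The functions with a pole of order at most `p` along the boundary of the cone. -/
def poleSpace (hc : IsCorner δ x₀ O) (p : ℕ) : Submodule ℂ (Hol O) where
  carrier := {f | ∃ C : ℝ, ∀ᶠ x in 𝓝 x₀, 0 < δ (x - x₀) → ‖f.toFun x‖ * δ (x - x₀) ^ p ≤ C}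
  zero_mem' := ⟨0, by simp [Hol.toFun_zero]⟩
  add_mem' := by
    rintro f g ⟨C, hC⟩ ⟨C', hC'⟩
    refine ⟨C + C', ?_⟩
    filter_upwards [hC, hC', hc.eventually_mem] with x h1 h2 hO h0
    rw [Hol.toFun_add _ _ (hO h0)]
    have := mul_le_mul_of_nonneg_right (norm_add_le (f.toFun x) (g.toFun x)) (pow_pos h0 p).le
    linarith [h1 h0, h2 h0]
  smul_mem' := by
    rintro c f ⟨C, hC⟩
    refine ⟨‖c‖ * C, ?_⟩
    filter_upwards [hC, hc.eventually_mem] with x h1 hO h0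
    rw [Hol.toFun_smul _ _ (hO h0), norm_mul, mul_assoc]
    exact mul_le_mul_of_nonneg_left (h1 h0) (norm_nonneg _)

theorem poleSpace_mono (hc : IsCorner δ x₀ O) {p q : ℕ} (h : p ≤ q) :
    hc.poleSpace p ≤ hc.poleSpace q := by
  rintro f ⟨C, hC⟩
  refine ⟨C, ?_⟩
  filter_upwards [hC, hc.eventually_lt_one] with x h1 h2 h0
  exact (mul_le_mul_of_nonneg_left (pow_le_pow_of_le_one h0.le h2 h) (norm_nonneg _)).trans (h1 h0)

theorem algebraMap_mem (hc : IsCorner δ x₀ O) (c : ℂ) (p : ℕ) :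
    algebraMap ℂ (Hol O) c ∈ hc.poleSpace p := by
  refine hc.poleSpace_mono (Nat.zero_le p) ⟨‖c‖, ?_⟩
  filter_upwards [hc.eventually_mem] with x hO h0
  rw [Hol.toFun_algebraMap _ (hO h0), pow_zero, mul_one]

theorem mul_mem (hc : IsCorner δ x₀ O) {p q : ℕ} {f g : Hol O} (hf : f ∈ hc.poleSpace p)
    (hg : g ∈ hc.poleSpace q) : f * g ∈ hc.poleSpace (p + q) := by
  obtain ⟨C, hC⟩ := hf
  obtain ⟨C', hC'⟩ := hg
  refine ⟨C * C', ?_⟩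
  filter_upwards [hC, hC', hc.eventually_mem] with x h1 h2 hO h0
  rw [Hol.toFun_mul _ _ (hO h0), norm_mul, pow_add, mul_mul_mul_comm]
  exact mul_le_mul (h1 h0) (h2 h0) (by positivity) (le_trans (by positivity) (h1 h0))

/-- Cauchy's estimate in the ball of radius δ/2, where δ remains at least half its value at the
centre. -/
theorem D_mem (hc : IsCorner δ x₀ O) {p : ℕ} {f : Hol O} (hf : f ∈ hc.poleSpace p) (i : Fin n) :
    Hol.D i f ∈ hc.poleSpace (p + 1) := by
  obtain ⟨C, hC⟩ := hf
  obtain ⟨ρ, hρ, hb⟩ := Metric.eventually_nhds_iff_ball.mp (hC.and hc.eventually_mem)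
  refine ⟨C * 2 ^ (p + 1), ?_⟩
  filter_upwards [ball_mem_nhds x₀ (half_pos hρ)] with x hx h0
  rw [mem_ball_iff_norm] at hx
  set d := δ (x - x₀) with hd
  have hdn : d ≤ ‖x - x₀‖ := (le_abs_self _).trans (hc.abs_le_norm _)
  have hsub : ∀ y ∈ closedBall x (d / 2), y ∈ ball x₀ ρ ∧ d / 2 ≤ δ (y - x₀) := by
    intro y hy
    rw [mem_closedBall_iff_norm] at hy
    constructor
    · rw [mem_ball_iff_norm]
      have := norm_sub_le_norm_sub_add_norm_sub y x x₀
      linarith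
    · have := hc.sub_norm_le (x - x₀) (y - x₀)
      rw [sub_sub_sub_cancel_right] at this
      linarith
  have hO : ∀ y ∈ closedBall x (d / 2), y ∈ O := fun y hy =>
    (hb y (hsub y hy).1).2 ((half_pos h0).trans_le (hsub y hy).2)
  have hC0 : 0 ≤ C := by
    have hxx := hsub x (mem_closedBall_self (half_pos h0).le)
    exact le_trans (by positivity) ((hb x hxx.1).1 h0)
  have h1 := norm_pderivFun_le (half_pos h0) (f.analyticOnNhd.mono hO) (C := C / (d / 2) ^ p)
    (fun y hy => by
      have h2 := (hb y (hsub y hy).1).1 ((half_pos h0).trans_le (hsub y hy).2)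
      rw [le_div_iff₀ (by positivity)]
      exact (mul_le_mul_of_nonneg_left (pow_le_pow_left₀ (half_pos h0).le (hsub y hy).2 p)
        (norm_nonneg _)).trans h2) i
  rw [Hol.toFun_D _ _ (hO x (mem_closedBall_self (half_pos h0).le))]
  calc ‖pderivFun i f.toFun x‖ * d ^ (p + 1) ≤ C / (d / 2) ^ p / (d / 2) * d ^ (p + 1) := by gcongr
    _ = C * 2 ^ (p + 1) := by
      rw [pow_succ, pow_succ, div_pow]; field_simp

/-- Integration along a ray in the cone. -/
theorem mem_of_fderiv (hc : IsCorner δ x₀ O) {p : ℕ} {f b : Hol O}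
    (hb : b ∈ hc.poleSpace (p + 2)) {ξ : Fin n → ℂ} (hξ : 0 < δ ξ)
    (hd : ∀ x ∈ O, fderiv ℂ f.toFun x ξ = b.toFun x) : f ∈ hc.poleSpace (p + 1) := by
  obtain ⟨C, hC⟩ := hb
  obtain ⟨ρ, hρ, hbρ⟩ := Metric.eventually_nhds_iff_ball.mp (hC.and hc.eventually_mem)
  obtain ⟨s, hs, hsξ⟩ : ∃ s : ℝ, 0 < s ∧ s * ‖ξ‖ < ρ / 2 := by
    have h1 : 0 < ‖ξ‖ + 1 := by positivity
    refine ⟨ρ / 2 / (‖ξ‖ + 1), by positivity, ?_⟩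
    rw [div_mul_eq_mul_div, div_lt_iff₀ h1]
    nlinarith
  set c := s * δ ξ with hcdef
  have hc0 : 0 < c := by positivity
  have hline : ∀ x ∈ ball x₀ (ρ / 2), 0 < δ (x - x₀) → ∀ t ∈ Icc (0 : ℝ) 1,
      x + ((t * s : ℝ) : ℂ) • ξ ∈ ball x₀ ρ ∧
        δ (x - x₀) + c * t ≤ δ (x + ((t * s : ℝ) : ℂ) • ξ - x₀) := by
    intro x hx h0 t ht
    constructor
    · rw [mem_ball_iff_norm] at hx ⊢
      have h2 : ‖((t * s : ℝ) : ℂ) • ξ‖ ≤ s * ‖ξ‖ := by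
        rw [norm_smul, Complex.norm_real, Real.norm_of_nonneg (mul_nonneg ht.1 hs.le)]
        have : t * s ≤ 1 * s := mul_le_mul_of_nonneg_right ht.2 hs.le
        exact mul_le_mul_of_nonneg_right (by linarith) (norm_nonneg _)
      have h3 := norm_add_le (x - x₀) (((t * s : ℝ) : ℂ) • ξ)
      rw [show x + ((t * s : ℝ) : ℂ) • ξ - x₀ = x - x₀ + ((t * s : ℝ) : ℂ) • ξ by abel]
      linarith
    · have := hc.le_line (x - x₀) ξ (mul_nonneg ht.1 hs.le)
      rw [show x + ((t * s : ℝ) : ℂ) • ξ - x₀ = x - x₀ + ((t * s : ℝ) : ℂ) • ξ by abel]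
      rw [hcdef]; linarith
  have hend : x₀ + (s : ℂ) • ξ ∈ O := by
    have h2 : δ ((s : ℂ) • ξ) = s * δ ξ := hc.smul s hs.le ξ
    refine (hbρ _ ?_).2 ?_
    · rw [mem_ball_iff_norm, add_sub_cancel_left, norm_smul, Complex.norm_real,
        Real.norm_of_nonneg hs.le]
      linarith
    · rw [add_sub_cancel_left, h2]; positivity
  have hM : ∀ᶠ x in 𝓝 x₀, ‖f.toFun (x + (s : ℂ) • ξ)‖ ≤ ‖f.toFun (x₀ + (s : ℂ) • ξ)‖ + 1 := by
    have h3 : ContinuousAt (fun x => ‖f.toFun (x + (s : ℂ) • ξ)‖) x₀ :=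
      (ContinuousAt.comp (g := f.toFun) (f := fun x => x + (s : ℂ) • ξ)
        (f.analyticOnNhd _ hend).continuousAt (by fun_prop)).norm
    exact (h3.eventually_lt_const (lt_add_one _)).mono fun x hx => hx.le
  set M := ‖f.toFun (x₀ + (s : ℂ) • ξ)‖ + 1
  -- Chosen so that K (d + c(1-t))^{-(p+1)} has derivative s C (d + c(1-t))^{-(p+2)}, the bound for
  -- the derivative along the path.
  set K := s * C / ((p + 1) * c) with hK
  refine ⟨M + K, ?_⟩
  filter_upwards [hM, ball_mem_nhds x₀ (half_pos hρ), hc.eventually_lt_one] with x hxM hx hx1 h0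
  set d := δ (x - x₀) with hdd
  have hxl := hline x hx h0
  have hpos : ∀ t ∈ Icc (0 : ℝ) 1, 0 < d + c * (1 - t) := fun t ht => by
    have : 0 ≤ c * (1 - t) := mul_nonneg hc0.le (by linarith [ht.2])
    linarith
  have hm : ∀ t ∈ Icc (0 : ℝ) 1, 1 - t ∈ Icc (0 : ℝ) 1 := fun t ht => ⟨by linarith [ht.2], by linarith [ht.1]⟩
  have hCn : 0 ≤ C := le_trans (by positivity)
    ((hbρ x (ball_subset_ball (by linarith) hx)).1 h0)
  -- The path runs from x + sξ, near an interior point of the cone where f is bounded independently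
  -- of x, to x itself.
  let γ : ℝ → Fin n → ℂ := fun t => x + (((1 - t) * s : ℝ) : ℂ) • ξ
  have hγO : ∀ t ∈ Icc (0 : ℝ) 1, γ t ∈ O ∧ ‖b.toFun (γ t)‖ ≤ C / (d + c * (1 - t)) ^ (p + 2) := by
    intro t ht
    obtain ⟨h4, h5⟩ := hxl (1 - t) (hm t ht)
    have h6 := (hpos t ht).trans_le h5
    refine ⟨(hbρ _ h4).2 h6, ?_⟩
    rw [le_div_iff₀ (pow_pos (hpos t ht) _)]
    exact (mul_le_mul_of_nonneg_left (pow_le_pow_left₀ (hpos t ht).le h5 _) (norm_nonneg _)).trans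
      ((hbρ _ h4).1 h6)
  have hγd : ∀ t ∈ Icc (0 : ℝ) 1, HasDerivAt (fun t => f.toFun (γ t)) (-(s : ℂ) * b.toFun (γ t)) t := by
    intro t ht
    have h7 : HasDerivAt γ (-(s : ℂ) • ξ) t := by
      have h8 : HasDerivAt (fun t : ℝ => (((1 - t) * s : ℝ) : ℂ)) (-(s : ℂ)) t := by
        have := (((hasDerivAt_id t).const_sub 1).mul_const s).ofReal_comp
        simpa using this
      exact (h8.smul_const ξ).const_add x
    have h9 : HasFDerivAt f.toFun ((fderiv ℂ f.toFun (γ t)).restrictScalars ℝ) (γ t) :=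
      (f.analyticOnNhd _ (hγO t ht).1).differentiableAt.hasFDerivAt.restrictScalars ℝ
    have := h9.comp_hasDerivAt t h7
    rw [ContinuousLinearMap.coe_restrictScalars', map_smul, hd _ (hγO t ht).1, smul_eq_mul] at this
    exact this
  have hBd : ∀ t ∈ Icc (0 : ℝ) 1, HasDerivAt (fun t => M + K * ((d + c * (1 - t)) ^ (p + 1))⁻¹)
      (s * (C / (d + c * (1 - t)) ^ (p + 2))) t := by
    intro t ht
    have h7 : HasDerivAt (fun t : ℝ => d + c * (1 - t)) (-c) t := by
      have := (((hasDerivAt_id t).const_sub 1).const_mul c).const_add d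
      simpa using this
    have h8 := (((h7.pow (p + 1)).inv (pow_pos (hpos t ht) _).ne').const_mul K).const_add M
    refine h8.congr_deriv ?_
    have := (hpos t ht).ne'
    rw [hK]
    simp only [Pi.pow_apply]
    push_cast
    field_simp
    ring
  have key := image_norm_le_of_norm_deriv_right_le_deriv_boundary' (a := 0) (b := 1)
    (f := fun t => f.toFun (γ t)) (f' := fun t => -(s : ℂ) * b.toFun (γ t))
    (B := fun t => M + K * ((d + c * (1 - t)) ^ (p + 1))⁻¹)
    (B' := fun t => s * (C / (d + c * (1 - t)) ^ (p + 2)))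
    (fun t ht => (hγd t ht).continuousAt.continuousWithinAt)
    (fun t ht => (hγd t (Ico_subset_Icc_self ht)).hasDerivWithinAt) (by
      have : 0 ≤ K * ((d + c * (1 - 0)) ^ (p + 1))⁻¹ := by
        have := hpos 0 (by simp)
        positivity
      have h10 : γ 0 = x + (s : ℂ) • ξ := by simp [γ]
      rw [h10]; linarith)
    (fun t ht => (hBd t ht).continuousAt.continuousWithinAt)
    (fun t ht => (hBd t (Ico_subset_Icc_self ht)).hasDerivWithinAt)
    (fun t ht => by
      rw [norm_mul, norm_neg, Complex.norm_real, Real.norm_of_nonneg hs.le]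
      exact mul_le_mul_of_nonneg_left (hγO t (Ico_subset_Icc_self ht)).2 hs.le)
    (right_mem_Icc.mpr zero_le_one)
  have h10 : γ 1 = x := by simp [γ]
  simp only [h10, sub_self, mul_zero, add_zero] at key
  have hM0 : 0 ≤ M := by positivity
  calc ‖f.toFun x‖ * d ^ (p + 1) ≤ (M + K * (d ^ (p + 1))⁻¹) * d ^ (p + 1) := by gcongr
    _ = M * d ^ (p + 1) + K := by field_simp
    _ ≤ M * 1 + K := by gcongr; exact pow_le_one₀ h0.le hx1
    _ = M + K := by rw [mul_one]

/-- Symbols of weight at most `e`, a coefficient of `∂^k` having a pole of order at most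
`e - |k|`. -/
def symbolSpace (hc : IsCorner δ x₀ O) (e : ℕ) : Submodule ℂ (MvPolynomial (Fin n) (Hol O)) where
  carrier := {P | ∀ k, P.coeff k ∈ hc.poleSpace (e - k.degree) ∧ (e < k.degree → P.coeff k = 0)}
  zero_mem' k := by simp
  add_mem' hP hQ k := ⟨by rw [coeff_add]; exact add_mem (hP k).1 (hQ k).1,
    fun h => by rw [coeff_add, (hP k).2 h, (hQ k).2 h, add_zero]⟩
  smul_mem' c P hP k := ⟨by rw [coeff_smul]; exact Submodule.smul_mem _ c (hP k).1,
    fun h => by rw [coeff_smul, (hP k).2 h, smul_zero]⟩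

theorem symbolSpace_mono (hc : IsCorner δ x₀ O) {e e' : ℕ} (h : e ≤ e') :
    hc.symbolSpace e ≤ hc.symbolSpace e' := fun _ hP k =>
  ⟨hc.poleSpace_mono (by omega) (hP k).1, fun h' => (hP k).2 (by omega)⟩

theorem monomial_mem (hc : IsCorner δ x₀ O) {p : ℕ} {a : Hol O} (ha : a ∈ hc.poleSpace p)
    (k : Fin n →₀ ℕ) {e : ℕ} (h : k.degree + p ≤ e) : monomial k a ∈ hc.symbolSpace e := by
  classical
  intro l
  rw [coeff_monomial]
  split_ifs with hl
  · subst hl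
    exact ⟨hc.poleSpace_mono (by omega) ha, fun h' => by omega⟩
  · simp

theorem induction_symbolSpace (hc : IsCorner δ x₀ O) {e : ℕ}
    {T : Submodule ℂ (MvPolynomial (Fin n) (Hol O))}
    (h : ∀ k : Fin n →₀ ℕ, k.degree ≤ e → ∀ a ∈ hc.poleSpace (e - k.degree), monomial k a ∈ T)
    {P : MvPolynomial (Fin n) (Hol O)} (hP : P ∈ hc.symbolSpace e) : P ∈ T := by
  rw [← support_sum_monomial_coeff P]
  refine sum_mem fun k hk => h k ?_ _ (hP k).1
  by_contra hlt
  exact mem_support_iff.mp hk ((hP k).2 (by omega))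

theorem coeffMap_D_mem (hc : IsCorner δ x₀ O) {e : ℕ} {P : MvPolynomial (Fin n) (Hol O)}
    (hP : P ∈ hc.symbolSpace e) (i : Fin n) :
    coeffMap (Hol.D i).toLinearMap P ∈ hc.symbolSpace (e + 1) := by
  intro k
  rw [coeff_coeffMap]
  constructor
  · by_cases hk : e < k.degree
    · rw [(hP k).2 hk, map_zero]; exact zero_mem _
    · exact hc.poleSpace_mono (by omega) (hc.D_mem (hP k).1 i)
  · intro hk
    rw [(hP k).2 (by omega), map_zero]

theorem smul_mem (hc : IsCorner δ x₀ O) {e p : ℕ} {P : MvPolynomial (Fin n) (Hol O)}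
    (hP : P ∈ hc.symbolSpace e) {a : Hol O} (ha : a ∈ hc.poleSpace p) :
    a • P ∈ hc.symbolSpace (e + p) := by
  intro k
  rw [coeff_smul, smul_eq_mul]
  constructor
  · by_cases hk : e < k.degree
    · rw [(hP k).2 hk, mul_zero]; exact zero_mem _
    · exact hc.poleSpace_mono (by omega) (hc.mul_mem ha (hP k).1)
  · intro hk
    rw [(hP k).2 (by omega), mul_zero]

theorem X_mul_mem (hc : IsCorner δ x₀ O) {e : ℕ} {P : MvPolynomial (Fin n) (Hol O)}
    (hP : P ∈ hc.symbolSpace e) (i : Fin n) : X i * P ∈ hc.symbolSpace (e + 1) := by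
  refine hc.induction_symbolSpace
    (T := (hc.symbolSpace (e + 1)).comap (LinearMap.mulLeft ℂ (X i))) (fun k hk a ha => ?_) hP
  rw [Submodule.mem_comap, LinearMap.mulLeft_apply, X, monomial_mul, one_mul]
  exact hc.monomial_mem ha _ (by simp; omega)

theorem nabla_mem (hc : IsCorner δ x₀ O) {e : ℕ} {P : MvPolynomial (Fin n) (Hol O)}
    (hP : P ∈ hc.symbolSpace e) (i : Fin n) :
    (symbolConnection Hol.D Hol.D_comm).nabla i P ∈ hc.symbolSpace (e + 1) := by
  rw [symbol_nabla]
  exact add_mem (hc.coeffMap_D_mem hP i) (hc.X_mul_mem hP i)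

theorem deriv_mem (hc : IsCorner δ x₀ O) {e : ℕ} {P : MvPolynomial (Fin n) (Hol O)}
    (hP : P ∈ hc.symbolSpace e) (k : Fin n →₀ ℕ) :
    (symbolConnection Hol.D Hol.D_comm).deriv k P ∈ hc.symbolSpace (e + k.degree) := by
  induction k using exponent_induction with
  | zero => simpa using hP
  | step k i ih =>
    rw [Connection.deriv_add_single, map_add, Finsupp.degree_single, ← add_assoc]
    exact hc.nabla_mem ih i

theorem act_mem (hc : IsCorner δ x₀ O) {e d : ℕ} {P l : MvPolynomial (Fin n) (Hol O)}
    (hP : P ∈ hc.symbolSpace e) (hl : l ∈ hc.symbolSpace d) :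
    (symbolConnection Hol.D Hol.D_comm).act P l ∈ hc.symbolSpace (e + d) := by
  refine hc.induction_symbolSpace (T := (hc.symbolSpace (e + d)).comap
    (((symbolConnection Hol.D Hol.D_comm).act P).restrictScalars ℂ)) (fun k hk a ha => ?_) hl
  rw [Submodule.mem_comap, LinearMap.restrictScalars_apply, Connection.act_monomial]
  exact hc.symbolSpace_mono (by omega) (hc.smul_mem (hc.deriv_mem hP k) ha)

/-- Differentiating a coefficient costs one order of pole and multiplication by u costs two, so the
defect raises the weight by at most two. -/
theorem commDefect_mem (hc : IsCorner δ x₀ O) {u : Hol O} (hu : u ∈ hc.poleSpace 2) {e : ℕ}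
    {P : MvPolynomial (Fin n) (Hol O)} (hP : P ∈ hc.symbolSpace e) :
    commDefect Hol.D_comm u P ∈ hc.symbolSpace (e + 2) := by
  refine sub_mem (sub_mem ?_ ?_) (sum_mem fun j _ => hc.coeffMap_D_mem (hc.coeffMap_D_mem hP j) j)
  · rw [← smul_eq_C_mul]; exact hc.smul_mem hP hu
  · rw [add_comm]
    exact hc.act_mem (hc.monomial_mem hu 0 (by simp)) hP

theorem evalAt_homogeneousComponent_mem (hc : IsCorner δ x₀ O) {e : ℕ}
    {P : MvPolynomial (Fin n) (Hol O)} (hP : P ∈ hc.symbolSpace e) (r : ℕ) (ξ : Fin n → ℂ) :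
    evalAt ξ (homogeneousComponent r P) ∈ hc.poleSpace (e - r) := by
  rw [homogeneousComponent_apply, map_sum]
  refine sum_mem fun k hk => ?_
  rw [evalAt_monomial, mul_comm, ← Algebra.smul_def]
  rw [← (Finset.mem_filter.mp hk).2]
  exact Submodule.smul_mem _ _ (hP k).1

/-- The order of the poles of an operator that commutes with `-Δ + u`. -/
theorem mem_symbolSpace (hc : IsCorner δ x₀ O) {u : Hol O} (hu : u ∈ hc.poleSpace 2) {d : ℕ}
    {P : MvPolynomial (Fin n) (Hol O)}
    (hcomm : (symbolConnection Hol.D Hol.D_comm).act (-(∑ j, X j ^ 2) + C u) P =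
      (symbolConnection Hol.D Hol.D_comm).act P (-(∑ j, X j ^ 2) + C u)) :
    ∀ r ≤ d, ∀ M ∈ hc.symbolSpace d, P - M ∈ degLT (Hol O) n r → P ∈ hc.symbolSpace d
  | 0, _, M, hM, h => by rwa [sub_eq_zero.mp (degLT_zero h)]
  | r + 1, hr, M, hM, h => by
    have h1 : ∀ k ∈ P.support.filter fun k => k.degree = r, P.coeff k ∈ hc.poleSpace (d - r) := by
      -- The directions inside the cone form the nonempty open set on which the integration below is
      -- possible.
      refine mem_of_forall_sum_smul_mem (hc.poleSpace (d - r)) _ (fun k => P.coeff k)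
        (V := {ξ | 0 < δ ξ}) (isOpen_lt continuous_const hc.continuous) hc.exists_pos fun ξ hξ => ?_
      have h2 : ∑ k ∈ P.support with k.degree = r, (∏ i, ξ i ^ k i) • P.coeff k =
          evalAt ξ (homogeneousComponent r P) := by
        rw [homogeneousComponent_apply, map_sum]
        refine Finset.sum_congr rfl fun k _ => ?_
        rw [evalAt_monomial, mul_comm, ← Algebra.smul_def]
      rw [h2]
      -- The defect has weight d + 2, so its part of degree r + 1 has poles of order at most d - r +
      -- 1, and integration lowers this to d - r. As r < d, the order before integration is at least
      -- two and no logarithm arises.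
      obtain ⟨p, hp⟩ : ∃ p, d - r = p + 1 := ⟨d - r - 1, by omega⟩
      rw [hp]
      have h3 : (2⁻¹ : ℂ) • evalAt ξ (homogeneousComponent (r + 1) (commDefect Hol.D_comm u M)) ∈
          hc.poleSpace (p + 2) := by
        have := hc.evalAt_homogeneousComponent_mem (hc.commDefect_mem hu hM) (r + 1) ξ
        rw [show d + 2 - (r + 1) = p + 2 by omega] at this
        exact Submodule.smul_mem _ _ this
      refine hc.mem_of_fderiv h3 hξ fun x hx => ?_
      have h4 := two_mul_sum_D_evalAt Hol.D_comm u P hcomm r ξ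
      have h5 := commDefect_mem_degLT Hol.D_comm u h
      rw [commDefect_sub] at h5
      rw [homogeneousComponent_congr h5] at h4
      rw [← h4, Hol.toFun_smul _ _ hx, fderiv_apply_eq_sum]
      have h6 : (2 : Hol O) = algebraMap ℂ (Hol O) 2 := (map_ofNat _ 2).symm
      rw [h6, Hol.toFun_mul _ _ hx, Hol.toFun_algebraMap _ hx, inv_mul_cancel_left₀ two_ne_zero,
        Hol.toFun_sum _ _ hx]
      refine Finset.sum_congr rfl fun j _ => ?_
      rw [Hol.toFun_mul _ _ hx, Hol.toFun_algebraMap _ hx, Hol.toFun_D _ _ hx]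
    refine hc.mem_symbolSpace hu hcomm r (by omega)
      (M - homogeneousComponent r M + homogeneousComponent r P)
      (add_mem (sub_mem hM fun k => ?_) ?_) fun k hk => ?_
    · rw [coeff_homogeneousComponent]
      split_ifs
      · exact hM k
      · simp
    · rw [homogeneousComponent_apply]
      refine sum_mem fun k hk => ?_
      have hk2 := (Finset.mem_filter.mp hk).2
      exact hc.monomial_mem (h1 k hk) k (by omega)
    · simp only [coeff_sub, coeff_add, coeff_homogeneousComponent]
      rcases hk.lt_or_eq with hk | hk
      · have := h k hk
        rw [coeff_sub] at this
        simpa [hk.ne'] using this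
      · simp [hk]

theorem map_algebraMap_mem (hc : IsCorner δ x₀ O) {d : ℕ} {q : MvPolynomial (Fin n) ℂ}
    (hq : q.IsHomogeneous d) : map (algebraMap ℂ (Hol O)) q ∈ hc.symbolSpace d := by
  intro k
  rw [coeff_map]
  refine ⟨hc.algebraMap_mem _ _, fun h => ?_⟩
  rw [hq.coeff_eq_zero h.ne', map_zero]

end IsCorner

end SeveralComplex
end

noncomputable section

/-! ### Moderate growth of solutions in a cone -/

namespace SeveralComplex

open Set Metric Filter TopologicalSpace LameOperators SymbolCalculus MvPolynomial
open HomogeneousParameters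

/-- Gronwall's inequality for a system with a simple pole, the components being weighted by powers
of the distance to the pole. -/
theorem weighted_gronwall {I : Type*} [Fintype I] {d : I → ℕ} {D N : ℕ} (hd : ∀ j, d j ≤ D)
    {a a' : I → ℝ → ℂ} {S c A B : ℝ} (hS : 0 < S) (hc : 0 < c) (hA : 0 ≤ A) (hB : 0 ≤ B)
    (hN : D + B / c ≤ N) (ha : ∀ t ∈ Icc (0 : ℝ) 1, ∀ j, HasDerivAt (a j) (a' j t) t)
    (hb : ∀ t ∈ Icc (0 : ℝ) 1, ∀ M, (∀ j, (S + c * t) ^ d j * ‖a j t‖ ≤ M) →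
      ∀ j, (S + c * t) ^ (d j + 1) * ‖a' j t‖ ≤ B * M)
    (h1 : ∀ j, (S + c) ^ d j * ‖a j 1‖ ≤ A) (j : I) :
    S ^ d j * ‖a j 0‖ ≤ A * ((S + c) / S) ^ N := by
  set T := S + c with hT
  have hT0 : 0 < T := by positivity
  -- The distance s = S + ct is reparametrized as Te^{-σ}. In the logarithmic time σ the simple pole
  -- disappears and the functions s^{d_j} a_j satisfy a linear inequality with constant coefficient.
  let s : ℝ → ℝ := fun σ => T * Real.exp (-σ)
  let t : ℝ → ℝ := fun σ => (s σ - S) / c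
  have hst : ∀ σ, S + c * t σ = s σ := fun σ => by simp only [t]; field_simp; ring
  have hs0 : ∀ σ, 0 < s σ := fun σ => by positivity
  set L := Real.log (T / S) with hL
  have hL0 : 0 ≤ L := Real.log_nonneg (by rw [le_div_iff₀ hS]; linarith)
  have hsL : s L = S := by
    simp only [s, hL, Real.exp_neg, Real.exp_log (div_pos hT0 hS)]; field_simp
  have hs1 : s 0 = T := by simp [s]
  have hanti : Antitone s := fun x y hxy => by
    simp only [s]; gcongr
  have ht : ∀ σ ∈ Icc 0 L, t σ ∈ Icc (0 : ℝ) 1 := by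
    intro σ hσ
    have h2 : S ≤ s σ := hsL ▸ hanti hσ.2
    have h3 : s σ ≤ T := hs1 ▸ hanti hσ.1
    exact ⟨div_nonneg (by linarith) hc.le, by simp only [t]; rw [div_le_one hc]; linarith⟩
  have hsd : ∀ σ, HasDerivAt s (-s σ) σ := fun σ => by
    have := ((hasDerivAt_neg σ).exp).const_mul T
    simpa [s] using this
  have htd : ∀ σ, HasDerivAt t (-s σ / c) σ := fun σ => ((hsd σ).sub_const S).div_const c
  let f : ℝ → I → ℂ := fun σ j => ((s σ ^ d j : ℝ) : ℂ) * a j (t σ)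
  let f' : ℝ → I → ℂ := fun σ j => ((-(d j) * s σ ^ d j : ℝ) : ℂ) * a j (t σ) +
    ((s σ ^ d j : ℝ) : ℂ) * (((-s σ / c : ℝ) : ℂ) * a' j (t σ))
  have hf : ∀ σ ∈ Icc 0 L, HasDerivAt f (f' σ) σ := by
    intro σ hσ
    refine hasDerivAt_pi.mpr fun j => ?_
    have h2 : HasDerivAt (fun σ => s σ ^ d j) (-(d j) * s σ ^ d j) σ := by
      refine ((hsd σ).pow (d j)).congr_deriv ?_
      rcases Nat.eq_zero_or_pos (d j) with h | h
      · simp [h]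
      · rw [mul_neg, mul_assoc, ← pow_succ, Nat.sub_add_cancel h, neg_mul]
    have h3 := (ha (t σ) (ht σ hσ) j).scomp σ (htd σ)
    exact h2.ofReal_comp.mul h3
  -- D comes from differentiating the weights s^{d_j}, and B/c from the system, c being the speed of
  -- s.
  set K : ℝ := D + B / c with hK
  have hK0 : 0 ≤ K := by positivity
  have hbound : ∀ σ ∈ Ico 0 L, ‖f' σ‖ ≤ K * ‖f σ‖ + 0 := by
    intro σ hσ
    have hσ' := Ico_subset_Icc_self hσ
    rw [add_zero, pi_norm_le_iff_of_nonneg (by positivity)]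
    intro j
    have hc1 : ∀ j, (S + c * t σ) ^ d j * ‖a j (t σ)‖ ≤ ‖f σ‖ := by
      intro j
      refine le_trans (le_of_eq ?_) (norm_le_pi_norm (f σ) j)
      rw [hst, norm_mul, Complex.norm_real, Real.norm_of_nonneg (pow_pos (hs0 σ) _).le]
    have h4 := hb (t σ) (ht σ hσ') _ hc1 j
    have h5 := hc1 j
    rw [hst] at h4 h5
    have hdj : (d j : ℝ) ≤ D := by exact_mod_cast hd j
    calc ‖f' σ j‖ ≤ d j * (s σ ^ d j * ‖a j (t σ)‖) + s σ ^ (d j + 1) * ‖a' j (t σ)‖ / c := by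
          refine (norm_add_le _ _).trans (le_of_eq ?_)
          simp only [norm_mul, Complex.norm_real, norm_neg, norm_div, norm_pow, Real.norm_natCast,
            Real.norm_of_nonneg (hs0 σ).le, Real.norm_of_nonneg hc.le, pow_succ]
          ring
      _ ≤ D * ‖f σ‖ + B * ‖f σ‖ / c := by gcongr
      _ = K * ‖f σ‖ := by rw [hK]; ring
  have h0 : ‖f 0‖ ≤ A := by
    rw [pi_norm_le_iff_of_nonneg hA]
    intro j
    have h6 : t 0 = 1 := by simp only [t, hs1, hT]; field_simp; ring
    have := h1 j
    simp only [f, norm_mul, Complex.norm_real, hs1, h6, norm_pow, Real.norm_of_nonneg hT0.le]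
    exact this
  have key := norm_le_gronwallBound_of_norm_deriv_right_le (f := f) (f' := f') (δ := A) (K := K)
    (ε := 0) (a := 0) (b := L) (fun σ hσ => (hf σ hσ).continuousAt.continuousWithinAt)
    (fun σ hσ => (hf σ (Ico_subset_Icc_self hσ)).hasDerivWithinAt) h0 hbound L
    (right_mem_Icc.mpr hL0)
  rw [gronwallBound_ε0, sub_zero] at key
  have h7 : t L = 0 := by simp only [t, hsL, sub_self, zero_div]
  have h8 := (norm_le_pi_norm (f L) j).trans key
  simp only [f, norm_mul, Complex.norm_real, hsL, h7, norm_pow, Real.norm_of_nonneg hS.le] at h8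
  refine h8.trans (mul_le_mul_of_nonneg_left ?_ hA)
  have h9 : Real.exp (K * L) ≤ Real.exp (N * L) := by gcongr
  refine h9.trans (le_of_eq ?_)
  rw [Real.exp_nat_mul, hL, Real.exp_log (div_pos hT0 hS)]

variable {n : ℕ} {O : Opens (Fin n → ℂ)} {δ : (Fin n → ℂ) → ℝ} {x₀ : Fin n → ℂ}
  {s : Fin n → MvPolynomial (Fin n) ℂ} {l : Fin n → MvPolynomial (Fin n) (Hol O)}

/-- The derivatives of high order of the solutions. -/
theorem IsHolonomic.exists_deriv_eq (hS : IsHolonomic s l) (hc : IsCorner δ x₀ O)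
    (hl : ∀ i, l i ∈ hc.symbolSpace (s i).totalDegree) (lam : Fin n → ℂ) {k : Fin n →₀ ℕ}
    (hk : monomial k (1 : ℂ) ∈ paramIdeal s) :
    ∃ m ∈ hc.symbolSpace k.degree, m ∈ degLT (Hol O) n k.degree ∧
      ∀ {U : Opens (Fin n → ℂ)} (h : U ≤ O), ∀ ψ ∈ Sol l lam h,
        (Sec.conn h).deriv k ψ = (Sec.conn h).act ψ m := by
  obtain ⟨y, hy, hyd⟩ := exists_homogeneousComponent_of_mem hS.homogeneous hk k.degree
  rw [homogeneousComponent_of_mem (isHomogeneous_monomial (1 : ℂ) rfl), if_pos rfl] at hy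
  let Y : Fin n → MvPolynomial (Fin n) (Hol O) := fun i =>
    MvPolynomial.map (algebraMap ℂ (Hol O)) (y i)
  have hY : monomial k (1 : Hol O) = ∑ i, map (algebraMap ℂ (Hol O)) (s i) * Y i := by
    have := congrArg (MvPolynomial.map (algebraMap ℂ (Hol O))) hy
    rw [map_monomial, map_one, map_sum] at this
    simpa only [map_mul] using this
  have hcase : ∀ i, (s i).totalDegree ≤ k.degree ∧
      (y i).IsHomogeneous (k.degree - (s i).totalDegree) ∨ Y i = 0 := by
    intro i
    by_cases h : (s i).totalDegree ≤ k.degree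
    · exact Or.inl ⟨h, (hyd i).1 h⟩
    · right; simp only [Y, (hyd i).2 h, map_zero]
  -- With ξ^k = Σ s_i y_i, subtracting Σ Y_i (l_i - λ_i) does not change the action on solutions and
  -- removes the leading symbol. Every term has weight at most |k|, so the pole orders remain under
  -- control.
  refine ⟨monomial k 1 - ∑ i, (symbolConnection Hol.D Hol.D_comm).act (l i) (Y i) +
    ∑ i, lam i • Y i, ?_, ?_, fun {U} h ψ hψ => ?_⟩
  · refine add_mem (sub_mem ?_ (sum_mem fun i _ => ?_)) (sum_mem fun i _ => ?_)
    · have := hc.algebraMap_mem 1 0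
      rw [map_one] at this
      exact hc.monomial_mem this k le_rfl
    · rcases hcase i with ⟨h1, h2⟩ | h0
      · exact hc.symbolSpace_mono (by omega) (hc.act_mem (hl i) (hc.map_algebraMap_mem h2))
      · rw [h0, map_zero]; exact zero_mem _
    · rcases hcase i with ⟨h1, h2⟩ | h0
      · exact Submodule.smul_mem _ _ (hc.symbolSpace_mono (by omega) (hc.map_algebraMap_mem h2))
      · rw [h0, smul_zero]; exact zero_mem _
  · rw [hY, ← Finset.sum_sub_distrib]
    refine add_mem (sum_mem fun i _ => ?_) (sum_mem fun i _ => ?_)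
    · rcases hcase i with ⟨h1, h2⟩ | h0
      · rw [← neg_sub]
        refine neg_mem (degLT_mono ?_ (symbol_act_sub_mem Hol.D_comm
          (map_mem_degLT (hS.homogeneous i)) (hS.symbol i) (map_mem_degLT h2)))
        omega
      · rw [h0, map_zero, mul_zero, sub_zero]; exact zero_mem _
    · rcases hcase i with ⟨h1, h2⟩ | h0
      · have h3 : lam i • Y i = algebraMap ℂ (Hol O) (lam i) • Y i := (algebraMap_smul _ _ _).symm
        rw [h3]
        refine Submodule.smul_mem _ _ (degLT_mono ?_ (map_mem_degLT h2))
        have := hS.pos i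
        omega
      · rw [h0, smul_zero]; exact zero_mem _
  · have h6 : ∀ i f, (Sec.conn h).act ψ (lam i • f) = lam i • (Sec.conn h).act ψ f := fun i f => by
      rw [← algebraMap_smul (Hol O) (lam i) f, map_smul, algebraMap_smul]
    simp only [map_add, map_sub, map_sum, Connection.act_monomial, one_smul, ← act_act, hψ _, h6,
      Connection.act_smul_left, sub_add_cancel]

/-- Solutions have moderate growth at the vertex of a cone. -/
theorem IsHolonomic.exists_growth (hS : IsHolonomic s l) (hc : IsCorner δ x₀ O)
    (hl : ∀ i, l i ∈ hc.symbolSpace (s i).totalDegree) {lam : Fin n → ℂ} (k : Fin n →₀ ℕ)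
    {Q : Opens (Fin n → ℂ)} (h : Q ≤ O) (hQ : ∀ᶠ x in 𝓝 x₀, 0 < δ (x - x₀) → x ∈ Q)
    {ψ : Sec h} (hψ : ψ ∈ Sol l lam h) :
    ∃ (C : ℝ) (K : ℕ), ∀ᶠ x in 𝓝 x₀, 0 < δ (x - x₀) →
      ‖partialDeriv k ψ.toFun x‖ * δ (x - x₀) ^ K ≤ C := by
  classical
  obtain ⟨M, hM⟩ := exists_X_pow_mem hS.homogeneous hS.finite
  -- All monomials of degree D lie in the ideal, so the derivatives of order D are combinations of
  -- those of lower order j, with poles of order at most D - |j|. The unknowns are all derivatives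
  -- of order below D, among them ∂^kψ, the one of index j being weighted by the distance to the
  -- power |j|.
  obtain ⟨D, hkD, hD⟩ : ∃ D, k.degree < D ∧ ∀ k' : Fin n →₀ ℕ, k'.degree = D →
      monomial k' (1 : ℂ) ∈ paramIdeal s :=
    ⟨max (n * M + 1) (k.degree + 1), by omega, fun k' hk' => monomial_mem_of_degree hM (by omega)⟩
  have hfin : {k : Fin n →₀ ℕ | k.degree < D}.Finite :=
    (Finsupp.finite_of_degree_le D).subset fun k hk => by
      simp only [mem_setOf_eq] at hk ⊢; omega
  let I := hfin.toFinset
  have hI : ∀ k', k' ∈ I ↔ k'.degree < D := fun k' => by simp [I]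
  choose! m hm1 hm2 hm3 using fun k' (hk' : k'.degree = D) =>
    hS.exists_deriv_eq hc hl lam (hD k' hk')
  let a : (Fin n →₀ ℕ) → (Fin n → ℂ) → ℂ := fun k' => ((Sec.conn h).deriv k' ψ).toFun
  have hak : ∀ k', AnalyticOnNhd ℂ (a k') Q := fun k' => ((Sec.conn h).deriv k' ψ).analyticOnNhd
  let B : Finset ((Fin n →₀ ℕ) × Fin n × (Fin n →₀ ℕ)) := I ×ˢ Finset.univ ×ˢ I
  have hcoef : ∀ t ∈ B, ∃ C : ℝ, t.1.degree + 1 = D → ∀ᶠ x in 𝓝 x₀, 0 < δ (x - x₀) →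
      ‖((m (t.1 + Finsupp.single t.2.1 1)).coeff t.2.2).toFun x‖ *
        δ (x - x₀) ^ (D - t.2.2.degree) ≤ C := by
    intro t _
    by_cases ht : t.1.degree + 1 = D
    · have ht' : (t.1 + Finsupp.single t.2.1 1).degree = D := by simpa using ht
      obtain ⟨C, hC⟩ := (hm1 _ ht' t.2.2).1
      rw [ht'] at hC
      exact ⟨C, fun _ => hC⟩
    · exact ⟨0, fun h => absurd h ht⟩
  choose! C hC using hcoef
  set C₀ := ∑ t ∈ B, |C t| with hC₀
  have hC₀0 : 0 ≤ C₀ := Finset.sum_nonneg fun _ _ => abs_nonneg _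
  have hev : ∀ᶠ x in 𝓝 x₀, 0 < δ (x - x₀) → x ∈ Q ∧ ∀ k' ∈ I, ∀ i, ∀ j ∈ I, k'.degree + 1 = D →
      ‖((m (k' + Finsupp.single i 1)).coeff j).toFun x‖ * δ (x - x₀) ^ (D - j.degree) ≤ C₀ := by
    have h1 : ∀ᶠ x in 𝓝 x₀, ∀ t ∈ B, t.1.degree + 1 = D → 0 < δ (x - x₀) →
      ‖((m (t.1 + Finsupp.single t.2.1 1)).coeff t.2.2).toFun x‖ *
        δ (x - x₀) ^ (D - t.2.2.degree) ≤ C t := by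
      rw [Finset.eventually_all]
      intro t ht
      by_cases h2 : t.1.degree + 1 = D
      · filter_upwards [hC t ht h2] with x hx _ using hx
      · exact Eventually.of_forall fun x h3 => absurd h3 h2
    filter_upwards [h1, hQ] with x hx hxQ h0
    refine ⟨hxQ h0, fun k' hk' i j hj hkD => ?_⟩
    have ht : (⟨k', i, j⟩ : (Fin n →₀ ℕ) × Fin n × (Fin n →₀ ℕ)) ∈ B := by simp [B, hk', hj]
    exact (hx _ ht hkD h0).trans ((le_abs_self _).trans
      (Finset.single_le_sum (f := fun t => |C t|) (fun _ _ => abs_nonneg _) ht))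
  obtain ⟨ρ, hρ, hb⟩ := Metric.eventually_nhds_iff_ball.mp hev
  obtain ⟨ξ, hξ0, hξρ⟩ : ∃ ξ, 0 < δ ξ ∧ ‖ξ‖ < ρ / 2 := by
    obtain ⟨v, hv⟩ := hc.exists_pos
    have h1 : 0 < ‖v‖ + 1 := by positivity
    refine ⟨((ρ / 2 / (‖v‖ + 1) : ℝ) : ℂ) • v, ?_, ?_⟩
    · rw [hc.smul _ (by positivity)]; positivity
    · rw [norm_smul, Complex.norm_real, Real.norm_of_nonneg (by positivity), div_mul_eq_mul_div,
        div_lt_iff₀ h1]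
      nlinarith
  set c := δ ξ with hcdef
  have hline : ∀ x ∈ ball x₀ (ρ / 2), ∀ t ∈ Icc (0 : ℝ) 1, x + (t : ℂ) • ξ ∈ ball x₀ ρ ∧
      δ (x - x₀) + c * t ≤ δ (x + (t : ℂ) • ξ - x₀) := by
    intro x hx t ht
    have h1 : x + (t : ℂ) • ξ - x₀ = x - x₀ + (t : ℂ) • ξ := by abel
    constructor
    · rw [mem_ball_iff_norm] at hx ⊢
      have h2 : ‖(t : ℂ) • ξ‖ ≤ ‖ξ‖ := by
        rw [norm_smul, Complex.norm_real, Real.norm_of_nonneg ht.1]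
        exact mul_le_of_le_one_left (norm_nonneg _) ht.2
      rw [h1]
      linarith [norm_add_le (x - x₀) ((t : ℂ) • ξ)]
    · rw [h1]; linarith [hc.le_line (x - x₀) ξ ht.1]
  have hend : x₀ + ξ ∈ Q := by
    refine (hb _ ?_ ?_).1
    · rw [mem_ball_iff_norm, add_sub_cancel_left]; linarith
    · rwa [add_sub_cancel_left]
  set A₁ := ∑ j ∈ I, (‖a j (x₀ + ξ)‖ + 1) with hA₁
  have hA₁0 : 0 ≤ A₁ := Finset.sum_nonneg fun _ _ => by positivity
  have hbd : ∀ᶠ x in 𝓝 x₀, ∀ j ∈ I, ‖a j (x + ξ)‖ ≤ A₁ := by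
    rw [Finset.eventually_all]
    intro j hj
    have h3 : ContinuousAt (fun x => ‖a j (x + ξ)‖) x₀ :=
      (ContinuousAt.comp (g := a j) (f := fun x => x + ξ)
        (hak j _ hend).continuousAt (by fun_prop)).norm
    filter_upwards [h3.eventually_lt_const (lt_add_one _)] with x hx
    exact hx.le.trans (Finset.single_le_sum (f := fun j => ‖a j (x₀ + ξ)‖ + 1)
      (fun _ _ => by positivity) hj)
  -- A further derivative of an unknown either is an unknown, which accounts for the 1, or has order
  -- D and is a sum over `I` with weighted coefficients at most C₀. The factor Σ|ξ_i| comes from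
  -- differentiating along ξ.
  set B₁ : ℝ := (∑ i, ‖ξ i‖) * (1 + I.card * C₀) with hB₁
  have hB₁0 : 0 ≤ B₁ := by positivity
  obtain ⟨N, hN⟩ := exists_nat_ge (D + B₁ / c)
  refine ⟨(1 + c) ^ D * A₁ * (1 + c) ^ N, k.degree + N, ?_⟩
  filter_upwards [hbd, ball_mem_nhds x₀ (half_pos hρ), hc.eventually_lt_one] with x hxA hx hx1 h0
  set S := δ (x - x₀) with hSdef
  have hpt : ∀ t ∈ Icc (0 : ℝ) 1, 0 < S + c * t ∧ 0 < δ (x + (t : ℂ) • ξ - x₀) := fun t ht => by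
    have h1 : 0 < S + c * t := by have := mul_nonneg hξ0.le ht.1; linarith
    exact ⟨h1, h1.trans_le (hline x hx t ht).2⟩
  have hptQ : ∀ t ∈ Icc (0 : ℝ) 1, x + (t : ℂ) • ξ ∈ Q := fun t ht =>
    (hb _ (hline x hx t ht).1 (hpt t ht).2).1
  have key := weighted_gronwall (I := I) (d := fun j => j.1.degree) (D := D) (N := N)
    (a := fun j t => a j.1 (x + (t : ℂ) • ξ))
    (a' := fun j t => ∑ i, ξ i * a (j.1 + Finsupp.single i 1) (x + (t : ℂ) • ξ))
    (S := S) (c := c) (A := (1 + c) ^ D * A₁) (B := B₁)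
    (fun j => ((hI j.1).mp j.2).le) h0 hξ0 (by positivity) hB₁0 hN ?_ ?_ ?_ ⟨k, (hI k).mpr hkD⟩
  · simp only [Complex.ofReal_zero, zero_smul, add_zero] at key
    have h2 : a k x = partialDeriv k ψ.toFun x := by
      have := hptQ 0 (by simp)
      simp only [Complex.ofReal_zero, zero_smul, add_zero] at this
      exact Sec.toFun_deriv k ψ this
    rw [h2] at key
    have hcpos : 0 < c := hξ0
    calc ‖partialDeriv k ψ.toFun x‖ * S ^ (k.degree + N)
        = (S ^ k.degree * ‖partialDeriv k ψ.toFun x‖) * S ^ N := by rw [pow_add]; ring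
      _ ≤ ((1 + c) ^ D * A₁ * ((S + c) / S) ^ N) * S ^ N := by gcongr
      _ = (1 + c) ^ D * A₁ * (S + c) ^ N := by rw [div_pow]; field_simp
      _ ≤ (1 + c) ^ D * A₁ * (1 + c) ^ N := by gcongr
  · intro t ht j
    have h7 : HasDerivAt (fun t : ℝ => x + (t : ℂ) • ξ) ξ t := by
      have := ((Complex.ofRealCLM.hasDerivAt (x := t)).smul_const ξ).const_add x
      simpa using this
    have h9 : HasFDerivAt (a j.1) ((fderiv ℂ (a j.1) (x + (t : ℂ) • ξ)).restrictScalars ℝ)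
        (x + (t : ℂ) • ξ) :=
      (hak j.1 _ (hptQ t ht)).differentiableAt.hasFDerivAt.restrictScalars ℝ
    have := h9.comp_hasDerivAt t h7
    rw [ContinuousLinearMap.coe_restrictScalars', fderiv_apply_eq_sum] at this
    refine this.congr_deriv (Finset.sum_congr rfl fun i _ => ?_)
    simp only [a]
    rw [Connection.deriv_add_single, Sec.toFun_nabla _ _ (hptQ t ht)]
  · intro t ht A hA j
    set y := x + (t : ℂ) • ξ with hy
    set w := S + c * t with hw
    have hw0 : 0 < w := (hpt t ht).1
    have hwy : w ≤ δ (y - x₀) := (hline x hx t ht).2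
    have hA0 : 0 ≤ A := le_trans (by positivity) (hA j)
    have hone : ∀ i, w ^ (j.1.degree + 1) * ‖a (j.1 + Finsupp.single i 1) y‖ ≤
        (1 + I.card * C₀) * A := by
      intro i
      have hdeg : (j.1 + Finsupp.single i 1).degree = j.1.degree + 1 := by simp
      by_cases hj : j.1.degree + 1 = D
      · have h10 : a (j.1 + Finsupp.single i 1) y =
            ∑ j' ∈ (m (j.1 + Finsupp.single i 1)).support,
              ((m (j.1 + Finsupp.single i 1)).coeff j').toFun y * a j' y := by
          simp only [a]
          rw [hm3 _ (hdeg.trans hj) h ψ hψ, Connection.act_eq_sum, Sec.toFun_sum _ _ (hptQ t ht)]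
          exact Finset.sum_congr rfl fun j' _ => by rw [Sec.toFun_hol_smul _ _ (hptQ t ht)]
        have hsub : (m (j.1 + Finsupp.single i 1)).support ⊆ I := by
          intro j' hj'
          rw [hI]
          by_contra hlt
          refine mem_support_iff.mp hj' (hm2 _ (hdeg.trans hj) j' ?_)
          rw [hdeg, hj]; omega
        have hterm : ∀ j' ∈ I, w ^ D * (‖((m (j.1 + Finsupp.single i 1)).coeff j').toFun y‖ *
            ‖a j' y‖) ≤ C₀ * A := by
          intro j' hj'
          have h11 := (hb y (hline x hx t ht).1 (hpt t ht).2).2 j.1 j.2 i j' hj' hj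
          have h12 : w ^ (D - j'.degree) ≤ δ (y - x₀) ^ (D - j'.degree) :=
            pow_le_pow_left₀ hw0.le hwy _
          have h13 : w ^ D = w ^ (D - j'.degree) * w ^ j'.degree := by
            rw [← pow_add, Nat.sub_add_cancel ((hI j').mp hj').le]
          calc _ = (‖((m (j.1 + Finsupp.single i 1)).coeff j').toFun y‖ * w ^ (D - j'.degree)) *
                (w ^ j'.degree * ‖a j' y‖) := by rw [h13]; ring
            _ ≤ C₀ * A := mul_le_mul ((mul_le_mul_of_nonneg_left h12 (norm_nonneg _)).trans h11)
                (hA ⟨j', hj'⟩) (by positivity) hC₀0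
        rw [h10, hj]
        calc _ ≤ w ^ D * ∑ j' ∈ (m (j.1 + Finsupp.single i 1)).support,
              ‖((m (j.1 + Finsupp.single i 1)).coeff j').toFun y‖ * ‖a j' y‖ := by
              refine mul_le_mul_of_nonneg_left ((norm_sum_le _ _).trans (le_of_eq ?_)) (by positivity)
              exact Finset.sum_congr rfl fun _ _ => norm_mul _ _
          _ ≤ ∑ j' ∈ I, C₀ * A := by
              rw [Finset.mul_sum]
              exact (Finset.sum_le_sum fun j' hj' => hterm j' (hsub hj')).trans
                (Finset.sum_le_sum_of_subset_of_nonneg hsub fun _ _ _ => mul_nonneg hC₀0 hA0)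
          _ ≤ (1 + I.card * C₀) * A := by
              rw [Finset.sum_const, nsmul_eq_mul]; linarith
      · have hmem : j.1 + Finsupp.single i 1 ∈ I := by
          rw [hI, hdeg]
          have := (hI j.1).mp j.2
          omega
        have := hA ⟨_, hmem⟩
        simp only [hdeg] at this
        refine this.trans (le_mul_of_one_le_left hA0 ?_)
        have : 0 ≤ I.card * C₀ := by positivity
        linarith
    calc _ ≤ w ^ (j.1.degree + 1) * ∑ i, ‖ξ i‖ * ‖a (j.1 + Finsupp.single i 1) y‖ := by
          refine mul_le_mul_of_nonneg_left ((norm_sum_le _ _).trans (le_of_eq ?_)) (by positivity)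
          exact Finset.sum_congr rfl fun _ _ => norm_mul _ _
      _ = ∑ i, ‖ξ i‖ * (w ^ (j.1.degree + 1) * ‖a (j.1 + Finsupp.single i 1) y‖) := by
          rw [Finset.mul_sum]; exact Finset.sum_congr rfl fun _ _ => by ring
      _ ≤ ∑ i, ‖ξ i‖ * ((1 + I.card * C₀) * A) := 
          Finset.sum_le_sum fun i _ => mul_le_mul_of_nonneg_left (hone i) (norm_nonneg _)
      _ = B₁ * A := by rw [← Finset.sum_mul, hB₁]; ring
  · intro j
    have hcpos : 0 < c := hξ0
    have h14 : ‖a j.1 (x + ((1 : ℝ) : ℂ) • ξ)‖ ≤ A₁ := by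
      rw [Complex.ofReal_one, one_smul]; exact hxA j.1 j.2
    have h15 : (S + c) ^ j.1.degree ≤ (1 + c) ^ D :=
      (pow_le_pow_left₀ (by positivity) (by linarith) _).trans
        (pow_le_pow_right₀ (by linarith) ((hI j.1).mp j.2).le)
    exact mul_le_mul h15 h14 (norm_nonneg _) (by positivity)

end SeveralComplex
end

noncomputable section

/-! ### Analytic continuation in simply connected domains -/

namespace SeveralComplex

open Set Filter TopologicalSpace

section Continuation

open CategoryTheory Opposite TopCat.Presheaf

variable {X : Type} [TopologicalSpace X] (P : (X → ℂ) → X → Prop)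

/-- The presheaf of functions satisfying a condition at every point. -/
def localPresheaf (hP : ∀ f g x, f =ᶠ[𝓝 x] g → P f x → P g x) :
    TopCat.Presheaf (Type) (TopCat.of X) where
  obj V := {f : X → ℂ // (∀ x ∉ V.unop, f x = 0) ∧ ∀ x ∈ V.unop, P f x}
  map {V W} i := ↾fun f => ⟨(W.unop : Set X).indicator f.1, fun x hx => indicator_of_notMem hx _,
    fun x hx => hP f.1 _ x (by
      filter_upwards [W.unop.isOpen.mem_nhds hx] with y hy
      rw [indicator_of_mem hy]) (f.2.2 x (i.unop.le hx))⟩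
  map_id V := by
    ext f x
    by_cases hx : x ∈ V.unop
    · exact indicator_of_mem (s := (V.unop : Set X)) hx _
    · exact (indicator_of_notMem (s := (V.unop : Set X)) hx _).trans (f.2.1 x hx).symm
  map_comp {U V W} i j := by
    ext f x
    by_cases hx : x ∈ W.unop
    · have hx' := j.unop.le hx
      refine (indicator_of_mem (s := (W.unop : Set X)) hx _).trans ?_
      symm
      refine (indicator_of_mem (s := (W.unop : Set X)) hx _).trans ?_
      exact indicator_of_mem (s := (V.unop : Set X)) hx' _
    · refine (indicator_of_notMem (s := (W.unop : Set X)) hx _).trans ?_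
      exact (indicator_of_notMem (s := (W.unop : Set X)) hx _).symm

variable {P} {hP : ∀ f g x, f =ᶠ[𝓝 x] g → P f x → P g x}

theorem localPresheaf_map_eventuallyEq {V W : Opens (TopCat.of X)} (i : W ⟶ V)
    (f : (localPresheaf P hP).obj (op V)) {x : X} (hx : x ∈ W) :
    ((localPresheaf P hP).map i.op f).1 =ᶠ[𝓝 x] f.1 := by
  filter_upwards [W.isOpen.mem_nhds hx] with y hy
  exact indicator_of_mem (s := (W : Set X)) hy _

/-- Sections are functions extended by zero, so elements of the stalk are ordinary germs of
functions. -/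
theorem germ_eq_iff {U V : Opens (TopCat.of X)} {x : X} (hU : x ∈ U) (hV : x ∈ V)
    (f : (localPresheaf P hP).obj (op U)) (g : (localPresheaf P hP).obj (op V)) :
    (localPresheaf P hP).germ U x hU f = (localPresheaf P hP).germ V x hV g ↔
      f.1 =ᶠ[𝓝 x] g.1 := by
  constructor
  · intro h
    obtain ⟨W, hW, iU, iV, e⟩ := (localPresheaf P hP).germ_eq x hU hV f g h
    refine (localPresheaf_map_eventuallyEq iU f hW).symm.trans ?_
    rw [e]
    exact localPresheaf_map_eventuallyEq iV g hW
  · intro h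
    obtain ⟨W, hW, hWo, hx⟩ := _root_.mem_nhds_iff.mp h
    let W' : Opens (TopCat.of X) := ⟨W, hWo⟩ ⊓ (U ⊓ V)
    have hx' : x ∈ W' := ⟨hx, hU, hV⟩
    refine (localPresheaf P hP).germ_ext W' hx' (homOfLE (inf_le_right.trans inf_le_left))
      (homOfLE (inf_le_right.trans inf_le_right)) ?_
    refine Subtype.ext (funext fun y => ?_)
    by_cases hy : y ∈ W'
    · refine (indicator_of_mem (s := (W' : Set X)) hy _).trans ?_
      refine Eq.trans ?_ (indicator_of_mem (s := (W' : Set X)) hy _).symm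
      exact hW hy.1
    · refine (indicator_of_notMem (s := (W' : Set X)) hy _).trans ?_
      exact (indicator_of_notMem (s := (W' : Set X)) hy _).symm

/-- A function represents a point of the étalé space. -/
def IsGermOf (e : EtaleSpace (localPresheaf P hP)) (f : X → ℂ) : Prop :=
  ∃ (U : Opens (TopCat.of X)) (h : e.base ∈ U) (s : (localPresheaf P hP).obj (op U)),
    e.germ = (localPresheaf P hP).germ U e.base h s ∧ s.1 =ᶠ[𝓝 e.base] f

theorem IsGermOf.eventuallyEq {e : EtaleSpace (localPresheaf P hP)} {f g : X → ℂ}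
    (hf : IsGermOf e f) (hg : IsGermOf e g) : f =ᶠ[𝓝 e.base] g := by
  obtain ⟨U, hU, s, h1, h2⟩ := hf
  obtain ⟨V, hV, t, h3, h4⟩ := hg
  exact h2.symm.trans (((germ_eq_iff hU hV s t).mp (h1.symm.trans h3)).trans h4)

theorem IsGermOf.eventually {e : EtaleSpace (localPresheaf P hP)} {f : X → ℂ}
    (hf : IsGermOf e f) : ∀ᶠ e' in 𝓝 e, IsGermOf e' f := by
  obtain ⟨U, hU, s, h1, h2⟩ := hf
  have h3 := (EtaleSpace.continuous_base (localPresheaf P hP)).continuousAt.eventually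
    (eventually_eventually_nhds.mpr h2)
  filter_upwards [e.eventually_nhds hU s h1.symm, h3] with e' ⟨h4, h5⟩ h6
  exact ⟨U, h4, s, h5, h6⟩

theorem exists_isGermOf (e : EtaleSpace (localPresheaf P hP)) :
    ∃ f, IsGermOf e f ∧ P f e.base := by
  obtain ⟨U, hU, s, hs⟩ := (localPresheaf P hP).exists_germ_eq e.germ
  exact ⟨s.1, ⟨U, hU, s, hs.symm, .rfl⟩, s.2.2 _ hU⟩

theorem exists_section {p : X} {f : X → ℂ} (hf : ∀ᶠ z in 𝓝 p, P f z) :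
    ∃ (U : Opens (TopCat.of X)) (_ : p ∈ U) (s : (localPresheaf P hP).obj (op U)),
      s.1 =ᶠ[𝓝 p] f := by
  obtain ⟨U, hU, hUo, hp⟩ := _root_.mem_nhds_iff.mp hf
  refine ⟨⟨U, hUo⟩, hp, ⟨U.indicator f, fun x hx => indicator_of_notMem hx _,
    fun x hx => hP f _ x ?_ (hU hx)⟩, ?_⟩
  · filter_upwards [hUo.mem_nhds hx] with y hy
    rw [indicator_of_mem hy]
  · filter_upwards [hUo.mem_nhds hp] with y hy
    exact indicator_of_mem hy _

/-- The monodromy theorem: in a simply connected space, germs that have unique continuations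
locally have global continuations. -/
theorem exists_continuation [SimplyConnectedSpace X] [LocallyPathConnectedSpace X]
    (hP : ∀ f g x, f =ᶠ[𝓝 x] g → P f x → P g x)
    (h : ∀ x, ∃ U, IsOpen U ∧ x ∈ U ∧ ∀ y ∈ U,
      (∀ f, (∀ᶠ z in 𝓝 y, P f z) → ∃ g, (∀ z ∈ U, P g z) ∧ g =ᶠ[𝓝 y] f) ∧
      ∀ f g, (∀ z ∈ U, P f z) → (∀ z ∈ U, P g z) → f =ᶠ[𝓝 y] g → EqOn f g U)
    (p : X) {f : X → ℂ} (hf : ∀ᶠ z in 𝓝 p, P f z) :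
    ∃ g, (∀ x, P g x) ∧ g =ᶠ[𝓝 p] f := by
  -- Over each U of the hypothesis, the sections on U map bijectively to the stalk at every point of
  -- U, which makes the étalé space a covering.
  have hcov : IsCoveringMap (EtaleSpace.base (F := localPresheaf P hP)) := by
    refine EtaleSpace.isCoveringMap_base fun x => ?_
    obtain ⟨U, hUo, hx, hU⟩ := h x
    refine ⟨⟨U, hUo⟩, hx, fun y hy => ⟨fun s t hst => ?_, fun g => ?_⟩⟩
    · have h1 := (germ_eq_iff hy hy s t).mp hst
      refine Subtype.ext (funext fun z => ?_)
      by_cases hz : z ∈ U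
      · exact (hU y hy).2 s.1 t.1 s.2.2 t.2.2 h1 hz
      · rw [s.2.1 z hz, t.2.1 z hz]
    · obtain ⟨V, hV, s, rfl⟩ := (localPresheaf P hP).exists_germ_eq g
      obtain ⟨g, hg, he⟩ := (hU y hy).1 s.1
        (Filter.eventually_of_mem (V.isOpen.mem_nhds hV) s.2.2)
      have he' : ∀ z ∈ U, U.indicator g =ᶠ[𝓝 z] g := fun z hz => by
        filter_upwards [hUo.mem_nhds hz] with w hw
        exact indicator_of_mem hw _
      let t : (localPresheaf P hP).obj (op ⟨U, hUo⟩) := ⟨U.indicator g,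
        fun x hx => indicator_of_notMem hx _, fun x hx => hP g _ x (he' x hx).symm (hg x hx)⟩
      exact ⟨t, (germ_eq_iff hy hV t s).mpr ((he' y hy).trans he)⟩
  obtain ⟨U, hp, s, hs⟩ := exists_section (hP := hP) hf
  let e₀ : EtaleSpace (localPresheaf P hP) := ⟨p, (localPresheaf P hP).germ U p hp s⟩
  have he₀ : IsGermOf e₀ f := ⟨U, hp, s, rfl, hs⟩
  -- The identity of a simply connected space lifts through the covering. The lift picks a germ at
  -- each point, and the values of these germs at their base points form the global function.
  obtain ⟨F, ⟨hF0, hF⟩, -⟩ := hcov.existsUnique_continuousMap_lifts (ContinuousMap.id X) p e₀ rfl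
  have hb : ∀ x, (F x).base = x := fun x => congrFun hF x
  choose g hg hgP using fun x => exists_isGermOf (F x)
  have hloc : ∀ x f', IsGermOf (F x) f' → (fun y => g y y) =ᶠ[𝓝 x] f' := by
    intro x f' hf'
    filter_upwards [F.continuous.continuousAt.eventually hf'.eventually] with y hy
    have := ((hg y).eventuallyEq hy).eq_of_nhds
    rwa [hb y] at this
  refine ⟨fun y => g y y, fun x => ?_, hloc p f (hF0 ▸ he₀)⟩
  have h1 := hgP x
  rw [hb x] at h1
  exact hP _ _ x (hloc x _ (hg x)).symm h1

end Continuation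

/-- The monodromy theorem for a simply connected open subset. -/
theorem exists_continuation_on {E : Type} [TopologicalSpace E] [LocallyPathConnectedSpace E]
    {U : Set E} (hU : IsOpen U) [SimplyConnectedSpace U] {P : (E → ℂ) → E → Prop}
    (hP : ∀ f g x, f =ᶠ[𝓝 x] g → P f x → P g x)
    (h : ∀ x ∈ U, ∃ V ⊆ U, IsOpen V ∧ x ∈ V ∧ ∀ y ∈ V,
      (∀ f, (∀ᶠ z in 𝓝 y, P f z) → ∃ g, (∀ z ∈ V, P g z) ∧ g =ᶠ[𝓝 y] f) ∧
      ∀ f g, (∀ z ∈ V, P f z) → (∀ z ∈ V, P g z) → f =ᶠ[𝓝 y] g → EqOn f g V)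
    {p : E} (hp : p ∈ U) {f : E → ℂ} (hf : ∀ᶠ z in 𝓝 p, P f z) :
    ∃ g, (∀ x ∈ U, P g x) ∧ g =ᶠ[𝓝 p] f := by
  have : LocallyPathConnectedSpace U := hU.locallyPathConnectedSpace
  have hemb : Topology.IsOpenEmbedding ((↑) : U → E) := hU.isOpenEmbedding_subtypeVal
  have hinj : Function.Injective ((↑) : U → E) := Subtype.val_injective
  let ex : (U → ℂ) → E → ℂ := fun f => Function.extend (↑) f 0
  have hex : ∀ f (y : U), ex f y = f y := fun f y => hinj.extend_apply f 0 y
  have hev : ∀ (x : U) (S : E → Prop), (∀ᶠ y in 𝓝 (x : E), S y) ↔ ∀ᶠ y : U in 𝓝 x, S (y : E) := by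
    intro x S
    rw [← hemb.map_nhds_eq, eventually_map]
  have hexr : ∀ (f : E → ℂ) (x : U), ex (fun y => f y) =ᶠ[𝓝 (x : E)] f := fun f x =>
    (hev x fun z => ex (fun y => f y) z = f z).mpr (.of_forall fun y => hex _ y)
  have key := exists_continuation (X := U) (P := fun f x => P (ex f) x) ?_ ?_ ⟨p, hp⟩
    (f := fun y => f y) ?_
  · obtain ⟨g, hg, he⟩ := key
    refine ⟨ex g, fun x hx => hg ⟨x, hx⟩, (hev ⟨p, hp⟩ _).mpr (he.mono fun y hy => ?_)⟩
    rw [hex, hy]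
  · intro f g x hfg
    exact hP _ _ _ ((hev x _).mpr (hfg.mono fun y hy => by rw [hex, hex, hy]))
  · intro x
    obtain ⟨V, hVU, hVo, hx, hV⟩ := h x x.2
    refine ⟨Subtype.val ⁻¹' V, hVo.preimage continuous_subtype_val, hx, fun y hy => ⟨fun f hf => ?_, ?_⟩⟩
    · obtain ⟨g, hg, he⟩ := (hV y hy).1 (ex f) ((hev y _).mpr hf)
      refine ⟨fun z => g z, fun z hz => hP _ _ _ (hexr g z).symm (hg z hz), ?_⟩
      exact ((hev y _).mp he).mono fun z hz => hz.trans (hex f z)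
    · intro f g hf hg hfg z hz
      have := (hV y hy).2 (ex f) (ex g) (fun w hw => hf ⟨w, hVU hw⟩ hw)
        (fun w hw => hg ⟨w, hVU hw⟩ hw)
        ((hev y _).mpr (hfg.mono fun w hw => by rw [hex, hex, hw])) hz
      simpa only [hex] using this
  · refine (hev ⟨p, hp⟩ (fun z => P (ex fun y => f y) z)).mp ?_
    filter_upwards [hf, hU.mem_nhds hp] with z hz hzU
    exact hP _ _ _ (hexr f ⟨z, hzU⟩).symm hz

end SeveralComplex

end

noncomputable section

/-! ### Solutions of the joint eigenvalue problem and their initial values -/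

namespace LameOperators

open Set Metric Filter TopologicalSpace SeveralComplex SymbolCalculus MvPolynomial
open HomogeneousParameters

variable {n : ℕ}

theorem partialDeriv_congr (k : Fin n →₀ ℕ) {f g : (Fin n → ℂ) → ℂ} {x : Fin n → ℂ}
    (h : f =ᶠ[𝓝 x] g) : partialDeriv k f =ᶠ[𝓝 x] partialDeriv k g := by
  have h1 : ∀ (i : Fin n) (r : ℕ) {f g : (Fin n → ℂ) → ℂ}, f =ᶠ[𝓝 x] g →
      (pderivFun i)^[r] f =ᶠ[𝓝 x] (pderivFun i)^[r] g := by
    intro i r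
    induction r with
    | zero => exact fun h => h
    | succ r ih =>
      intro f g h
      simp only [Function.iterate_succ_apply']
      exact pderivFun_congr i (ih h)
  unfold partialDeriv
  induction List.finRange n with
  | nil => exact h
  | cons a t ih => exact h1 a (k a) ih

theorem partialDeriv_lin (k : Fin n →₀ ℕ) (c : ℂ) {f g : (Fin n → ℂ) → ℂ} {x : Fin n → ℂ}
    (hf : AnalyticAt ℂ f x) (hg : AnalyticAt ℂ g x) :
    partialDeriv k (c • f + g) x = c * partialDeriv k f x + partialDeriv k g x :=
  (foldr_lin k c hf hg (List.finRange n)).2.2.eq_of_nhds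

theorem isSolutionAt_congr {L : Fin n → DiffOp n} {lam : Fin n → ℂ} {f g : (Fin n → ℂ) → ℂ}
    {x : Fin n → ℂ} (h : f =ᶠ[𝓝 x] g) (hf : IsSolutionAt L lam f x) : IsSolutionAt L lam g x := by
  refine ⟨hf.1.congr h, fun i hi => ?_⟩
  rw [← h.eq_of_nhds, ← hf.2 i hi]
  exact Finset.sum_congr rfl fun k _ => by rw [(partialDeriv_congr k h).eq_of_nhds]

/-- The derivatives `∂^{e j} ψ (p)` of a solution. -/
def jet {κ : Type} (L : Fin n → DiffOp n) (lam : Fin n → ℂ) (e : κ → Fin n →₀ ℕ)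
    {U : Set (Fin n → ℂ)} {p : Fin n → ℂ} (hp : p ∈ U) : solutionSpace L lam U →ₗ[ℂ] κ → ℂ where
  toFun ψ j := partialDeriv (e j) ψ.1 p
  map_add' f g := funext fun j => by
    simpa using partialDeriv_lin (e j) 1 (f.2.2 p hp).1 (g.2.2 p hp).1
  map_smul' c f := funext fun j => by
    have h0 : AnalyticAt ℂ (0 : (Fin n → ℂ) → ℂ) p := analyticAt_const
    have h1 := partialDeriv_lin (e j) c (f.2.2 p hp).1 h0
    have h2 := partialDeriv_lin (e j) 0 h0 h0
    have h3 := partialDeriv_lin (e j) 1 h0 h0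
    simp only [zero_smul, zero_mul, zero_add, add_zero, one_smul, one_mul] at h1 h2 h3
    have h4 : partialDeriv (e j) (0 : (Fin n → ℂ) → ℂ) p = 0 := by linear_combination -h3
    rw [h4, add_zero] at h1
    simpa using h1

theorem indicator_mem_solutionSpace {L : Fin n → DiffOp n} {lam : Fin n → ℂ}
    {U : Set (Fin n → ℂ)} (hU : IsOpen U) {ψ : (Fin n → ℂ) → ℂ}
    (h : ∀ x ∈ U, IsSolutionAt L lam ψ x) : U.indicator ψ ∈ solutionSpace L lam U :=
  ⟨fun _ hx => indicator_of_notMem hx _, fun x hx => isSolutionAt_congr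
    (by filter_upwards [hU.mem_nhds hx] with y hy; rw [indicator_of_mem hy]) (h x hx)⟩

variable {τ : UpperHalfPlane} {A : Finset (AffineForm n)} [NeZero n] {m : AffineForm n → ℕ}
  {L : Fin n → DiffOp n} {Λ : AddSubgroup (Fin n → ℂ)} {s : Fin n → MvPolynomial (Fin n) ℂ}
  {κ : Type} [Fintype κ] [DecidableEq κ] {e : κ → Fin n →₀ ℕ}

theorem jet_injective (hL : IsStronglyIntegrable Λ (schrodinger (potential τ A m)) L s)
    (he : IsQuotBasis s e) (lam : Fin n → ℂ) {U : Set (Fin n → ℂ)} (hU : IsOpen U)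
    (hUc : IsPreconnected U) (hUS : Disjoint U (singularLocus τ A)) {p : Fin n → ℂ} (hp : p ∈ U) :
    Function.Injective (jet L lam e hp) := by
  obtain ⟨l, hS, -, hl⟩ := exists_isHolonomic hL
  have h : (⟨U, hU⟩ : Opens (Fin n → ℂ)) ≤ regularSet τ A := fun x hx =>
    disjoint_left.mp hUS hx
  refine (injective_iff_map_eq_zero _).mpr fun ψ hψ => ?_
  obtain ⟨ha, hm⟩ := (forall_isSolutionAt_iff hL hl lam h).mp ψ.2.2
  have h0 := hS.eq_zero_of_deriv he (U := ⟨U, hU⟩) (h := h) hUc hm (p := p) hp fun j => by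
    rw [Sec.toFun_deriv_of_eqOn (e j) (fun x hx => Sec.toFun_mk ha hx) p hp]
    exact congrFun hψ j
  refine Subtype.ext (funext fun x => ?_)
  by_cases hx : x ∈ U
  · rw [← Sec.toFun_mk (h := h) ha (x := x) hx, h0, Sec.toFun_zero]
    rfl
  · exact ψ.2.1 x hx

theorem exists_solution_ball (hL : IsStronglyIntegrable Λ (schrodinger (potential τ A m)) L s)
    (he : IsQuotBasis s e) (lam : Fin n → ℂ) {U : Set (Fin n → ℂ)} (hU : IsOpen U)
    (hUS : Disjoint U (singularLocus τ A)) {p : Fin n → ℂ} (hp : p ∈ U) :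
    ∃ ρ, ∃ hρ : 0 < ρ, ball p ρ ⊆ U ∧
      Function.Surjective (jet L lam e (mem_ball_self (x := p) hρ)) := by
  obtain ⟨l, hS, -, hl⟩ := exists_isHolonomic hL
  obtain ⟨ρ₀, hρ₀, H⟩ := hS.exists_solution he lam (p := p) (disjoint_left.mp hUS hp)
  obtain ⟨ρ₁, hρ₁, hb⟩ := Metric.isOpen_iff.mp hU p hp
  have hρ : 0 < min ρ₀ ρ₁ := lt_min hρ₀ hρ₁
  obtain ⟨h, hs⟩ := H _ hρ (min_le_left _ _)
  refine ⟨_, hρ, (ball_subset_ball (min_le_right _ _)).trans hb, fun v => ?_⟩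
  obtain ⟨ψ, hψ, hv⟩ := hs v
  have hsol := (forall_isSolutionAt_iff hL hl lam h (ψ := ψ.toFun)).mpr
    ⟨ψ.analyticOnNhd, by
      have : Sec.mk h ψ.toFun ψ.analyticOnNhd = ψ :=
        Sec.ext_toFun fun x hx => Sec.toFun_mk _ hx
      rwa [this]⟩
  refine ⟨⟨_, indicator_mem_solutionSpace isOpen_ball hsol⟩, funext fun j => ?_⟩
  rw [← hv j, Sec.toFun_deriv (e j) ψ (mem_ball_self hρ)]
  refine (partialDeriv_congr (e j) ?_).eq_of_nhds
  filter_upwards [isOpen_ball.mem_nhds (mem_ball_self hρ)] with y hy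
  exact indicator_of_mem hy _

/-- Solutions continue analytically in simply connected domains. -/
theorem exists_solution_continuation
    (hL : IsStronglyIntegrable Λ (schrodinger (potential τ A m)) L s)
    (he : IsQuotBasis s e) (lam : Fin n → ℂ) {U : Set (Fin n → ℂ)} (hU : IsOpen U)
    [SimplyConnectedSpace U] (hUS : Disjoint U (singularLocus τ A)) {p : Fin n → ℂ} (hp : p ∈ U)
    {f : (Fin n → ℂ) → ℂ} (hf : ∀ᶠ z in 𝓝 p, IsSolutionAt L lam f z) :
    ∃ g, (∀ x ∈ U, IsSolutionAt L lam g x) ∧ g =ᶠ[𝓝 p] f := by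
  refine exists_continuation_on hU (P := IsSolutionAt L lam)
    (fun f g x h => isSolutionAt_congr h) (fun x hx => ?_) hp hf
  obtain ⟨ρ, hρ, hbU, hs⟩ := exists_solution_ball hL he lam hU hUS hx
  have hball : ∀ {y : Fin n → ℂ} {r : ℝ}, IsPreconnected (ball y r) :=
    fun {y r} => (convex_ball y r).isPreconnected
  have hi := jet_injective hL he lam isOpen_ball hball (hUS.mono_left hbU) (mem_ball_self hρ)
  let E := LinearEquiv.ofBijective _ ⟨hi, hs⟩
  refine ⟨ball x ρ, hbU, isOpen_ball, mem_ball_self hρ, fun y hy => ⟨fun f hf => ?_, ?_⟩⟩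
  · have hiy := jet_injective hL he lam isOpen_ball hball (hUS.mono_left hbU) hy
    -- Initial values at the centre x identify the solutions on the ball with ℂ^κ; initial values at
    -- y are injective on this space, hence also surjective, by dimension.
    have hsy : Function.Surjective (jet L lam e hy) := by
      have := (LinearMap.injective_iff_surjective (f := (jet L lam e hy) ∘ₗ E.symm.toLinearMap)).mp
        (hiy.comp E.symm.injective)
      rw [LinearMap.coe_comp] at this
      exact this.of_comp
    obtain ⟨g, hg⟩ := hsy fun j => partialDeriv (e j) f y
    refine ⟨g.1, g.2.2, ?_⟩
    obtain ⟨r, hr, hrf⟩ := Metric.eventually_nhds_iff_ball.mp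
      (hf.and (isOpen_ball.mem_nhds hy))
    have hrS : Disjoint (ball y r) (singularLocus τ A) :=
      hUS.mono_left fun z hz => hbU (hrf z hz).2
    have h1 := indicator_mem_solutionSpace (isOpen_ball (x := y) (ε := r))
      fun z hz => (hrf z hz).1
    have h2 := indicator_mem_solutionSpace (isOpen_ball (x := y) (ε := r))
      fun z hz => g.2.2 z (hrf z hz).2
    have hind : ∀ f' : (Fin n → ℂ) → ℂ, (ball y r).indicator f' =ᶠ[𝓝 y] f' := fun f' => by
      filter_upwards [isOpen_ball.mem_nhds (mem_ball_self hr)] with z hz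
      exact indicator_of_mem hz _
    have h3 := jet_injective hL he lam isOpen_ball hball hrS (mem_ball_self hr)
      (a₁ := ⟨_, h2⟩) (a₂ := ⟨_, h1⟩) (by
        funext j
        refine (partialDeriv_congr (e j) (hind _)).eq_of_nhds.trans ((congrFun hg j).trans ?_)
        exact (partialDeriv_congr (e j) (hind _)).eq_of_nhds.symm)
    have h4 := congrArg Subtype.val h3
    simp only at h4
    exact (hind _).symm.trans (h4.eventuallyEq.trans (hind f))
  · intro f g hf hg hfg z hz
    have h1 := indicator_mem_solutionSpace isOpen_ball hf
    have h2 := indicator_mem_solutionSpace isOpen_ball hg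
    have hind : ∀ f' : (Fin n → ℂ) → ℂ, (ball x ρ).indicator f' =ᶠ[𝓝 y] f' := fun f' => by
      filter_upwards [isOpen_ball.mem_nhds hy] with z hz
      exact indicator_of_mem hz _
    have h3 := jet_injective hL he lam isOpen_ball hball (hUS.mono_left hbU) hy
      (a₁ := ⟨_, h1⟩) (a₂ := ⟨_, h2⟩) (funext fun j => (partialDeriv_congr (e j)
        ((hind f).trans (hfg.trans (hind g).symm))).eq_of_nhds)
    have h4 := congrFun (congrArg Subtype.val h3) z
    simpa only [indicator_of_mem hz] using h4

/-- In a simply connected domain the solutions correspond to their initial values. -/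
theorem jet_bijective (hL : IsStronglyIntegrable Λ (schrodinger (potential τ A m)) L s)
    (he : IsQuotBasis s e) (lam : Fin n → ℂ) {U : Set (Fin n → ℂ)} (hU : IsOpen U)
    [SimplyConnectedSpace U] (hUS : Disjoint U (singularLocus τ A)) {p : Fin n → ℂ} (hp : p ∈ U) :
    Function.Bijective (jet L lam e hp) := by
  have hUc : IsPreconnected U := isPreconnected_iff_preconnectedSpace.mpr inferInstance
  refine ⟨jet_injective hL he lam hU hUc hUS hp, fun v => ?_⟩
  obtain ⟨ρ, hρ, hbU, hs⟩ := exists_solution_ball hL he lam hU hUS hp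
  obtain ⟨f, hf⟩ := hs v
  obtain ⟨g, hg, hgf⟩ := exists_solution_continuation hL he lam hU hUS hp (f := f.1)
    (by filter_upwards [isOpen_ball.mem_nhds (mem_ball_self hρ)] with y hy; exact f.2.2 y hy)
  refine ⟨⟨_, indicator_mem_solutionSpace hU hg⟩, funext fun j => ?_⟩
  rw [← hf]
  refine (partialDeriv_congr (e j) (EventuallyEq.trans ?_ hgf)).eq_of_nhds
  filter_upwards [hU.mem_nhds hp] with y hy
  exact indicator_of_mem hy _

end LameOperators

end

noncomputable section

/-! ### Solutions on the torus -/

namespace LameOperators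

open Set Metric Filter TopologicalSpace SeveralComplex SymbolCalculus MvPolynomial
open HomogeneousParameters

variable {n : ℕ}

theorem partialDeriv_comp_add_right (k : Fin n →₀ ℕ) (f : (Fin n → ℂ) → ℂ) (v : Fin n → ℂ) :
    partialDeriv k (fun x => f (x + v)) = fun x => partialDeriv k f (x + v) := by
  have h0 : ∀ (i : Fin n) (f : (Fin n → ℂ) → ℂ),
      pderivFun i (fun x => f (x + v)) = fun x => pderivFun i f (x + v) := fun i f => by
    funext x
    simp only [pderivFun, fderiv_comp_add_right]
  have h1 : ∀ (i : Fin n) (r : ℕ) (f : (Fin n → ℂ) → ℂ),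
      (pderivFun i)^[r] (fun x => f (x + v)) = fun x => (pderivFun i)^[r] f (x + v) := by
    intro i r
    induction r with
    | zero => exact fun f => rfl
    | succ r ih =>
      intro f
      rw [Function.iterate_succ_apply', Function.iterate_succ_apply', ih, h0]
  unfold partialDeriv
  induction List.finRange n with
  | nil => rfl
  | cons a t ih => rw [List.foldr_cons, List.foldr_cons, ih, h1]

theorem isSolutionAt_comp_add_right {L : Fin n → DiffOp n} {lam : Fin n → ℂ} {v : Fin n → ℂ}
    (hv : ∀ i k x, (L i).coeff k (x + v) = (L i).coeff k x) {f : (Fin n → ℂ) → ℂ} {x : Fin n → ℂ}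
    (hf : IsSolutionAt L lam f (x + v)) : IsSolutionAt L lam (fun y => f (y + v)) x := by
  have hadd : ∀ (w z : Fin n → ℂ), AnalyticAt ℂ (fun y => y + w) z := fun w z =>
    analyticAt_id.add analyticAt_const
  refine ⟨AnalyticAt.comp' (f := fun y => y + v) hf.1 (hadd v x), fun i hi => ?_⟩
  have hr : (L i).RegularAt (x + v) := fun k => by
    have h1 : (L i).coeff k = fun y => (L i).coeff k (y + -v) := by
      funext y
      rw [← hv i k (y + -v), neg_add_cancel_right]
    have h2 : AnalyticAt ℂ ((L i).coeff k) (x + v + -v) := by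
      rw [add_neg_cancel_right]
      exact hi k
    rw [h1]
    exact AnalyticAt.comp' (f := fun y => y + -v) h2 (hadd (-v) (x + v))
  rw [← hf.2 i hr]
  exact Finset.sum_congr rfl fun k _ => by rw [partialDeriv_comp_add_right, hv]

variable {τ : UpperHalfPlane} {A : Finset (AffineForm n)}

theorem lin_mem_lattice_of_mem_periodLattice {v : Fin n → ℂ} (hv : v ∈ periodLattice τ A)
    {α : AffineForm n} (hα : α ∈ A) : α.lin v ∈ (periodPair τ).lattice := by
  obtain ⟨a, ha, b, ⟨c, hc, rfl⟩, rfl⟩ := AddSubgroup.mem_sup.mp hv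
  obtain ⟨p, hp⟩ := ha α hα
  obtain ⟨q, hq⟩ := hc α hα
  rw [← AffineForm.lin_apply] at hp hq
  refine mem_lattice_periodPair.mpr ⟨p, q, ?_⟩
  simp only [DistribSMul.toAddMonoidHom_apply, map_add, map_smul, hp, hq, smul_eq_mul]
  ring

/-- The bilinear scalar product with v vanishes on all gradients, which span. -/
theorem eq_zero_of_lin_eq_zero
    (hA : Submodule.span ℂ (AffineForm.grad '' (A : Set (AffineForm n))) = ⊤) {v : Fin n → ℂ}
    (hv : ∀ α ∈ A, α.lin v = 0) : v = 0 := by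
  let F : (Fin n → ℂ) →ₗ[ℂ] ℂ := ∑ j, v j • LinearMap.proj j
  have hF : ∀ w, F w = ∑ j, v j * w j := fun w => by simp [F]
  have h : ∀ w, F w = 0 := by
    intro w
    have hw : w ∈ Submodule.span ℂ (AffineForm.grad '' (A : Set (AffineForm n))) := hA ▸ trivial
    refine Submodule.span_induction ?_ (map_zero F) (fun a b _ _ ha hb => ?_)
      (fun c a _ ha => ?_) hw
    · rintro _ ⟨α, hα, rfl⟩
      rw [hF, ← hv α hα, AffineForm.lin_apply]
      exact Finset.sum_congr rfl fun j _ => mul_comm _ _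
    · rw [map_add, ha, hb, add_zero]
    · rw [map_smul, ha, smul_zero]
  funext j
  have := h (Pi.single j 1)
  rw [hF] at this
  simpa [Pi.single_apply] using this

/-- On the period lattice each linear form takes values in ℤ + τℤ. Near 0 these values must
therefore vanish for every α, and the gradients span. -/
theorem isDiscrete_periodLattice
    (hA : Submodule.span ℂ (AffineForm.grad '' (A : Set (AffineForm n))) = ⊤) :
    IsDiscrete (periodLattice τ A : Set (Fin n → ℂ)) := by
  classical
  have h := eventually_eval_mem_lattice (τ := τ)
    (A.image fun α => (⟨α.grad, 0⟩ : AffineForm n)) 0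
  have h' : ∀ᶠ y in 𝓝 (0 : Fin n → ℂ), y ∈ periodLattice τ A → y = 0 := by
    filter_upwards [h] with y hy hyl
    refine eq_zero_of_lin_eq_zero hA fun α hα => ?_
    have h1 := hy _ (Finset.mem_image_of_mem _ hα)
    have h2 := lin_mem_lattice_of_mem_periodLattice hyl hα
    rw [AffineForm.eval_eq, zero_add, map_zero] at h1
    rw [AffineForm.lin_apply] at h1 h2 ⊢
    exact h1 h2
  refine ⟨discreteTopology_of_isOpen_singleton_zero ?_⟩
  rw [isOpen_singleton_iff_nhds_eq_pure, nhds_subtype_eq_comap, ZeroMemClass.coe_zero]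
  refine le_antisymm ?_ (by
    have := pure_le_nhds (0 : periodLattice τ A)
    rwa [nhds_subtype_eq_comap] at this)
  rw [le_pure_iff]
  exact ⟨_, h', fun y hy => Subtype.ext (hy y.2)⟩

theorem isCoveringMap_toTorus
    (hA : Submodule.span ℂ (AffineForm.grad '' (A : Set (AffineForm n))) = ⊤) :
    IsCoveringMap (toTorus τ A) :=
  ((periodLattice τ A).isAddQuotientCoveringMap_of_comm
    (isDiscrete_periodLattice hA)).isCoveringMap

theorem isQuotientMap_toTorus : Topology.IsQuotientMap (toTorus τ A) := isQuotientMap_quotient_mk'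

theorem toTorus_eq_iff {x y : Fin n → ℂ} :
    toTorus τ A x = toTorus τ A y ↔ y - x ∈ periodLattice τ A := by
  rw [toTorus, toTorus, QuotientAddGroup.eq, neg_add_eq_sub]

/-- A simply connected domain in the torus has a holomorphic section. -/
theorem exists_section_torus
    (hA : Submodule.span ℂ (AffineForm.grad '' (A : Set (AffineForm n))) = ⊤)
    {W : Set (Torus τ A)} (hW : IsOpen W) [SimplyConnectedSpace W] :
    ∃ σ : W → (Fin n → ℂ), Topology.IsOpenEmbedding σ ∧ ∀ w, toTorus τ A (σ w) = w := by
  have hcov := isCoveringMap_toTorus (τ := τ) hA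
  have : LocallyPathConnectedSpace (Torus τ A) :=
    (isQuotientMap_toTorus (τ := τ) (A := A)).locallyPathConnectedSpace
  have : LocallyPathConnectedSpace W := hW.locallyPathConnectedSpace
  obtain ⟨w₀⟩ : Nonempty W := inferInstance
  obtain ⟨p, hp⟩ := (isQuotientMap_toTorus (τ := τ) (A := A)).surjective w₀
  obtain ⟨F, ⟨-, hF⟩, -⟩ := hcov.existsUnique_continuousMap_lifts
    (⟨Subtype.val, continuous_subtype_val⟩ : C(W, Torus τ A)) w₀ p hp
  have hF' : ∀ w, toTorus τ A (F w) = w := fun w => congrFun hF w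
  -- The lift of the inclusion of W through the covering map is a local homeomorphism, and it is
  -- injective as a section.
  have hl : IsLocalHomeomorph F := .of_comp (g := toTorus τ A) (by
    rw [hF]
    exact hW.isOpenEmbedding_subtypeVal.isLocalHomeomorph) hcov.isLocalHomeomorph F.continuous
  refine ⟨F, hl.isOpenEmbedding_of_injective fun a b hab => Subtype.ext ?_, hF'⟩
  rw [← hF' a, ← hF' b, hab]

variable [NeZero n] {m : AffineForm n → ℕ} {L : Fin n → DiffOp n}
  {s : Fin n → MvPolynomial (Fin n) ℂ}

/-- The number of independent solutions in a simply connected domain of the torus. -/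
theorem finrank_torusSolutionSpace
    (hA : Submodule.span ℂ (AffineForm.grad '' (A : Set (AffineForm n))) = ⊤)
    (hL : IsStronglyIntegrable (periodLattice τ A) (schrodinger (potential τ A m)) L s)
    {κ : Type} [Fintype κ] {e : κ → Fin n →₀ ℕ} (he : IsQuotBasis s e) (lam : Fin n → ℂ)
    {W : Set (Torus τ A)} (hW : IsOpen W) [SimplyConnectedSpace W]
    (hWS : Disjoint W (toTorus τ A '' singularLocus τ A)) :
    Module.finrank ℂ (torusSolutionSpace τ A L lam W) = Fintype.card κ := by
  classical
  obtain ⟨σ, hσ, hσW⟩ := exists_section_torus hA hW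
  obtain ⟨w₀⟩ : Nonempty W := inferInstance
  have hU : IsOpen (range σ) := hσ.isOpen_range
  have : SimplyConnectedSpace (range σ) :=
    hσ.isEmbedding.toHomeomorph.symm.toHomotopyEquiv.simplyConnectedSpace
  have hmem : ∀ w, σ w ∈ toTorus τ A ⁻¹' W := fun w => by
    rw [mem_preimage, hσW]
    exact w.2
  have hUS : Disjoint (range σ) (singularLocus τ A) := by
    refine disjoint_left.mpr ?_
    rintro _ ⟨w, rfl⟩ hs
    exact disjoint_left.mp hWS w.2 ⟨_, hs, hσW w⟩
  have hbij := jet_bijective hL he lam hU hUS (mem_range_self w₀)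
  have hrest : ∀ f ∈ torusSolutionSpace τ A L lam W, ∀ x ∈ range σ,
      IsSolutionAt L lam (fun y => f (toTorus τ A y)) x := by
    rintro f hf _ ⟨w, rfl⟩
    exact hf.2 _ (hmem w)
  -- Restriction of the pull-back to the single sheet σ(W) of the preimage of W.
  let R : torusSolutionSpace τ A L lam W →ₗ[ℂ] solutionSpace L lam (range σ) :=
    { toFun f := ⟨(range σ).indicator fun y => f.1 (toTorus τ A y),
        indicator_mem_solutionSpace hU (hrest f.1 f.2)⟩
      map_add' f g := Subtype.ext (indicator_add' (range σ) (fun y => f.1 (toTorus τ A y))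
        fun y => g.1 (toTorus τ A y))
      map_smul' c f := Subtype.ext (indicator_const_smul (range σ) c
        fun y => f.1 (toTorus τ A y)) }
  have hR : ∀ f w, (R f).1 (σ w) = f.1 w := fun f w => by
    change (range σ).indicator (fun y => f.1 (toTorus τ A y)) (σ w) = f.1 w
    rw [indicator_of_mem (mem_range_self w), hσW]
  have hRb : Function.Bijective R := by
    constructor
    · intro f g hfg
      refine Subtype.ext (funext fun t => ?_)
      by_cases ht : t ∈ W
      · rw [← hR f ⟨t, ht⟩, ← hR g ⟨t, ht⟩, hfg]
      · obtain ⟨x, rfl⟩ := isQuotientMap_toTorus.surjective t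
        exact (f.2.1 x ht).trans (g.2.1 x ht).symm
    · intro g
      -- Conversely a solution on one sheet descends to W. Its pull-back near any other point of the
      -- preimage is a lattice translate, again a solution by periodicity of the coefficients.
      let f : Torus τ A → ℂ := fun t => if h : t ∈ W then g.1 (σ ⟨t, h⟩) else 0
      have hf : f ∈ torusSolutionSpace τ A L lam W := by
        refine ⟨fun x hx => dif_neg hx, fun x hx => ?_⟩
        set w : W := ⟨toTorus τ A x, hx⟩ with hw
        set v := σ w - x with hv
        have hvL : v ∈ periodLattice τ A := toTorus_eq_iff.mp (hσW w).symm
        have hxv : x + v = σ w := by rw [hv, add_sub_cancel]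
        have hsol := isSolutionAt_comp_add_right (fun i k x => hL.periodic i k v hvL x) (x := x)
          (hxv.symm ▸ g.2.2 (σ w) (mem_range_self w))
        refine isSolutionAt_congr ?_ hsol
        have hcont : ContinuousAt (fun y => y + v) x := by fun_prop
        filter_upwards [hcont.preimage_mem_nhds (hU.mem_nhds (hxv ▸ mem_range_self w))]
        rintro y ⟨w', hw'⟩
        have h1 : toTorus τ A y = w' := by
          rw [← hσW w', toTorus_eq_iff, hw', add_sub_cancel_left]
          exact hvL
        change g.1 (y + v) = f (toTorus τ A y)
        rw [h1]
        simp only [f, w'.2, dif_pos, Subtype.coe_eta]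
        rw [hw']
      refine ⟨⟨f, hf⟩, Subtype.ext (funext fun x => ?_)⟩
      by_cases hx : x ∈ range σ
      · obtain ⟨w, rfl⟩ := hx
        rw [hR]
        simp only [f, w.2, dif_pos, Subtype.coe_eta]
      · change (range σ).indicator (fun y => f (toTorus τ A y)) x = g.1 x
        rw [indicator_of_notMem hx, g.2.1 x hx]
  have h := (LinearEquiv.ofBijective R hRb).trans (LinearEquiv.ofBijective _ hbij)
  rw [h.finrank_eq, Module.finrank_pi]

end LameOperators

end

noncomputable section

/-! ### Cones in the complement of the polar hyperplanes -/

namespace LameOperators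

open Set Metric Filter TopologicalSpace SeveralComplex

/-- At a lattice point w, `weierstrassPExcept w` omits the summand with the pole at w and is
continuous there, leaving the double pole; elsewhere ℘ is continuous. -/
theorem exists_bound_weierstrassP (P : PeriodPair) (w : ℂ) :
    ∃ C : ℝ, ∀ᶠ z in 𝓝 w, ‖P.weierstrassP z‖ * ‖z - w‖ ^ 2 ≤ C := by
  by_cases hw : w ∈ P.lattice
  · have hc : ContinuousAt (P.weierstrassPExcept w) w :=
      ((P.differentiableOn_weierstrassPExcept w).differentiableAt
        (P.compl_lattice_sdiff_singleton_mem_nhds w)).continuousAt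
    have hg : ContinuousAt (fun z => ‖P.weierstrassPExcept w z - 1 / w ^ 2‖ * ‖z - w‖ ^ 2 + 1) w :=
      by fun_prop
    refine ⟨‖P.weierstrassPExcept w w - 1 / w ^ 2‖ * ‖w - w‖ ^ 2 + 1 + 1, ?_⟩
    filter_upwards [hg.eventually_lt continuousAt_const (lt_add_one _)] with z hz
    refine le_trans ?_ hz.le
    have h := P.weierstrassPExcept_add ⟨w, hw⟩ z
    have h1 : P.weierstrassP z =
        (P.weierstrassPExcept w z - 1 / w ^ 2) + 1 / (z - w) ^ 2 := by rw [← h]; ring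
    have h2 : ‖1 / (z - w) ^ 2‖ * ‖z - w‖ ^ 2 ≤ 1 := by
      rw [norm_div, norm_one, norm_pow]
      rcases eq_or_ne (‖z - w‖ ^ 2) 0 with h0 | h0
      · rw [h0]; norm_num
      · exact (div_mul_cancel₀ 1 h0).le
    rw [h1]
    have h3 := mul_le_mul_of_nonneg_right
      (norm_add_le (P.weierstrassPExcept w z - 1 / w ^ 2) (1 / (z - w) ^ 2))
      (by positivity : (0 : ℝ) ≤ ‖z - w‖ ^ 2)
    linarith
  · have hc : ContinuousAt P.weierstrassP w := (P.analyticOnNhd_weierstrassP w hw).continuousAt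
    have hg : ContinuousAt (fun z => ‖P.weierstrassP z‖ * ‖z - w‖ ^ 2) w := by fun_prop
    exact ⟨_, (hg.eventually_lt continuousAt_const (lt_add_one _)).mono fun z hz => hz.le⟩

theorem exists_bound_weierstrassP_of_notMem (P : PeriodPair) {w : ℂ} (hw : w ∉ P.lattice) :
    ∃ C : ℝ, ∀ᶠ z in 𝓝 w, ‖P.weierstrassP z‖ ≤ C := by
  have hc : ContinuousAt P.weierstrassP w := (P.analyticOnNhd_weierstrassP w hw).continuousAt
  exact ⟨_, (hc.norm.eventually_lt continuousAt_const (lt_add_one _)).mono fun z hz => hz.le⟩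

variable {n : ℕ}

/-- A concave function that is positive on the cone `Re (conj ω_α α₀(v)) > 0`, `α ∈ B`. -/
def coneDist (B : Finset (AffineForm n)) (hB : B.Nonempty) (ω : AffineForm n → ℂ)
    (v : Fin n → ℂ) : ℝ :=
  B.inf' hB fun α => (starRingEnd ℂ (ω α) * α.lin v).re / (‖ω α‖ * ‖α.lin‖)

section

variable {B : Finset (AffineForm n)} {hB : B.Nonempty} {ω : AffineForm n → ℂ}

theorem abs_re_conj_mul_div_le {α : AffineForm n} (hω : ω α ≠ 0) (hα : α.lin ≠ 0)
    (v : Fin n → ℂ) : |(starRingEnd ℂ (ω α) * α.lin v).re / (‖ω α‖ * ‖α.lin‖)| ≤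
      ‖α.lin v‖ / ‖α.lin‖ := by
  have h1 : 0 < ‖ω α‖ := norm_pos_iff.mpr hω
  have h2 : 0 < ‖α.lin‖ := norm_pos_iff.mpr hα
  rw [abs_div, abs_of_pos (mul_pos h1 h2), div_le_div_iff₀ (mul_pos h1 h2) h2]
  have := Complex.abs_re_le_norm (starRingEnd ℂ (ω α) * α.lin v)
  rw [norm_mul, RCLike.norm_conj] at this
  nlinarith

/-- A minimum of real-linear functionals is concave and positively homogeneous, and the
normalization bounds it by the norm. Where it is positive, no hyperplane through x₀ is met, and near
x₀ there are no others. -/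
theorem isCorner_coneDist {τ : UpperHalfPlane} {A : Finset (AffineForm n)}
    (hA : ∀ α ∈ A, α.sq ≠ 0) {x₀ : Fin n → ℂ}
    (hBA : ∀ α, α ∈ B ↔ α ∈ A ∧ α.eval x₀ ∈ (periodPair τ).lattice) (hω : ∀ α ∈ B, ω α ≠ 0)
    (hpos : ∃ v, 0 < coneDist B hB ω v) : IsCorner (coneDist B hB ω) x₀ (regularSet τ A) where
  smul t ht v := by
    have h : ∀ α : AffineForm n,
        (starRingEnd ℂ (ω α) * α.lin ((t : ℂ) • v)).re / (‖ω α‖ * ‖α.lin‖) =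
          t * ((starRingEnd ℂ (ω α) * α.lin v).re / (‖ω α‖ * ‖α.lin‖)) := fun α => by
      rw [map_smul, smul_eq_mul, mul_left_comm, Complex.re_ofReal_mul, mul_div_assoc]
    refine le_antisymm ?_ ((Finset.le_inf'_iff hB _).mpr fun α hα => ?_)
    · obtain ⟨α, hα, he⟩ := B.exists_mem_eq_inf' hB fun α =>
        (starRingEnd ℂ (ω α) * α.lin v).re / (‖ω α‖ * ‖α.lin‖)
      rw [coneDist, coneDist, he, ← h]
      exact Finset.inf'_le _ hα
    · rw [h]
      exact mul_le_mul_of_nonneg_left (Finset.inf'_le _ hα) ht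
  add_le v w := by
    refine (Finset.le_inf'_iff hB _).mpr fun α hα => ?_
    rw [map_add, mul_add, Complex.add_re, add_div]
    exact add_le_add (Finset.inf'_le _ hα) (Finset.inf'_le _ hα)
  abs_le_norm v := by
    obtain ⟨α, hα, he⟩ := B.exists_mem_eq_inf' hB fun α =>
      (starRingEnd ℂ (ω α) * α.lin v).re / (‖ω α‖ * ‖α.lin‖)
    have h0 := AffineForm.lin_ne_zero (hA α ((hBA α).mp hα).1)
    rw [coneDist, he]
    refine (abs_re_conj_mul_div_le (hω α hα) h0 v).trans ?_
    rw [div_le_iff₀ (norm_pos_iff.mpr h0), mul_comm]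
    exact α.lin.le_opNorm v
  exists_pos := hpos
  eventually_mem := by
    filter_upwards [eventually_eval_mem_lattice (τ := τ) A x₀] with y hy h0
    rw [mem_regularSet, mem_singularLocus]
    rintro ⟨α, hα, hl⟩
    have h1 := hy α hα hl
    have h2 : α.eval y = α.eval x₀ := by rw [α.eval_eq, α.eval_eq, h1]
    have h3 := (Finset.lt_inf'_iff hB).mp h0 α ((hBA α).mpr ⟨hα, h2 ▸ hl⟩)
    rw [map_sub, h1, sub_self, mul_zero, Complex.zero_re, zero_div] at h3
    exact h3.false

/-- For a hyperplane through x₀ the gauge is at most |α(x) - α(x₀)|/‖α‖, so its square absorbs the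
double pole of ℘; the remaining summands are bounded near x₀. -/
theorem potentialHol_mem_poleSpace {τ : UpperHalfPlane} {A : Finset (AffineForm n)}
    (hA : ∀ α ∈ A, α.sq ≠ 0) {x₀ : Fin n → ℂ}
    (hBA : ∀ α, α ∈ B ↔ α ∈ A ∧ α.eval x₀ ∈ (periodPair τ).lattice) (hω : ∀ α ∈ B, ω α ≠ 0)
    (m : AffineForm n → ℕ) (hc : IsCorner (coneDist B hB ω) x₀ (regularSet τ A)) :
    potentialHol τ A m ∈ hc.poleSpace 2 := by
  have key : ∀ α : A, ∃ C : ℝ, ∀ᶠ x in 𝓝 x₀, 0 < coneDist B hB ω (x - x₀) →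
      ‖(periodPair τ).weierstrassP (α.1.eval x)‖ * coneDist B hB ω (x - x₀) ^ 2 ≤ C := by
    rintro ⟨α, hα⟩
    have h0 := AffineForm.lin_ne_zero (hA α hα)
    by_cases hl : α.eval x₀ ∈ (periodPair τ).lattice
    · obtain ⟨C, hC⟩ := exists_bound_weierstrassP (periodPair τ) (α.eval x₀)
      refine ⟨C / ‖α.lin‖ ^ 2, ?_⟩
      filter_upwards [α.continuous_eval.continuousAt.eventually hC] with x hx hp
      have hαB : α ∈ B := (hBA α).mpr ⟨hα, hl⟩
      have h1 : coneDist B hB ω (x - x₀) ≤ ‖α.eval x - α.eval x₀‖ / ‖α.lin‖ := by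
        rw [α.eval_eq, α.eval_eq, add_sub_add_left_eq_sub, ← map_sub]
        exact (Finset.inf'_le _ hαB).trans
          ((le_abs_self _).trans (abs_re_conj_mul_div_le (hω α hαB) h0 _))
      calc ‖(periodPair τ).weierstrassP (α.eval x)‖ * coneDist B hB ω (x - x₀) ^ 2
          ≤ ‖(periodPair τ).weierstrassP (α.eval x)‖ *
            (‖α.eval x - α.eval x₀‖ / ‖α.lin‖) ^ 2 := by gcongr
        _ = ‖(periodPair τ).weierstrassP (α.eval x)‖ *
            ‖α.eval x - α.eval x₀‖ ^ 2 / ‖α.lin‖ ^ 2 := by rw [div_pow, mul_div_assoc]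
        _ ≤ C / ‖α.lin‖ ^ 2 := by gcongr
    · obtain ⟨C, hC⟩ := exists_bound_weierstrassP_of_notMem (periodPair τ) hl
      refine ⟨C, ?_⟩
      filter_upwards [α.continuous_eval.continuousAt.eventually hC, ball_mem_nhds x₀ one_pos]
        with x hx h1 hp
      rw [mem_ball, dist_eq_norm] at h1
      have h2 : coneDist B hB ω (x - x₀) ≤ 1 :=
        ((le_abs_self _).trans (hc.abs_le_norm _)).trans h1.le
      calc _ ≤ ‖(periodPair τ).weierstrassP (α.eval x)‖ * 1 :=
            mul_le_mul_of_nonneg_left (pow_le_one₀ hp.le h2) (norm_nonneg _)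
        _ ≤ C := by rw [mul_one]; exact hx
  choose C hC using key
  refine ⟨∑ α : A, ‖(m α.1 : ℂ) * ((m α.1 : ℂ) + 1) * α.1.sq‖ * C α, ?_⟩
  filter_upwards [eventually_all.mpr hC, hc.eventually_mem] with x hx hO hp
  have hpot : (potentialHol τ A m).toFun x = potential τ A m x := Hol.toFun_mk _ (hO hp)
  rw [hpot, potential, ← Finset.sum_coe_sort]
  refine (mul_le_mul_of_nonneg_right (norm_sum_le _ _) (by positivity)).trans ?_
  rw [Finset.sum_mul]
  refine Finset.sum_le_sum fun α _ => ?_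
  rw [norm_mul, mul_assoc]
  exact mul_le_mul_of_nonneg_left (hx α hp) (norm_nonneg _)

end

end LameOperators

end

noncomputable section

/-! ### Regular singularities -/

namespace LameOperators

open Set Metric Filter TopologicalSpace SeveralComplex SymbolCalculus MvPolynomial
open HomogeneousParameters

variable {n : ℕ}

/-- Polar coordinates. -/
def polar (q : ℝ × ℝ) : ℂ := q.1 * Complex.exp (q.2 * Complex.I)

theorem continuous_polar : Continuous polar := by unfold polar; fun_prop

theorem norm_polar {q : ℝ × ℝ} (hq : 0 < q.1) : ‖polar q‖ = q.1 := by
  rw [polar, norm_mul, Complex.norm_exp_ofReal_mul_I, mul_one, Complex.norm_real,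
    Real.norm_of_nonneg hq.le]

/-- The filter of the points that approach the origin along a ray. -/
def rayFilter (θ : ℝ) : Filter (ℝ × ℝ) := 𝓝[>] 0 ×ˢ 𝓝 θ

instance (θ : ℝ) : (rayFilter θ).NeBot := by unfold rayFilter; infer_instance

theorem rayFilter_le_nhds (θ : ℝ) : rayFilter θ ≤ 𝓝 (0, θ) := by
  rw [nhds_prod_eq]
  exact prod_mono nhdsWithin_le_nhds le_rfl

theorem tendsto_polar (θ : ℝ) : Tendsto polar (rayFilter θ) (𝓝 0) := by
  have h := (continuous_polar.tendsto (0, θ)).mono_left (rayFilter_le_nhds θ)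
  simpa [polar] using h

theorem eventually_rayFilter_pos (θ : ℝ) : ∀ᶠ q in rayFilter θ, 0 < q.1 ∧ q.1 < 1 :=
  tendsto_fst.eventually (Ioo_mem_nhdsGT one_pos)

theorem eventually_rayFilter_iff {θ : ℝ} {p : ℝ × ℝ → Prop} :
    (∀ᶠ q in rayFilter θ, p q) ↔
      ∃ r > 0, ∃ η > 0, ∀ ρ ∈ Ioo 0 r, ∀ t ∈ Ioo (θ - η) (θ + η), p (ρ, t) := by
  constructor
  · intro h
    obtain ⟨u, hu, v, hv, huv⟩ := eventually_prod_iff.mp h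
    obtain ⟨r, hr, hr'⟩ := (nhdsGT_basis (0 : ℝ)).mem_iff.mp hu
    obtain ⟨η, hη, hη'⟩ := Metric.eventually_nhds_iff_ball.mp hv
    refine ⟨r, hr, η, hη, fun ρ hρ t ht => huv (hr' hρ) (hη' t ?_)⟩
    rwa [Real.ball_eq_Ioo]
  · rintro ⟨r, hr, η, hη, h⟩
    have h1 : ∀ᶠ ρ in 𝓝[>] (0 : ℝ), ρ ∈ Ioo 0 r := Ioo_mem_nhdsGT hr
    have h2 : ∀ᶠ t in 𝓝 θ, t ∈ Ioo (θ - η) (θ + η) :=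
      Ioo_mem_nhds (by linarith) (by linarith)
    filter_upwards [h1.prod_mk h2] with q hq
    exact h _ hq.1 _ hq.2

/-- Write g(z) = z^p h(z) with h(0) ≠ 0. Near the ray of angle θ, g divided by ρ^p is close to ω =
e^{ipθ}h(0), so its product with the conjugate of ω has real part above |ω|²/2. -/
theorem exists_re_lower_bound {g : ℂ → ℂ} (hg : AnalyticAt ℂ g 0)
    (h0 : ∃ᶠ z in 𝓝 0, g z ≠ 0) (θ : ℝ) :
    ∃ ω : ℂ, ω ≠ 0 ∧ ∃ c > 0, ∃ p : ℕ, ∀ᶠ q in rayFilter θ,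
      c * q.1 ^ p ≤ (starRingEnd ℂ ω * g (polar q)).re := by
  obtain ⟨p, h, hh, hh0, he⟩ := hg.exists_eventuallyEq_pow_smul_nonzero_iff.mpr
    fun h => h0 (h.mono fun z hz => not_not.mpr hz)
  set ω := Complex.exp (θ * Complex.I) ^ p * h 0 with hω
  have hω0 : ω ≠ 0 := mul_ne_zero (pow_ne_zero _ (Complex.exp_ne_zero _)) hh0
  have hn : 0 < ‖ω‖ := norm_pos_iff.mpr hω0
  refine ⟨ω, hω0, ‖ω‖ ^ 2 / 2, by positivity, p, ?_⟩
  let G : ℝ × ℝ → ℝ := fun q =>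
    (starRingEnd ℂ ω * (Complex.exp (q.2 * Complex.I) ^ p * h (polar q))).re
  have hp0 : polar (0, θ) = 0 := by simp [polar]
  have hG : ContinuousAt G (0, θ) := by
    have h1 : ContinuousAt (fun q => h (polar q)) (0, θ) :=
      ContinuousAt.comp' (by rw [hp0]; exact hh.continuousAt) continuous_polar.continuousAt
    have h2 : ContinuousAt (fun q : ℝ × ℝ => starRingEnd ℂ ω *
        (Complex.exp (q.2 * Complex.I) ^ p * h (polar q))) (0, θ) := by
      have h3 : Continuous fun q : ℝ × ℝ => Complex.exp (q.2 * Complex.I) ^ p := by fun_prop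
      exact continuousAt_const.mul (h3.continuousAt.mul h1)
    exact Complex.continuous_re.continuousAt.comp' h2
  have hG0 : G (0, θ) = ‖ω‖ ^ 2 := by
    simp only [G, hp0]
    rw [← hω, ← Complex.normSq_eq_conj_mul_self, Complex.ofReal_re, Complex.normSq_eq_norm_sq]
  have h1 : ∀ᶠ q in 𝓝 ((0 : ℝ), θ), ‖ω‖ ^ 2 / 2 < G q :=
    hG.eventually_const_lt (by rw [hG0]; nlinarith)
  filter_upwards [rayFilter_le_nhds θ h1, (tendsto_polar θ).eventually he,
    eventually_rayFilter_pos θ] with q hq1 hq2 hq3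
  have h2 : starRingEnd ℂ ω * g (polar q) = ((q.1 ^ p : ℝ) : ℂ) *
      (starRingEnd ℂ ω * (Complex.exp (q.2 * Complex.I) ^ p * h (polar q))) := by
    rw [hq2, sub_zero, smul_eq_mul, polar, mul_pow]
    push_cast
    ring
  rw [h2, Complex.re_ofReal_mul, mul_comm]
  exact mul_le_mul_of_nonneg_left (le_of_lt hq1) (pow_nonneg hq3.1.le _)

/-- A curve which leaves the hyperplanes approaches its origin, along a ray, inside a cone. -/
theorem exists_coneDist {B : Finset (AffineForm n)} (hB : B.Nonempty)
    (hlin : ∀ α ∈ B, α.lin ≠ 0) {φ : ℂ → Fin n → ℂ} (hφ : AnalyticAt ℂ φ 0)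
    (h0 : ∀ α ∈ B, ∃ᶠ z in 𝓝 0, α.lin (φ z - φ 0) ≠ 0) (θ : ℝ) :
    ∃ ω : AffineForm n → ℂ, (∀ α ∈ B, ω α ≠ 0) ∧ ∃ c > 0, ∃ p : ℕ, ∀ᶠ q in rayFilter θ,
      c * q.1 ^ p ≤ coneDist B hB ω (φ (polar q) - φ 0) := by
  have h1 : ∀ α : AffineForm n, ∃ ω : ℂ, α ∈ B → ω ≠ 0 ∧ ∃ c > 0, ∃ p : ℕ,
      ∀ᶠ q in rayFilter θ,
        c * q.1 ^ p ≤ (starRingEnd ℂ ω * α.lin (φ (polar q) - φ 0)).re := by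
    intro α
    by_cases hα : α ∈ B
    · have hg : AnalyticAt ℂ (fun z => α.lin (φ z - φ 0)) 0 :=
        (α.lin.analyticAt _).comp' (hφ.sub analyticAt_const)
      obtain ⟨ω, hω, h⟩ := exists_re_lower_bound hg (h0 α hα) θ
      exact ⟨ω, fun _ => ⟨hω, h⟩⟩
    · exact ⟨0, fun h => absurd h hα⟩
  choose ω hω using h1
  have h2 : ∀ α : B, ∃ c > 0, ∃ p : ℕ, ∀ᶠ q in rayFilter θ,
      c * q.1 ^ p ≤ (starRingEnd ℂ (ω α.1) * α.1.lin (φ (polar q) - φ 0)).re :=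
    fun α => (hω α.1 α.2).2
  choose c hc p hp using h2
  have : Nonempty B := hB.to_subtype
  obtain ⟨α₀, hα₀⟩ := Finite.exists_min fun α : B => c α / (‖ω α.1‖ * ‖α.1.lin‖)
  have hpos : ∀ α : B, 0 < ‖ω α.1‖ * ‖α.1.lin‖ := fun α =>
    mul_pos (norm_pos_iff.mpr (hω α.1 α.2).1) (norm_pos_iff.mpr (hlin α.1 α.2))
  -- The smallest constant and the sum of the exponents serve all α at once, since ρ < 1 near the
  -- vertex of the ray.
  refine ⟨ω, fun α hα => (hω α hα).1, _, div_pos (hc α₀) (hpos α₀), ∑ α, p α, ?_⟩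
  filter_upwards [eventually_all.mpr hp, eventually_rayFilter_pos θ] with q hq hq0
  refine (Finset.le_inf'_iff hB _).mpr fun α hα => ?_
  have h3 : q.1 ^ (∑ α, p α) ≤ q.1 ^ p ⟨α, hα⟩ := pow_le_pow_of_le_one hq0.1.le hq0.2.le
    (Finset.single_le_sum (f := p) (fun _ _ => Nat.zero_le _) (Finset.mem_univ _))
  calc _ ≤ c ⟨α, hα⟩ / (‖ω α‖ * ‖α.lin‖) * q.1 ^ p ⟨α, hα⟩ :=
        mul_le_mul (hα₀ ⟨α, hα⟩) h3 (pow_nonneg hq0.1.le _) (div_pos (hc _) (hpos ⟨α, hα⟩)).le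
    _ = c ⟨α, hα⟩ * q.1 ^ p ⟨α, hα⟩ / (‖ω α‖ * ‖α.lin‖) := by rw [div_mul_eq_mul_div]
    _ ≤ _ := div_le_div_of_nonneg_right (hq ⟨α, hα⟩) (hpos ⟨α, hα⟩).le

/-- A branch is given by a single function where the latter is defined. -/
theorem IsBranchAlong.eventuallyEq {L : Fin n → DiffOp n} {lam : Fin n → ℂ}
    {φ : ℂ → (Fin n → ℂ)} {S T : Set ℂ} {Ψ : ℂ → (Fin n → ℂ) → ℂ}
    (hΨ : IsBranchAlong L lam φ S Ψ) (hTS : T ⊆ S) (hT : IsPreconnected T)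
    (hφ : ∀ z ∈ T, ContinuousAt φ z) {Q : Set (Fin n → ℂ)} (hQ : IsOpen Q)
    (hφQ : ∀ z ∈ T, φ z ∈ Q) {ψ : (Fin n → ℂ) → ℂ} (hψ : ∀ x ∈ Q, AnalyticAt ℂ ψ x)
    {w z : ℂ} (hw : w ∈ T) (hz : z ∈ T) (h : Ψ w =ᶠ[𝓝 (φ w)] ψ) : Ψ z =ᶠ[𝓝 (φ z)] ψ := by
  -- Whether the germ at a point is that of ψ is locally constant along the connected set T, by the
  -- identity theorem in a small ball.
  refine (hT.induction₂ (fun a b => (Ψ a =ᶠ[𝓝 (φ a)] ψ ↔ Ψ b =ᶠ[𝓝 (φ b)] ψ)) (fun a ha => ?_)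
    (fun a b c _ _ _ => Iff.trans) (fun a b _ _ => Iff.symm) hw hz).mp h
  refine nhdsWithin_le_nhds ?_
  obtain ⟨h1, h2⟩ := hΨ a (hTS ha)
  obtain ⟨r, hr, hb⟩ := Metric.eventually_nhds_iff_ball.mp
    (h1.and (hQ.mem_nhds (hφQ a ha)))
  filter_upwards [h2, (hφ a ha).preimage_mem_nhds (ball_mem_nhds _ hr)] with b h3 h4
  have key : ∀ x ∈ ball (φ a) r, ∀ y ∈ ball (φ a) r, Ψ a =ᶠ[𝓝 x] ψ → Ψ a =ᶠ[𝓝 y] ψ := by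
    intro x hx y hy hxy
    have := AnalyticOnNhd.eqOn_of_preconnected_of_eventuallyEq (f := Ψ a) (g := ψ)
      (fun t ht => (hb t ht).1.1) (fun t ht => hψ t (hb t ht).2)
      (convex_ball (φ a) r).isPreconnected hx hxy
    exact this.eventuallyEq_of_mem (isOpen_ball.mem_nhds hy)
  exact ⟨fun h => h3.trans (key _ (mem_ball_self hr) _ h4 h),
    fun h => key _ h4 _ (mem_ball_self hr) (h3.symm.trans h)⟩

end LameOperators

end

/-! ### Growth of branches near rays and in sectors -/

noncomputable section

namespace LameOperators

open Set Metric Filter TopologicalSpace SeveralComplex SymbolCalculus MvPolynomial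
open HomogeneousParameters

variable {n : ℕ}

theorem _root_.SeveralComplex.IsCorner.convex {O : Opens (Fin n → ℂ)} {δ : (Fin n → ℂ) → ℝ}
    {x₀ : Fin n → ℂ} (hc : IsCorner δ x₀ O) : Convex ℝ {x | 0 < δ (x - x₀)} := by
  intro x hx y hy s t hs ht hst
  simp only [mem_setOf_eq] at hx hy ⊢
  have h1 : s • x + t • y - x₀ = (s : ℂ) • (x - x₀) + (t : ℂ) • (y - x₀) := by
    have hst' : (s : ℂ) + t = 1 := by exact_mod_cast hst
    funext j
    simp only [Pi.add_apply, Pi.sub_apply, Pi.smul_apply, Complex.real_smul, smul_eq_mul]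
    linear_combination (x₀ j) * hst'
  rw [h1]
  refine lt_of_lt_of_le ?_ (hc.add_le _ _)
  rw [hc.smul s hs, hc.smul t ht]
  rcases hs.eq_or_lt with rfl | hs'
  · rw [zero_add] at hst
    rw [hst]
    linarith
  · exact add_pos_of_pos_of_nonneg (mul_pos hs' hx) (mul_nonneg ht hy.le)

variable {τ : UpperHalfPlane} {A : Finset (AffineForm n)} [NeZero n] {m : AffineForm n → ℕ}
  {L : Fin n → DiffOp n} {Λ : AddSubgroup (Fin n → ℂ)} {s : Fin n → MvPolynomial (Fin n) ℂ}

/-- Moderate growth of a branch of a solution near a ray. -/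
theorem exists_growth_ray (hA : ∀ α ∈ A, α.sq ≠ 0)
    (hL : IsStronglyIntegrable Λ (schrodinger (potential τ A m)) L s) {lam : Fin n → ℂ}
    {ε : ℝ} {φ : ℂ → (Fin n → ℂ)} (hε : 0 < ε) (hφ : AnalyticOnNhd ℂ φ (ball 0 ε))
    (h0 : φ 0 ∈ singularLocus τ A)
    (hφS : ∀ z ∈ ball (0 : ℂ) ε, z ≠ 0 → φ z ∉ singularLocus τ A) {a b : ℝ} (hab : a < b)
    {Ψ : ℂ → (Fin n → ℂ) → ℂ} (hΨ : IsBranchAlong L lam φ (sector ε a b) Ψ) (k : Fin n →₀ ℕ)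
    {θ : ℝ} (hθ : θ ∈ Icc a b) :
    ∃ (C : ℝ) (K : ℕ), ∀ᶠ q in rayFilter θ, q.2 ∈ Ioo a b →
      ‖partialDeriv k (Ψ (polar q)) (φ (polar q))‖ ≤ C / q.1 ^ K := by
  classical
  set B := A.filter fun α => α.eval (φ 0) ∈ (periodPair τ).lattice with hBdef
  have hBA : ∀ α, α ∈ B ↔ α ∈ A ∧ α.eval (φ 0) ∈ (periodPair τ).lattice := fun α => by
    rw [hBdef, Finset.mem_filter]
  have hB : B.Nonempty := by
    obtain ⟨α, hα, hl⟩ := mem_singularLocus.mp h0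
    exact ⟨α, (hBA α).mpr ⟨hα, hl⟩⟩
  have hlin : ∀ α ∈ B, α.lin ≠ 0 := fun α hα => AffineForm.lin_ne_zero (hA α ((hBA α).mp hα).1)
  have hφ0 : AnalyticAt ℂ φ 0 := hφ 0 (mem_ball_self hε)
  have hfreq : ∀ α ∈ B, ∃ᶠ z in 𝓝 (0 : ℂ), α.lin (φ z - φ 0) ≠ 0 := by
    intro α hα
    have : ∀ᶠ z in 𝓝[≠] (0 : ℂ), α.lin (φ z - φ 0) ≠ 0 := by
      filter_upwards [self_mem_nhdsWithin, nhdsWithin_le_nhds (ball_mem_nhds (0 : ℂ) hε)]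
        with z hz0 hz h
      refine hφS z hz hz0 (mem_singularLocus.mpr ⟨α, ((hBA α).mp hα).1, ?_⟩)
      rw [map_sub, sub_eq_zero] at h
      have := ((hBA α).mp hα).2
      rwa [α.eval_eq, ← h, ← α.eval_eq] at this
    exact this.frequently.filter_mono nhdsWithin_le_nhds
  obtain ⟨ω, hω, c, hc, p, hcone⟩ := exists_coneDist hB hlin hφ0 hfreq θ
  set δ := coneDist B hB ω with hδ
  have hpos : ∃ v, 0 < δ v := by
    obtain ⟨q, h1, h2⟩ := (hcone.and (eventually_rayFilter_pos θ)).exists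
    exact ⟨_, lt_of_lt_of_le (mul_pos hc (pow_pos h2.1 _)) h1⟩
  have hcor : IsCorner δ (φ 0) (regularSet τ A) := isCorner_coneDist hA hBA hω hpos
  have hpole := potentialHol_mem_poleSpace hA hBA hω m hcor
  obtain ⟨l, hS, hl0, hl⟩ := exists_isHolonomic hL
  have hsym : ∀ i, l i ∈ hcor.symbolSpace (s i).totalDegree := fun i =>
    hcor.mem_symbolSpace hpole (by rw [← hl0]; exact hS.comm 0 i) _ le_rfl _
      (hcor.map_algebraMap_mem (hS.homogeneous i)) (hS.symbol i)
  obtain ⟨ρ, hρ, hρO⟩ := Metric.eventually_nhds_iff_ball.mp hcor.eventually_mem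
  -- Convex, hence simply connected, and off Sing: the branch near the ray is represented on Q by
  -- one single-valued solution.
  set Q : Set (Fin n → ℂ) := {x | 0 < δ (x - φ 0)} ∩ ball (φ 0) ρ with hQ
  have hQo : IsOpen Q := (isOpen_lt continuous_const
    (hcor.continuous.comp (continuous_id.sub continuous_const))).inter isOpen_ball
  have hQreg : (⟨Q, hQo⟩ : Opens (Fin n → ℂ)) ≤ regularSet τ A := fun x hx => hρO x hx.2 hx.1
  have hQS : Disjoint Q (singularLocus τ A) := disjoint_left.mpr fun x hx => hQreg hx
  have htend : Tendsto (fun q => φ (polar q)) (rayFilter θ) (𝓝 (φ 0)) :=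
    hφ0.continuousAt.tendsto.comp (tendsto_polar θ)
  have hφQ : ∀ᶠ q in rayFilter θ, φ (polar q) ∈ Q ∧ q.1 < ε := by
    have h1 : ∀ᶠ q in rayFilter θ, polar q ∈ ball (0 : ℂ) ε :=
      (tendsto_polar θ).eventually (ball_mem_nhds _ hε)
    filter_upwards [hcone, eventually_rayFilter_pos θ, htend.eventually (ball_mem_nhds _ hρ), h1]
      with q h2 h3 h4 h5
    refine ⟨⟨lt_of_lt_of_le (mul_pos hc (pow_pos h3.1 _)) h2, h4⟩, ?_⟩
    rwa [mem_ball_zero_iff, norm_polar h3.1] at h5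
  obtain ⟨r, hr, η, hη, hbox⟩ := eventually_rayFilter_iff.mp hφQ
  set T' : Set (ℝ × ℝ) := Ioo 0 r ×ˢ (Ioo (θ - η) (θ + η) ∩ Ioo a b) with hT'
  have hT'Q : ∀ q ∈ T', φ (polar q) ∈ Q := fun q hq => (hbox q.1 hq.1 q.2 hq.2.1).1
  have hTS : polar '' T' ⊆ sector ε a b := by
    rintro _ ⟨q, hq, rfl⟩
    exact ⟨q.1, q.2, hq.1.1, (hbox q.1 hq.1 q.2 hq.2.1).2, hq.2.2.1, hq.2.2.2, rfl⟩
  have hT : IsPreconnected (polar '' T') :=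
    (((convex_Ioo _ _).prod ((convex_Ioo _ _).inter (convex_Ioo _ _))).isPreconnected).image _
      continuous_polar.continuousOn
  have hTφ : ∀ z ∈ polar '' T', ContinuousAt φ z := by
    rintro _ ⟨q, hq, rfl⟩
    refine (hφ _ ?_).continuousAt
    rw [mem_ball_zero_iff, norm_polar hq.1.1]
    exact (hbox q.1 hq.1 q.2 hq.2.1).2
  -- The angle θ may be an endpoint of [a, b], so the window around it is intersected with (a, b)
  -- and a common point is exhibited.
  obtain ⟨q₁, hq₁⟩ : T'.Nonempty := by
    have h1 : max (θ - η) a < min (θ + η) b := by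
      rw [max_lt_iff, lt_min_iff, lt_min_iff]
      exact ⟨⟨by linarith, by linarith [hθ.2]⟩, by linarith [hθ.1], hab⟩
    obtain ⟨t, ht⟩ := exists_between h1
    rw [max_lt_iff, lt_min_iff] at ht
    exact ⟨(r / 2, t), ⟨half_pos hr, half_lt_self hr⟩, ⟨ht.1.1, ht.2.1⟩, ht.1.2, ht.2.2⟩
  have : ContractibleSpace Q :=
    (hcor.convex.inter (convex_ball _ _)).contractibleSpace ⟨_, hT'Q q₁ hq₁⟩
  have : SimplyConnectedSpace Q := SimplyConnectedSpace.ofContractible Q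
  obtain ⟨κ, _, e, he⟩ := exists_isQuotBasis hL.homogeneous hL.finite
  obtain ⟨ψ, hψ, hψe⟩ := exists_solution_continuation hL he lam hQo hQS (hT'Q q₁ hq₁)
    (hΨ _ (hTS (mem_image_of_mem _ hq₁))).1
  have hΨψ : ∀ q ∈ T', Ψ (polar q) =ᶠ[𝓝 (φ (polar q))] ψ := fun q hq =>
    hΨ.eventuallyEq hTS hT hTφ hQo (by rintro _ ⟨q, hq, rfl⟩; exact hT'Q q hq)
      (fun x hx => (hψ x hx).1) (mem_image_of_mem _ hq₁) (mem_image_of_mem _ hq) hψe.symm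
  obtain ⟨hψa, hψm⟩ := (forall_isSolutionAt_iff hL hl lam hQreg).mp hψ
  obtain ⟨C, K, hCK⟩ := hS.exists_growth hcor hsym k hQreg
    (by filter_upwards [ball_mem_nhds _ hρ] with x hx h; exact ⟨h, hx⟩) hψm
  -- The gauge is at least c ρ^p along the disc, which turns C/δ^K into C/(c^K ρ^{pK}).
  refine ⟨C / c ^ K, p * K, ?_⟩
  have hmem : ∀ᶠ q in rayFilter θ, q.2 ∈ Ioo a b → q ∈ T' :=
    eventually_rayFilter_iff.mpr ⟨r, hr, η, hη, fun ρ hρ t ht h => ⟨hρ, ht, h⟩⟩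
  filter_upwards [hmem, htend.eventually hCK, hcone, eventually_rayFilter_pos θ]
    with q h1 h2 h3 h4 hq
  have hqQ := hT'Q q (h1 hq)
  have h5 : (Sec.mk hQreg ψ hψa).toFun =ᶠ[𝓝 (φ (polar q))] ψ :=
    Hol.eventuallyEq_of_eqOn (U := ⟨Q, hQo⟩) (fun x hx => Sec.toFun_mk hψa hx) hqQ
  have h6 := h2 hqQ.1
  rw [(partialDeriv_congr k (h5.trans (hΨψ q (h1 hq)).symm)).eq_of_nhds] at h6
  have h7 : 0 < c * q.1 ^ p := mul_pos hc (pow_pos h4.1 _)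
  rw [div_div, pow_mul, ← mul_pow, le_div_iff₀ (pow_pos h7 _)]
  exact (mul_le_mul_of_nonneg_left (pow_le_pow_left₀ h7.le h3 K) (norm_nonneg _)).trans h6

/-- The system has regular singularities. -/
theorem hasRegularSingularities (hA : ∀ α ∈ A, α.sq ≠ 0)
    (hL : IsStronglyIntegrable Λ (schrodinger (potential τ A m)) L s) (lam : Fin n → ℂ) :
    HasRegularSingularities L lam (singularLocus τ A) := by
  intro ε φ hε hφ h0 hφS a b hab _ Ψ hΨ k
  have key : ∃ (C r : ℝ) (K : ℕ), 0 < r ∧ ∀ ρ ∈ Ioo 0 r, ∀ t ∈ Icc a b, t ∈ Ioo a b →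
      ‖partialDeriv k (Ψ (polar (ρ, t))) (φ (polar (ρ, t)))‖ ≤ C / ρ ^ K := by
    -- Each direction has a neighbourhood with its own bound. Working on the closed interval,
    -- endpoints included, lets finitely many of them cover the sector up to its edges.
    refine isCompact_Icc.induction_on (p := fun S => ∃ (C r : ℝ) (K : ℕ), 0 < r ∧
      ∀ ρ ∈ Ioo 0 r, ∀ t ∈ S, t ∈ Ioo a b →
        ‖partialDeriv k (Ψ (polar (ρ, t))) (φ (polar (ρ, t)))‖ ≤ C / ρ ^ K)
      ⟨0, 1, 0, one_pos, fun _ _ _ h => absurd h (notMem_empty _)⟩ ?_ ?_ ?_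
    · rintro S T hST ⟨C, r, K, hr, h⟩
      exact ⟨C, r, K, hr, fun ρ hρ t ht => h ρ hρ t (hST ht)⟩
    · rintro S T ⟨C, r, K, hr, h⟩ ⟨C', r', K', hr', h'⟩
      have hbound : ∀ (C₀ : ℝ) (K₀ : ℕ), C₀ ≤ max (max C C') 0 → K₀ ≤ max K K' →
          ∀ ρ ∈ Ioo (0 : ℝ) 1, C₀ / ρ ^ K₀ ≤ max (max C C') 0 / ρ ^ max K K' := by
        intro C₀ K₀ hC hK ρ hρ
        exact div_le_div₀ (le_max_right _ _) hC (pow_pos hρ.1 _)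
          (pow_le_pow_of_le_one hρ.1.le hρ.2.le hK)
      refine ⟨max (max C C') 0, min (min r r') 1, max K K', lt_min (lt_min hr hr') one_pos, ?_⟩
      rintro ρ ⟨hρ0, hρ⟩ t ht htab
      rw [lt_min_iff, lt_min_iff] at hρ
      rcases ht with ht | ht
      · exact (h ρ ⟨hρ0, hρ.1.1⟩ t ht htab).trans (hbound C K
          ((le_max_left _ _).trans (le_max_left _ _)) (le_max_left _ _) ρ ⟨hρ0, hρ.2⟩)
      · exact (h' ρ ⟨hρ0, hρ.1.2⟩ t ht htab).trans (hbound C' K'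
          ((le_max_right _ _).trans (le_max_left _ _)) (le_max_right _ _) ρ ⟨hρ0, hρ.2⟩)
    · intro θ hθ
      obtain ⟨C, K, h⟩ := exists_growth_ray hA hL hε hφ h0 hφS hab hΨ k hθ
      obtain ⟨r, hr, η, hη, h'⟩ := eventually_rayFilter_iff.mp h
      exact ⟨Ioo (θ - η) (θ + η), nhdsWithin_le_nhds (Ioo_mem_nhds (by linarith) (by linarith)),
        C, r, K, hr, h'⟩
  obtain ⟨C, r, K, hr, h⟩ := key
  refine ⟨C, r, K, hr, ?_⟩
  rintro z ⟨ρ, t, hρ, -, hat, htb, rfl⟩ hz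
  have h1 : ‖polar (ρ, t)‖ = ρ := norm_polar (q := (ρ, t)) hρ
  change ‖polar (ρ, t)‖ < r at hz
  change ‖partialDeriv k (Ψ (polar (ρ, t))) (φ (polar (ρ, t)))‖ ≤ C / ‖polar (ρ, t)‖ ^ K
  rw [h1] at hz ⊢
  exact h ρ ⟨hρ, hz⟩ t ⟨hat.le, htb.le⟩ ⟨hat, htb⟩

end LameOperators

end

theorem mainTheorem5 (n : ℕ) [NeZero n] (τ : UpperHalfPlane)
    (A : Finset (LameOperators.AffineForm n)) (m : LameOperators.AffineForm n → ℕ)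
    (hA : LameOperators.IsGeneralizedLame τ A m)
    (L : Fin n → LameOperators.DiffOp n) (s : Fin n → MvPolynomial (Fin n) ℂ)
    (hL : LameOperators.IsStronglyIntegrable (LameOperators.periodLattice τ A)
      (LameOperators.schrodinger (LameOperators.potential τ A m)) L s) :
    Module.Free (Algebra.adjoin ℂ (Set.range s)) (MvPolynomial (Fin n) ℂ) ∧
    (∀ (i : Fin n) (k : Fin n →₀ ℕ), ∃ a : (Fin n → ℂ) → ℂ,
      AnalyticOnNhd ℂ a (LameOperators.singularLocus τ A)ᶜ ∧
      ∀ x ∉ LameOperators.singularLocus τ A,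
        AnalyticAt ℂ ((L i).coeff k) x → (L i).coeff k x = a x) ∧
    ∀ lam : Fin n → ℂ,
      (∀ W : Set (LameOperators.Torus τ A), IsOpen W → SimplyConnectedSpace W →
        Disjoint W (LameOperators.toTorus τ A '' LameOperators.singularLocus τ A) →
        Module.finrank ℂ (LameOperators.torusSolutionSpace τ A L lam W) =
          LameOperators.symbolRank s) ∧
      LameOperators.HasRegularSingularities L lam (LameOperators.singularLocus τ A) := by
  obtain ⟨κ, _, e, he⟩ := HomogeneousParameters.exists_isQuotBasis hL.homogeneous hL.finite
  obtain ⟨b⟩ := he.exists_adjoin_basis hL.homogeneous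
    (HomogeneousParameters.totalDegree_pos hL.algebraicIndependent) hL.finite
  refine ⟨Module.Free.of_basis b, fun i k => ?_, fun lam => ⟨fun W hW hWs hWS => ?_,
    LameOperators.hasRegularSingularities hA.nonisotropic hL lam⟩⟩
  · obtain ⟨l, -, -, hl⟩ := LameOperators.exists_isHolonomic hL
    exact ⟨((l i).coeff k).toFun, ((l i).coeff k).2, fun x hx h => hl i k x hx h⟩
  -- The same monomials index the initial values of solutions and the basis of ℂ[ξ] over ℂ[s]; hence
  -- the two numbers agree.
  · rw [LameOperators.finrank_torusSolutionSpace hA.span_eq hL he lam hW hWS,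
      LameOperators.symbolRank, Module.finrank_eq_card_basis b]
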